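/- Write $R$ for the generator of rotations about the vertical axis of $\mathbb R^3$ and $\vec i,\vec j,\vec k$ for its coordinate vectors. Let $h_1(r)=\frac{2r^2}{r^4+1}$, $h_3(r)=\frac{r^4-1}{r^4+1}$, and for $\alpha\in\mathbb R$, $\lambda>0$ let $Q^2_{\alpha,\lambda}(r,\theta)=e^{2\alpha R}e^{2\theta R}(h_1(\lambda r),0,h_3(\lambda r))$. All radial functions are measured with respect to $r\,dr$ on $(0,\infty)$. **Function spaces.** Fix $m\in C_c^\infty((\frac14,2))$ real-valued with $\sum_{k\in\mathbb Z}m(2^{-k}\xi)=1$ for all $\xi>0$, and let $P_k=m(2^{-k}|D|)$ be the corresponding Littlewood--Paley projectors in $\mathbb R^2$. Put $\|f\|_{X}=\sum_k 2^k\|P_kf\|_{L^2(\mathbb R^2)}$ ($X=\dot B^1_{2,1}(\mathbb R^2)$). For radial $f\in L^2$ let $P^e_kf$ be defined by $P_k(e^{2i\theta}f)=e^{2i\theta}P_k^ef$, and put $\|f\|_{L\bar X}=\sum_k\|P^e_kf\|_{L^2}$; $L\bar X=\dot B^0_{2,1,e}$ is the space of $f\in L^2$ for which this is finite. **Setup.**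 Fix $\varkappa\in C^\infty$, real-valued and supported in $[\frac12,2]$, with $\langle\varkappa,h_1\rangle\ne0$ and $\langle\varkappa,h_1h_3\rangle\neq0$. Let $u:\mathbb R^2\to\mathbb S^2$, $u\in\dot H^1$, be $2$-equivariant, $u(r,\theta)=e^{2\theta R}\bar u(r)$, with $\bar u(r)\to-\vec k$ as $r\to0$ and $\bar u(r)\to\vec k$ as $r\to\infty$, and with $E(u)=\frac12\int_{\mathbb R^2}|\nabla u|^2\,dx\le 8\pi+\delta^2$. Let $(v,w)=(e^{2\theta R}\bar v(r),e^{2\theta R}\bar w(r))$ be its Coulomb frame, i.e. the orthonormal frame of $T_u\mathbb S^2$ with $u\times v=w$, $\partial_r\bar v\cdot\bar w=0$, $\bar v\to\vec i$ and $\bar w\to\vec j$ as $r\to\infty$. Let $$\psi_1=\partial_ru\cdot v+i\,\partial_ru\cdot w,\qquad \psi_2=\partial_\theta u\cdot v+i\,\partial_\theta u\cdot w,\qquad \psi=\psi_1-i\frac{\psi_2}{r}.$$ Let $(\alpha,\lambda)$ be modulation parameters of $u$, i.e. $\lambda>0$ and, with $\delta^{\lambda,\alpha}\psi_2=\psi_2-2ie^{2i\alpha}h_1(\lambda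 r)$, $$\langle\delta^{\lambda,\alpha}\psi_2,\varkappa(\lambda\,\cdot)\rangle=0,\qquad \|\delta^{\lambda,\alpha}\psi_2\|_{L^\infty}\le K\delta .$$ **Proposition.** There is a constant $C>0$, depending only on $m$ and $\varkappa$, such that for every $K>0$ there is $\delta_0>0$ such that the following holds for all $0<\delta\le\delta_0$ and all $u$, $(v,w)$, $(\alpha,\lambda)$ as in the setup. (i) If $\|u-Q^2_{\alpha,\lambda}\|_X<\infty$, then $\psi\in L\bar X$ and $\|\psi\|_{L\bar X}\le C\,\|u-Q^2_{\alpha,\lambda}\|_X$. (ii) Conversely, if $\psi\in L\bar X$, then $\|u-Q^2_{\alpha,\lambda}\|_X\le C\,\|\psi\|_{L\bar X}$. -/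

import Mathlib

open MeasureTheory Set Filter Topology
open scoped ENNReal FourierTransform Convolution RealInnerProductSpace ContDiff

noncomputable section

namespace SchrodingerMap

/-- The target space `ℝ³`, with its Euclidean norm. The plane `ℝ²` is represented by `ℂ`
(Euclidean norm, Lebesgue measure). -/
abbrev E3 : Type := EuclideanSpace ℝ (Fin 3)

/-- `e^{βR}`: the rotation of `ℝ³` of angle `β` around the vertical axis. -/
def rotZ (β : ℝ) (p : E3) : E3 :=
  !₂[Real.cos β * p 0 - Real.sin β * p 1, Real.sin β * p 0 + Real.cos β * p 1, p 2]

/-- The vector product of `ℝ³`. -/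
def cross (p q : E3) : E3 :=
  WithLp.toLp 2 (crossProduct (WithLp.ofLp p) (WithLp.ofLp q))

/-- The first coordinate vector. -/
def vecI : E3 := !₂[1, 0, 0]

/-- The second coordinate vector. -/
def vecJ : E3 := !₂[0, 1, 0]

/-- The third coordinate vector (the vertical direction). -/
def vecK : E3 := !₂[0, 0, 1]

/-! ### Solitons -/

/-- `h₁(r) = 2r² / (r⁴ + 1)`. -/
def h1 (r : ℝ) : ℝ := 2 * r ^ 2 / (r ^ 4 + 1)

/-- `h₃(r) = (r⁴ - 1) / (r⁴ + 1)`. -/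
def h3 (r : ℝ) : ℝ := (r ^ 4 - 1) / (r ^ 4 + 1)

/-- The soliton `Q²_{α,λ}(r,θ) = e^{2αR} e^{2θR} (h₁(λr), 0, h₃(λr))`. -/
def soliton (α lam : ℝ) (x : ℂ) : E3 :=
  rotZ (2 * α) (rotZ (2 * Complex.arg x) !₂[h1 (lam * ‖x‖), 0, h3 (lam * ‖x‖)])

/-! ### Equivariant maps and their energy -/

/-- Local absolute continuity on `(0, ∞)`. -/
def LocallyAC {F : Type*} [PseudoMetricSpace F] (f : ℝ → F) : Prop :=
  ∀ a b : ℝ, 0 < a → a ≤ b → AbsolutelyContinuousOnInterval f a b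

/-- The radial profile `ū(r) = u(r, θ = 0)` of an equivariant map. -/
def profile (u : ℂ → E3) (r : ℝ) : E3 := u (r : ℂ)

/-- The energy `E(u) = ½ ∫_{ℝ²} |∇u|² dx`, in `[0, ∞]`. For a map whose profile is locally absolutely
continuous, the classical gradient exists almost everywhere and is the weak gradient. -/
def energy (u : ℂ → E3) : ℝ≥0∞ :=
  (1 / 2) * ∫⁻ x : ℂ, (‖fderiv ℝ u x 1‖ₑ ^ 2 + ‖fderiv ℝ u x Complex.I‖ₑ ^ 2)

/-- `2`-equivariant maps `u : ℝ² → 𝕊²` of class `Ḣ¹`, in the homotopy class of `Q²`: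
`u(r,θ) = e^{2θR} ū(r)`, with `ū(0) = -k` and `ū(∞) = k`. (In one radial variable,
`Ḣ¹` regularity is local absolute continuity of the profile together with finite energy.) -/
structure IsEquivariantMap (u : ℂ → E3) : Prop where
  norm_eq_one : ∀ x, ‖u x‖ = 1
  equivariant : ∀ (θ : ℝ) (x : ℂ), u (Complex.exp (θ * Complex.I) * x) = rotZ (2 * θ) (u x)
  locallyAC : LocallyAC (profile u)
  energy_lt_top : energy u < ⊤
  tendsto_zero : Tendsto (profile u) (𝓝[>] 0) (𝓝 (-vecK))
  tendsto_infty : Tendsto (profile u) atTop (𝓝 vecK)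

/-! ### The Coulomb gauge and the reduced field -/

/-- `v`, `w` are the radial profiles of the Coulomb frame of the map `u`: the `2`-equivariant
orthonormal frame `(e^{2θR} v(r), e^{2θR} w(r))` of `T_u 𝕊²`, oriented by `u × v = w`, with
`A₁ = ∂ᵣ v · w = 0`, and with `v → i`, `w → j` as `r → ∞`. -/
structure IsCoulombFrame (u : ℂ → E3) (v w : ℝ → E3) : Prop where
  norm_v : ∀ r, 0 < r → ‖v r‖ = 1
  norm_w : ∀ r, 0 < r → ‖w r‖ = 1
  inner_vw : ∀ r, 0 < r → ⟪v r, w r⟫ = 0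
  inner_uv : ∀ r, 0 < r → ⟪profile u r, v r⟫ = 0
  inner_uw : ∀ r, 0 < r → ⟪profile u r, w r⟫ = 0
  cross_uv : ∀ r, 0 < r → cross (profile u r) (v r) = w r
  locallyAC_v : LocallyAC v
  locallyAC_w : LocallyAC w
  coulomb : ∀ᵐ r : ℝ, 0 < r → ⟪deriv v r, w r⟫ = 0
  tendsto_v : Tendsto v atTop (𝓝 vecI)
  tendsto_w : Tendsto w atTop (𝓝 vecJ)

/-- `ψ₁ = ∂ᵣ u · v + i ∂ᵣ u · w`, a radial function (computed at `θ = 0`). -/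
def psi1 (u : ℂ → E3) (v w : ℝ → E3) (r : ℝ) : ℂ :=
  (⟪deriv (profile u) r, v r⟫ : ℝ) + Complex.I * (⟪deriv (profile u) r, w r⟫ : ℝ)

/-- The angular derivative `∂_θ u` at the point `(r, θ = 0)`. -/
def angularDeriv (u : ℂ → E3) (r : ℝ) : E3 :=
  deriv (fun θ : ℝ => u (r * Complex.exp (θ * Complex.I))) 0

/-- `ψ₂ = ∂_θ u · v + i ∂_θ u · w`, a radial function (computed at `θ = 0`). -/
def psi2 (u : ℂ → E3) (v w : ℝ → E3) (r : ℝ) : ℂ :=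
  (⟪angularDeriv u r, v r⟫ : ℝ) + Complex.I * (⟪angularDeriv u r, w r⟫ : ℝ)

/-- The reduced field `ψ = ψ₁ - i ψ₂ / r`. -/
def gaugeField (u : ℂ → E3) (v w : ℝ → E3) (r : ℝ) : ℂ :=
  psi1 u v w r - Complex.I * psi2 u v w r / r

/-! ### Modulation parameters -/

/-- The weights admitted in the orthogonality condition: smooth, supported in `[1/2, 2]`, with
`⟨ϰ, h₁⟩ ≠ 0` and `⟨ϰ, h₁h₃⟩ ≠ 0` (with respect to `r dr`). -/
structure IsModulationWeight (κ : ℝ → ℝ) : Prop where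
  smooth : ContDiff ℝ ∞ κ
  support : tsupport κ ⊆ Icc (1 / 2) 2
  nondeg_h1 : ∫ r in Ioi (0 : ℝ), κ r * h1 r * r ≠ 0
  nondeg_h1h3 : ∫ r in Ioi (0 : ℝ), κ r * (h1 r * h3 r) * r ≠ 0

/-- `δ^{λ,α} ψ₂ = ψ₂ - 2 i e^{2iα} h₁(λ r)`. -/
def deltaPsi2 (u : ℂ → E3) (v w : ℝ → E3) (α lam r : ℝ) : ℂ :=
  psi2 u v w r - 2 * Complex.I * Complex.exp (2 * Complex.I * α) * (h1 (lam * r) : ℝ)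

/-- The conditions that select the modulation parameters `(α, λ)`: the orthogonality
`⟨δ^{λ,α} ψ₂, ϰ(λ ·)⟩ = 0` in `L²(r dr)`, and the bound `‖δ^{λ,α} ψ₂‖_{L^∞} ≤ η`. -/
structure IsModulation (κ : ℝ → ℝ) (u : ℂ → E3) (v w : ℝ → E3) (α lam η : ℝ) : Prop where
  lam_pos : 0 < lam
  orthogonal : ∫ r in Ioi (0 : ℝ), deltaPsi2 u v w α lam r * ((κ (lam * r) * r : ℝ) : ℂ) = 0
  small : ∀ r, 0 < r → ‖deltaPsi2 u v w α lam r‖ ≤ η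

/-! ### Littlewood-Paley projectors and Besov norms -/

/-- A smooth dyadic partition of unity `∑ⱼ m(ξ / 2ʲ) = 1` on `(0, ∞)`, with `m` smooth and
compactly supported in `(1/4, 2)`. -/
structure IsDyadicCutoff (m : ℝ → ℝ) : Prop where
  smooth : ContDiff ℝ ∞ m
  support : tsupport m ⊆ Ioo (1 / 4) 2
  hasSum : ∀ ξ : ℝ, 0 < ξ → HasSum (fun j : ℤ => m (ξ / 2 ^ j)) 1

/-- The convolution kernel of `P_k = m(2^{-k} |D|)` on `ℝ²`. The factor `2π` is due to the
normalization `e^{2πi x·ξ}` of `𝓕⁻`, and the kernel is real because its symbol is real and even. -/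
def lpKernel (m : ℝ → ℝ) (k : ℤ) (x : ℂ) : ℝ :=
  (𝓕⁻ (fun ξ : ℂ => (m (2 * Real.pi * ‖ξ‖ / 2 ^ k) : ℂ)) x).re

/-- The Littlewood-Paley projector `P_k` in `ℝ²`, on scalar or vector valued functions. -/
def lpProj {F : Type*} [NormedAddCommGroup F] [NormedSpace ℝ F]
    (m : ℝ → ℝ) (k : ℤ) (f : ℂ → F) : ℂ → F :=
  lpKernel m k ⋆[ContinuousLinearMap.lsmul ℝ ℝ, volume] f

/-- The norm of `X = Ḃ¹_{2,1}(ℝ²)`: `∑ₖ 2ᵏ ‖P_k f‖_{L²(ℝ²)}`, in `[0, ∞]`. -/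
def normX (m : ℝ → ℝ) (f : ℂ → E3) : ℝ≥0∞ :=
  ∑' k : ℤ, (2 : ℝ≥0∞) ^ k * eLpNorm (lpProj m k f) 2 volume

/-- The measure `r dr` on `(0, ∞)`. -/
def radialMeasure : Measure ℝ :=
  (volume.restrict (Ioi 0)).withDensity (fun r => ENNReal.ofReal r)

/-- The `2`-equivariant extension `e^{2iθ} f(r)` of a radial function. -/
def equivariantLift (f : ℝ → ℂ) (x : ℂ) : ℂ :=
  Complex.exp (2 * Complex.I * Complex.arg x) * f ‖x‖

/-- The spectral projector `P_k^e` of `-∂ᵣ² - r⁻¹∂ᵣ + 4r⁻²`: the restriction of `P_k` to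
`2`-equivariant functions, read on radial profiles. -/
def lpProjE (m : ℝ → ℝ) (k : ℤ) (f : ℝ → ℂ) (r : ℝ) : ℂ :=
  lpProj m k (equivariantLift f) (r : ℂ)

/-- The norm of `LX̄ = Ḃ⁰_{2,1,e}`: `∑ₖ ‖P_k^e f‖_{L²(r dr)}`, in `[0, ∞]`. -/
def normLX (m : ℝ → ℝ) (f : ℝ → ℂ) : ℝ≥0∞ :=
  ∑' k : ℤ, eLpNorm (lpProjE m k f) 2 radialMeasure

/-- The space `LX̄ = Ḃ⁰_{2,1,e}`: the `f ∈ L²(r dr)` of finite `Ḃ⁰_{2,1,e}` norm. -/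
def MemLX (m : ℝ → ℝ) (f : ℝ → ℂ) : Prop :=
  MemLp f 2 radialMeasure ∧ normLX m f < ⊤

end SchrodingerMap

end

open SchrodingerMap

open MeasureTheory Set Filter Topology
open scoped ENNReal FourierTransform Convolution RealInnerProductSpace ContDiff

noncomputable section

namespace SchrodingerMap

/-! ### Absolutely continuous functions on the half-line -/

lemma LocallyAC.of_dist_le {F G : Type*} [PseudoMetricSpace F] [PseudoMetricSpace G]
    {f : ℝ → F} {g : ℝ → G} (hf : LocallyAC f)
    (h : ∀ a b : ℝ, 0 < a → a ≤ b → ∃ C : ℝ, ∀ x ∈ Icc a b, ∀ y ∈ Icc a b,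
      dist (g x) (g y) ≤ C * dist (f x) (f y)) : LocallyAC g := by
  intro a b ha hab
  obtain ⟨C, hC⟩ := h a b ha hab
  have hfa := hf a b ha hab
  rw [absolutelyContinuousOnInterval_iff] at hfa ⊢
  intro ε hε
  obtain ⟨δ, hδ, H⟩ := hfa (ε / (|C| + 1)) (by positivity)
  refine ⟨δ, hδ, fun E hE hs => ?_⟩
  have h1 := H E hE hs
  have h2 : ∑ i ∈ Finset.range E.1, dist (g (E.2 i).1) (g (E.2 i).2) ≤
      (|C| + 1) * ∑ i ∈ Finset.range E.1, dist (f (E.2 i).1) (f (E.2 i).2) := by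
    rw [Finset.mul_sum]
    refine Finset.sum_le_sum fun i hi => ?_
    have hm := hE.1 i hi
    rw [uIcc_of_le hab] at hm
    refine (hC _ hm.1 _ hm.2).trans ?_
    gcongr
    linarith [le_abs_self C]
  calc _ ≤ _ := h2
    _ < (|C| + 1) * (ε / (|C| + 1)) := by gcongr
    _ = ε := by field_simp

lemma LocallyAC.continuousOn {F : Type*} [SeminormedAddCommGroup F] {f : ℝ → F} (hf : LocallyAC f) :
    ContinuousOn f (Ioi 0) := by
  intro x hx
  have hx0 : 0 < x := hx
  have h : ContinuousOn f (uIcc (x / 2) (x + 1)) :=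
    AbsolutelyContinuousOnInterval.continuousOn (hf (x / 2) (x + 1) (half_pos hx0) (by linarith))
  have hm : uIcc (x / 2) (x + 1) ∈ 𝓝 x := by
    rw [uIcc_of_le (by linarith)]
    exact Icc_mem_nhds (by linarith) (by linarith)
  exact (h.continuousAt hm).continuousWithinAt

lemma ae_pos_of_forall_Icc {P : ℝ → Prop}
    (h : ∀ a b : ℝ, 0 < a → a ≤ b → ∀ᵐ r : ℝ, r ∈ Icc a b → P r) : ∀ᵐ r : ℝ, 0 < r → P r := by
  have h2 : ∀ᵐ r : ℝ, ∀ n : ℕ, r ∈ Icc (1 / ((n : ℝ) + 1)) ((n : ℝ) + 1) → P r := by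
    rw [ae_all_iff]
    intro n
    apply h _ _ (by positivity)
    rw [div_le_iff₀ (by positivity)]
    have : (0 : ℝ) ≤ n := by positivity
    nlinarith
  filter_upwards [h2] with r hr hpos
  obtain ⟨n, hn⟩ := exists_nat_gt (max r (1 / r))
  refine hr n ⟨?_, ?_⟩
  · rw [div_le_iff₀ (by positivity)]
    have : 1 / r < n := lt_of_le_of_lt (le_max_right _ _) hn
    rw [div_lt_iff₀ hpos] at this
    nlinarith
  · have : r < n := lt_of_le_of_lt (le_max_left _ _) hn
    linarith

lemma LocallyAC.re {f : ℝ → ℂ} (hf : LocallyAC f) : LocallyAC (fun r => (f r).re) :=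
  hf.of_dist_le fun a b _ _ => ⟨1, fun x _ y _ => by
    rw [one_mul, Real.dist_eq, Complex.dist_eq, ← Complex.sub_re]; exact Complex.abs_re_le_norm _⟩

lemma LocallyAC.im {f : ℝ → ℂ} (hf : LocallyAC f) : LocallyAC (fun r => (f r).im) :=
  hf.of_dist_le fun a b _ _ => ⟨1, fun x _ y _ => by
    rw [one_mul, Real.dist_eq, Complex.dist_eq, ← Complex.sub_im]; exact Complex.abs_im_le_norm _⟩

lemma LocallyAC.ofReal {f : ℝ → ℝ} (hf : LocallyAC f) : LocallyAC (fun r => (f r : ℂ)) :=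
  hf.of_dist_le fun a b _ _ => ⟨1, fun x _ y _ => by
    rw [one_mul, Complex.dist_eq, ← Complex.ofReal_sub, Complex.norm_real, Real.dist_eq,
      Real.norm_eq_abs]⟩

lemma LocallyAC.ae_differentiableAt {f : ℝ → ℂ} (hf : LocallyAC f) :
    ∀ᵐ r : ℝ, 0 < r → DifferentiableAt ℝ f r := by
  refine ae_pos_of_forall_Icc fun a b ha hab => ?_
  have h1 := (hf.re a b ha hab).ae_differentiableAt
  have h2 := (hf.im a b ha hab).ae_differentiableAt
  rw [uIcc_of_le hab] at h1 h2
  filter_upwards [h1, h2] with r h1 h2 hr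
  have h3 : f = fun r => ((f r).re : ℂ) + ((f r).im : ℂ) * Complex.I := by
    ext r; exact (Complex.re_add_im _).symm
  rw [h3]
  exact ((h1 hr).hasDerivAt.ofReal_comp.add
    ((h2 hr).hasDerivAt.ofReal_comp.mul_const Complex.I)).differentiableAt

/-- `f` is locally absolutely continuous on `(0, ∞)`, with derivative `f'` almost everywhere. -/
structure ACDeriv (f f' : ℝ → ℂ) : Prop where
  ac : LocallyAC f
  hasDerivAt : ∀ᵐ r : ℝ, 0 < r → HasDerivAt f (f' r) r

namespace ACDeriv

variable {f f' g g' : ℝ → ℂ}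

lemma of_locallyAC (hf : LocallyAC f) : ACDeriv f (deriv f) :=
  ⟨hf, hf.ae_differentiableAt.mono fun _ h hr => (h hr).hasDerivAt⟩

lemma congr_deriv (hf : ACDeriv f f') (h : ∀ᵐ r : ℝ, 0 < r → f' r = g' r) : ACDeriv f g' :=
  ⟨hf.ac, by filter_upwards [hf.hasDerivAt, h] with r h1 h2 hr; rw [← h2 hr]; exact h1 hr⟩

lemma congr (hf : ACDeriv f f') (h : ∀ r, 0 < r → f r = g r) : ACDeriv g f' := by
  refine ⟨hf.ac.of_dist_le fun a b ha hab => ⟨1, fun x hx y hy => ?_⟩, ?_⟩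
  · rw [← h x (ha.trans_le hx.1), ← h y (ha.trans_le hy.1), one_mul]
  · filter_upwards [hf.hasDerivAt] with r h1 hr
    refine (h1 hr).congr_of_eventuallyEq ?_
    filter_upwards [lt_mem_nhds hr] with s hs using (h s hs).symm

lemma ae_deriv_eq (hf : ACDeriv f f') : ∀ᵐ r : ℝ, 0 < r → deriv f r = f' r :=
  hf.hasDerivAt.mono fun _ h hr => (h hr).deriv

lemma continuousOn (hf : ACDeriv f f') : ContinuousOn f (Ioi 0) := hf.ac.continuousOn

lemma re (hf : ACDeriv f f') :
    ∀ᵐ r : ℝ, 0 < r → HasDerivAt (fun r => (f r).re) (f' r).re r := by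
  filter_upwards [hf.hasDerivAt] with r h hr
  exact (Complex.reCLM.hasFDerivAt.comp_hasDerivAt r (h hr))

lemma im (hf : ACDeriv f f') :
    ∀ᵐ r : ℝ, 0 < r → HasDerivAt (fun r => (f r).im) (f' r).im r := by
  filter_upwards [hf.hasDerivAt] with r h hr
  exact (Complex.imCLM.hasFDerivAt.comp_hasDerivAt r (h hr))

lemma real_ftc {φ φ' : ℝ → ℝ} (hφ : LocallyAC φ)
    (h : ∀ᵐ r : ℝ, 0 < r → HasDerivAt φ (φ' r) r) {a b : ℝ} (ha : 0 < a) (hab : a ≤ b) :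
    IntervalIntegrable φ' volume a b ∧ ∫ r in a..b, φ' r = φ b - φ a := by
  have hac := hφ a b ha hab
  have hae : ∀ᵐ r : ℝ, r ∈ uIoc a b → deriv φ r = φ' r := by
    filter_upwards [h] with r hr hm
    rw [uIoc_of_le hab] at hm
    exact (hr (ha.trans hm.1)).deriv
  constructor
  · refine hac.intervalIntegrable_deriv.congr_ae ?_
    rw [Filter.EventuallyEq, ae_restrict_iff' measurableSet_uIoc]
    exact hae
  · rw [← hac.integral_deriv_eq_sub]
    refine intervalIntegral.integral_congr_ae ?_
    filter_upwards [hae] with r hr hm using (hr hm).symm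

lemma ftc_of_le (hf : ACDeriv f f') {a b : ℝ} (ha : 0 < a) (hab : a ≤ b) :
    IntervalIntegrable f' volume a b ∧ ∫ r in a..b, f' r = f b - f a := by
  have h1 := real_ftc hf.ac.re hf.re ha hab
  have h2 := real_ftc hf.ac.im hf.im ha hab
  have h3 : f' = fun r => ((f' r).re : ℂ) + ((f' r).im : ℂ) * Complex.I := by
    ext r; exact (Complex.re_add_im _).symm
  have i1 : IntervalIntegrable (fun r => ((f' r).re : ℂ)) volume a b := ⟨h1.1.1.ofReal, h1.1.2.ofReal⟩
  have i2 : IntervalIntegrable (fun r => ((f' r).im : ℂ) * Complex.I) volume a b :=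
    IntervalIntegrable.mul_const ⟨h2.1.1.ofReal, h2.1.2.ofReal⟩ _
  constructor
  · rw [h3]; exact i1.add i2
  · rw [h3, intervalIntegral.integral_add i1 i2, intervalIntegral.integral_mul_const,
      intervalIntegral.integral_ofReal, intervalIntegral.integral_ofReal, h1.2, h2.2]
    apply Complex.ext <;> simp

lemma integral_eq (hf : ACDeriv f f') {a b : ℝ} (ha : 0 < a) (hb : 0 < b) :
    ∫ r in a..b, f' r = f b - f a := by
  rcases le_total a b with h | h
  · exact (hf.ftc_of_le ha h).2
  · rw [intervalIntegral.integral_symm, (hf.ftc_of_le hb h).2, neg_sub]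

lemma add (hf : ACDeriv f f') (hg : ACDeriv g g') :
    ACDeriv (fun r => f r + g r) (fun r => f' r + g' r) :=
  ⟨fun a b ha hab => (hf.ac a b ha hab).fun_add (hg.ac a b ha hab), by
    filter_upwards [hf.hasDerivAt, hg.hasDerivAt] with r h1 h2 hr using (h1 hr).fun_add (h2 hr)⟩

lemma mul (hf : ACDeriv f f') (hg : ACDeriv g g') :
    ACDeriv (fun r => f r * g r) (fun r => f' r * g r + f r * g' r) :=
  ⟨fun a b ha hab => (hf.ac a b ha hab).fun_smul (hg.ac a b ha hab), by
    filter_upwards [hf.hasDerivAt, hg.hasDerivAt] with r h1 h2 hr using (h1 hr).fun_mul (h2 hr)⟩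

lemma of_contDiffOn (h : ContDiffOn ℝ 1 f (Ioi 0)) (hd : ∀ r, 0 < r → HasDerivAt f (f' r) r) :
    ACDeriv f f' :=
  ⟨fun a b ha hab => (h.mono (by
    rw [uIcc_of_le hab]; exact fun x hx => ha.trans_le hx.1)).absolutelyContinuousOnInterval,
    Eventually.of_forall hd⟩

lemma const (c : ℂ) : ACDeriv (fun _ => c) (fun _ => 0) :=
  of_contDiffOn contDiffOn_const fun r _ => hasDerivAt_const r c

lemma of_hasDerivAt (hd : ∀ r, 0 < r → HasDerivAt f (f' r) r) (hc : ContinuousOn f' (Ioi 0)) :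
    ACDeriv f f' := by
  refine of_contDiffOn ?_ hd
  rw [contDiffOn_one_iff_derivWithin isOpen_Ioi.uniqueDiffOn]
  refine ⟨fun r hr => (hd r hr).differentiableAt.differentiableWithinAt, hc.congr fun r hr => ?_⟩
  exact (hd r hr).hasDerivWithinAt.derivWithin (isOpen_Ioi.uniqueDiffWithinAt hr)

lemma const_mul (c : ℂ) (hf : ACDeriv f f') : ACDeriv (fun r => c * f r) (fun r => c * f' r) :=
  ((const c).mul hf).congr_deriv (Eventually.of_forall fun r _ => by simp)

lemma neg (hf : ACDeriv f f') : ACDeriv (fun r => - f r) (fun r => - f' r) := by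
  simpa using hf.const_mul (-1)

lemma sub (hf : ACDeriv f f') (hg : ACDeriv g g') :
    ACDeriv (fun r => f r - g r) (fun r => f' r - g' r) := by
  simpa [sub_eq_add_neg] using hf.add hg.neg

lemma conj (hf : ACDeriv f f') :
    ACDeriv (fun r => (starRingEnd ℂ) (f r)) (fun r => (starRingEnd ℂ) (f' r)) := by
  refine ⟨hf.ac.of_dist_le fun a b _ _ => ⟨1, fun x _ y _ => ?_⟩, ?_⟩
  · rw [one_mul, Complex.dist_conj_conj]
  · filter_upwards [hf.hasDerivAt] with r h hr
    exact (Complex.conjCLE.toContinuousLinearMap.hasFDerivAt.comp_hasDerivAt r (h hr))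

lemma inv (hf : ACDeriv f f') {c : ℝ} (hc : 0 < c) (h : ∀ r, 0 < r → c ≤ ‖f r‖) :
    ACDeriv (fun r => (f r)⁻¹) (fun r => - f' r / f r ^ 2) := by
  refine ⟨hf.ac.of_dist_le fun a b ha _ => ⟨(c * c)⁻¹, fun x hx y hy => ?_⟩, ?_⟩
  · have hx := h x (ha.trans_le hx.1)
    have hy := h y (ha.trans_le hy.1)
    have h0x : f x ≠ 0 := by rw [← norm_pos_iff]; linarith
    have h0y : f y ≠ 0 := by rw [← norm_pos_iff]; linarith
    rw [dist_inv_inv₀ h0x h0y, div_eq_inv_mul]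
    gcongr
  · filter_upwards [hf.hasDerivAt] with r h1 hr
    refine (h1 hr).fun_inv ?_
    rw [← norm_pos_iff]; linarith [h r hr]

lemma ofReal_integral {h : ℝ → ℝ} {c : ℝ} (hc : 0 < c)
    (hh : ∀ a b, 0 < a → a ≤ b → IntervalIntegrable h volume a b) :
    ACDeriv (fun r => ((∫ s in c..r, h s : ℝ) : ℂ)) (fun r => (h r : ℂ)) := by
  have key : ∀ a b, 0 < a → a ≤ b → ∃ a' b', 0 < a' ∧ a' ≤ a ∧ b ≤ b' ∧ c ∈ Icc a' b' := by
    intro a b ha hab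
    exact ⟨min a c, max b c, lt_min ha hc, min_le_left _ _, le_max_left _ _,
      min_le_right _ _, le_max_right _ _⟩
  constructor
  · apply LocallyAC.ofReal
    intro a b ha hab
    obtain ⟨a', b', ha', h1, h2, h3⟩ := key a b ha hab
    have hab' : a' ≤ b' := h1.trans (hab.trans h2)
    refine ((hh a' b' ha' hab').absolutelyContinuousOnInterval_intervalIntegral
      (c := c) (by rw [uIcc_of_le hab']; exact h3)).mono ?_
    rw [uIcc_of_le hab, uIcc_of_le hab']
    exact Icc_subset_Icc h1 h2
  · refine ae_pos_of_forall_Icc fun a b ha hab => ?_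
    obtain ⟨a', b', ha', h1, h2, h3⟩ := key a b ha hab
    have hab' : a' ≤ b' := h1.trans (hab.trans h2)
    filter_upwards [(hh a' b' ha' hab').ae_hasDerivAt_integral] with r hr hm
    have hm' : r ∈ uIcc a' b' := by
      rw [uIcc_of_le hab']; exact ⟨h1.trans hm.1, hm.2.trans h2⟩
    exact (hr hm' c (by rw [uIcc_of_le hab']; exact h3)).ofReal_comp

lemma integral {h : ℝ → ℂ} {c : ℝ} (hc : 0 < c)
    (hh : ∀ a b, 0 < a → a ≤ b → IntervalIntegrable h volume a b) :
    ACDeriv (fun r => ∫ s in c..r, h s) h := by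
  have hre : ∀ a b, 0 < a → a ≤ b → IntervalIntegrable (fun r => (h r).re) volume a b := by
    intro a b ha hab
    exact ⟨(hh a b ha hab).1.re, (hh a b ha hab).2.re⟩
  have him : ∀ a b, 0 < a → a ≤ b → IntervalIntegrable (fun r => (h r).im) volume a b := by
    intro a b ha hab
    exact ⟨(hh a b ha hab).1.im, (hh a b ha hab).2.im⟩
  have h1 := (ofReal_integral hc hre).add ((ofReal_integral hc him).const_mul Complex.I)
  have hI : ∀ r, 0 < r → IntervalIntegrable h volume c r := by
    intro r hr
    rcases le_total c r with h' | h'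
    · exact hh _ _ hc h'
    · exact (hh _ _ hr h').symm
  refine (h1.congr fun r hr => ?_).congr_deriv (Eventually.of_forall fun r _ => ?_)
  · have e1 : ((∫ s in c..r, (h s).re : ℝ) : ℂ) = ((∫ s in c..r, h s).re : ℂ) := by
      congr 1
      exact (Complex.reCLM.intervalIntegral_comp_comm (hI r hr))
    have e2 : ((∫ s in c..r, (h s).im : ℝ) : ℂ) = ((∫ s in c..r, h s).im : ℂ) := by
      congr 1
      exact (Complex.imCLM.intervalIntegral_comp_comm (hI r hr))
    rw [e1, e2, mul_comm]
    exact Complex.re_add_im _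
  · rw [mul_comm]; exact Complex.re_add_im _

lemma hasDerivAt_of_continuousOn (hf : ACDeriv f f') (hc : ContinuousOn f' (Ioi 0)) {r : ℝ}
    (hr : 0 < r) : HasDerivAt f (f' r) r := by
  have h1 : HasDerivAt (fun x => f r + ∫ s in r..x, f' s) (f' r) r := by
    refine HasDerivAt.const_add _ (intervalIntegral.integral_hasDerivAt_right ?_ ?_ ?_)
    · simp
    · exact hc.stronglyMeasurableAtFilter isOpen_Ioi r hr
    · exact hc.continuousAt (Ioi_mem_nhds hr)
  refine h1.congr_of_eventuallyEq ?_
  filter_upwards [Ioi_mem_nhds hr] with x hx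
  rw [hf.integral_eq hr hx]; ring

end ACDeriv

/-! ### The radial `L²` norm -/

/-- The norm of `L²((0, ∞), r dr)`. -/
def radNorm (f : ℝ → ℂ) : ℝ≥0∞ := eLpNorm f 2 radialMeasure

lemma ae_radialMeasure_iff {P : ℝ → Prop} :
    (∀ᵐ r ∂radialMeasure, P r) ↔ ∀ᵐ r : ℝ, 0 < r → P r := by
  rw [radialMeasure, ae_withDensity_iff (by fun_prop), ae_restrict_iff' measurableSet_Ioi]
  refine eventually_congr (Eventually.of_forall fun r => ?_)
  simp only [mem_Ioi, ne_eq, ENNReal.ofReal_eq_zero, not_le]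
  tauto

lemma lintegral_radialMeasure (φ : ℝ → ℝ≥0∞) :
    ∫⁻ r, φ r ∂radialMeasure = ∫⁻ r in Ioi 0, ENNReal.ofReal r * φ r := by
  rw [radialMeasure, lintegral_withDensity_eq_lintegral_mul_non_measurable _ (by fun_prop)
    (Eventually.of_forall fun _ => ENNReal.ofReal_lt_top)]
  rfl

lemma radNorm_sq (f : ℝ → ℂ) :
    radNorm f ^ 2 = ∫⁻ r in Ioi 0, ENNReal.ofReal r * ‖f r‖ₑ ^ 2 := by
  rw [← lintegral_radialMeasure, radNorm, eLpNorm_eq_lintegral_rpow_enorm_toReal (by simp) (by simp),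
    ← ENNReal.rpow_natCast, ← ENNReal.rpow_mul]
  simp

lemma aestronglyMeasurable_of_continuousOn {f : ℝ → ℂ} (hf : ContinuousOn f (Ioi 0)) :
    AEStronglyMeasurable f radialMeasure :=
  (hf.aestronglyMeasurable measurableSet_Ioi).mono_ac (withDensity_absolutelyContinuous _ _)

lemma ACDeriv.aesm {f f' : ℝ → ℂ} (hf : ACDeriv f f') : AEStronglyMeasurable f radialMeasure :=
  aestronglyMeasurable_of_continuousOn hf.continuousOn

lemma ACDeriv.aesm_deriv {f f' : ℝ → ℂ} (hf : ACDeriv f f') :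
    AEStronglyMeasurable f' radialMeasure :=
  (measurable_deriv f).aestronglyMeasurable.congr (ae_radialMeasure_iff.2 hf.ae_deriv_eq)

lemma aemeasurable_restrict_of_aesm {f : ℝ → ℂ} (hf : AEStronglyMeasurable f radialMeasure) :
    AEMeasurable f (volume.restrict (Ioi 0)) := by
  refine hf.aemeasurable.mono_ac ?_
  refine withDensity_absolutelyContinuous' (by fun_prop) ?_
  rw [ae_restrict_iff' measurableSet_Ioi]
  exact Eventually.of_forall fun r hr => by simpa using hr

lemma radNorm_mono {f g : ℝ → ℂ} (h : ∀ᵐ r : ℝ, 0 < r → ‖f r‖ ≤ ‖g r‖) :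
    radNorm f ≤ radNorm g :=
  eLpNorm_mono_ae (ae_radialMeasure_iff.2 h)

lemma radNorm_congr {f g : ℝ → ℂ} (h : ∀ᵐ r : ℝ, 0 < r → f r = g r) : radNorm f = radNorm g :=
  eLpNorm_congr_ae (ae_radialMeasure_iff.2 h)

lemma radNorm_const_mul (c : ℂ) (f : ℝ → ℂ) : radNorm (fun r => c * f r) = ‖c‖ₑ * radNorm f :=
  eLpNorm_const_smul c f 2 radialMeasure

lemma radNorm_le_mul {f g : ℝ → ℂ} {c : ℝ} (hc : 0 ≤ c)
    (h : ∀ᵐ r : ℝ, 0 < r → ‖f r‖ ≤ c * ‖g r‖) : radNorm f ≤ ENNReal.ofReal c * radNorm g := by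
  have h1 := radNorm_const_mul c g
  have h2 : ‖(c : ℂ)‖ₑ = ENNReal.ofReal c := by
    rw [← ofReal_norm, Complex.norm_real, Real.norm_of_nonneg hc]
  rw [← h2, ← h1]
  refine radNorm_mono (h.mono fun r hr hp => ?_)
  rw [norm_mul, Complex.norm_real, Real.norm_of_nonneg hc]
  exact hr hp

lemma radNorm_add_le {f g : ℝ → ℂ} (hf : AEStronglyMeasurable f radialMeasure)
    (hg : AEStronglyMeasurable g radialMeasure) :
    radNorm (fun r => f r + g r) ≤ radNorm f + radNorm g :=
  eLpNorm_add_le hf hg (by norm_num)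

lemma radNorm_sub_le {f g : ℝ → ℂ} (hf : AEStronglyMeasurable f radialMeasure)
    (hg : AEStronglyMeasurable g radialMeasure) :
    radNorm (fun r => f r - g r) ≤ radNorm f + radNorm g :=
  eLpNorm_sub_le hf hg (by norm_num)

lemma radNorm_conj (f : ℝ → ℂ) : radNorm (fun r => (starRingEnd ℂ) (f r)) = radNorm f :=
  eLpNorm_congr_norm_ae (Eventually.of_forall fun r => by simp)

/-! ### Hardy inequalities -/

lemma sq_lintegral_mul_le {α : Type*} [MeasurableSpace α] (μ : Measure α) {f g : α → ℝ≥0∞}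
    (hf : AEMeasurable f μ) (hg : AEMeasurable g μ) :
    (∫⁻ a, f a * g a ∂μ) ^ 2 ≤ (∫⁻ a, f a ^ 2 ∂μ) * ∫⁻ a, g a ^ 2 ∂μ := by
  have h := ENNReal.lintegral_mul_le_Lp_mul_Lq μ Real.HolderConjugate.two_two hf hg
  have e : ∀ x : ℝ≥0∞, (x ^ (1 / 2 : ℝ)) ^ 2 = x := fun x => by
    rw [← ENNReal.rpow_natCast, ← ENNReal.rpow_mul]; simp
  calc (∫⁻ a, f a * g a ∂μ) ^ 2 ≤ ((∫⁻ a, f a ^ (2 : ℝ) ∂μ) ^ (1 / 2 : ℝ) *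
        (∫⁻ a, g a ^ (2 : ℝ) ∂μ) ^ (1 / 2 : ℝ)) ^ 2 := by gcongr; exact h
    _ = _ := by rw [mul_pow, e, e]; simp

lemma lintegral_tail {a φ : ℝ → ℝ≥0∞} (ha : Measurable a) (hφ : AEMeasurable φ (volume.restrict (Ioi 0))) :
    ∫⁻ r in Ioi 0, a r * ∫⁻ s in Ioi r, φ s = ∫⁻ s in Ioi 0, (∫⁻ r in Ioo 0 s, a r) * φ s := by
  have hφ' : AEMeasurable ((Ioi (0 : ℝ)).indicator φ) :=
    (aemeasurable_indicator_iff measurableSet_Ioi).2 hφ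
  have key : ∀ r s : ℝ, (Ioi (0 : ℝ)).indicator a r * (Ioi r).indicator φ s =
      (Ioo 0 s).indicator a r * (Ioi (0 : ℝ)).indicator φ s := by
    intro r s
    by_cases hr : 0 < r <;> by_cases hs : r < s
    · simp [indicator, hr, hs, hr.trans hs]
    · simp [indicator, hs]
    · simp [indicator, hr]
    · simp [indicator, hr]
  calc _ = ∫⁻ r, ∫⁻ s, (Ioi (0 : ℝ)).indicator a r * (Ioi r).indicator φ s := by
        rw [← lintegral_indicator measurableSet_Ioi]
        refine lintegral_congr fun r => ?_
        by_cases hr : r ∈ Ioi (0 : ℝ)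
        · rw [indicator_of_mem hr, indicator_of_mem hr, ← lintegral_indicator measurableSet_Ioi,
            lintegral_const_mul'']
          refine (aemeasurable_indicator_iff measurableSet_Ioi).2 (hφ.mono_measure ?_)
          exact Measure.restrict_mono (Ioi_subset_Ioi (le_of_lt hr)) le_rfl
        · rw [indicator_of_notMem hr, indicator_of_notMem hr]; simp
    _ = ∫⁻ r, ∫⁻ s, (Ioo 0 s).indicator a r * (Ioi (0 : ℝ)).indicator φ s := by simp_rw [key]
    _ = ∫⁻ s, ∫⁻ r, (Ioo 0 s).indicator a r * (Ioi (0 : ℝ)).indicator φ s := by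
        rw [lintegral_lintegral_swap]
        refine AEMeasurable.mul ?_ hφ'.comp_snd
        have : (fun p : ℝ × ℝ => (Ioo 0 p.2).indicator a p.1) =
            {p : ℝ × ℝ | 0 < p.1 ∧ p.1 < p.2}.indicator (fun p => a p.1) := by
          ext ⟨r, s⟩
          simp [indicator]
        rw [this]
        refine ((ha.comp measurable_fst).indicator ?_).aemeasurable
        exact (measurableSet_lt measurable_const measurable_fst).inter
          (measurableSet_lt measurable_fst measurable_snd)
    _ = _ := by
        rw [← lintegral_indicator measurableSet_Ioi]
        refine lintegral_congr fun s => ?_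
        rw [lintegral_mul_const'' _ (ha.indicator measurableSet_Ioo).aemeasurable,
          lintegral_indicator measurableSet_Ioo]
        by_cases hs : s ∈ Ioi (0 : ℝ)
        · rw [indicator_of_mem hs, indicator_of_mem hs]
        · rw [indicator_of_notMem hs, indicator_of_notMem hs, mul_zero]

lemma lintegral_Ioi_inv_sq {r : ℝ} (hr : 0 < r) :
    ∫⁻ s in Ioi r, ENNReal.ofReal s⁻¹ ^ 2 = ENNReal.ofReal r⁻¹ := by
  have hd : ∀ x ∈ Ici r, HasDerivAt (fun s : ℝ => - s⁻¹) ((x ^ 2)⁻¹) x := by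
    intro x hx
    have hx0 : x ≠ 0 := (hr.trans_le hx).ne'
    simpa using (hasDerivAt_inv hx0).fun_neg
  have ht : Tendsto (fun s : ℝ => - s⁻¹) atTop (𝓝 0) := by
    simpa using (tendsto_inv_atTop_zero (𝕜 := ℝ)).neg
  have h1 := integral_Ioi_of_hasDerivAt_of_nonneg' hd (fun x _ => by positivity) ht
  have h2 := integrableOn_Ioi_deriv_of_nonneg' hd (fun x _ => by positivity) ht
  have h3 := ofReal_integral_eq_lintegral_ofReal h2 (Eventually.of_forall fun x => by positivity)
  rw [h1] at h3
  rw [show r⁻¹ = 0 - -r⁻¹ by ring, h3]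
  refine setLIntegral_congr_fun measurableSet_Ioi fun x hx => ?_
  have hx0 : 0 < x := hr.trans hx
  rw [← ENNReal.ofReal_pow (by positivity), inv_pow]

lemma lintegral_Ioo_const_one {s : ℝ} : ∫⁻ _ in Ioo 0 s, (1 : ℝ≥0∞) = ENNReal.ofReal s := by simp

lemma hardy_tail {φ : ℝ → ℝ≥0∞} (hφ : AEMeasurable φ (volume.restrict (Ioi 0))) :
    ∫⁻ r in Ioi 0, ENNReal.ofReal r * (∫⁻ s in Ioi r, φ s) ^ 2 ≤
      ∫⁻ s in Ioi 0, ENNReal.ofReal s * (ENNReal.ofReal s * φ s) ^ 2 := by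
  have hψ : AEMeasurable (fun s => (ENNReal.ofReal s * φ s) ^ 2) (volume.restrict (Ioi 0)) :=
    ((by fun_prop : AEMeasurable (fun s : ℝ => ENNReal.ofReal s) _).mul hφ).pow_const 2
  have h1 : ∀ r ∈ Ioi (0 : ℝ), ENNReal.ofReal r * (∫⁻ s in Ioi r, φ s) ^ 2 ≤
      1 * ∫⁻ s in Ioi r, (ENNReal.ofReal s * φ s) ^ 2 := by
    intro r hr
    have hr : 0 < r := hr
    have hm : AEMeasurable φ (volume.restrict (Ioi r)) :=
      hφ.mono_measure (Measure.restrict_mono (Ioi_subset_Ioi hr.le) le_rfl)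
    have e1 : ∫⁻ s in Ioi r, φ s =
        ∫⁻ s in Ioi r, ENNReal.ofReal s⁻¹ * (ENNReal.ofReal s * φ s) := by
      refine setLIntegral_congr_fun measurableSet_Ioi fun s hs => ?_
      have hs0 : 0 < s := hr.trans hs
      rw [← mul_assoc, ← ENNReal.ofReal_mul (by positivity), inv_mul_cancel₀ hs0.ne',
        ENNReal.ofReal_one, one_mul]
    have e2 := sq_lintegral_mul_le (volume.restrict (Ioi r))
      (f := fun s => ENNReal.ofReal s⁻¹) (g := fun s => ENNReal.ofReal s * φ s)
      (by fun_prop) ((by fun_prop : AEMeasurable (fun s : ℝ => ENNReal.ofReal s) _).mul hm)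
    rw [← e1, lintegral_Ioi_inv_sq hr] at e2
    calc _ ≤ ENNReal.ofReal r * (ENNReal.ofReal r⁻¹ * _) := by gcongr
      _ = _ := by
        rw [← mul_assoc, ← ENNReal.ofReal_mul hr.le, mul_inv_cancel₀ hr.ne', ENNReal.ofReal_one]
  calc _ ≤ ∫⁻ r in Ioi 0, 1 * ∫⁻ s in Ioi r, (ENNReal.ofReal s * φ s) ^ 2 :=
        setLIntegral_mono' measurableSet_Ioi h1
    _ = _ := by
        rw [lintegral_tail measurable_const hψ]
        simp_rw [lintegral_Ioo_const_one]

lemma hardy_tail_one {φ : ℝ → ℝ≥0∞} (hφ : AEMeasurable φ (volume.restrict (Ioi 0))) :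
    ∫⁻ r in Ioi 0, ENNReal.ofReal r * (∫⁻ s in Ioi r, φ s) ^ 2 ≤
      (∫⁻ s in Ioi 0, ENNReal.ofReal s * φ s) ^ 2 := by
  set I := ∫⁻ s in Ioi 0, ENNReal.ofReal s * φ s with hI
  by_cases hI' : I = ⊤
  · simp [hI']
  have h1 : ∀ r ∈ Ioi (0 : ℝ), ENNReal.ofReal r * (∫⁻ s in Ioi r, φ s) ^ 2 ≤
      I * (1 * ∫⁻ s in Ioi r, φ s) := by
    intro r hr
    have hr : 0 < r := hr
    rw [pow_two, ← mul_assoc, one_mul]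
    gcongr
    have hm : AEMeasurable φ (volume.restrict (Ioi r)) :=
      hφ.mono_measure (Measure.restrict_mono (Ioi_subset_Ioi hr.le) le_rfl)
    rw [← lintegral_const_mul'' _ hm]
    calc _ ≤ ∫⁻ s in Ioi r, ENNReal.ofReal s * φ s := by
          refine setLIntegral_mono' measurableSet_Ioi fun s hs => ?_
          have : r ≤ s := le_of_lt hs
          gcongr
      _ ≤ _ := lintegral_mono_set (Ioi_subset_Ioi hr.le)
  calc _ ≤ ∫⁻ r in Ioi 0, I * (1 * ∫⁻ s in Ioi r, φ s) := setLIntegral_mono' measurableSet_Ioi h1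
    _ ≤ _ := by
        rw [lintegral_const_mul' _ _ hI', lintegral_tail measurable_const hφ, pow_two]
        simp_rw [lintegral_Ioo_const_one]
        exact le_of_eq rfl

/-! ### Series in `L²` -/

lemma lintegral_tsum_sq_le {α ι : Type*} [MeasurableSpace α] [Countable ι] (μ : Measure α)
    {f : ι → α → ℂ} (hf : ∀ i, AEStronglyMeasurable (f i) μ) :
    ∫⁻ a, (∑' i, ‖f i a‖ₑ) ^ 2 ∂μ ≤ (∑' i, eLpNorm (f i) 2 μ) ^ 2 := by
  have hsq : ∀ i, ∫⁻ a, ‖f i a‖ₑ ^ 2 ∂μ = eLpNorm (f i) 2 μ ^ 2 := by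
    intro i
    rw [eLpNorm_eq_lintegral_rpow_enorm_toReal (by simp) (by simp), ← ENNReal.rpow_natCast,
      ← ENNReal.rpow_mul]
    simp
  have hcs : ∀ i j, ∫⁻ a, ‖f i a‖ₑ * ‖f j a‖ₑ ∂μ ≤ eLpNorm (f i) 2 μ * eLpNorm (f j) 2 μ := by
    intro i j
    have := sq_lintegral_mul_le μ (hf i).enorm (hf j).enorm
    rw [hsq, hsq, ← mul_pow] at this
    exact (ENNReal.pow_le_pow_left_iff two_ne_zero).1 this
  calc _ = ∫⁻ a, ∑' i, ∑' j, ‖f i a‖ₑ * ‖f j a‖ₑ ∂μ := by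
        refine lintegral_congr fun a => ?_
        simp_rw [pow_two, ENNReal.tsum_mul_left, ENNReal.tsum_mul_right]
    _ = ∑' i, ∑' j, ∫⁻ a, ‖f i a‖ₑ * ‖f j a‖ₑ ∂μ := by
        have hm : ∀ i j, AEMeasurable (fun a => ‖f i a‖ₑ * ‖f j a‖ₑ) μ :=
          fun i j => (hf i).enorm.mul (hf j).enorm
        rw [lintegral_tsum fun i => AEMeasurable.tsum fun j => hm i j]
        congr 1; ext i
        rw [lintegral_tsum fun j => hm i j]
    _ ≤ ∑' i, ∑' j, eLpNorm (f i) 2 μ * eLpNorm (f j) 2 μ :=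
        ENNReal.tsum_le_tsum fun i => ENNReal.tsum_le_tsum fun j => hcs i j
    _ = _ := by simp_rw [pow_two, ENNReal.tsum_mul_left, ENNReal.tsum_mul_right]

lemma ae_summable_of_tsum_eLpNorm {α ι : Type*} [MeasurableSpace α] [Countable ι] {μ : Measure α}
    {f : ι → α → ℂ} (hf : ∀ i, AEStronglyMeasurable (f i) μ) (h : ∑' i, eLpNorm (f i) 2 μ ≠ ⊤) :
    ∀ᵐ a ∂μ, Summable fun i => ‖f i a‖ := by
  have h1 := (lintegral_tsum_sq_le μ hf).trans_lt (ENNReal.pow_lt_top h.lt_top)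
  have h2 := ae_lt_top' ((AEMeasurable.tsum fun i => (hf i).enorm).pow_const 2) h1.ne
  filter_upwards [h2] with a ha
  have ha' : ∑' i, ‖f i a‖ₑ ≠ ⊤ := by
    intro h; rw [h] at ha; simp at ha
  have := ENNReal.summable_toReal ha'
  simpa using this

lemma eLpNorm_le_tsum_of_hasSum {α ι : Type*} [MeasurableSpace α] [Countable ι] {μ : Measure α}
    {f : ι → α → ℂ} {g : α → ℂ} (hf : ∀ i, AEStronglyMeasurable (f i) μ)
    (h : ∀ᵐ a ∂μ, HasSum (fun i => f i a) (g a)) :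
    eLpNorm g 2 μ ≤ ∑' i, eLpNorm (f i) 2 μ := by
  refine (ENNReal.pow_le_pow_left_iff two_ne_zero).1 (le_trans ?_ (lintegral_tsum_sq_le μ hf))
  rw [eLpNorm_eq_lintegral_rpow_enorm_toReal (by simp) (by simp), ← ENNReal.rpow_natCast,
      ← ENNReal.rpow_mul]
  simp only [ENNReal.toReal_ofNat, ENNReal.rpow_ofNat, one_div, Nat.cast_ofNat, ne_eq,
    OfNat.ofNat_ne_zero, not_false_eq_true, inv_mul_cancel₀, ENNReal.rpow_one]
  refine lintegral_mono_ae (h.mono fun a ha => ?_)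
  gcongr
  by_cases ht : ∑' i, ‖f i a‖ₑ = ⊤
  · rw [ht]; exact le_top
  have hs : Summable fun i => ‖f i a‖ := by simpa using ENNReal.summable_toReal ht
  rw [← ha.tsum_eq, ← ofReal_norm]
  calc _ ≤ ENNReal.ofReal (∑' i, ‖f i a‖) := ENNReal.ofReal_le_ofReal (norm_tsum_le_tsum_norm hs)
    _ = ∑' i, ENNReal.ofReal ‖f i a‖ := ENNReal.ofReal_tsum_of_nonneg (fun _ => norm_nonneg _) hs
    _ = _ := by simp

/-! ### Pointwise bounds and primitives -/

lemma cauchy_schwarz_radial {f g : ℝ → ℂ} (hf : AEStronglyMeasurable f radialMeasure)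
    (hg : AEStronglyMeasurable g radialMeasure) :
    ∫⁻ r in Ioi 0, ENNReal.ofReal r * (‖f r‖ₑ * ‖g r‖ₑ) ≤ radNorm f * radNorm g := by
  have := sq_lintegral_mul_le radialMeasure hf.enorm hg.enorm
  rw [lintegral_radialMeasure, lintegral_radialMeasure, lintegral_radialMeasure, ← radNorm_sq,
    ← radNorm_sq, ← mul_pow] at this
  exact (ENNReal.pow_le_pow_left_iff two_ne_zero).1 this

lemma enorm_div_mul {r : ℝ} (hr : 0 < r) (z : ℂ) : ENNReal.ofReal r * ‖z / r‖ₑ = ‖z‖ₑ := by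
  rw [← ofReal_norm, ← ofReal_norm, ← ENNReal.ofReal_mul hr.le, norm_div, Complex.norm_real,
    Real.norm_of_nonneg hr.le, mul_div_cancel₀ _ hr.ne']

lemma aesm_div {f : ℝ → ℂ} (hf : AEStronglyMeasurable f radialMeasure) :
    AEStronglyMeasurable (fun r => f r / r) radialMeasure := by
  have h : AEStronglyMeasurable (fun r : ℝ => (r : ℂ)⁻¹) radialMeasure :=
    (Complex.measurable_ofReal.inv).aestronglyMeasurable
  exact (hf.mul h).congr (Eventually.of_forall fun r => by simp [div_eq_mul_inv])

namespace ACDeriv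

variable {f f' : ℝ → ℂ}

lemma enorm_sub_le (hf : ACDeriv f f') {a b : ℝ} (ha : 0 < a) (hb : 0 < b) :
    ‖f b - f a‖ₑ ≤ ∫⁻ s in uIoc a b, ‖f' s‖ₑ := by
  rw [← hf.integral_eq ha hb, ← ofReal_norm, intervalIntegral.norm_intervalIntegral_eq, ofReal_norm]
  exact enorm_integral_le_lintegral_enorm _

lemma enorm_sq_le (hf : ACDeriv f f') {a b : ℝ} (ha : 0 < a) (hb : 0 < b) :
    ‖f b‖ₑ ^ 2 ≤ ‖f a‖ₑ ^ 2 + 2 * ∫⁻ s in uIoc a b, ‖f s‖ₑ * ‖f' s‖ₑ := by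
  have h := (hf.mul hf.conj).enorm_sub_le ha hb
  have e : ∀ r, ‖f r * (starRingEnd ℂ) (f r)‖ₑ = ‖f r‖ₑ ^ 2 := by
    intro r; rw [enorm_mul, pow_two]; congr 1; exact (RCLike.enorm_conj _)
  calc _ = ‖(f b * (starRingEnd ℂ) (f b) - f a * (starRingEnd ℂ) (f a)) +
        f a * (starRingEnd ℂ) (f a)‖ₑ := by rw [sub_add_cancel, e]
    _ ≤ _ := enorm_add_le _ _
    _ ≤ (∫⁻ s in uIoc a b, 2 * (‖f s‖ₑ * ‖f' s‖ₑ)) + ‖f a‖ₑ ^ 2 := by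
        rw [e]
        gcongr
        refine h.trans (lintegral_mono fun s => ?_)
        refine (enorm_add_le _ _).trans (le_of_eq ?_)
        rw [enorm_mul, enorm_mul, RCLike.enorm_conj, RCLike.enorm_conj]
        ring
    _ = _ := by rw [lintegral_const_mul' _ _ (by simp), add_comm]

lemma uIoc_subset {a b : ℝ} (ha : 0 < a) (hb : 0 < b) : uIoc a b ⊆ Ioi 0 :=
  fun _ hx => (lt_min ha hb).trans hx.1

lemma lintegral_mul_le (hf : ACDeriv f f') :
    ∫⁻ s in Ioi 0, ‖f s‖ₑ * ‖f' s‖ₑ ≤ radNorm (fun r => f r / r) * radNorm f' := by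
  refine le_trans (le_of_eq ?_) (cauchy_schwarz_radial (aesm_div hf.aesm) hf.aesm_deriv)
  refine setLIntegral_congr_fun measurableSet_Ioi fun r hr => ?_
  rw [← mul_assoc, enorm_div_mul hr]

lemma lintegral_Ioo_inv {r : ℝ} (hr : 0 < r) :
    ∫⁻ s in Ioo 0 r, ENNReal.ofReal s⁻¹ = ⊤ := by
  by_contra h
  have h1 : IntegrableOn (fun s : ℝ => s⁻¹) (Ioo 0 r) := by
    refine ⟨measurable_inv.aestronglyMeasurable, ?_⟩
    rw [hasFiniteIntegral_iff_enorm]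
    refine lt_of_le_of_lt (le_of_eq ?_) (lt_top_iff_ne_top.2 h)
    refine setLIntegral_congr_fun measurableSet_Ioo fun s hs => ?_
    rw [Real.enorm_of_nonneg (inv_nonneg.2 hs.1.le)]
  have h2 : IntervalIntegrable (fun s : ℝ => s⁻¹) volume 0 r := by
    rw [intervalIntegrable_iff_integrableOn_Ioo_of_le hr.le]; exact h1
  rw [intervalIntegrable_inv_iff, uIcc_of_le hr.le] at h2
  rcases h2 with h2 | h2
  · exact hr.ne h2
  · exact h2 ⟨le_rfl, hr.le⟩

lemma enorm_sq_le_of_div (hf : ACDeriv f f') (h : radNorm (fun r => f r / r) ≠ ⊤) {r : ℝ}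
    (hr : 0 < r) : ‖f r‖ₑ ^ 2 ≤ 2 * (radNorm (fun r => f r / r) * radNorm f') := by
  set I := 2 * (radNorm (fun r => f r / r) * radNorm f') with hI
  by_contra! hlt
  have hle : ∀ ρ ∈ Ioo 0 r, ‖f r‖ₑ ^ 2 - I ≤ ‖f ρ‖ₑ ^ 2 := by
    intro ρ hρ
    rw [tsub_le_iff_right]
    refine (hf.enorm_sq_le hρ.1 hr).trans ?_
    gcongr
    rw [hI]
    gcongr
    exact (lintegral_mono_set (uIoc_subset hρ.1 hr)).trans hf.lintegral_mul_le
  have hpos : ‖f r‖ₑ ^ 2 - I ≠ 0 := (tsub_pos_of_lt hlt).ne'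
  have h1 : (⊤ : ℝ≥0∞) ≤ radNorm (fun r => f r / r) ^ 2 := by
    calc (⊤ : ℝ≥0∞) = (‖f r‖ₑ ^ 2 - I) * ∫⁻ s in Ioo 0 r, ENNReal.ofReal s⁻¹ := by
          rw [lintegral_Ioo_inv hr, ENNReal.mul_top hpos]
      _ = ∫⁻ s in Ioo 0 r, (‖f r‖ₑ ^ 2 - I) * ENNReal.ofReal s⁻¹ := by
          rw [lintegral_const_mul _ (by fun_prop)]
      _ ≤ ∫⁻ s in Ioo 0 r, ENNReal.ofReal s * ‖f s / s‖ₑ ^ 2 := by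
          refine setLIntegral_mono' measurableSet_Ioo fun s hs => ?_
          have hs0 : (0 : ℝ) < s := hs.1
          have e : ENNReal.ofReal s * ‖f s / s‖ₑ ^ 2 = ‖f s‖ₑ ^ 2 * ENNReal.ofReal s⁻¹ := by
            rw [← enorm_div_mul hs0 (f s), mul_pow, pow_two (ENNReal.ofReal s),
              ENNReal.ofReal_inv_of_pos hs0]
            have : ENNReal.ofReal s ≠ 0 := by simpa using hs0
            calc _ = (ENNReal.ofReal s * (ENNReal.ofReal s)⁻¹) *
                (ENNReal.ofReal s * ‖f s / s‖ₑ ^ 2) := by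
                  rw [ENNReal.mul_inv_cancel this (by simp), one_mul]
              _ = _ := by ring
          rw [e]
          gcongr
          exact hle s hs
      _ ≤ _ := by
          rw [radNorm_sq]
          exact lintegral_mono_set Ioo_subset_Ioi_self
  exact h (by simpa using h1)

lemma enorm_sq_le_of_tail (hf : ACDeriv f f') (h : radNorm f ≠ ⊤) {r : ℝ}
    (hr : 0 < r) : ‖f r‖ₑ ^ 2 ≤ 2 * (ENNReal.ofReal r⁻¹ * (radNorm f * radNorm f')) := by
  set I := 2 * (ENNReal.ofReal r⁻¹ * (radNorm f * radNorm f')) with hI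
  have hint : ∫⁻ s in Ioi r, ‖f s‖ₑ * ‖f' s‖ₑ ≤ ENNReal.ofReal r⁻¹ * (radNorm f * radNorm f') := by
    calc _ ≤ ∫⁻ s in Ioi r, ENNReal.ofReal r⁻¹ * (ENNReal.ofReal s * (‖f s‖ₑ * ‖f' s‖ₑ)) := by
          refine setLIntegral_mono' measurableSet_Ioi fun s hs => ?_
          have hs : r < s := hs
          rw [← mul_assoc, ← ENNReal.ofReal_mul (by positivity)]
          refine le_mul_of_one_le_left (by simp) ?_
          rw [← ENNReal.ofReal_one]
          refine ENNReal.ofReal_le_ofReal ?_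
          rw [inv_mul_eq_div, le_div_iff₀ hr]; linarith
      _ = ENNReal.ofReal r⁻¹ * ∫⁻ s in Ioi r, ENNReal.ofReal s * (‖f s‖ₑ * ‖f' s‖ₑ) := by
          rw [lintegral_const_mul' _ _ (by simp)]
      _ ≤ _ := by
          gcongr
          exact (lintegral_mono_set (Ioi_subset_Ioi hr.le)).trans
            (cauchy_schwarz_radial hf.aesm hf.aesm_deriv)
  by_contra! hlt
  have hle : ∀ ρ ∈ Ioi r, ‖f r‖ₑ ^ 2 - I ≤ ‖f ρ‖ₑ ^ 2 := by
    intro ρ hρ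
    have hρ : r < ρ := hρ
    rw [tsub_le_iff_right]
    refine (hf.enorm_sq_le (hr.trans hρ) hr).trans ?_
    gcongr
    rw [hI]
    gcongr
    refine (lintegral_mono_set ?_).trans hint
    rw [uIoc_of_ge hρ.le]; exact Ioc_subset_Ioi_self
  have hpos : ‖f r‖ₑ ^ 2 - I ≠ 0 := (tsub_pos_of_lt hlt).ne'
  have h1 : (⊤ : ℝ≥0∞) ≤ radNorm f ^ 2 := by
    calc (⊤ : ℝ≥0∞) = ∫⁻ _ in Ioi r, ENNReal.ofReal r * (‖f r‖ₑ ^ 2 - I) := by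
          rw [setLIntegral_const, Real.volume_Ioi, ENNReal.mul_top]
          simp [hpos, hr]
      _ ≤ ∫⁻ s in Ioi r, ENNReal.ofReal s * ‖f s‖ₑ ^ 2 := by
          refine setLIntegral_mono' measurableSet_Ioi fun s hs => ?_
          have hs' : r ≤ s := le_of_lt hs
          gcongr
          exact hle s hs
      _ ≤ _ := by
          rw [radNorm_sq]
          exact lintegral_mono_set (Ioi_subset_Ioi hr.le)
  exact h (by simpa using h1)

end ACDeriv

lemma exists_tail_primitive {h : ℝ → ℂ} (hm : AEStronglyMeasurable h radialMeasure) {B : ℝ≥0∞}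
    (hB : B ≠ ⊤)
    (H : ∫⁻ r in Ioi 0, ENNReal.ofReal r * (∫⁻ s in Ioi r, ‖h s‖ₑ) ^ 2 ≤ B ^ 2) :
    ∃ b, ACDeriv b h ∧ radNorm b ≤ B := by
  have hm' : AEStronglyMeasurable h (volume.restrict (Ioi 0)) :=
    (aemeasurable_restrict_of_aesm hm).aestronglyMeasurable
  have hfin : ∀ r, 0 < r → ∫⁻ s in Ioi r, ‖h s‖ₑ ≠ ⊤ := by
    intro r hr htop
    have h1 : (⊤ : ℝ≥0∞) ≤ B ^ 2 := by
      calc (⊤ : ℝ≥0∞) = ∫⁻ _ in Ioo (r / 2) r, ⊤ := by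
            rw [setLIntegral_const, Real.volume_Ioo, ENNReal.top_mul]
            simp; linarith
        _ ≤ ∫⁻ ρ in Ioo (r / 2) r, ENNReal.ofReal ρ * (∫⁻ s in Ioi ρ, ‖h s‖ₑ) ^ 2 := by
            refine setLIntegral_mono' measurableSet_Ioo fun ρ hρ => ?_
            have : ∫⁻ s in Ioi ρ, ‖h s‖ₑ = ⊤ := by
              rw [eq_top_iff, ← htop]
              exact lintegral_mono_set (Ioi_subset_Ioi hρ.2.le)
            rw [this]
            have hρ0 : 0 < ρ := by linarith [hρ.1]
            simp [ENNReal.mul_top, hρ0]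
        _ ≤ _ := lintegral_mono_set fun ρ hρ => by
            have : r / 2 < ρ := hρ.1
            exact (half_pos hr).trans this
        _ ≤ _ := H
    exact (ENNReal.pow_lt_top hB.lt_top).not_ge h1
  have hint : ∀ r, 0 < r → IntegrableOn h (Ioi r) := fun r hr =>
    ⟨hm'.mono_measure (Measure.restrict_mono (Ioi_subset_Ioi hr.le) le_rfl), by
      rw [hasFiniteIntegral_iff_enorm]; exact (hfin r hr).lt_top⟩
  have hii : ∀ a b, 0 < a → a ≤ b → IntervalIntegrable h volume a b := fun a b ha hab => by
    rw [intervalIntegrable_iff_integrableOn_Ioc_of_le hab]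
    exact (hint a ha).mono_set Ioc_subset_Ioi_self
  have h1 := (ACDeriv.integral one_pos hii).add (ACDeriv.const (-∫ s in Ioi 1, h s))
  refine ⟨fun r => - ∫ s in Ioi r, h s, ?_, ?_⟩
  · refine (h1.congr_deriv (Eventually.of_forall fun r _ => add_zero _)).congr fun r hr => ?_
    have := intervalIntegral.integral_Ioi_sub_Ioi' (hint 1 one_pos) (hint r hr)
    rw [← this]; ring
  · refine (ENNReal.pow_le_pow_left_iff two_ne_zero).1 (le_trans ?_ H)
    rw [radNorm_sq]
    refine lintegral_mono fun r => ?_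
    gcongr
    rw [enorm_neg]
    exact enorm_integral_le_lintegral_enorm _

/-! ### Atoms of the radial Besov space -/

lemma radNorm_le_emul {f g : ℝ → ℂ} {M : ℝ≥0∞} (hM : M ≠ ⊤)
    (h : ∀ᵐ r : ℝ, 0 < r → ‖f r‖ₑ ≤ M * ‖g r‖ₑ) : radNorm f ≤ M * radNorm g := by
  refine (ENNReal.pow_le_pow_left_iff two_ne_zero).1 ?_
  rw [mul_pow, radNorm_sq, radNorm_sq, ← lintegral_const_mul' _ _ (by finiteness)]
  refine lintegral_mono_ae ?_
  rw [ae_restrict_iff' measurableSet_Ioi]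
  filter_upwards [h] with r hr hp
  calc _ ≤ ENNReal.ofReal r * (M * ‖g r‖ₑ) ^ 2 := by gcongr; exact hr hp
    _ = _ := by ring

/-- A building block of the radial Besov space at the length scale `t`. -/
structure IsAtom (t : ℝ) (A : ℝ≥0∞) (f : ℝ → ℂ) : Prop where
  pos : 0 < t
  ne_top : A ≠ ⊤
  ac : LocallyAC f
  norm_le : radNorm f ≤ A
  deriv_le : ENNReal.ofReal t * radNorm (deriv f) ≤ A
  div_le : ENNReal.ofReal t * radNorm (fun r => f r / r) ≤ A
  prim : ∃ g, ACDeriv g f ∧ radNorm g ≤ ENNReal.ofReal t * A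

lemma mul_le_iff_le_inv {t : ℝ} (ht : 0 < t) {x y : ℝ≥0∞} :
    ENNReal.ofReal t * x ≤ y ↔ x ≤ ENNReal.ofReal t⁻¹ * y := by
  rw [ENNReal.ofReal_inv_of_pos ht]
  exact ENNReal.mul_le_iff_le_inv (by simpa using ht) (by simp)

lemma ofReal_inv_mul_cancel {t : ℝ} (ht : 0 < t) (x : ℝ≥0∞) :
    ENNReal.ofReal t * (ENNReal.ofReal t⁻¹ * x) = x := by
  rw [← mul_assoc, ← ENNReal.ofReal_mul ht.le, mul_inv_cancel₀ ht.ne', ENNReal.ofReal_one, one_mul]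

lemma ofReal_mul_inv_cancel {t : ℝ} (ht : 0 < t) (x : ℝ≥0∞) :
    ENNReal.ofReal t⁻¹ * (ENNReal.ofReal t * x) = x := by
  rw [← mul_assoc, ← ENNReal.ofReal_mul (by positivity), inv_mul_cancel₀ ht.ne', ENNReal.ofReal_one,
    one_mul]

namespace IsAtom

variable {t : ℝ} {A : ℝ≥0∞} {f : ℝ → ℂ}

lemma acDeriv (hf : IsAtom t A f) : ACDeriv f (deriv f) := ACDeriv.of_locallyAC hf.ac

lemma aesm (hf : IsAtom t A f) : AEStronglyMeasurable f radialMeasure := hf.acDeriv.aesm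

lemma enorm_le (hf : IsAtom t A f) {r : ℝ} (hr : 0 < r) : ENNReal.ofReal t * ‖f r‖ₑ ≤ 2 * A := by
  have h1 : radNorm (fun r => f r / r) ≠ ⊤ := by
    have h := (mul_le_iff_le_inv hf.pos).1 hf.div_le
    exact ne_top_of_le_ne_top (ENNReal.mul_ne_top (by simp) hf.ne_top) h
  refine (ENNReal.pow_le_pow_left_iff two_ne_zero).1 ?_
  calc _ = ENNReal.ofReal t ^ 2 * ‖f r‖ₑ ^ 2 := mul_pow _ _ _
    _ ≤ ENNReal.ofReal t ^ 2 * (2 * (radNorm (fun r => f r / r) * radNorm (deriv f))) := by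
        gcongr; exact hf.acDeriv.enorm_sq_le_of_div h1 hr
    _ = 2 * ((ENNReal.ofReal t * radNorm (fun r => f r / r)) *
          (ENNReal.ofReal t * radNorm (deriv f))) := by ring
    _ ≤ 2 * (A * A) := by gcongr; exacts [hf.div_le, hf.deriv_le]
    _ ≤ 2 * (A * A) + 2 * (A * A) := le_self_add
    _ = _ := by ring

lemma lintegral_Ioc_le (hf : IsAtom t A f) : ∫⁻ s in Ioc 0 t, ‖f s‖ₑ ≤ A := by
  have h1 : AEStronglyMeasurable ((Ioc 0 t).indicator (fun _ => (1 : ℂ))) radialMeasure :=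
    (measurable_const.indicator measurableSet_Ioc).aestronglyMeasurable
  have h2 := cauchy_schwarz_radial (aesm_div hf.aesm) h1
  have h3 : radNorm ((Ioc 0 t).indicator (fun _ => (1 : ℂ))) ≤ ENNReal.ofReal t := by
    refine (ENNReal.pow_le_pow_left_iff two_ne_zero).1 ?_
    rw [radNorm_sq]
    calc _ ≤ ∫⁻ r in Ioi 0, (Ioc 0 t).indicator (fun _ => ENNReal.ofReal t) r := by
          refine lintegral_mono fun r => ?_
          by_cases hr : r ∈ Ioc 0 t
          · simp only [indicator_of_mem hr]
            simpa using ENNReal.ofReal_le_ofReal hr.2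
          · simp [indicator_of_notMem hr]
      _ ≤ ∫⁻ r, (Ioc 0 t).indicator (fun _ => ENNReal.ofReal t) r := setLIntegral_le_lintegral _ _
      _ = _ := by
          rw [lintegral_indicator measurableSet_Ioc, setLIntegral_const, Real.volume_Ioc, sub_zero,
            pow_two]
  calc _ = ∫⁻ s in Ioc 0 t, ENNReal.ofReal s *
        (‖f s / s‖ₑ * ‖(Ioc 0 t).indicator (fun _ => (1 : ℂ)) s‖ₑ) := by
        refine setLIntegral_congr_fun measurableSet_Ioc fun s hs => ?_
        rw [indicator_of_mem hs, enorm_one, mul_one, enorm_div_mul hs.1]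
    _ ≤ _ := lintegral_mono_set fun s hs => hs.1
    _ ≤ _ := h2
    _ ≤ radNorm (fun r => f r / r) * ENNReal.ofReal t := by gcongr
    _ ≤ A := by rw [mul_comm]; exact hf.div_le

lemma exists_prim (hf : IsAtom t A f) : ∃ g, ACDeriv g f ∧ radNorm g ≤ ENNReal.ofReal t * A ∧
    (∀ r, 0 < r → ‖g r‖ₑ ≤ 3 * A) ∧ Tendsto g atTop (𝓝 0) := by
  obtain ⟨g, hg, hgn⟩ := hf.prim
  have hfin : radNorm g ≠ ⊤ := ne_top_of_le_ne_top (ENNReal.mul_ne_top (by simp) hf.ne_top) hgn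
  have hsq : ∀ r, 0 < r → ‖g r‖ₑ ^ 2 ≤ ENNReal.ofReal r⁻¹ * (ENNReal.ofReal t * (2 * (A * A))) := by
    intro r hr
    refine (hg.enorm_sq_le_of_tail hfin hr).trans ?_
    calc _ ≤ 2 * (ENNReal.ofReal r⁻¹ * ((ENNReal.ofReal t * A) * A)) := by
          gcongr; exact hf.norm_le
      _ = _ := by ring
  have hbig : ∀ r, t ≤ r → ‖g r‖ₑ ≤ 2 * A := by
    intro r hr
    have hr0 := hf.pos.trans_le hr
    refine (ENNReal.pow_le_pow_left_iff two_ne_zero).1 ((hsq r hr0).trans ?_)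
    calc _ ≤ ENNReal.ofReal t⁻¹ * (ENNReal.ofReal t * (2 * (A * A))) := by
          gcongr; exact hf.pos
      _ = 2 * (A * A) := ofReal_mul_inv_cancel hf.pos _
      _ ≤ 2 * (A * A) + 2 * (A * A) := le_self_add
      _ = _ := by ring
  refine ⟨g, hg, hgn, fun r hr => ?_, ?_⟩
  · rcases le_total t r with h | h
    · refine (hbig r h).trans ?_
      gcongr; norm_num
    · have h1 := hg.enorm_sub_le hf.pos hr
      rw [uIoc_of_ge h] at h1
      calc ‖g r‖ₑ = ‖(g r - g t) + g t‖ₑ := by rw [sub_add_cancel]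
        _ ≤ ‖g r - g t‖ₑ + ‖g t‖ₑ := enorm_add_le _ _
        _ ≤ A + 2 * A := by
            gcongr
            · exact h1.trans ((lintegral_mono_set (Ioc_subset_Ioc_left hr.le)).trans
                hf.lintegral_Ioc_le)
            · exact hbig t le_rfl
        _ = _ := by ring
  · have h0 : Tendsto (fun r => ‖g r‖ₑ ^ 2) atTop (𝓝 0) := by
      have hlim : Tendsto (fun r : ℝ => ENNReal.ofReal r⁻¹ * (ENNReal.ofReal t * (2 * (A * A))))
          atTop (𝓝 0) := by
        have : ENNReal.ofReal t * (2 * (A * A)) ≠ ⊤ := by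
          have := hf.ne_top
          finiteness
        have h2 := ENNReal.Tendsto.mul_const (ENNReal.tendsto_ofReal (tendsto_inv_atTop_zero (𝕜 := ℝ)))
          (Or.inr this)
        simpa using h2
      refine tendsto_of_tendsto_of_tendsto_of_le_of_le' tendsto_const_nhds hlim
        (Eventually.of_forall fun _ => zero_le) ?_
      filter_upwards [eventually_gt_atTop 0] with r hr using hsq r hr
    rw [tendsto_zero_iff_norm_tendsto_zero]
    have h3 := (ENNReal.continuous_rpow_const (y := (1 / 2 : ℝ))).continuousAt.tendsto.comp h0
    have h4 : Tendsto (fun r => ‖g r‖ₑ) atTop (𝓝 0) := by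
      refine (h3.congr fun r => ?_).trans_eq ?_
      · simp only [Function.comp]
        rw [← ENNReal.rpow_natCast, ← ENNReal.rpow_mul]; simp
      · simp
    have h5 := (ENNReal.tendsto_toReal ENNReal.zero_ne_top).comp h4
    simpa [Function.comp_def] using h5

lemma conj (hf : IsAtom t A f) : IsAtom t A (fun r => (starRingEnd ℂ) (f r)) := by
  obtain ⟨g, hg, hgn⟩ := hf.prim
  refine ⟨hf.pos, hf.ne_top, hf.acDeriv.conj.ac, by rw [radNorm_conj]; exact hf.norm_le, ?_, ?_,
    _, hg.conj, by rw [radNorm_conj]; exact hgn⟩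
  · rw [radNorm_congr hf.acDeriv.conj.ae_deriv_eq, radNorm_conj]; exact hf.deriv_le
  · have : (fun r : ℝ => (starRingEnd ℂ) (f r) / r) = fun r : ℝ => (starRingEnd ℂ) (f r / r) := by
      ext r; simp
    rw [this, radNorm_conj]; exact hf.div_le

end IsAtom

/-- A bounded radial function whose gradient is square integrable. -/
structure IsMult (a : ℝ → ℂ) (M : ℝ≥0∞) : Prop where
  ac : LocallyAC a
  bound : ∀ r, 0 < r → ‖a r‖ₑ ≤ M
  deriv : radNorm (deriv a) ≤ M

lemma IsMult.acDeriv {a : ℝ → ℂ} {M : ℝ≥0∞} (ha : IsMult a M) : ACDeriv a (_root_.deriv a) :=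
  ACDeriv.of_locallyAC ha.ac

lemma IsMult.of_acDeriv {a a' : ℝ → ℂ} {M : ℝ≥0∞} (ha : ACDeriv a a')
    (hb : ∀ r, 0 < r → ‖a r‖ₑ ≤ M) (hd : radNorm a' ≤ M) : IsMult a M :=
  ⟨ha.ac, hb, by rw [radNorm_congr ha.ae_deriv_eq]; exact hd⟩

lemma IsAtom.mul {t : ℝ} {A M : ℝ≥0∞} {a f : ℝ → ℂ} (ha : IsMult a M) (hM : M ≠ ⊤)
    (hf : IsAtom t A f) : IsAtom t (3 * M * A) (fun r => a r * f r) := by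
  have hp := hf.pos
  have hA := hf.ne_top
  have hd := ha.acDeriv.mul hf.acDeriv
  obtain ⟨g, hg, hgn⟩ := hf.prim
  have hae : ∀ h : ℝ → ℂ, radNorm (fun r => a r * h r) ≤ M * radNorm h := fun h =>
    radNorm_le_emul hM (Eventually.of_forall fun r hr => by
      rw [enorm_mul]; gcongr; exact ha.bound r hr)
  have e3 : 3 * M * A = 2 * A * M + M * A := by ring
  refine ⟨hp, by finiteness, hd.ac, ?_, ?_, ?_, ?_⟩
  · refine (hae f).trans ?_
    rw [e3]
    exact (mul_le_mul_right hf.norm_le M).trans le_add_self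
  · rw [radNorm_congr hd.ae_deriv_eq]
    have h1 : ENNReal.ofReal t * radNorm (fun r => deriv a r * f r) ≤ 2 * A * M := by
      rw [mul_le_iff_le_inv hp]
      calc _ ≤ (ENNReal.ofReal t⁻¹ * (2 * A)) * radNorm (deriv a) := by
            refine radNorm_le_emul (by finiteness) (Eventually.of_forall fun r hr => ?_)
            rw [enorm_mul, mul_comm]
            gcongr
            exact (mul_le_iff_le_inv hp).1 (hf.enorm_le hr)
        _ ≤ (ENNReal.ofReal t⁻¹ * (2 * A)) * M := by gcongr; exact ha.deriv
        _ = _ := by ring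
    have h2 : ENNReal.ofReal t * radNorm (fun r => a r * deriv f r) ≤ M * A := by
      calc _ ≤ ENNReal.ofReal t * (M * radNorm (deriv f)) := by gcongr; exact hae _
        _ = M * (ENNReal.ofReal t * radNorm (deriv f)) := by ring
        _ ≤ _ := by gcongr; exact hf.deriv_le
    calc _ ≤ ENNReal.ofReal t * (radNorm (fun r => deriv a r * f r) +
          radNorm (fun r => a r * deriv f r)) := by
            gcongr
            exact radNorm_add_le (ha.acDeriv.aesm_deriv.mul hf.aesm)
              (ha.acDeriv.aesm.mul hf.acDeriv.aesm_deriv)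
      _ ≤ _ := by rw [mul_add, e3]; gcongr
  · have : (fun r : ℝ => a r * f r / r) = fun r : ℝ => a r * (f r / r) := by
      ext r; rw [mul_div_assoc]
    rw [this, e3]
    calc _ ≤ ENNReal.ofReal t * (M * radNorm (fun r => f r / r)) := by gcongr; exact hae _
      _ = M * (ENNReal.ofReal t * radNorm (fun r => f r / r)) := by ring
      _ ≤ M * A := by gcongr; exact hf.div_le
      _ ≤ _ := le_add_self
  · have hm : AEStronglyMeasurable (fun r => deriv a r * g r) radialMeasure :=
      ha.acDeriv.aesm_deriv.mul hg.aesm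
    have hB : ∫⁻ s in Ioi 0, ENNReal.ofReal s * ‖deriv a s * g s‖ₑ ≤ ENNReal.ofReal t * (M * A) := by
      simp_rw [enorm_mul]
      calc _ ≤ _ := cauchy_schwarz_radial ha.acDeriv.aesm_deriv hg.aesm
        _ ≤ M * (ENNReal.ofReal t * A) := by gcongr; exact ha.deriv
        _ = _ := by ring
    have hE := hardy_tail_one (aemeasurable_restrict_of_aesm hm).enorm
    obtain ⟨b, hb, hbn⟩ := exists_tail_primitive hm (B := ENNReal.ofReal t * (M * A))
      (by finiteness) (hE.trans (by gcongr))
    refine ⟨fun r => a r * g r - b r, ?_, ?_⟩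
    · exact ((ha.acDeriv.mul hg).sub hb).congr_deriv (Eventually.of_forall fun r _ => by ring)
    · calc _ ≤ radNorm (fun r => a r * g r) + radNorm b :=
            radNorm_sub_le (ha.acDeriv.aesm.mul hg.aesm) hb.aesm
        _ ≤ M * (ENNReal.ofReal t * A) + ENNReal.ofReal t * (M * A) := by
            gcongr
            exact (hae g).trans (by gcongr)
        _ = ENNReal.ofReal t * (2 * (M * A)) := by ring
        _ ≤ ENNReal.ofReal t * (2 * (M * A) + M * A) := by
            gcongr
            exact le_self_add
        _ = _ := by ring

lemma radNorm_sq_le_mul_div {f : ℝ → ℂ} (hf : AEStronglyMeasurable f radialMeasure) :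
    radNorm f ^ 2 ≤ radNorm (fun r => r * f r) * radNorm (fun r => f r / r) := by
  have h1 : AEStronglyMeasurable (fun r : ℝ => (r : ℂ) * f r) radialMeasure :=
    Complex.measurable_ofReal.aestronglyMeasurable.mul hf
  refine le_trans (le_of_eq ?_) (cauchy_schwarz_radial h1 (aesm_div hf))
  rw [radNorm_sq]
  refine setLIntegral_congr_fun measurableSet_Ioi fun r hr => ?_
  have hr : 0 < r := hr
  have hr' : (r : ℂ) ≠ 0 := by exact_mod_cast hr.ne'
  rw [← enorm_mul, pow_two, ← enorm_mul]
  congr 2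
  field_simp

/-- An atom whose primitive is obtained from a splitting `f = g' + h`. -/
lemma IsAtom.of_split {t : ℝ} {A : ℝ≥0∞} {f g k h : ℝ → ℂ} (ht : 0 < t) (hA : A ≠ ⊤)
    (hf : LocallyAC f) (h0 : radNorm f ≤ 2 * A) (h1 : ENNReal.ofReal t * radNorm (deriv f) ≤ 2 * A)
    (h2 : ENNReal.ofReal t * radNorm (fun r => f r / r) ≤ 2 * A) (hg : ACDeriv g k)
    (hgn : radNorm g ≤ ENNReal.ofReal t * A) (hh : AEStronglyMeasurable h radialMeasure)
    (hhn : radNorm (fun r => r * h r) ≤ ENNReal.ofReal t * A)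
    (he : ∀ᵐ r : ℝ, 0 < r → f r = k r + h r) : IsAtom t (2 * A) f := by
  have hE := hardy_tail (aemeasurable_restrict_of_aesm hh).enorm
  have e1 : ∫⁻ s in Ioi 0, ENNReal.ofReal s * (ENNReal.ofReal s * ‖h s‖ₑ) ^ 2 =
      radNorm (fun r => r * h r) ^ 2 := by
    rw [radNorm_sq]
    refine setLIntegral_congr_fun measurableSet_Ioi fun s hs => ?_
    have hs : 0 < s := hs
    rw [enorm_mul, ← ofReal_norm (s : ℂ), Complex.norm_real, Real.norm_of_nonneg hs.le]
  rw [e1] at hE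
  obtain ⟨b, hb, hbn⟩ := exists_tail_primitive hh (B := ENNReal.ofReal t * A) (by finiteness)
    (hE.trans (by gcongr))
  refine ⟨ht, by finiteness, hf, h0, h1, h2, fun r => g r + b r, ?_, ?_⟩
  · exact (hg.add hb).congr_deriv (he.mono fun r hr hp => (hr hp).symm)
  · calc _ ≤ radNorm g + radNorm b := radNorm_add_le hg.aesm hb.aesm
      _ ≤ _ := by rw [two_mul, mul_add]; gcongr

lemma IsAtom.of_weight {t : ℝ} {A : ℝ≥0∞} {f : ℝ → ℂ} (ht : 0 < t) (hA : A ≠ ⊤)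
    (hf : LocallyAC f) (h1 : ENNReal.ofReal t * radNorm (deriv f) ≤ A)
    (h2 : ENNReal.ofReal t * radNorm (fun r => f r / r) ≤ A)
    (h3 : radNorm (fun r => r * f r) ≤ ENNReal.ofReal t * A) : IsAtom t (2 * A) f := by
  have hA2 : A ≤ 2 * A := by rw [two_mul]; exact le_self_add
  have hm := (ACDeriv.of_locallyAC hf).aesm
  refine IsAtom.of_split (g := fun _ => 0) (k := fun _ => 0) (h := f) ht hA hf ?_ (h1.trans hA2)
    (h2.trans hA2) (ACDeriv.const 0) (by simp [radNorm]) hm h3 (by simp)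
  refine (ENNReal.pow_le_pow_left_iff two_ne_zero).1 ((radNorm_sq_le_mul_div hm).trans ?_)
  calc _ ≤ (ENNReal.ofReal t * A) * radNorm (fun r => f r / r) := by gcongr
    _ = A * (ENNReal.ofReal t * radNorm (fun r => f r / r)) := by ring
    _ ≤ A * A := by gcongr
    _ ≤ (2 * A) * (2 * A) := by gcongr
    _ = _ := by ring

/-! ### The radial Besov space -/

/-- `f` is a sum of atoms of total size at most `B`. -/
def IsBesov (f : ℝ → ℂ) (B : ℝ≥0∞) : Prop :=
  ∃ (ι : Type) (_ : Countable ι) (F : ι → ℝ → ℂ) (t : ι → ℝ) (A : ι → ℝ≥0∞),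
    (∀ i, IsAtom (t i) (A i) (F i)) ∧ ∑' i, A i ≤ B ∧
      ∀ᵐ r : ℝ, 0 < r → HasSum (fun i => F i r) (f r)

lemma IsAtom.isBesov {t : ℝ} {A : ℝ≥0∞} {f : ℝ → ℂ} (hf : IsAtom t A f) : IsBesov f A :=
  ⟨Unit, inferInstance, fun _ => f, fun _ => t, fun _ => A, fun _ => hf, by simp,
    Eventually.of_forall fun r _ => by simp⟩

lemma ae_summable_atoms {ι : Type} [Countable ι] {F : ι → ℝ → ℂ} {t : ι → ℝ} {A : ι → ℝ≥0∞}
    (h : ∀ i, IsAtom (t i) (A i) (F i)) (hA : ∑' i, A i ≠ ⊤) :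
    ∀ᵐ r : ℝ, 0 < r → Summable fun i => ‖F i r‖ := by
  rw [← ae_radialMeasure_iff]
  exact ae_summable_of_tsum_eLpNorm (fun i => (h i).aesm)
    (ne_top_of_le_ne_top hA (ENNReal.tsum_le_tsum fun i => (h i).norm_le))

namespace IsBesov

variable {f g : ℝ → ℂ} {B B' : ℝ≥0∞}

lemma mono (hf : IsBesov f B) (h : B ≤ B') : IsBesov f B' := by
  obtain ⟨ι, hι, F, t, A, h1, h2, h3⟩ := hf
  exact ⟨ι, hι, F, t, A, h1, h2.trans h, h3⟩

lemma congr (hf : IsBesov f B) (h : ∀ᵐ r : ℝ, 0 < r → f r = g r) : IsBesov g B := by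
  obtain ⟨ι, hι, F, t, A, h1, h2, h3⟩ := hf
  refine ⟨ι, hι, F, t, A, h1, h2, ?_⟩
  filter_upwards [h, h3] with r h h3 hr
  rw [← h hr]; exact h3 hr

lemma aesm (hf : IsBesov f B) : AEStronglyMeasurable f radialMeasure := by
  obtain ⟨ι, hι, F, t, A, h1, h2, h3⟩ := hf
  refine aestronglyMeasurable_of_tendsto_ae (u := (atTop : Filter (Finset ι)))
    (f := fun s r => ∑ i ∈ s, F i r) (fun s => ?_) (ae_radialMeasure_iff.2 h3)
  exact Finset.aestronglyMeasurable_fun_sum s fun i _ => (h1 i).aesm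

lemma radNorm_le (hf : IsBesov f B) : radNorm f ≤ B := by
  obtain ⟨ι, hι, F, t, A, h1, h2, h3⟩ := hf
  exact ((eLpNorm_le_tsum_of_hasSum (fun i => (h1 i).aesm) (ae_radialMeasure_iff.2 h3)).trans
    (ENNReal.tsum_le_tsum fun i => (h1 i).norm_le)).trans h2

lemma of_hasSum {κ : Type} [Countable κ] {y : κ → ℝ → ℂ} {B : κ → ℝ≥0∞}
    (hy : ∀ k, IsBesov (y k) (B k)) (hB : ∑' k, B k ≠ ⊤)
    (h : ∀ᵐ r : ℝ, 0 < r → HasSum (fun k => y k r) (f r)) : IsBesov f (∑' k, B k) := by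
  choose ι hι F t A h1 h2 h3 using hy
  have hsum : ∑' σ : Σ k, ι k, A σ.1 σ.2 ≤ ∑' k, B k := by
    rw [ENNReal.tsum_sigma fun k i => A k i]
    exact ENNReal.tsum_le_tsum h2
  refine ⟨Σ k, ι k, inferInstance, fun σ => F σ.1 σ.2, fun σ => t σ.1 σ.2, fun σ => A σ.1 σ.2,
    fun σ => h1 σ.1 σ.2, hsum, ?_⟩
  have h4 := ae_summable_atoms (fun σ : Σ k, ι k => h1 σ.1 σ.2) (ne_top_of_le_ne_top hB hsum)
  filter_upwards [h, h4, ae_all_iff.2 h3] with r hr h4 h3 hp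
  have hs : Summable fun σ : Σ k, ι k => F σ.1 σ.2 r := (h4 hp).of_norm
  have := hs.hasSum.sigma (fun k => h3 k hp)
  rw [(hr hp).unique this]
  exact hs.hasSum

lemma of_hasSum_le {κ : Type} [Countable κ] {y : κ → ℝ → ℂ} {A : κ → ℝ≥0∞} {C : ℝ≥0∞} (hC : C ≠ ⊤)
    (hy : ∀ k, IsBesov (y k) (C * A k)) (hA : ∑' k, A k ≤ B) (hB : B ≠ ⊤)
    (h : ∀ᵐ r : ℝ, 0 < r → HasSum (fun k => y k r) (f r)) : IsBesov f (C * B) := by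
  have e : ∑' k, C * A k = C * ∑' k, A k := ENNReal.tsum_mul_left
  have hle : C * ∑' k, A k ≤ C * B := by gcongr
  refine (of_hasSum hy ?_ h).mono (e.le.trans hle)
  rw [e]
  exact ne_top_of_le_ne_top (by finiteness) hle

lemma zero : IsBesov (fun _ => 0) 0 :=
  ⟨Empty, inferInstance, fun _ _ => 0, fun _ => 1, fun _ => 0, fun i => i.elim, by simp,
    Eventually.of_forall fun r _ => by simp⟩

lemma add (hf : IsBesov f B) (hg : IsBesov g B') : IsBesov (fun r => f r + g r) (B + B') := by
  obtain ⟨ι, hι, F, t, A, h1, h2, h3⟩ := hf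
  obtain ⟨ι', hι', F', t', A', h1', h2', h3'⟩ := hg
  refine ⟨ι ⊕ ι', inferInstance, Sum.elim F F', Sum.elim t t', Sum.elim A A', ?_, ?_, ?_⟩
  · rintro (i | i)
    exacts [h1 i, h1' i]
  · rw [ENNReal.summable.tsum_sum (by exact ENNReal.summable)]
    exact add_le_add h2 h2'
  · filter_upwards [h3, h3'] with r h h' hr
    exact HasSum.sum (f := fun i => Sum.elim F F' i r) (h hr) (h' hr)

lemma mul {a : ℝ → ℂ} {M : ℝ≥0∞} (ha : IsMult a M) (hM : M ≠ ⊤) (hf : IsBesov f B) :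
    IsBesov (fun r => a r * f r) (3 * M * B) := by
  obtain ⟨ι, hι, F, t, A, h1, h2, h3⟩ := hf
  refine ⟨ι, hι, fun i r => a r * F i r, t, fun i => 3 * M * A i, fun i => (h1 i).mul ha hM, ?_, ?_⟩
  · rw [ENNReal.tsum_mul_left]; gcongr
  · filter_upwards [h3] with r h hr using (h hr).mul_left _

lemma conj (hf : IsBesov f B) : IsBesov (fun r => (starRingEnd ℂ) (f r)) B := by
  obtain ⟨ι, hι, F, t, A, h1, h2, h3⟩ := hf
  refine ⟨ι, hι, _, t, A, fun i => (h1 i).conj, h2, ?_⟩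
  filter_upwards [h3] with r h hr using (h hr).map (starRingEnd ℂ) Complex.continuous_conj

end IsBesov

/-! ### Multipliers -/

namespace IsMult

variable {a b : ℝ → ℂ} {M M' : ℝ≥0∞}

lemma mono (ha : IsMult a M) (h : M ≤ M') : IsMult a M' :=
  ⟨ha.ac, fun r hr => (ha.bound r hr).trans h, ha.deriv.trans h⟩

lemma congr (ha : IsMult a M) (h : ∀ r, 0 < r → a r = b r) : IsMult b M :=
  of_acDeriv (ha.acDeriv.congr h) (fun r hr => h r hr ▸ ha.bound r hr) ha.deriv

lemma const (c : ℂ) : IsMult (fun _ => c) ‖c‖ₑ :=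
  of_acDeriv (ACDeriv.const c) (fun _ _ => le_rfl) (by simp [radNorm])

lemma add (ha : IsMult a M) (hb : IsMult b M') : IsMult (fun r => a r + b r) (M + M') :=
  of_acDeriv (ha.acDeriv.add hb.acDeriv)
    (fun r hr => (enorm_add_le _ _).trans (add_le_add (ha.bound r hr) (hb.bound r hr)))
    ((radNorm_add_le ha.acDeriv.aesm_deriv hb.acDeriv.aesm_deriv).trans
      (add_le_add ha.deriv hb.deriv))

lemma mul (ha : IsMult a M) (hb : IsMult b M') (hM : M ≠ ⊤) (hM' : M' ≠ ⊤) :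
    IsMult (fun r => a r * b r) (2 * M * M') := by
  have e : 2 * M * M' = M' * M + M * M' := by ring
  refine of_acDeriv (ha.acDeriv.mul hb.acDeriv) (fun r hr => ?_) ?_
  · rw [enorm_mul, e]
    exact (mul_le_mul' (ha.bound r hr) (hb.bound r hr)).trans le_add_self
  · refine (radNorm_add_le (ha.acDeriv.aesm_deriv.mul hb.acDeriv.aesm)
      (ha.acDeriv.aesm.mul hb.acDeriv.aesm_deriv)).trans ?_
    rw [e]
    gcongr
    · refine (radNorm_le_emul (g := _root_.deriv a) hM' (Eventually.of_forall fun r hr => ?_)).trans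
        (by gcongr; exact ha.deriv)
      rw [Pi.mul_apply, enorm_mul, mul_comm]; gcongr; exact hb.bound r hr
    · refine (radNorm_le_emul (g := _root_.deriv b) hM (Eventually.of_forall fun r hr => ?_)).trans
        (by gcongr; exact hb.deriv)
      rw [Pi.mul_apply, enorm_mul]; gcongr; exact ha.bound r hr

lemma conj (ha : IsMult a M) : IsMult (fun r => (starRingEnd ℂ) (a r)) M :=
  of_acDeriv ha.acDeriv.conj (fun r hr => by rw [RCLike.enorm_conj]; exact ha.bound r hr)
    (by rw [radNorm_conj]; exact ha.deriv)

lemma neg (ha : IsMult a M) : IsMult (fun r => - a r) M :=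
  of_acDeriv ha.acDeriv.neg (fun r hr => by rw [enorm_neg]; exact ha.bound r hr)
    ((radNorm_mono (Eventually.of_forall fun r _ => by rw [norm_neg])).trans ha.deriv)

lemma sub (ha : IsMult a M) (hb : IsMult b M') : IsMult (fun r => a r - b r) (M + M') := by
  simpa [sub_eq_add_neg] using ha.add hb.neg

lemma inv (ha : IsMult a M) (h : ∀ r, 0 < r → 1 ≤ ‖a r‖) : IsMult (fun r => (a r)⁻¹) (M + 1) := by
  refine of_acDeriv (ha.acDeriv.inv one_pos h) (fun r hr => ?_) ?_
  · refine le_trans ?_ le_add_self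
    rw [← ofReal_norm, ← ENNReal.ofReal_one, norm_inv]
    exact ENNReal.ofReal_le_ofReal (inv_le_one_of_one_le₀ (h r hr))
  · refine (radNorm_mono (g := _root_.deriv a) (Eventually.of_forall fun r hr => ?_)).trans
      (ha.deriv.trans le_self_add)
    rw [norm_div, norm_neg, norm_pow]
    exact div_le_self (norm_nonneg _) (one_le_pow₀ (h r hr))

end IsMult

lemma IsBesov.const_mul {f : ℝ → ℂ} {B : ℝ≥0∞} (c : ℂ) (hf : IsBesov f B) :
    IsBesov (fun r => c * f r) (3 * ‖c‖ₑ * B) := hf.mul (IsMult.const c) (by simp)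

lemma IsBesov.neg {f : ℝ → ℂ} {B : ℝ≥0∞} (hf : IsBesov f B) : IsBesov (fun r => - f r) (3 * B) := by
  simpa using hf.const_mul (-1)

lemma IsBesov.sub {f g : ℝ → ℂ} {B B' : ℝ≥0∞} (hf : IsBesov f B) (hg : IsBesov g B') :
    IsBesov (fun r => f r - g r) (B + 3 * B') := by
  simpa [sub_eq_add_neg] using hf.add hg.neg

/-! ### Termwise integration -/

lemma exists_local_L1_bound {a b : ℝ} (ha : 0 < a) (hb : 0 < b) : ∃ C : ℝ≥0∞, C ≠ ⊤ ∧
    ∀ F : ℝ → ℂ, AEStronglyMeasurable F radialMeasure →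
      ∫⁻ s in uIoc a b, ‖F s‖ₑ ≤ C * radNorm F := by
  set G : ℝ → ℂ := (uIoc a b).indicator (fun s => (s : ℂ)⁻¹) with hG
  have hGm : AEStronglyMeasurable G radialMeasure :=
    ((Complex.measurable_ofReal.inv).indicator measurableSet_uIoc).aestronglyMeasurable
  have hpos : ∀ s ∈ uIoc a b, 0 < s := fun s hs => (lt_min ha hb).trans hs.1
  refine ⟨radNorm G, ?_, fun F hF => ?_⟩
  · have hle : radNorm G ^ 2 ≤ ENNReal.ofReal (min a b)⁻¹ * volume (uIoc a b) := by
      rw [radNorm_sq]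
      calc _ ≤ ∫⁻ r in Ioi 0, (uIoc a b).indicator (fun _ => ENNReal.ofReal (min a b)⁻¹) r := by
            refine lintegral_mono fun r => ?_
            by_cases hr : r ∈ uIoc a b
            · have hr0 := hpos r hr
              simp only [hG, indicator_of_mem hr]
              have : ENNReal.ofReal r * ‖(r : ℂ)⁻¹‖ₑ ^ 2 = ENNReal.ofReal r⁻¹ := by
                rw [← ofReal_norm, norm_inv, Complex.norm_real, Real.norm_of_nonneg hr0.le,
                  ← ENNReal.ofReal_pow (by positivity), ← ENNReal.ofReal_mul hr0.le]
                congr 1; field_simp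
              rw [this]
              refine ENNReal.ofReal_le_ofReal ?_
              exact inv_anti₀ (lt_min ha hb) (le_of_lt hr.1)
            · simp [hG, indicator_of_notMem hr]
        _ ≤ _ := (setLIntegral_le_lintegral _ _).trans
            (by rw [lintegral_indicator measurableSet_uIoc, setLIntegral_const])
    intro htop
    rw [htop] at hle
    have : ENNReal.ofReal (min a b)⁻¹ * volume (uIoc a b) ≠ ⊤ := by
      rw [uIoc, Real.volume_Ioc]; finiteness
    exact this (top_unique (by simpa using hle))
  · rw [mul_comm]
    refine le_trans (le_trans (le_of_eq ?_) (lintegral_mono_set (ACDeriv.uIoc_subset ha hb)))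
      (cauchy_schwarz_radial hF hGm)
    refine setLIntegral_congr_fun measurableSet_uIoc fun s hs => ?_
    simp only [hG, indicator_of_mem hs]
    have hs0 := hpos s hs
    rw [← enorm_mul, ← div_eq_mul_inv, enorm_div_mul hs0]

lemma hasSum_intervalIntegral {ι : Type} [Countable ι] {F : ι → ℝ → ℂ} {f k : ℝ → ℂ}
    (hF : ∀ i, AEStronglyMeasurable (F i) radialMeasure) (hs : ∑' i, radNorm (F i) ≠ ⊤)
    (h : ∀ᵐ r : ℝ, 0 < r → HasSum (fun i => F i r) (f r)) (hk : ContinuousOn k (Ioi 0))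
    {a b : ℝ} (ha : 0 < a) (hb : 0 < b) :
    HasSum (fun i => ∫ s in a..b, k s * F i s) (∫ s in a..b, k s * f s) := by
  obtain ⟨C, hC, hloc⟩ := exists_local_L1_bound ha hb
  have hsub : uIoc a b ⊆ Ioi 0 := ACDeriv.uIoc_subset ha hb
  have hsub' : uIcc a b ⊆ Ioi 0 := fun x hx => (lt_min ha hb).trans_le hx.1
  obtain ⟨D, hD⟩ := isCompact_uIcc.exists_bound_of_continuousOn (hk.mono hsub')
  have hD' : ∀ s ∈ uIoc a b, ‖k s‖ₑ ≤ ENNReal.ofReal D := fun s hs => by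
    rw [← ofReal_norm]; exact ENNReal.ofReal_le_ofReal (hD s (uIoc_subset_uIcc hs))
  have hm : ∀ i, AEStronglyMeasurable (fun s => k s * F i s) (volume.restrict (uIoc a b)) := by
    intro i
    refine AEStronglyMeasurable.mul ?_ ?_
    · exact (hk.mono hsub).aestronglyMeasurable measurableSet_uIoc
    · exact (aemeasurable_restrict_of_aesm (hF i)).aestronglyMeasurable.mono_measure
        (Measure.restrict_mono hsub le_rfl)
  have hb1 : ∀ i, ∫⁻ s in uIoc a b, ‖k s * F i s‖ₑ ≤ ENNReal.ofReal D * (C * radNorm (F i)) := by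
    intro i
    calc _ ≤ ∫⁻ s in uIoc a b, ENNReal.ofReal D * ‖F i s‖ₑ := by
          refine setLIntegral_mono' measurableSet_uIoc fun s hs => ?_
          rw [enorm_mul]; gcongr; exact hD' s hs
      _ = ENNReal.ofReal D * ∫⁻ s in uIoc a b, ‖F i s‖ₑ := lintegral_const_mul' _ _ (by simp)
      _ ≤ _ := by gcongr; exact hloc _ (hF i)
  have hfin : ∑' i, ∫⁻ s in uIoc a b, ‖k s * F i s‖ₑ ≠ ⊤ := by
    refine ne_top_of_le_ne_top ?_ (ENNReal.tsum_le_tsum hb1)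
    rw [ENNReal.tsum_mul_left, ENNReal.tsum_mul_left]
    finiteness
  have hint : ∀ i, Integrable (fun s => k s * F i s) (volume.restrict (uIoc a b)) := fun i =>
    ⟨hm i, by
      rw [hasFiniteIntegral_iff_enorm]
      exact lt_of_le_of_lt (ENNReal.le_tsum i) hfin.lt_top⟩
  have key := hasSum_integral_of_summable_integral_norm hint (by
    refine (ENNReal.summable_toReal hfin).congr fun i => ?_
    rw [integral_norm_eq_lintegral_enorm (hm i)])
  have e : ∫ s in uIoc a b, ∑' i, k s * F i s = ∫ s in uIoc a b, k s * f s := by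
    refine integral_congr_ae ?_
    rw [EventuallyEq, ae_restrict_iff' measurableSet_uIoc]
    filter_upwards [h] with s hs hm
    exact ((hs (hsub hm)).mul_left (k s)).tsum_eq
  rw [e] at key
  simp_rw [intervalIntegral.intervalIntegral_eq_integral_uIoc]
  exact key.const_smul _

/-- A primitive, vanishing at infinity, of a function of the radial Besov space is bounded. -/
lemma IsBesov.primitive_bound {f G : ℝ → ℂ} {B : ℝ≥0∞} (hf : IsBesov f B) (hB : B ≠ ⊤)
    (hG : ACDeriv G f) (hlim : Tendsto G atTop (𝓝 0)) {r : ℝ} (hr : 0 < r) : ‖G r‖ₑ ≤ 3 * B := by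
  obtain ⟨ι, hι, F, t, A, h1, h2, h3⟩ := hf
  have hA : ∑' i, A i ≠ ⊤ := ne_top_of_le_ne_top hB h2
  choose g hg _ hgb hg0 using fun i => (h1 i).exists_prim
  have hAs : Summable fun i => 3 * (A i).toReal := (ENNReal.summable_toReal hA).mul_left 3
  have hgn : ∀ i r, 0 < r → ‖g i r‖ ≤ 3 * (A i).toReal := by
    intro i r hr
    have := ENNReal.toReal_mono (ENNReal.mul_ne_top (by simp) (h1 i).ne_top) (hgb i r hr)
    simpa using this
  have hsum : ∀ r, 0 < r → Summable fun i => g i r := fun r hr =>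
    Summable.of_norm_bounded hAs fun i => hgn i r hr
  have hinc : ∀ r', 0 < r' → G r' - G r = ∑' i, g i r' - ∑' i, g i r := by
    intro r' hr'
    have e := hasSum_intervalIntegral (k := fun _ => 1) (fun i => (h1 i).aesm)
      (ne_top_of_le_ne_top hA (ENNReal.tsum_le_tsum fun i => (h1 i).norm_le)) h3
      continuousOn_const hr hr'
    simp only [one_mul] at e
    rw [hG.integral_eq hr hr'] at e
    simp_rw [fun i => (hg i).integral_eq hr hr'] at e
    rw [← Summable.tsum_sub (hsum r' hr') (hsum r hr)]
    exact e.tsum_eq.symm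
  have hl1 : Tendsto (fun r' => ∑' i, g i r') atTop (𝓝 0) := by
    have := tendsto_tsum_of_dominated_convergence (f := fun r' i => g i r') (g := fun _ => (0 : ℂ)) hAs hg0 (by
        filter_upwards [eventually_gt_atTop 0] with r hr i using hgn i r hr)
    simpa using this
  have hl2 : Tendsto (fun r' => G r' - G r) atTop (𝓝 (0 - ∑' i, g i r)) := by
    refine (hl1.sub_const _).congr' ?_
    filter_upwards [eventually_gt_atTop 0] with r' hr' using (hinc r' hr').symm
  have heq : G r = ∑' i, g i r := by
    have := tendsto_nhds_unique hl2 (hlim.sub_const (G r))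
    simpa using this.symm
  rw [heq]
  calc _ ≤ ∑' i, ‖g i r‖ₑ := enorm_tsum_le_tsum_enorm
    _ ≤ ∑' i, 3 * A i := ENNReal.tsum_le_tsum fun i => hgb i r hr
    _ ≤ _ := by rw [ENNReal.tsum_mul_left]; gcongr

/-! ### The soliton profiles -/

section Soliton

variable {lam r : ℝ}

lemma h1_pos (hr : 0 < r) : 0 < h1 r := by unfold h1; positivity

lemma h1_sq_add_h3_sq (r : ℝ) : h1 r ^ 2 + h3 r ^ 2 = 1 := by
  have : r ^ 4 + 1 ≠ 0 := by positivity
  unfold h1 h3; field_simp; ring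

lemma h1_nonneg (r : ℝ) : 0 ≤ h1 r := by unfold h1; positivity

lemma h1_le_one (r : ℝ) : h1 r ≤ 1 := by nlinarith [h1_sq_add_h3_sq r, sq_nonneg (h3 r)]

lemma abs_h3_le_one (r : ℝ) : |h3 r| ≤ 1 :=
  abs_le_one_iff_mul_self_le_one.2 (by nlinarith [h1_sq_add_h3_sq r, sq_nonneg (h1 r)])

lemma hasDerivAt_h1 (hl : 0 < lam) (hr : 0 < r) :
    HasDerivAt (fun r => h1 (lam * r)) (-2 * h1 (lam * r) * h3 (lam * r) / r) r := by
  have h0 : (lam * r) ^ 4 + 1 ≠ 0 := by positivity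
  have hd : HasDerivAt (fun r : ℝ => lam * r) lam r := by
    simpa using (hasDerivAt_id r).const_mul lam
  have := (((hd.pow 2).const_mul 2).div ((hd.pow 4).add_const 1) h0)
  refine HasDerivAt.congr_deriv (f := fun r => h1 (lam * r)) this ?_
  simp only [h1, h3, Pi.pow_apply]
  field_simp
  ring

lemma hasDerivAt_h3 (hl : 0 < lam) (hr : 0 < r) :
    HasDerivAt (fun r => h3 (lam * r)) (2 * h1 (lam * r) ^ 2 / r) r := by
  have h0 : (lam * r) ^ 4 + 1 ≠ 0 := by positivity
  have hd : HasDerivAt (fun r : ℝ => lam * r) lam r := by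
    simpa using (hasDerivAt_id r).const_mul lam
  have := ((hd.pow 4).sub_const 1).div ((hd.pow 4).add_const 1) h0
  refine HasDerivAt.congr_deriv (f := fun r => h3 (lam * r)) this ?_
  simp only [h1, Pi.pow_apply]
  field_simp
  ring

lemma continuousOn_h1 (hl : 0 < lam) : ContinuousOn (fun r => h1 (lam * r)) (Ioi 0) :=
  fun _ hr => (hasDerivAt_h1 hl hr).continuousAt.continuousWithinAt

lemma continuousOn_h3 (hl : 0 < lam) : ContinuousOn (fun r => h3 (lam * r)) (Ioi 0) :=
  fun _ hr => (hasDerivAt_h3 hl hr).continuousAt.continuousWithinAt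

lemma acDeriv_h1 (hl : 0 < lam) : ACDeriv (fun r => (h1 (lam * r) : ℂ))
    (fun r => ((-2 * h1 (lam * r) * h3 (lam * r) / r : ℝ) : ℂ)) := by
  refine ACDeriv.of_hasDerivAt (fun r hr => (hasDerivAt_h1 hl hr).ofReal_comp) ?_
  refine Complex.continuous_ofReal.comp_continuousOn ?_
  exact ((continuousOn_const.mul (continuousOn_h1 hl)).mul (continuousOn_h3 hl)).div
    continuousOn_id fun r hr => (ne_of_gt hr)

lemma acDeriv_h3 (hl : 0 < lam) : ACDeriv (fun r => (h3 (lam * r) : ℂ))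
    (fun r => ((2 * h1 (lam * r) ^ 2 / r : ℝ) : ℂ)) := by
  refine ACDeriv.of_hasDerivAt (fun r hr => (hasDerivAt_h3 hl hr).ofReal_comp) ?_
  refine Complex.continuous_ofReal.comp_continuousOn ?_
  exact (continuousOn_const.mul ((continuousOn_h1 hl).pow 2)).div
    continuousOn_id fun r hr => (ne_of_gt hr)

lemma h1_le_weight {ρ : ℝ} (hρ : 0 < ρ) :
    h1 ρ ≤ 4 / (1 + ρ ^ 2) ∧ h1 ρ / ρ ≤ 4 / (1 + ρ ^ 2) ∧ h1 ρ / ρ ^ 2 ≤ 4 / (1 + ρ ^ 2) := by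
  have h0 : 0 < ρ ^ 4 + 1 := by positivity
  unfold h1
  refine ⟨?_, ?_, ?_⟩
  · rw [div_le_div_iff₀ h0 (by positivity)]
    nlinarith [sq_nonneg (ρ ^ 2 - 1)]
  · rw [div_div, div_le_div_iff₀ (by positivity) (by positivity)]
    nlinarith [sq_nonneg (ρ ^ 2 - 1), sq_nonneg (ρ - 1), mul_pos hρ hρ, sq_nonneg (ρ * (ρ - 1)),
      mul_nonneg hρ.le (sq_nonneg (ρ ^ 2 - 1)), mul_nonneg hρ.le (sq_nonneg (ρ - 1))]
  · rw [div_div, div_le_div_iff₀ (by positivity) (by positivity)]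
    nlinarith [sq_nonneg (ρ ^ 2 - 1), mul_nonneg (sq_nonneg ρ) (sq_nonneg (ρ ^ 2 - 1))]

lemma radNorm_weight_le (hl : 0 < lam) :
    radNorm (fun r => ((4 / (1 + (lam * r) ^ 2) : ℝ) : ℂ)) ≤ ENNReal.ofReal (3 / lam) := by
  refine (ENNReal.pow_le_pow_left_iff two_ne_zero).1 ?_
  rw [radNorm_sq, ← ENNReal.ofReal_pow (by positivity)]
  have hd : ∀ x ∈ Ici (0 : ℝ), HasDerivAt (fun s : ℝ => - (8 / lam ^ 2) / (1 + (lam * s) ^ 2))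
      (x * (4 / (1 + (lam * x) ^ 2)) ^ 2) x := by
    intro x _
    have h0 : 1 + (lam * x) ^ 2 ≠ 0 := by positivity
    have hd : HasDerivAt (fun r : ℝ => lam * r) lam x := by
      simpa using (hasDerivAt_id x).const_mul lam
    have := (hasDerivAt_const x (-(8 / lam ^ 2))).div ((hd.pow 2).const_add 1) h0
    refine HasDerivAt.congr_deriv this ?_
    simp only [Pi.pow_apply]
    field_simp
    ring
  have hp : ∀ x ∈ Ioi (0 : ℝ), 0 ≤ x * (4 / (1 + (lam * x) ^ 2)) ^ 2 := fun x hx => by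
    have : (0 : ℝ) < x := hx
    positivity
  have ht : Tendsto (fun s : ℝ => - (8 / lam ^ 2) / (1 + (lam * s) ^ 2)) atTop (𝓝 0) := by
    refine Tendsto.const_div_atTop ?_ _
    refine tendsto_atTop_add_const_left _ _ ?_
    exact (tendsto_pow_atTop two_ne_zero).comp (tendsto_id.const_mul_atTop hl)
  have i1 := integral_Ioi_of_hasDerivAt_of_nonneg' hd hp ht
  have i2 := integrableOn_Ioi_deriv_of_nonneg' hd hp ht
  have i3 := ofReal_integral_eq_lintegral_ofReal i2
    ((ae_restrict_iff' measurableSet_Ioi).2 (Eventually.of_forall hp))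
  calc _ = ∫⁻ x in Ioi 0, ENNReal.ofReal (x * (4 / (1 + (lam * x) ^ 2)) ^ 2) := by
        refine setLIntegral_congr_fun measurableSet_Ioi fun x hx => ?_
        have hx : (0 : ℝ) < x := hx
        rw [← ofReal_norm, Complex.norm_real, Real.norm_of_nonneg (by positivity),
          ← ENNReal.ofReal_pow (by positivity), ← ENNReal.ofReal_mul hx.le]
    _ ≤ _ := by
        rw [← i3, i1]
        refine ENNReal.ofReal_le_ofReal ?_
        rw [div_pow]
        have : 0 < lam ^ 2 := by positivity
        field_simp
        norm_num

lemma radNorm_h1_aux (hl : 0 < lam) {f : ℝ → ℂ} {c : ℝ} (hc : 0 ≤ c)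
    (h : ∀ r, 0 < r → ‖f r‖ ≤ c * (4 / (1 + (lam * r) ^ 2))) :
    radNorm f ≤ ENNReal.ofReal (c * (3 / lam)) := by
  rw [ENNReal.ofReal_mul hc]
  refine (radNorm_le_mul hc (Eventually.of_forall fun r hr => ?_)).trans
    (by gcongr; exact radNorm_weight_le hl)
  rw [Complex.norm_real, Real.norm_of_nonneg (by positivity)]
  exact h r hr

lemma radNorm_h1 (hl : 0 < lam) :
    radNorm (fun r => (h1 (lam * r) : ℂ)) ≤ ENNReal.ofReal (3 / lam) := by
  have := radNorm_h1_aux (c := 1) (f := fun r => (h1 (lam * r) : ℂ)) hl zero_le_one fun r hr => by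
    rw [Complex.norm_real, Real.norm_of_nonneg (h1_nonneg _), one_mul]
    exact (h1_le_weight (mul_pos hl hr)).1
  simpa using this

lemma radNorm_h1_div (hl : 0 < lam) :
    radNorm (fun r => (h1 (lam * r) : ℂ) / r) ≤ 3 := by
  have := radNorm_h1_aux (c := lam) (f := fun r => (h1 (lam * r) : ℂ) / r) hl hl.le fun r hr => by
    rw [norm_div, Complex.norm_real, Complex.norm_real, Real.norm_of_nonneg (h1_nonneg _),
      Real.norm_of_nonneg hr.le]
    have := (h1_le_weight (mul_pos hl hr)).2.1
    calc h1 (lam * r) / r = lam * (h1 (lam * r) / (lam * r)) := by field_simp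
      _ ≤ _ := by gcongr
  rw [mul_div_cancel₀ _ hl.ne'] at this
  simpa using this

lemma radNorm_h1_div_sq (hl : 0 < lam) :
    radNorm (fun r => (h1 (lam * r) : ℂ) / r / r) ≤ ENNReal.ofReal (3 * lam) := by
  have := radNorm_h1_aux (c := lam ^ 2) (f := fun r => (h1 (lam * r) : ℂ) / r / r) hl
    (by positivity) fun r hr => by
    rw [norm_div, norm_div, Complex.norm_real, Complex.norm_real,
      Real.norm_of_nonneg (h1_nonneg _), Real.norm_of_nonneg hr.le]
    have := (h1_le_weight (mul_pos hl hr)).2.2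
    calc h1 (lam * r) / r / r = lam ^ 2 * (h1 (lam * r) / (lam * r) ^ 2) := by field_simp
      _ ≤ _ := by gcongr
  rw [show lam ^ 2 * (3 / lam) = 3 * lam by field_simp] at this
  exact this

lemma enorm_ofReal_le {x c : ℝ} (h : |x| ≤ c) : ‖(x : ℂ)‖ₑ ≤ ENNReal.ofReal c := by
  rw [← ofReal_norm, Complex.norm_real, Real.norm_eq_abs]
  exact ENNReal.ofReal_le_ofReal h

lemma norm_h1_div (hr : 0 < r) : ‖(h1 (lam * r) : ℂ) / r‖ = h1 (lam * r) / r := by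
  rw [norm_div, Complex.norm_real, Complex.norm_real, Real.norm_of_nonneg (h1_nonneg _),
    Real.norm_of_nonneg hr.le]

lemma radNorm_le_of_h1_div (hl : 0 < lam) {f : ℝ → ℂ}
    (h : ∀ r, 0 < r → ‖f r‖ ≤ 2 * (h1 (lam * r) / r)) : radNorm f ≤ 6 := by
  refine (radNorm_le_mul (g := fun r => (h1 (lam * r) : ℂ) / r) zero_le_two
    (Eventually.of_forall fun r hr => ?_)).trans
    ((mul_le_mul_right (radNorm_h1_div hl) _).trans (by norm_num))
  rw [norm_h1_div hr]; exact h r hr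

lemma isMult_h1 (hl : 0 < lam) : IsMult (fun r => (h1 (lam * r) : ℂ)) 6 := by
  refine IsMult.of_acDeriv (acDeriv_h1 hl) (fun r _ => ?_) (radNorm_le_of_h1_div hl fun r hr => ?_)
  · refine (enorm_ofReal_le (abs_le.2 ⟨?_, h1_le_one _⟩)).trans (by norm_num)
    linarith [h1_nonneg (lam * r)]
  · rw [Complex.norm_real, Real.norm_eq_abs, abs_div, abs_mul, abs_mul, abs_of_pos hr,
      abs_of_nonneg (h1_nonneg _), ← mul_div_assoc]
    have := abs_h3_le_one (lam * r)
    have := h1_nonneg (lam * r)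
    rw [abs_neg, abs_two]
    refine div_le_div_of_nonneg_right ?_ hr.le
    nlinarith

lemma isMult_h3 (hl : 0 < lam) : IsMult (fun r => (h3 (lam * r) : ℂ)) 6 := by
  refine IsMult.of_acDeriv (acDeriv_h3 hl) (fun r _ => ?_) (radNorm_le_of_h1_div hl fun r hr => ?_)
  · exact (enorm_ofReal_le (abs_h3_le_one _)).trans (by norm_num)
  · have h0 := h1_nonneg (lam * r)
    have h1' := h1_le_one (lam * r)
    rw [Complex.norm_real, Real.norm_of_nonneg (by positivity), ← mul_div_assoc]
    gcongr
    nlinarith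

end Soliton

/-! ### An energy estimate for `z' = -(2σ/r) z + φ` -/

lemma lintegral_Ioi_le_of_forall {a : ℝ} {F : ℝ → ℝ≥0∞} {C : ℝ≥0∞}
    (h : ∀ R, a < R → ∫⁻ s in Ioc a R, F s ≤ C) : ∫⁻ s in Ioi a, F s ≤ C := by
  have e : Ioi a = ⋃ n : ℕ, Ioc a (a + 1 + n) := by
    ext x
    simp only [mem_Ioi, mem_iUnion, mem_Ioc]
    constructor
    · intro hx
      obtain ⟨n, hn⟩ := exists_nat_ge (x - a)
      exact ⟨n, hx, by linarith⟩
    · rintro ⟨n, hx, _⟩; exact hx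
  rw [e, setLIntegral_iUnion_of_directed]
  · exact iSup_le fun n => h _ (by linarith [(Nat.cast_nonneg n : (0 : ℝ) ≤ n)])
  · refine Monotone.directed_le fun m n hmn => ?_
    have : (m : ℝ) ≤ n := by exact_mod_cast hmn
    exact Ioc_subset_Ioc_right (by linarith)

lemma lintegral_Ioc_le_of_forall {a : ℝ} (ha : 0 < a) {F : ℝ → ℝ≥0∞} {C : ℝ≥0∞}
    (h : ∀ R, 0 < R → R < a → ∫⁻ s in Ioc R a, F s ≤ C) : ∫⁻ s in Ioc 0 a, F s ≤ C := by
  have e : Ioc 0 a = ⋃ n : ℕ, Ioc (a / (n + 2)) a := by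
    ext x
    simp only [mem_iUnion, mem_Ioc]
    constructor
    · rintro ⟨hx, hxa⟩
      obtain ⟨n, hn⟩ := exists_nat_ge (a / x)
      refine ⟨n, ?_, hxa⟩
      rw [div_le_iff₀ hx] at hn
      rw [div_lt_iff₀ (by positivity)]
      nlinarith
    · rintro ⟨n, hx, hxa⟩
      exact ⟨lt_trans (by positivity) hx, hxa⟩
  rw [e, setLIntegral_iUnion_of_directed]
  · refine iSup_le fun n => h _ (by positivity) ?_
    rw [div_lt_iff₀ (by positivity)]
    have : (0 : ℝ) ≤ n := Nat.cast_nonneg n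
    nlinarith
  · refine Monotone.directed_le fun m n hmn => ?_
    have : (m : ℝ) ≤ n := by exact_mod_cast hmn
    refine Ioc_subset_Ioc_left ?_
    gcongr

lemma lintegral_le_of_integral_le {a b : ℝ} (ha : 0 < a) (hab : a ≤ b) {p q : ℝ → ℝ}
    (hp : ContinuousOn p (Ioi 0)) (hq : ContinuousOn q (Ioi 0)) (hp0 : ∀ r, 0 < r → 0 ≤ p r)
    (hq0 : ∀ r, 0 < r → 0 ≤ q r) (h : ∫ r in a..b, p r ≤ ∫ r in a..b, q r) :
    ∫⁻ r in Ioc a b, ENNReal.ofReal (p r) ≤ ∫⁻ r in Ioc a b, ENNReal.ofReal (q r) := by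
  have hsub : Icc a b ⊆ Ioi 0 := fun x hx => ha.trans_le hx.1
  have key : ∀ f : ℝ → ℝ, ContinuousOn f (Ioi 0) → (∀ r, 0 < r → 0 ≤ f r) →
      ∫⁻ r in Ioc a b, ENNReal.ofReal (f r) = ENNReal.ofReal (∫ r in a..b, f r) := by
    intro f hf hf0
    rw [intervalIntegral.integral_of_le hab, ofReal_integral_eq_lintegral_ofReal]
    · exact ((hf.mono hsub).integrableOn_Icc).mono_set Ioc_subset_Icc_self
    · rw [EventuallyLE, ae_restrict_iff' measurableSet_Ioc]
      exact Eventually.of_forall fun r hr => hf0 r (ha.trans hr.1)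
  rw [key p hp hp0, key q hq hq0]
  exact ENNReal.ofReal_le_ofReal h

/-- If `E ≥ 0`, `E(a) = 0`, `E' ≤ q - p` beyond `a` and `E' ≥ p - q` before `a`, then the integral
of `p` is at most the integral of `q`, on each side of `a`. -/
lemma energy_comparison {E E' p q : ℝ → ℝ} {a : ℝ} (ha : 0 < a)
    (hE : ∀ r, 0 < r → HasDerivAt E (E' r) r) (hE' : ContinuousOn E' (Ioi 0))
    (h0 : ∀ r, 0 < r → 0 ≤ E r) (hEa : E a = 0)
    (hp : ContinuousOn p (Ioi 0)) (hq : ContinuousOn q (Ioi 0)) (hp0 : ∀ r, 0 < r → 0 ≤ p r)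
    (hq0 : ∀ r, 0 < r → 0 ≤ q r) :
    ((∀ r, 0 < r → E' r ≤ q r - p r) →
      ∫⁻ r in Ioi a, ENNReal.ofReal (p r) ≤ ∫⁻ r in Ioi a, ENNReal.ofReal (q r)) ∧
    ((∀ r, 0 < r → p r - q r ≤ E' r) →
      ∫⁻ r in Ioc 0 a, ENNReal.ofReal (p r) ≤ ∫⁻ r in Ioc 0 a, ENNReal.ofReal (q r)) := by
  have hii : ∀ (f : ℝ → ℝ), ContinuousOn f (Ioi 0) → ∀ b c, 0 < b → b ≤ c →
      IntervalIntegrable f volume b c := fun f hf b c hb hbc => by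
    refine (hf.mono fun x hx => ?_).intervalIntegrable
    rw [uIcc_of_le hbc] at hx
    exact hb.trans_le hx.1
  have hftc : ∀ b c, 0 < b → b ≤ c → ∫ r in b..c, E' r = E c - E b := fun b c hb hbc => by
    refine intervalIntegral.integral_eq_sub_of_hasDerivAt (fun x hx => ?_) (hii E' hE' b c hb hbc)
    rw [uIcc_of_le hbc] at hx
    exact hE x (hb.trans_le hx.1)
  constructor
  · intro h
    refine lintegral_Ioi_le_of_forall fun R hR => ?_
    refine (lintegral_le_of_integral_le ha hR.le hp hq hp0 hq0 ?_).trans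
      (lintegral_mono_set Ioc_subset_Ioi_self)
    have h1 : ∫ r in a..R, E' r ≤ ∫ r in a..R, (q r - p r) :=
      intervalIntegral.integral_mono_on hR.le (hii _ hE' _ _ ha hR.le)
        (hii _ (hq.sub hp) _ _ ha hR.le) fun r hr => h r (ha.trans_le hr.1)
    rw [hftc _ _ ha hR.le, intervalIntegral.integral_sub (hii _ hq _ _ ha hR.le)
      (hii _ hp _ _ ha hR.le), hEa] at h1
    linarith [h0 R (ha.trans hR)]
  · intro h
    refine lintegral_Ioc_le_of_forall ha fun R hR hRa => ?_
    refine (lintegral_le_of_integral_le hR hRa.le hp hq hp0 hq0 ?_).trans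
      (lintegral_mono_set (Ioc_subset_Ioc_left hR.le))
    have h1 : ∫ r in R..a, (p r - q r) ≤ ∫ r in R..a, E' r :=
      intervalIntegral.integral_mono_on hRa.le (hii _ (hp.sub hq) _ _ hR hRa.le)
        (hii _ hE' _ _ hR hRa.le) fun r hr => h r (hR.trans_le hr.1)
    rw [hftc _ _ hR hRa.le, intervalIntegral.integral_sub (hii _ hp _ _ hR hRa.le)
      (hii _ hq _ _ hR hRa.le), hEa] at h1
    linarith [h0 R hR]

section Duhamel

variable {lam : ℝ} {σ : ℝ → ℝ}

lemma h1_inv_sq_bounds {ρ : ℝ} (hρ : 0 < ρ) :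
    (1 ≤ ρ → ρ ^ 4 / 4 ≤ (h1 ρ ^ 2)⁻¹ ∧ (h1 ρ ^ 2)⁻¹ ≤ ρ ^ 4) ∧
    (ρ ≤ 1 → (ρ ^ 4)⁻¹ / 4 ≤ (h1 ρ ^ 2)⁻¹ ∧ (h1 ρ ^ 2)⁻¹ ≤ (ρ ^ 4)⁻¹) := by
  have e : (h1 ρ ^ 2)⁻¹ = (ρ ^ 4 + 1) ^ 2 / (4 * ρ ^ 4) := by
    unfold h1; field_simp; norm_num
  have h4 : 0 < ρ ^ 4 := by positivity
  rw [e]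
  refine ⟨fun h => ?_, fun h => ?_⟩
  · have h1 : 1 ≤ ρ ^ 4 := one_le_pow₀ h
    constructor
    · rw [le_div_iff₀ (by positivity)]; nlinarith
    · rw [div_le_iff₀ (by positivity)]; nlinarith
  · have h1 : ρ ^ 4 ≤ 1 := pow_le_one₀ hρ.le h
    constructor
    · rw [le_div_iff₀ (by positivity)]
      have : (ρ ^ 4)⁻¹ / 4 * (4 * ρ ^ 4) = 1 := by field_simp
      nlinarith
    · rw [div_le_iff₀ (by positivity)]
      have : (ρ ^ 4)⁻¹ * (4 * ρ ^ 4) = 4 := by field_simp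
      nlinarith

lemma hasDerivAt_weight (hl : 0 < lam) (n : ℤ) {r : ℝ} (hr : 0 < r) :
    HasDerivAt (fun r => (h1 (lam * r) ^ 2)⁻¹ * r ^ n)
      ((4 * h3 (lam * r) + n) / r * ((h1 (lam * r) ^ 2)⁻¹ * r ^ n)) r := by
  have hp := h1_pos (mul_pos hl hr)
  have h1' := (((hasDerivAt_h1 hl hr).fun_pow 2).fun_inv (by positivity)).fun_mul
    (hasDerivAt_zpow n r (Or.inl hr.ne'))
  refine h1'.congr_deriv ?_
  rw [zpow_sub_one₀ hr.ne']
  field_simp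
  push_cast
  ring

lemma energy_side (hl : 0 < lam)
    (hσ : ∀ r, 0 < r → |σ r - h3 (lam * r)| ≤ 1 / 4) {z z' φ : ℝ → ℂ} {a : ℝ} (ha : 0 < a)
    (hza : z a = 0) (hφ : ContinuousOn φ (Ioi 0)) (hσc : ContinuousOn σ (Ioi 0))
    (hz : ∀ r, 0 < r → HasDerivAt z (z' r) r)
    (hz' : ∀ r, 0 < r → z' r = ((-(2 * σ r / r) : ℝ) : ℂ) * z r + φ r) (n : ℤ) :
    (n ≤ -2 → ∫⁻ r in Ioi a, ENNReal.ofReal ((h1 (lam * r) ^ 2)⁻¹ * r ^ n * ‖z r‖ ^ 2 / r / 2) ≤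
      ∫⁻ r in Ioi a, ENNReal.ofReal ((h1 (lam * r) ^ 2)⁻¹ * r ^ n * ‖φ r‖ ^ 2 * r * 2)) ∧
    (2 ≤ n → ∫⁻ r in Ioc 0 a, ENNReal.ofReal ((h1 (lam * r) ^ 2)⁻¹ * r ^ n * ‖z r‖ ^ 2 / r / 2) ≤
      ∫⁻ r in Ioc 0 a, ENNReal.ofReal ((h1 (lam * r) ^ 2)⁻¹ * r ^ n * ‖φ r‖ ^ 2 * r * 2)) := by
  set w : ℝ → ℝ := fun r => (h1 (lam * r) ^ 2)⁻¹ * r ^ n with hw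
  have hw0 : ∀ r, 0 < r → 0 < w r := fun r hr => by
    have := h1_pos (mul_pos hl hr); positivity
  have hwc : ContinuousOn w (Ioi 0) := fun r hr =>
    (hasDerivAt_weight hl n hr).continuousAt.continuousWithinAt
  have hzc : ContinuousOn z (Ioi 0) := fun r hr => (hz r hr).continuousAt.continuousWithinAt
  have hidc : ContinuousOn (fun r : ℝ => r) (Ioi 0) := continuousOn_id
  have hne : ∀ r ∈ Ioi (0 : ℝ), r ≠ 0 := fun r hr => (mem_Ioi.1 hr).ne'
  have hz'c : ContinuousOn z' (Ioi 0) := by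
    refine ContinuousOn.congr (f := fun r => ((-(2 * σ r / r) : ℝ) : ℂ) * z r + φ r) ?_ hz'
    refine (ContinuousOn.mul ?_ hzc).add hφ
    exact Complex.continuous_ofReal.comp_continuousOn
      (((continuousOn_const.mul hσc).div hidc hne).neg)
  set E' : ℝ → ℝ := fun r => 2 * ⟪z r, z' r⟫ * w r +
    ‖z r‖ ^ 2 * ((4 * h3 (lam * r) + n) / r * w r) with hE'
  have hE : ∀ r, 0 < r → HasDerivAt (fun r => ‖z r‖ ^ 2 * w r) (E' r) r := fun r hr =>
    ((hz r hr).norm_sq).fun_mul (hasDerivAt_weight hl n hr)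
  have hE'c : ContinuousOn E' (Ioi 0) :=
    ((continuousOn_const.mul (hzc.inner hz'c)).mul hwc).add ((hzc.norm.pow 2).mul
      (((((continuousOn_const.mul (continuousOn_h3 hl)).add continuousOn_const)).div hidc hne).mul hwc))
  have hp : ContinuousOn (fun r => w r * ‖z r‖ ^ 2 / r / 2) (Ioi 0) :=
    ((hwc.mul (hzc.norm.pow 2)).div hidc hne).div_const 2
  have hq : ContinuousOn (fun r => w r * ‖φ r‖ ^ 2 * r * 2) (Ioi 0) :=
    ((hwc.mul (hφ.norm.pow 2)).mul hidc).mul continuousOn_const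
  have hcmp := energy_comparison (E := fun r => ‖z r‖ ^ 2 * w r) ha hE hE'c
    (fun r hr => by have := hw0 r hr; positivity) (by simp [hza]) hp hq
    (fun r hr => by have := hw0 r hr; positivity) (fun r hr => by have := hw0 r hr; positivity)
  have hform : ∀ r, 0 < r → E' r = w r * (‖z r‖ ^ 2 / r * (n - 4 * (σ r - h3 (lam * r)))
      + 2 * ⟪z r, φ r⟫) := fun r hr => by
    have : ⟪z r, ((-(2 * σ r / r) : ℝ) : ℂ) * z r⟫ = -(2 * σ r / r) * ‖z r‖ ^ 2 := by
      rw [← Complex.real_smul, real_inner_smul_right, real_inner_self_eq_norm_sq]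
    simp only [hE']
    rw [hz' r hr, inner_add_right, this]
    field_simp
    ring
  have hip : ∀ r, 0 < r → |2 * ⟪z r, φ r⟫| ≤ ‖z r‖ ^ 2 / r / 2 + ‖φ r‖ ^ 2 * r * 2 := fun r hr => by
    rw [abs_mul, abs_two]
    have h1 := abs_real_inner_le_norm (z r) (φ r)
    have h2 : ‖z r‖ ^ 2 / r / 2 + ‖φ r‖ ^ 2 * r * 2 - 2 * (‖z r‖ * ‖φ r‖) =
        (‖z r‖ - 2 * (‖φ r‖ * r)) ^ 2 / (2 * r) := by field_simp; ring
    have h3 : 0 ≤ (‖z r‖ - 2 * (‖φ r‖ * r)) ^ 2 / (2 * r) := by positivity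
    linarith
  constructor
  · intro hn
    refine hcmp.1 fun r hr => ?_
    have hn' : (n : ℝ) ≤ -2 := by exact_mod_cast hn
    have h1 := abs_le.1 (hσ r hr)
    have h2 := (abs_le.1 (hip r hr)).2
    have h3 : ‖z r‖ ^ 2 / r * (n - 4 * (σ r - h3 (lam * r))) ≤ ‖z r‖ ^ 2 / r * (-1) :=
      mul_le_mul_of_nonneg_left (by linarith) (by positivity)
    calc E' r = _ := hform r hr
      _ ≤ w r * (‖φ r‖ ^ 2 * r * 2 - ‖z r‖ ^ 2 / r / 2) :=
        mul_le_mul_of_nonneg_left (by linarith) (hw0 r hr).le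
      _ = _ := by ring
  · intro hn
    refine hcmp.2 fun r hr => ?_
    have hn' : (2 : ℝ) ≤ n := by exact_mod_cast hn
    have h1 := abs_le.1 (hσ r hr)
    have h2 := (abs_le.1 (hip r hr)).1
    have h4 : ‖z r‖ ^ 2 / r * 1 ≤ ‖z r‖ ^ 2 / r * (n - 4 * (σ r - h3 (lam * r))) :=
      mul_le_mul_of_nonneg_left (by linarith) (by positivity)
    calc _ = w r * (‖z r‖ ^ 2 / r / 2 - ‖φ r‖ ^ 2 * r * 2) := by ring
      _ ≤ w r * (‖z r‖ ^ 2 / r * (n - 4 * (σ r - h3 (lam * r))) + 2 * ⟪z r, φ r⟫) :=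
        mul_le_mul_of_nonneg_left (by linarith) (hw0 r hr).le
      _ = _ := (hform r hr).symm

lemma lintegral_le_of_weights {s : Set ℝ} (hs : MeasurableSet s) (hs0 : s ⊆ Ioi 0)
    {W w F G : ℝ → ℝ} (hF : ∀ r ∈ s, 0 ≤ F r) (hG : ∀ r ∈ s, 0 ≤ G r)
    (h1 : ∀ r ∈ s, W r / 4 ≤ w r) (h2 : ∀ r ∈ s, w r ≤ W r)
    (h : ∫⁻ r in s, ENNReal.ofReal (w r * F r / r / 2) ≤
      ∫⁻ r in s, ENNReal.ofReal (w r * G r * r * 2)) :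
    ∫⁻ r in s, ENNReal.ofReal (W r * F r / r) ≤
      16 * ∫⁻ r in s, ENNReal.ofReal (W r * G r * r) := by
  calc ∫⁻ r in s, ENNReal.ofReal (W r * F r / r)
      ≤ ∫⁻ r in s, 8 * ENNReal.ofReal (w r * F r / r / 2) := by
        refine setLIntegral_mono' hs fun r hr => ?_
        have hr0 : 0 < r := hs0 hr
        rw [show (8 : ℝ≥0∞) = ENNReal.ofReal 8 by norm_num, ← ENNReal.ofReal_mul (by norm_num)]
        refine ENNReal.ofReal_le_ofReal ?_
        have := mul_le_mul_of_nonneg_right (h1 r hr) (hF r hr)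
        rw [show 8 * (w r * F r / r / 2) = (4 * (w r * F r)) / r by ring]
        refine div_le_div_of_nonneg_right ?_ hr0.le
        linarith
    _ = 8 * ∫⁻ r in s, ENNReal.ofReal (w r * F r / r / 2) :=
        lintegral_const_mul' _ _ (by norm_num)
    _ ≤ 8 * ∫⁻ r in s, ENNReal.ofReal (w r * G r * r * 2) := by gcongr
    _ ≤ 8 * ∫⁻ r in s, 2 * ENNReal.ofReal (W r * G r * r) := by
        gcongr 8 * ?_
        refine setLIntegral_mono' hs fun r hr => ?_
        have hr0 : 0 < r := hs0 hr
        rw [show (2 : ℝ≥0∞) = ENNReal.ofReal 2 by norm_num, ← ENNReal.ofReal_mul (by norm_num)]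
        refine ENNReal.ofReal_le_ofReal ?_
        have := mul_le_mul_of_nonneg_right (h2 r hr) (hG r hr)
        have := mul_le_mul_of_nonneg_right this hr0.le
        linarith
    _ = _ := by
        rw [lintegral_const_mul' _ _ (by norm_num), ← mul_assoc]; norm_num

/-- Weighted energy estimate for `z' = -(2σ/r) z + φ`, `z(1/λ) = 0`. -/
lemma energy_estimate (hl : 0 < lam)
    (hσ : ∀ r, 0 < r → |σ r - h3 (lam * r)| ≤ 1 / 4) {z z' φ : ℝ → ℂ}
    (hza : z lam⁻¹ = 0) (hφ : ContinuousOn φ (Ioi 0)) (hσc : ContinuousOn σ (Ioi 0))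
    (hz : ∀ r, 0 < r → HasDerivAt z (z' r) r)
    (hz' : ∀ r, 0 < r → z' r = ((-(2 * σ r / r) : ℝ) : ℂ) * z r + φ r)
    (k : ℤ) (hk : -3 ≤ k) (hk' : k ≤ 1) :
    ∫⁻ r in Ioi 0, ENNReal.ofReal (r ^ (k + 1) * ‖z r‖ ^ 2 / r) ≤
      16 * ∫⁻ r in Ioi 0, ENNReal.ofReal (r ^ (k + 1) * ‖φ r‖ ^ 2 * r) := by
  have ha : 0 < lam⁻¹ := inv_pos.2 hl
  have hR := (energy_side hl hσ ha hza hφ hσc hz hz' (k - 3)).1 (by omega)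
  have hL := (energy_side hl hσ ha hza hφ hσc hz hz' (k + 5)).2 (by omega)
  have e : Ioi (0 : ℝ) = Ioc 0 lam⁻¹ ∪ Ioi lam⁻¹ := (Ioc_union_Ioi_eq_Ioi ha.le).symm
  have hd : Disjoint (Ioc (0 : ℝ) lam⁻¹) (Ioi lam⁻¹) :=
    Set.disjoint_left.2 fun x hx hx' => absurd hx.2 (not_le.2 hx')
  rw [e, lintegral_union measurableSet_Ioi hd, lintegral_union measurableSet_Ioi hd, mul_add]
  have hcomm : ∀ (c : ℝ) (n : ℤ) (r : ℝ), r ≠ 0 → r ^ (n + 4) = r ^ n * r ^ 4 := fun c n r hr => by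
    rw [zpow_add₀ hr]; norm_cast
  refine add_le_add ?_ ?_
  · have h := lintegral_le_of_weights (W := fun r => (lam ^ 4)⁻¹ * r ^ (k + 1)) (w := fun r =>
      (h1 (lam * r) ^ 2)⁻¹ * r ^ (k + 5)) (F := fun r => ‖z r‖ ^ 2) (G := fun r => ‖φ r‖ ^ 2)
      measurableSet_Ioc (Ioc_subset_Ioi_self) (fun _ _ => by positivity) (fun _ _ => by positivity)
      (fun r hr => ?_) (fun r hr => ?_) hL
    · have hc : ∀ F : ℝ → ℝ, ∫⁻ r in Ioc 0 lam⁻¹, ENNReal.ofReal ((lam ^ 4)⁻¹ * F r) =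
          ENNReal.ofReal (lam ^ 4)⁻¹ * ∫⁻ r in Ioc 0 lam⁻¹, ENNReal.ofReal (F r) := fun F => by
        rw [← lintegral_const_mul' _ _ ENNReal.ofReal_ne_top]
        simp_rw [ENNReal.ofReal_mul (show (0 : ℝ) ≤ (lam ^ 4)⁻¹ by positivity)]
      have h5 : (0 : ℝ) < (lam ^ 4)⁻¹ := by positivity
      simp_rw [mul_assoc, mul_div_assoc] at h ⊢
      rw [hc, hc, ← mul_assoc, mul_comm (16 : ℝ≥0∞), mul_assoc] at h
      exact (ENNReal.mul_le_mul_iff_right (by simpa using h5) ENNReal.ofReal_ne_top).1 h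
    all_goals
      have hr0 : 0 < r := hr.1
      have h4 := (h1_inv_sq_bounds (mul_pos hl hr0)).2 (by
        calc lam * r ≤ lam * lam⁻¹ := by gcongr; exact hr.2
          _ = 1 := mul_inv_cancel₀ hl.ne')
      have h5 : (0 : ℝ) < r ^ (k + 5) := by positivity
      have h6 : r ^ (k + 5) = r ^ (k + 1) * r ^ 4 := by
        rw [← hcomm 0 (k + 1) r hr0.ne']; ring_nf
      have h7 : (lam ^ 4)⁻¹ * r ^ (k + 1) = ((lam * r) ^ 4)⁻¹ * r ^ (k + 5) := by
        rw [h6]; field_simp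
    · have := mul_le_mul_of_nonneg_right h4.1 h5.le
      rw [h7]; linarith
    · have := mul_le_mul_of_nonneg_right h4.2 h5.le
      rw [h7]; linarith
  · have h := lintegral_le_of_weights (W := fun r => lam ^ 4 * r ^ (k + 1)) (w := fun r =>
      (h1 (lam * r) ^ 2)⁻¹ * r ^ (k - 3)) (F := fun r => ‖z r‖ ^ 2) (G := fun r => ‖φ r‖ ^ 2)
      measurableSet_Ioi (Ioi_subset_Ioi ha.le) (fun _ _ => by positivity)
      (fun _ _ => by positivity) (fun r hr => ?_) (fun r hr => ?_) hR
    · have hc : ∀ F : ℝ → ℝ, ∫⁻ r in Ioi lam⁻¹, ENNReal.ofReal (lam ^ 4 * F r) =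
          ENNReal.ofReal (lam ^ 4) * ∫⁻ r in Ioi lam⁻¹, ENNReal.ofReal (F r) := fun F => by
        rw [← lintegral_const_mul' _ _ ENNReal.ofReal_ne_top]
        simp_rw [ENNReal.ofReal_mul (show (0 : ℝ) ≤ lam ^ 4 by positivity)]
      have h5 : (0 : ℝ) < lam ^ 4 := by positivity
      simp_rw [mul_assoc, mul_div_assoc] at h ⊢
      rw [hc, hc, ← mul_assoc, mul_comm (16 : ℝ≥0∞), mul_assoc] at h
      exact (ENNReal.mul_le_mul_iff_right (by simpa using h5) ENNReal.ofReal_ne_top).1 h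
    all_goals
      have hr0 : 0 < r := ha.trans hr
      have h4 := (h1_inv_sq_bounds (mul_pos hl hr0)).1 (by
        calc 1 = lam * lam⁻¹ := (mul_inv_cancel₀ hl.ne').symm
          _ ≤ lam * r := by gcongr; exact (mem_Ioi.1 hr).le)
      have h5 : (0 : ℝ) < r ^ (k - 3) := by positivity
      have h6 : r ^ (k + 1) = r ^ (k - 3) * r ^ 4 := by
        rw [← hcomm 0 (k - 3) r hr0.ne']; ring_nf
      have h7 : lam ^ 4 * r ^ (k + 1) = (lam * r) ^ 4 * r ^ (k - 3) := by
        rw [h6]; ring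
    · have := mul_le_mul_of_nonneg_right h4.1 h5.le
      rw [h7]; linarith
    · have := mul_le_mul_of_nonneg_right h4.2 h5.le
      rw [h7]; linarith

lemma radNorm_sq_eq_of_forall {f : ℝ → ℂ} {g : ℝ → ℝ} (h : ∀ r, 0 < r → r * ‖f r‖ ^ 2 = g r) :
    ∫⁻ r in Ioi 0, ENNReal.ofReal (g r) = radNorm f ^ 2 := by
  rw [radNorm_sq]
  refine setLIntegral_congr_fun measurableSet_Ioi fun r hr => ?_
  have hr : 0 < r := hr
  rw [← h r hr, ENNReal.ofReal_mul hr.le, ENNReal.ofReal_pow (norm_nonneg _), ofReal_norm]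

lemma radNorm_energy (hl : 0 < lam)
    (hσ : ∀ r, 0 < r → |σ r - h3 (lam * r)| ≤ 1 / 4) {z z' φ : ℝ → ℂ}
    (hza : z lam⁻¹ = 0) (hφ : ContinuousOn φ (Ioi 0)) (hσc : ContinuousOn σ (Ioi 0))
    (hz : ∀ r, 0 < r → HasDerivAt z (z' r) r)
    (hz' : ∀ r, 0 < r → z' r = ((-(2 * σ r / r) : ℝ) : ℂ) * z r + φ r) :
    radNorm z ≤ 4 * radNorm (fun r => r * φ r) ∧
    radNorm (fun r => z r / r) ≤ 4 * radNorm φ ∧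
    radNorm (fun r => z r / r / r) ≤ 4 * radNorm (fun r => φ r / r) := by
  have hn : ∀ r : ℝ, 0 < r → ‖(r : ℂ)‖ = r := fun r hr => by
    rw [Complex.norm_real, Real.norm_of_nonneg hr.le]
  have h := energy_estimate hl hσ hza hφ hσc hz hz'
  have key : ∀ {x y : ℝ≥0∞}, x ^ 2 ≤ 16 * y ^ 2 → x ≤ 4 * y := fun {x y} hxy => by
    rw [← ENNReal.pow_le_pow_left_iff two_ne_zero, mul_pow]
    refine hxy.trans (le_of_eq ?_)
    norm_num
  refine ⟨key ?_, key ?_, key ?_⟩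
  · have h1 := h 1 (by norm_num) (by norm_num)
    rwa [radNorm_sq_eq_of_forall (f := z), radNorm_sq_eq_of_forall (f := fun r => r * φ r)] at h1
    · intro r hr
      rw [norm_mul, hn r hr, show (1 + 1 : ℤ) = 2 by norm_num]
      norm_cast; ring
    · intro r hr
      rw [show (1 + 1 : ℤ) = 2 by norm_num, eq_div_iff hr.ne']
      norm_cast; ring
  · have h1 := h (-1) (by norm_num) (by norm_num)
    rwa [radNorm_sq_eq_of_forall (f := fun r => z r / r), radNorm_sq_eq_of_forall (f := φ)] at h1
    · intro r hr
      rw [show (-1 + 1 : ℤ) = 0 by norm_num, zpow_zero]; ring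
    · intro r hr
      rw [norm_div, hn r hr, show (-1 + 1 : ℤ) = 0 by norm_num, zpow_zero]; field_simp
  · have h1 := h (-3) (by norm_num) (by norm_num)
    have e : ∀ r : ℝ, r ^ (-3 + 1 : ℤ) = (r ^ 2)⁻¹ := fun r => by
      rw [show (-3 + 1 : ℤ) = -2 by norm_num, zpow_neg]; norm_cast
    rwa [radNorm_sq_eq_of_forall (f := fun r => z r / r / r),
      radNorm_sq_eq_of_forall (f := fun r => φ r / r)] at h1
    · intro r hr
      rw [norm_div, hn r hr, e]; field_simp
    · intro r hr
      rw [norm_div, norm_div, hn r hr, e]; field_simp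

end Duhamel

section Duhamel

variable {lam : ℝ} {σ : ℝ → ℝ}

/-- The linear flow `z' = -(2σ/r) z` around the soliton: `σ` is continuous and close to `h₃(λr)`. -/
structure IsNearSoliton (lam : ℝ) (σ : ℝ → ℝ) (ε : ℝ) : Prop where
  lam_pos : 0 < lam
  cont : ContinuousOn σ (Ioi 0)
  le : ∀ r, 0 < r → |σ r - h3 (lam * r)| ≤ ε
  eps_le : ε ≤ 1 / 4

/-- The solution of `H' = -(2σ/r) H` with `H(1/λ) = 1`. -/
def homSol (lam : ℝ) (σ : ℝ → ℝ) (r : ℝ) : ℂ :=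
  Complex.exp ((∫ s in lam⁻¹..r, -(2 * σ s / s) : ℝ) : ℂ)

namespace IsNearSoliton

variable {ε : ℝ}

lemma le' (h : IsNearSoliton lam σ ε) {r : ℝ} (hr : 0 < r) : |σ r - h3 (lam * r)| ≤ 1 / 4 :=
  (h.le r hr).trans h.eps_le

lemma abs_le (h : IsNearSoliton lam σ ε) {r : ℝ} (hr : 0 < r) : |σ r| ≤ 5 / 4 := by
  have h1 := h.le' hr
  have h2 := abs_h3_le_one (lam * r)
  rw [_root_.abs_le] at *
  constructor <;> linarith

lemma cont_coeff (h : IsNearSoliton lam σ ε) : ContinuousOn (fun r => -(2 * σ r / r)) (Ioi 0) :=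
  ((continuousOn_const.mul h.cont).div continuousOn_id fun _ hr => (mem_Ioi.1 hr).ne').neg

lemma hasDerivAt_homSol (h : IsNearSoliton lam σ ε) {r : ℝ} (hr : 0 < r) :
    HasDerivAt (homSol lam σ) (((-(2 * σ r / r) : ℝ) : ℂ) * homSol lam σ r) r := by
  have ha : 0 < lam⁻¹ := inv_pos.2 h.lam_pos
  have h1 := ACDeriv.ofReal_integral (h := fun s => -(2 * σ s / s)) ha fun a b ha' hab =>
    (h.cont_coeff.mono fun x hx => by
      rw [uIcc_of_le hab] at hx; exact ha'.trans_le hx.1).intervalIntegrable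
  have h2 := h1.hasDerivAt_of_continuousOn
    (Complex.continuous_ofReal.comp_continuousOn h.cont_coeff) hr
  have h3 := h2.cexp
  rw [mul_comm]
  exact h3

lemma homSol_ne_zero (r : ℝ) : homSol lam σ r ≠ 0 := Complex.exp_ne_zero _

lemma homSol_one : homSol lam σ lam⁻¹ = 1 := by simp [homSol]

lemma continuousOn_homSol (h : IsNearSoliton lam σ ε) : ContinuousOn (homSol lam σ) (Ioi 0) :=
  fun _ hr => (h.hasDerivAt_homSol hr).continuousAt.continuousWithinAt

lemma radNorm_sub_h1 (h : IsNearSoliton lam σ ε) :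
    radNorm (fun r => homSol lam σ r - h1 (lam * r)) ≤ ENNReal.ofReal (24 * ε / lam) ∧
    radNorm (fun r => (homSol lam σ r - h1 (lam * r)) / r) ≤ ENNReal.ofReal (24 * ε) ∧
    radNorm (fun r => (homSol lam σ r - h1 (lam * r)) / r / r) ≤ ENNReal.ofReal (24 * ε * lam) := by
  have hl := h.lam_pos
  have hε : 0 ≤ ε := (abs_nonneg _).trans (h.le 1 one_pos)
  set φ : ℝ → ℂ := fun r => ((-(2 * (σ r - h3 (lam * r)) / r) : ℝ) : ℂ) * h1 (lam * r) with hφ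
  have hφc : ContinuousOn φ (Ioi 0) := by
    refine ContinuousOn.mul (Complex.continuous_ofReal.comp_continuousOn ?_)
      (Complex.continuous_ofReal.comp_continuousOn (continuousOn_h1 hl))
    exact ((continuousOn_const.mul (h.cont.sub (continuousOn_h3 hl))).div continuousOn_id
      fun r hr => (mem_Ioi.1 hr).ne').neg
  have hz : ∀ r, 0 < r → HasDerivAt (fun r => homSol lam σ r - h1 (lam * r))
      (((-(2 * σ r / r) : ℝ) : ℂ) * (homSol lam σ r - h1 (lam * r)) + φ r) r := fun r hr => by
    refine ((h.hasDerivAt_homSol hr).fun_sub (hasDerivAt_h1 hl hr).ofReal_comp).congr_deriv ?_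
    simp only [hφ]; push_cast; ring
  have key := radNorm_energy hl (fun r hr => h.le' hr) (by
    simp [homSol_one, h1, hl.ne']; norm_num) hφc h.cont hz fun _ _ => rfl
  have hb : ∀ r, 0 < r → ‖φ r‖ ≤ 2 * ε * (h1 (lam * r) / r) := fun r hr => by
    rw [hφ, norm_mul, Complex.norm_real, Complex.norm_real, Real.norm_of_nonneg (h1_nonneg _),
      Real.norm_eq_abs, abs_neg, abs_div, abs_mul, abs_two, abs_of_pos hr]
    have := h.le r hr
    have := h1_nonneg (lam * r)
    calc _ ≤ 2 * ε / r * h1 (lam * r) := by gcongr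
      _ = _ := by ring
  have hn : ∀ r : ℝ, 0 < r → ‖(r : ℂ)‖ = r := fun r hr => by
    rw [Complex.norm_real, Real.norm_of_nonneg hr.le]
  have h1n : ∀ r : ℝ, ‖(h1 (lam * r) : ℂ)‖ = h1 (lam * r) := fun r => by
    rw [Complex.norm_real, Real.norm_of_nonneg (h1_nonneg _)]
  refine ⟨key.1.trans ?_, key.2.1.trans ?_, key.2.2.trans ?_⟩
  · refine (mul_le_mul_right ((radNorm_le_mul (g := fun r => (h1 (lam * r) : ℂ)) (c := 2 * ε)
      (by positivity) (Eventually.of_forall fun r hr => ?_)).trans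
      (mul_le_mul_right (radNorm_h1 hl) _)) _).trans ?_
    · rw [norm_mul, hn r hr, h1n]
      calc r * ‖φ r‖ ≤ r * (2 * ε * (h1 (lam * r) / r)) := by gcongr; exact hb r hr
        _ = _ := by field_simp
    · rw [← ENNReal.ofReal_mul (by positivity), ← ENNReal.ofReal_ofNat,
        ← ENNReal.ofReal_mul (by positivity)]
      exact ENNReal.ofReal_le_ofReal (le_of_eq (by ring))
  · refine (mul_le_mul_right ((radNorm_le_mul (g := fun r => (h1 (lam * r) : ℂ) / r) (c := 2 * ε)
      (by positivity) (Eventually.of_forall fun r hr => ?_)).trans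
      (mul_le_mul_right (radNorm_h1_div hl) _)) _).trans ?_
    · rw [norm_div, hn r hr, h1n]; exact hb r hr
    · rw [← ENNReal.ofReal_ofNat 3, ← ENNReal.ofReal_mul (by positivity), ← ENNReal.ofReal_ofNat,
        ← ENNReal.ofReal_mul (by positivity)]
      exact ENNReal.ofReal_le_ofReal (le_of_eq (by ring))
  · refine (mul_le_mul_right ((radNorm_le_mul (g := fun r => (h1 (lam * r) : ℂ) / r / r)
      (c := 2 * ε) (by positivity) (Eventually.of_forall fun r hr => ?_)).trans
      (mul_le_mul_right (radNorm_h1_div_sq hl) _)) _).trans ?_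
    · rw [norm_div, norm_div, norm_div, hn r hr, h1n, ← mul_div_assoc]
      gcongr
      exact hb r hr
    · rw [← ENNReal.ofReal_mul (by positivity), ← ENNReal.ofReal_ofNat,
        ← ENNReal.ofReal_mul (by positivity)]
      exact ENNReal.ofReal_le_ofReal (le_of_eq (by ring))

lemma aesm_homSol (h : IsNearSoliton lam σ ε) : AEStronglyMeasurable (homSol lam σ) radialMeasure :=
  aestronglyMeasurable_of_continuousOn h.continuousOn_homSol

lemma radNorm_homSol (h : IsNearSoliton lam σ ε) :
    radNorm (homSol lam σ) ≤ ENNReal.ofReal (9 / lam) ∧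
    radNorm (fun r => homSol lam σ r / r) ≤ 9 ∧
    radNorm (fun r => homSol lam σ r / r / r) ≤ ENNReal.ofReal (9 * lam) := by
  have hl := h.lam_pos
  obtain ⟨k1, k2, k3⟩ := h.radNorm_sub_h1
  have hε := h.eps_le
  have m1 : AEStronglyMeasurable (fun r => (h1 (lam * r) : ℂ)) radialMeasure := (acDeriv_h1 hl).aesm
  have m2 : AEStronglyMeasurable (fun r => homSol lam σ r - h1 (lam * r)) radialMeasure :=
    h.aesm_homSol.sub m1
  refine ⟨?_, ?_, ?_⟩
  · calc _ = radNorm (fun r => (homSol lam σ r - h1 (lam * r)) + h1 (lam * r)) :=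
          radNorm_congr (Eventually.of_forall fun r _ => by ring)
      _ ≤ _ := (radNorm_add_le m2 m1).trans (add_le_add k1 (radNorm_h1 hl))
      _ ≤ ENNReal.ofReal (6 / lam) + ENNReal.ofReal (3 / lam) := by gcongr; linarith
      _ = _ := by rw [← ENNReal.ofReal_add (by positivity) (by positivity)]; ring_nf
  · calc _ = radNorm (fun r => (homSol lam σ r - h1 (lam * r)) / r + h1 (lam * r) / r) :=
          radNorm_congr (Eventually.of_forall fun r _ => by ring)
      _ ≤ _ := (radNorm_add_le (aesm_div m2) (aesm_div m1)).trans
          (add_le_add k2 (radNorm_h1_div hl))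
      _ ≤ ENNReal.ofReal 6 + 3 := by gcongr; linarith
      _ = _ := by norm_num
  · calc _ = radNorm (fun r => (homSol lam σ r - h1 (lam * r)) / r / r + h1 (lam * r) / r / r) :=
          radNorm_congr (Eventually.of_forall fun r _ => by ring)
      _ ≤ _ := (radNorm_add_le (aesm_div (aesm_div m2)) (aesm_div (aesm_div m1))).trans
          (add_le_add k3 (radNorm_h1_div_sq hl))
      _ ≤ ENNReal.ofReal (6 * lam) + ENNReal.ofReal (3 * lam) := by gcongr; linarith
      _ = _ := by rw [← ENNReal.ofReal_add (by positivity) (by positivity)]; ring_nf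

/-- If `y' = -(2σ/r) y + f`, then `y / r` is locally AC and `(y/r)'` is controlled by `y/r²`, `f/r`. -/
lemma div_deriv (h : IsNearSoliton lam σ ε) {y f : ℝ → ℂ}
    (hy : ACDeriv y (fun r => ((-(2 * σ r / r) : ℝ) : ℂ) * y r + f r))
    (hf : AEStronglyMeasurable f radialMeasure) :
    ACDeriv (fun r => y r / r) (fun r => ((-(2 * σ r + 1) : ℝ) : ℂ) * (y r / r / r) + f r / r) ∧
    radNorm (deriv fun r => y r / r) ≤
      4 * radNorm (fun r => y r / r / r) + radNorm (fun r => f r / r) := by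
  have hinv : ACDeriv (fun r : ℝ => (r : ℂ)⁻¹) (fun r => - ((r : ℂ) ^ 2)⁻¹) := by
    refine ACDeriv.of_hasDerivAt (fun r hr => ?_) ?_
    · have h1 : HasDerivAt (fun r : ℝ => (r : ℂ)) 1 r := Complex.ofRealCLM.hasDerivAt
      have := h1.fun_inv (by exact_mod_cast hr.ne')
      exact this.congr_deriv (by field_simp)
    · have hc : Continuous fun r : ℝ => (r : ℂ) ^ 2 := by fun_prop
      exact (hc.continuousOn.inv₀ fun r hr => by
        exact_mod_cast pow_ne_zero 2 (mem_Ioi.1 hr).ne').neg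
  have key : ACDeriv (fun r => y r / r)
      (fun r => ((-(2 * σ r + 1) : ℝ) : ℂ) * (y r / r / r) + f r / r) := by
    refine (hy.mul hinv).congr_deriv (Eventually.of_forall fun r hr => ?_)
    have : (r : ℂ) ≠ 0 := by exact_mod_cast hr.ne'
    push_cast
    field_simp
    ring
  refine ⟨key, ?_⟩
  have m1 : AEStronglyMeasurable (fun r => ((-(2 * σ r + 1) : ℝ) : ℂ) * (y r / r / r))
      radialMeasure := by
    refine AEStronglyMeasurable.mul ?_ (aesm_div (aesm_div hy.aesm))
    exact aestronglyMeasurable_of_continuousOn (Complex.continuous_ofReal.comp_continuousOn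
      ((continuousOn_const.mul h.cont).add continuousOn_const).neg)
  rw [radNorm_congr key.ae_deriv_eq]
  refine (radNorm_add_le m1 (aesm_div hf)).trans (add_le_add_left ?_ _)
  refine (radNorm_le_mul (g := fun r => y r / r / r) (c := 4) (by norm_num) (Eventually.of_forall fun r hr => ?_)).trans
    (le_of_eq (by norm_num))
  rw [norm_mul, Complex.norm_real]
  gcongr
  have := h.abs_le hr
  rw [Real.norm_eq_abs]
  rw [_root_.abs_le] at *
  constructor <;> linarith

lemma acDeriv_homSol (h : IsNearSoliton lam σ ε) :
    ACDeriv (homSol lam σ) (fun r => ((-(2 * σ r / r) : ℝ) : ℂ) * homSol lam σ r) :=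
  ACDeriv.of_hasDerivAt (fun _ hr => h.hasDerivAt_homSol hr)
    ((Complex.continuous_ofReal.comp_continuousOn h.cont_coeff).mul h.continuousOn_homSol)

lemma radNorm_mul_div {f : ℝ → ℂ} : radNorm (fun r => r * (f r / r)) = radNorm f :=
  radNorm_congr (Eventually.of_forall fun r hr => by
    have : (r : ℂ) ≠ 0 := by exact_mod_cast hr.ne'
    field_simp)

lemma isAtom_homSol_div (h : IsNearSoliton lam σ ε) :
    IsAtom lam⁻¹ 72 (fun r => homSol lam σ r / r) := by
  have hl := h.lam_pos
  have ha : 0 < lam⁻¹ := inv_pos.2 hl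
  obtain ⟨k1, k2, k3⟩ := h.radNorm_homSol
  have hd := h.div_deriv (f := fun _ => 0) (h.acDeriv_homSol.congr_deriv
    (Eventually.of_forall fun r _ => (add_zero _).symm)) aestronglyMeasurable_const
  have e0 : radNorm (fun r => (0 : ℂ) / r) = 0 := by simp [radNorm]
  rw [e0, add_zero] at hd
  have e1 : ENNReal.ofReal lam⁻¹ * ENNReal.ofReal (9 * lam) = 9 := by
    rw [← ENNReal.ofReal_mul ha.le, ← ENNReal.ofReal_ofNat]
    congr 1; field_simp
  have := IsAtom.of_weight (t := lam⁻¹) (A := 36) ha (by norm_num) hd.1.ac ?_ ?_ ?_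
  · norm_num at this; exact this
  · calc _ ≤ ENNReal.ofReal lam⁻¹ * (4 * ENNReal.ofReal (9 * lam)) := by
          gcongr; exact hd.2.trans (by gcongr)
      _ = 4 * (ENNReal.ofReal lam⁻¹ * ENNReal.ofReal (9 * lam)) := by ring
      _ ≤ _ := by rw [e1]; norm_num
  · calc _ ≤ ENNReal.ofReal lam⁻¹ * ENNReal.ofReal (9 * lam) := by gcongr
      _ ≤ _ := by rw [e1]; norm_num
  · rw [radNorm_mul_div]
    refine k1.trans ?_
    rw [div_eq_inv_mul, ENNReal.ofReal_mul ha.le]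
    gcongr
    norm_num

end IsNearSoliton

end Duhamel

section Duhamel

variable {lam : ℝ} {σ : ℝ → ℝ} {ε t : ℝ} {A B : ℝ≥0∞}

/-- The solution of `S' = -(2σ/r) S + f` with `S(1/λ) = 0`. -/
def duhamel (lam : ℝ) (σ : ℝ → ℝ) (f : ℝ → ℂ) (r : ℝ) : ℂ :=
  homSol lam σ r * ∫ s in lam⁻¹..r, (homSol lam σ s)⁻¹ * f s

namespace IsNearSoliton

lemma continuousOn_inv_homSol (h : IsNearSoliton lam σ ε) :
    ContinuousOn (fun r => (homSol lam σ r)⁻¹) (Ioi 0) :=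
  h.continuousOn_homSol.inv₀ fun r _ => homSol_ne_zero r

lemma hasDerivAt_duhamel (h : IsNearSoliton lam σ ε) {f : ℝ → ℂ} (hf : ContinuousOn f (Ioi 0))
    {r : ℝ} (hr : 0 < r) : HasDerivAt (duhamel lam σ f)
      (((-(2 * σ r / r) : ℝ) : ℂ) * duhamel lam σ f r + f r) r := by
  have hc := h.continuousOn_inv_homSol.mul hf
  have h1 := ACDeriv.integral (inv_pos.2 h.lam_pos) (h := fun s => (homSol lam σ s)⁻¹ * f s)
    fun a b ha hab => (hc.mono fun x hx => by
      rw [uIcc_of_le hab] at hx; exact ha.trans_le hx.1).intervalIntegrable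
  refine ((h.hasDerivAt_homSol hr).fun_mul (h1.hasDerivAt_of_continuousOn hc hr)).congr_deriv ?_
  rw [duhamel, mul_inv_cancel_left₀ (homSol_ne_zero r)]
  ring

lemma acDeriv_of_flow (h : IsNearSoliton lam σ ε) {y f : ℝ → ℂ} (hf : ContinuousOn f (Ioi 0))
    (hy : ∀ r, 0 < r → HasDerivAt y (((-(2 * σ r / r) : ℝ) : ℂ) * y r + f r) r) :
    ACDeriv y (fun r => ((-(2 * σ r / r) : ℝ) : ℂ) * y r + f r) := by
  refine ACDeriv.of_hasDerivAt hy (ContinuousOn.add (ContinuousOn.mul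
    (Complex.continuous_ofReal.comp_continuousOn h.cont_coeff) ?_) hf)
  exact fun r hr => (hy r hr).continuousAt.continuousWithinAt

lemma isBesov_duhamel_atom (h : IsNearSoliton lam σ ε) {f : ℝ → ℂ} (hf : IsAtom t A f) :
    IsBesov (fun r => duhamel lam σ f r / r) (1000 * A) := by
  have hl := h.lam_pos
  have ha : 0 < lam⁻¹ := inv_pos.2 hl
  have ht := hf.pos
  have hA := hf.ne_top
  have hfc : ContinuousOn f (Ioi 0) := hf.acDeriv.continuousOn
  obtain ⟨k1, k2, k3⟩ := h.radNorm_homSol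
  obtain ⟨g, hg, hgn, hgb, -⟩ := hf.exists_prim
  have hgd : ∀ r, 0 < r → HasDerivAt g (f r) r := fun r hr => hg.hasDerivAt_of_continuousOn hfc hr
  set S := duhamel lam σ f with hS
  set H := homSol lam σ with hH
  have hSd : ∀ r, 0 < r → HasDerivAt S _ r := fun r hr => h.hasDerivAt_duhamel hfc hr
  have hSa : S lam⁻¹ = 0 := by simp [hS, duhamel]
  have hSac := h.acDeriv_of_flow hfc hSd
  obtain ⟨-, s2, s3⟩ := radNorm_energy hl (fun r hr => h.le' hr) hSa hfc h.cont hSd fun _ _ => rfl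
  have hdiv : radNorm (fun r => f r / r) ≤ ENNReal.ofReal t⁻¹ * A :=
    (mul_le_iff_le_inv ht).1 hf.div_le
  -- the solution equal to `g` at `1/λ`
  set a := lam⁻¹ with ha_def
  set y : ℝ → ℂ := fun r => S r + g a * H r with hy
  have hyd : ∀ r, 0 < r → HasDerivAt y (((-(2 * σ r / r) : ℝ) : ℂ) * y r + f r) r := fun r hr => by
    refine ((hSd r hr).fun_add ((h.hasDerivAt_homSol hr).const_mul (g a))).congr_deriv ?_
    simp only [hy]; ring
  have hyac := h.acDeriv_of_flow hfc hyd
  have hgc : ContinuousOn g (Ioi 0) := hg.continuousOn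
  have hyN : radNorm y ≤ ENNReal.ofReal t * (11 * A) := by
    set φ : ℝ → ℂ := fun r => ((-(2 * σ r / r) : ℝ) : ℂ) * g r with hφ
    have hφc : ContinuousOn φ (Ioi 0) :=
      (Complex.continuous_ofReal.comp_continuousOn h.cont_coeff).mul hgc
    have hz : ∀ r, 0 < r → HasDerivAt (fun r => y r - g r)
        (((-(2 * σ r / r) : ℝ) : ℂ) * (y r - g r) + φ r) r := fun r hr => by
      refine ((hyd r hr).fun_sub (hgd r hr)).congr_deriv ?_
      simp only [hφ]; ring
    have e := (radNorm_energy hl (fun r hr => h.le' hr) (z := fun r => y r - g r) (by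
      simp only [hy]; rw [hSa, hH, ha_def, homSol_one]; ring) hφc h.cont hz fun _ _ => rfl).1
    have e2 : radNorm (fun r => r * φ r) ≤ ENNReal.ofReal (5 / 2) * radNorm g := by
      refine radNorm_le_mul (by norm_num) (Eventually.of_forall fun r hr => ?_)
      rw [hφ, norm_mul, norm_mul, Complex.norm_real, Complex.norm_real,
        Real.norm_of_nonneg hr.le, Real.norm_eq_abs, abs_neg, abs_div, abs_mul, abs_two,
        abs_of_pos hr]
      have := h.abs_le hr
      calc r * (2 * |σ r| / r * ‖g r‖) = 2 * |σ r| * ‖g r‖ := by field_simp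
        _ ≤ _ := by gcongr; linarith
    calc radNorm y = radNorm (fun r => (y r - g r) + g r) :=
          radNorm_congr (Eventually.of_forall fun r _ => by ring)
      _ ≤ _ := radNorm_add_le (hyac.sub hg).aesm hg.aesm
      _ ≤ 4 * (ENNReal.ofReal (5 / 2) * radNorm g) + radNorm g := by
          gcongr; exact e.trans (by gcongr)
      _ = 11 * radNorm g := by
          rw [← mul_assoc, ← ENNReal.ofReal_ofNat 4, ← ENNReal.ofReal_mul (by norm_num)]
          norm_num
          ring
      _ ≤ 11 * (ENNReal.ofReal t * A) := by gcongr
      _ = _ := by ring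
  have hS3 : radNorm (fun r => S r / r / r) ≤ ENNReal.ofReal t⁻¹ * (4 * A) :=
    (s3.trans (mul_le_mul_right hdiv _)).trans (le_of_eq (by ring))
  have hga := hgb a ha
  have hHatom := h.isAtom_homSol_div
  have hcancel : ∀ c : ℝ≥0∞, ENNReal.ofReal t * (ENNReal.ofReal t⁻¹ * c) = c :=
    ofReal_inv_mul_cancel ht
  rcases le_total t a with hta | hta
  · -- `y / r` is an atom of scale `t`
    have hlam : ENNReal.ofReal (9 * lam) ≤ ENNReal.ofReal t⁻¹ * 9 := by
      rw [mul_comm 9 lam, ENNReal.ofReal_mul hl.le, ENNReal.ofReal_ofNat]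
      gcongr
      rw [ha_def] at hta
      exact (le_inv_comm₀ ht hl).1 hta
    have hy3 : radNorm (fun r => y r / r / r) ≤ ENNReal.ofReal t⁻¹ * (31 * A) := by
      calc _ = radNorm (fun r => S r / r / r + g a * (H r / r / r)) :=
            radNorm_congr (Eventually.of_forall fun r _ => by simp only [hy]; ring)
        _ ≤ radNorm (fun r => S r / r / r) + radNorm (fun r => g a * (H r / r / r)) :=
            radNorm_add_le (aesm_div (aesm_div hSac.aesm))
              ((aesm_div (aesm_div h.aesm_homSol)).const_mul _)
        _ ≤ ENNReal.ofReal t⁻¹ * (4 * A) + 3 * A * (ENNReal.ofReal t⁻¹ * 9) := by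
            rw [radNorm_const_mul]
            gcongr
            exact k3.trans hlam
        _ = _ := by ring
    have hd := h.div_deriv hyac hf.aesm
    have hyatom : IsAtom t (2 * (125 * A)) (fun r => y r / r) := by
      refine IsAtom.of_weight ht (by finiteness) hd.1.ac ?_ ?_ ?_
      · calc _ ≤ ENNReal.ofReal t * (4 * (ENNReal.ofReal t⁻¹ * (31 * A)) + ENNReal.ofReal t⁻¹ * A) := by
              gcongr; exact hd.2.trans (by gcongr)
          _ = ENNReal.ofReal t * (ENNReal.ofReal t⁻¹ * (125 * A)) := by ring
          _ = _ := hcancel _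
          _ ≤ _ := le_rfl
      · calc _ ≤ ENNReal.ofReal t * (ENNReal.ofReal t⁻¹ * (31 * A)) := by gcongr
          _ = 31 * A := hcancel _
          _ ≤ _ := by gcongr; norm_num
      · rw [radNorm_mul_div]
        refine hyN.trans ?_
        gcongr; norm_num
    have hb := hyatom.isBesov.add (hHatom.isBesov.const_mul (-g a))
    refine (hb.mono ?_).congr (Eventually.of_forall fun r _ => ?_)
    · rw [enorm_neg]
      calc _ ≤ 2 * (125 * A) + 3 * (3 * A) * 72 := by gcongr
        _ = (2 * 125 + 3 * 3 * 72) * A := by ring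
        _ ≤ _ := by gcongr; norm_num
    · simp only [hy]; ring
  · -- `S / r` is an atom of scale `t`
    have hSN : radNorm S ≤ ENNReal.ofReal t * (38 * A) := by
      have hlam : ENNReal.ofReal (9 / lam) ≤ ENNReal.ofReal t * 9 := by
        rw [mul_comm, ← ENNReal.ofReal_ofNat, ← ENNReal.ofReal_mul (by norm_num), div_eq_mul_inv]
        gcongr
      calc _ = radNorm (fun r => y r + (-g a) * H r) :=
            radNorm_congr (Eventually.of_forall fun r _ => by simp only [hy]; ring)
        _ ≤ radNorm y + radNorm (fun r => (-g a) * H r) :=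
            radNorm_add_le hyac.aesm (h.aesm_homSol.const_mul _)
        _ ≤ ENNReal.ofReal t * (11 * A) + 3 * A * (ENNReal.ofReal t * 9) := by
            rw [radNorm_const_mul, enorm_neg]
            gcongr
            exact k1.trans hlam
        _ = _ := by ring
    have hd := h.div_deriv hSac hf.aesm
    have hSatom : IsAtom t (2 * (38 * A)) (fun r => S r / r) := by
      refine IsAtom.of_weight ht (by finiteness) hd.1.ac ?_ ?_ ?_
      · calc _ ≤ ENNReal.ofReal t * (4 * (ENNReal.ofReal t⁻¹ * (4 * A)) + ENNReal.ofReal t⁻¹ * A) := by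
              gcongr; exact hd.2.trans (by gcongr)
          _ = ENNReal.ofReal t * (ENNReal.ofReal t⁻¹ * (17 * A)) := by ring
          _ = 17 * A := hcancel _
          _ ≤ _ := by gcongr; norm_num
      · calc _ ≤ ENNReal.ofReal t * (ENNReal.ofReal t⁻¹ * (4 * A)) := by gcongr
          _ = 4 * A := hcancel _
          _ ≤ _ := by gcongr; norm_num
      · rw [radNorm_mul_div]; exact hSN
    refine hSatom.isBesov.mono ?_
    rw [← mul_assoc]
    gcongr
    norm_num

lemma isBesov_duhamel (h : IsNearSoliton lam σ ε) {f : ℝ → ℂ} (hf : IsBesov f B) (hB : B ≠ ⊤) :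
    IsBesov (fun r => duhamel lam σ f r / r) (1000 * B) := by
  obtain ⟨ι, hι, F, t, A, hF, hA, hs⟩ := hf
  refine IsBesov.of_hasSum_le (by norm_num) (fun i => h.isBesov_duhamel_atom (hF i)) hA hB
    (Eventually.of_forall fun r hr => ?_)
  have := hasSum_intervalIntegral (fun i => (hF i).aesm)
    (ne_top_of_le_ne_top hB ((ENNReal.tsum_le_tsum fun i => (hF i).norm_le).trans hA)) hs
    h.continuousOn_inv_homSol (inv_pos.2 h.lam_pos) hr
  exact (this.mul_left (homSol lam σ r)).div_const _

lemma eq_duhamel (h : IsNearSoliton lam σ ε) {y f : ℝ → ℂ}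
    (hy : ACDeriv y (fun r => ((-(2 * σ r / r) : ℝ) : ℂ) * y r + f r)) {r : ℝ} (hr : 0 < r) :
    y r = y lam⁻¹ * homSol lam σ r + duhamel lam σ f r := by
  have hHinv : ACDeriv (fun r => (homSol lam σ r)⁻¹)
      (fun r => - (((-(2 * σ r / r) : ℝ) : ℂ) * homSol lam σ r) / homSol lam σ r ^ 2) := by
    refine ACDeriv.of_hasDerivAt (fun s hs => (h.hasDerivAt_homSol hs).fun_inv (homSol_ne_zero s)) ?_
    exact (((Complex.continuous_ofReal.comp_continuousOn h.cont_coeff).mul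
      h.continuousOn_homSol).neg).div (h.continuousOn_homSol.pow 2)
      fun s _ => pow_ne_zero 2 (homSol_ne_zero s)
  have hq := (hHinv.mul hy).congr_deriv (g' := fun s => (homSol lam σ s)⁻¹ * f s)
    (Eventually.of_forall fun s _ => by
      have := homSol_ne_zero (lam := lam) (σ := σ) s
      field_simp
      ring)
  have := hq.integral_eq (inv_pos.2 h.lam_pos) hr
  rw [duhamel, this, homSol_one]
  have := homSol_ne_zero (lam := lam) (σ := σ) r
  field_simp
  ring

/-- Solutions of `y' = -(2σ/r) y + f` with Besov right-hand side. -/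
lemma isBesov_of_flow (h : IsNearSoliton lam σ ε) {y f : ℝ → ℂ}
    (hy : ACDeriv y (fun r => ((-(2 * σ r / r) : ℝ) : ℂ) * y r + f r))
    (hf : IsBesov f B) (hB : B ≠ ⊤) :
    IsBesov (fun r => y r / r) (1000 * B + 216 * ‖y lam⁻¹‖ₑ) := by
  have := (h.isBesov_duhamel hf hB).add (h.isAtom_homSol_div.isBesov.const_mul (y lam⁻¹))
  refine (this.mono (le_of_eq (by ring))).congr (Eventually.of_forall fun r hr => ?_)
  rw [h.eq_duhamel hy hr]
  ring

end IsNearSoliton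

lemma integrable_radial_mul {f g : ℝ → ℂ} (hf : AEStronglyMeasurable f radialMeasure)
    (hg : AEStronglyMeasurable g radialMeasure) (hfN : radNorm f ≠ ⊤) (hgN : radNorm g ≠ ⊤) :
    IntegrableOn (fun r => f r * g r * r) (Ioi 0) ∧
    ‖∫ r in Ioi (0 : ℝ), f r * g r * r‖ₑ ≤ radNorm f * radNorm g := by
  have e : ∫⁻ r in Ioi (0 : ℝ), ‖f r * g r * r‖ₑ ≤ radNorm f * radNorm g := by
    refine le_trans (le_of_eq ?_) (cauchy_schwarz_radial hf hg)
    refine setLIntegral_congr_fun measurableSet_Ioi fun r hr => ?_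
    rw [enorm_mul, enorm_mul, mul_comm, ← ofReal_norm ((r : ℂ)), Complex.norm_real,
      Real.norm_of_nonneg (mem_Ioi.1 hr).le]
  refine ⟨⟨?_, e.trans_lt (by finiteness)⟩, (enorm_integral_le_lintegral_enorm _).trans e⟩
  exact (((aemeasurable_restrict_of_aesm hf).mul (aemeasurable_restrict_of_aesm hg)).mul
    (Complex.measurable_ofReal.aemeasurable)).aestronglyMeasurable

/-- Norms of a weight supported in `[0, 2/λ]`. -/
lemma radNorm_le_of_support {ϖ : ℝ → ℂ} {M : ℝ} (hl : 0 < lam) (hM : 0 ≤ M)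
    (hϖ : ∀ r, 0 < r → ‖ϖ r‖ ≤ M) (hs : ∀ r, 2 / lam < r → ϖ r = 0) :
    radNorm ϖ ≤ ENNReal.ofReal (2 * M / lam) ∧
    radNorm (fun r => r * ϖ r) ≤ ENNReal.ofReal (4 * M / lam ^ 2) := by
  have h1 : radNorm ϖ ≤ ENNReal.ofReal (2 * M / lam) := by
    rw [← ENNReal.pow_le_pow_left_iff two_ne_zero, radNorm_sq]
    calc ∫⁻ r in Ioi 0, ENNReal.ofReal r * ‖ϖ r‖ₑ ^ 2
        ≤ ∫⁻ r in Ioi 0, (Ioc 0 (2 / lam)).indicator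
          (fun _ => ENNReal.ofReal (2 / lam * M ^ 2)) r := by
          refine setLIntegral_mono' measurableSet_Ioi fun r hr => ?_
          have hr : 0 < r := hr
          by_cases h : r ≤ 2 / lam
          · rw [indicator_of_mem (show r ∈ Ioc 0 (2 / lam) from ⟨hr, h⟩),
              ENNReal.ofReal_mul (by positivity), ENNReal.ofReal_pow hM, ← ofReal_norm]
            gcongr
            exact hϖ r hr
          · rw [hs r (not_le.1 h)]; simp
      _ ≤ ∫⁻ r, (Ioc 0 (2 / lam)).indicator (fun _ => ENNReal.ofReal (2 / lam * M ^ 2)) r :=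
          setLIntegral_le_lintegral _ _
      _ = ENNReal.ofReal (2 * M / lam) ^ 2 := by
          rw [lintegral_indicator measurableSet_Ioc, setLIntegral_const, Real.volume_Ioc,
            ← ENNReal.ofReal_mul (by positivity), ← ENNReal.ofReal_pow (by positivity)]
          congr 1; field_simp; ring
  refine ⟨h1, ?_⟩
  calc _ ≤ ENNReal.ofReal (2 / lam) * radNorm ϖ := by
        refine radNorm_le_mul (by positivity) (Eventually.of_forall fun r hr => ?_)
        by_cases h : r ≤ 2 / lam
        · rw [norm_mul, Complex.norm_real, Real.norm_of_nonneg hr.le]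
          gcongr
        · rw [hs r (not_le.1 h)]; simp
    _ ≤ ENNReal.ofReal (2 / lam) * ENNReal.ofReal (2 * M / lam) := by gcongr
    _ = _ := by rw [← ENNReal.ofReal_mul (by positivity)]; congr 1; field_simp; ring

/-- A nondegenerate orthogonality condition controls the initial value of the flow. -/
lemma IsNearSoliton.initial_le (h : IsNearSoliton lam σ ε) {y f ϖ : ℝ → ℂ} {M c : ℝ}
    (hy : ACDeriv y (fun r => ((-(2 * σ r / r) : ℝ) : ℂ) * y r + f r))
    (hf : IsBesov f B) (hB : B ≠ ⊤) (hϖm : AEStronglyMeasurable ϖ radialMeasure) (hM : 0 ≤ M)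
    (hϖ : ∀ r, 0 < r → ‖ϖ r‖ ≤ M) (hs : ∀ r, 2 / lam < r → ϖ r = 0)
    (hc : c / lam ^ 2 ≤ ‖∫ r in Ioi (0 : ℝ), ϖ r * h1 (lam * r) * r‖)
    (hε : 96 * ε * M ≤ c) :
    ENNReal.ofReal (c / 2) * ‖y lam⁻¹‖ₑ ≤
      ENNReal.ofReal (lam ^ 2) * ‖∫ r in Ioi (0 : ℝ), ϖ r * y r * r‖ₑ +
        4000 * ENNReal.ofReal M * B := by
  have hl := h.lam_pos
  obtain ⟨n1, n2⟩ := radNorm_le_of_support hl hM hϖ hs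
  have n1' := ne_top_of_le_ne_top ENNReal.ofReal_ne_top n1
  have n2' := ne_top_of_le_ne_top ENNReal.ofReal_ne_top n2
  have m1 : AEStronglyMeasurable (fun r => (h1 (lam * r) : ℂ)) radialMeasure := (acDeriv_h1 hl).aesm
  have m2 : AEStronglyMeasurable (fun r => homSol lam σ r - h1 (lam * r)) radialMeasure :=
    h.aesm_homSol.sub m1
  have k := h.radNorm_sub_h1.1
  have hS := (h.isBesov_duhamel hf hB)
  have mid : AEStronglyMeasurable (fun r : ℝ => (r : ℂ)) radialMeasure :=
    Complex.continuous_ofReal.aestronglyMeasurable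
  obtain ⟨i1, b1⟩ := integrable_radial_mul hϖm m1 n1'
    (ne_top_of_le_ne_top ENNReal.ofReal_ne_top (radNorm_h1 hl))
  obtain ⟨i2, b2⟩ := integrable_radial_mul hϖm m2 n1' (ne_top_of_le_ne_top ENNReal.ofReal_ne_top k)
  obtain ⟨i3, b3⟩ := integrable_radial_mul (f := fun r => r * ϖ r) (mid.mul hϖm) hS.aesm n2'
    (ne_top_of_le_ne_top (by finiteness) hS.radNorm_le)
  have split : ∫ r in Ioi (0 : ℝ), ϖ r * y r * r =
      y lam⁻¹ * (∫ r in Ioi (0 : ℝ), ϖ r * h1 (lam * r) * r) +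
      y lam⁻¹ * (∫ r in Ioi (0 : ℝ), ϖ r * (homSol lam σ r - h1 (lam * r)) * r) +
      ∫ r in Ioi (0 : ℝ), (r * ϖ r) * (duhamel lam σ f r / r) * r := by
    rw [← integral_const_mul, ← integral_const_mul, ← integral_add (i1.const_mul _) (i2.const_mul _),
      ← integral_add (Integrable.fun_add (i1.const_mul _) (i2.const_mul _)) i3]
    refine setIntegral_congr_fun measurableSet_Ioi fun r hr => ?_
    have hr : 0 < r := hr
    have hr' : (r : ℂ) ≠ 0 := by exact_mod_cast hr.ne'
    rw [h.eq_duhamel hy hr]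
    field_simp
    ring
  set I := ∫ r in Ioi (0 : ℝ), ϖ r * h1 (lam * r) * r
  set J := ∫ r in Ioi (0 : ℝ), ϖ r * (homSol lam σ r - h1 (lam * r)) * r
  set L := ∫ r in Ioi (0 : ℝ), (r * ϖ r) * (duhamel lam σ f r / r) * r
  set D := ∫ r in Ioi (0 : ℝ), ϖ r * y r * r
  have hl2 : 0 < lam ^ 2 := by positivity
  have hε0 : 0 ≤ ε := (abs_nonneg _).trans (h.le 1 one_pos)
  have hJ : ‖J‖ ≤ c / 2 / lam ^ 2 := by
    have : ‖J‖ₑ ≤ ENNReal.ofReal (c / 2 / lam ^ 2) := by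
      refine b2.trans ((mul_le_mul' n1 k).trans ?_)
      rw [← ENNReal.ofReal_mul (by positivity)]
      refine ENNReal.ofReal_le_ofReal ?_
      rw [show 2 * M / lam * (24 * ε / lam) = (96 * ε * M) / 2 / lam ^ 2 by field_simp; ring]
      gcongr
    have hc0 : 0 ≤ c := le_trans (by positivity) hε
    rwa [← ofReal_norm, ENNReal.ofReal_le_ofReal_iff (by positivity)] at this
  have hL : ENNReal.ofReal (lam ^ 2) * ‖L‖ₑ ≤ 4000 * ENNReal.ofReal M * B := by
    calc _ ≤ ENNReal.ofReal (lam ^ 2) * (ENNReal.ofReal (4 * M / lam ^ 2) * (1000 * B)) := by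
          gcongr; exact b3.trans (mul_le_mul' n2 hS.radNorm_le)
      _ = ENNReal.ofReal (lam ^ 2 * (4 * M / lam ^ 2)) * (1000 * B) := by
          rw [ENNReal.ofReal_mul hl2.le, mul_assoc]
      _ = ENNReal.ofReal (4 * M) * (1000 * B) := by congr 2; field_simp
      _ = _ := by
          rw [ENNReal.ofReal_mul (by norm_num), ENNReal.ofReal_ofNat]
          ring
  have hmain : c / 2 * ‖y lam⁻¹‖ ≤ lam ^ 2 * (‖D‖ + ‖L‖) := by
    have e1 : y lam⁻¹ * (I + J) = D - L := by rw [split]; ring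
    have e2 : ‖y lam⁻¹‖ * ‖I + J‖ ≤ ‖D‖ + ‖L‖ := by
      rw [← norm_mul, e1]; exact norm_sub_le _ _
    have e3 : c / 2 / lam ^ 2 ≤ ‖I + J‖ := by
      have := norm_sub_norm_le I (-J)
      rw [norm_neg, sub_neg_eq_add] at this
      have h5 : c / lam ^ 2 = c / 2 / lam ^ 2 + c / 2 / lam ^ 2 := by ring
      linarith
    calc c / 2 * ‖y lam⁻¹‖ = lam ^ 2 * (‖y lam⁻¹‖ * (c / 2 / lam ^ 2)) := by field_simp
      _ ≤ lam ^ 2 * (‖y lam⁻¹‖ * ‖I + J‖) := by gcongr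
      _ ≤ _ := by gcongr
  calc ENNReal.ofReal (c / 2) * ‖y lam⁻¹‖ₑ = ENNReal.ofReal (c / 2 * ‖y lam⁻¹‖) := by
        rw [ENNReal.ofReal_mul' (norm_nonneg _), ofReal_norm]
    _ ≤ ENNReal.ofReal (lam ^ 2 * (‖D‖ + ‖L‖)) := ENNReal.ofReal_le_ofReal hmain
    _ = ENNReal.ofReal (lam ^ 2) * ‖D‖ₑ + ENNReal.ofReal (lam ^ 2) * ‖L‖ₑ := by
        rw [ENNReal.ofReal_mul hl2.le, ENNReal.ofReal_add (norm_nonneg _) (norm_nonneg _),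
          ofReal_norm, ofReal_norm, mul_add]
    _ ≤ _ := by gcongr

end Duhamel

open scoped SchwartzMap LineDeriv

/-! ### Convolution with Schwartz kernels on the plane -/

/-- The convolution `Φ * F` of a Schwartz kernel and a function on the plane. -/
def conv (Φ : 𝓢(ℂ, ℂ)) (F : ℂ → ℂ) (x : ℂ) : ℂ := ∫ y, Φ (x - y) * F y

lemma schwartz_decay (Φ : 𝓢(ℂ, ℂ)) :
    ∃ C : ℝ, 0 ≤ C ∧ ∀ x, ‖Φ x‖ ≤ C * (1 + ‖x‖) ^ (-(3 : ℝ)) ∧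
      ‖fderiv ℝ Φ x‖ ≤ C * (1 + ‖x‖) ^ (-(3 : ℝ)) := by
  have key : ∀ n : ℕ, ∃ C : ℝ, 0 ≤ C ∧
      ∀ x, ‖iteratedFDeriv ℝ n Φ x‖ ≤ C * (1 + ‖x‖) ^ (-(3 : ℝ)) := fun n => by
    refine ⟨2 ^ 3 * ((Finset.Iic (3, n)).sup fun m => SchwartzMap.seminorm ℝ m.1 m.2) Φ,
      by positivity, fun x => ?_⟩
    have := SchwartzMap.one_add_le_sup_seminorm_apply (𝕜 := ℝ) (m := (3, n)) le_rfl le_rfl Φ x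
    have hp : 0 < (1 + ‖x‖) ^ 3 := by positivity
    rw [Real.rpow_neg (by positivity), ← div_eq_mul_inv]
    rw [show (1 + ‖x‖) ^ (3 : ℝ) = (1 + ‖x‖) ^ (3 : ℕ) by norm_cast, le_div_iff₀ hp, mul_comm]
    exact this
  obtain ⟨C0, hC0, h0⟩ := key 0
  obtain ⟨C1, hC1, h1⟩ := key 1
  refine ⟨C0 + C1, by positivity, fun x => ⟨?_, ?_⟩⟩
  · have := h0 x
    rw [norm_iteratedFDeriv_zero] at this
    exact this.trans (by gcongr; linarith)
  · have := h1 x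
    rw [norm_iteratedFDeriv_one] at this
    exact this.trans (by gcongr; linarith)

lemma integrable_weight : Integrable (fun x : ℂ => (1 + ‖x‖) ^ (-(3 : ℝ))) :=
  integrable_one_add_norm (by rw [Complex.finrank_real_complex]; norm_num)

/-- `F` is measurable and `|Φ| * |F|` is bounded. -/
def IsTame (Φ : 𝓢(ℂ, ℂ)) (F : ℂ → ℂ) : Prop :=
  AEStronglyMeasurable F ∧ ∃ M : ℝ≥0∞, M ≠ ⊤ ∧ ∀ x, ∫⁻ y, ‖Φ (x - y)‖ₑ * ‖F y‖ₑ ≤ M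

/-- Bounded measurable functions. -/
def IsBdd (F : ℂ → ℂ) : Prop := AEStronglyMeasurable F ∧ ∃ M : ℝ, ∀ x, ‖F x‖ ≤ M

lemma lintegral_kernel (Φ : 𝓢(ℂ, ℂ)) (x : ℂ) : ∫⁻ y, ‖Φ (x - y)‖ₑ = ∫⁻ y, ‖Φ y‖ₑ :=
  lintegral_sub_left_eq_self (fun y => ‖Φ y‖ₑ) x

lemma lintegral_kernel_ne_top (Φ : 𝓢(ℂ, ℂ)) : ∫⁻ y, ‖Φ y‖ₑ ≠ ⊤ := Φ.integrable.2.ne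

lemma lintegral_sq_kernel_ne_top (Φ : 𝓢(ℂ, ℂ)) : ∫⁻ y, ‖Φ y‖ₑ ^ 2 ≠ ⊤ := by
  have h := (Φ.memLp 2 (μ := volume)).2
  rw [eLpNorm_lt_top_iff_lintegral_rpow_enorm_lt_top two_ne_zero ENNReal.ofNat_ne_top] at h
  convert h.ne using 4
  norm_num

lemma IsBdd.isTame {F : ℂ → ℂ} (hF : IsBdd F) (Φ : 𝓢(ℂ, ℂ)) : IsTame Φ F := by
  obtain ⟨hm, M, hM⟩ := hF
  refine ⟨hm, (∫⁻ y, ‖Φ y‖ₑ) * ENNReal.ofReal M, ENNReal.mul_ne_top (lintegral_kernel_ne_top Φ)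
    ENNReal.ofReal_ne_top, fun x => ?_⟩
  rw [← lintegral_kernel Φ x, ← lintegral_mul_const' _ _ ENNReal.ofReal_ne_top]
  refine lintegral_mono fun y => ?_
  gcongr
  rw [← ofReal_norm]
  exact ENNReal.ofReal_le_ofReal (hM y)

lemma eLpNorm_two_sq {α : Type*} [MeasurableSpace α] (μ : Measure α) (F : α → ℂ) :
    eLpNorm F 2 μ ^ 2 = ∫⁻ y, ‖F y‖ₑ ^ 2 ∂μ := by
  have := eLpNorm_nnreal_pow_eq_lintegral (μ := μ) (f := F) (p := 2) (by norm_num)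
  norm_num at this
  exact this

lemma isTame_of_L2 {F : ℂ → ℂ} (hF : AEStronglyMeasurable F) (h : eLpNorm F 2 volume ≠ ⊤)
    (Φ : 𝓢(ℂ, ℂ)) : IsTame Φ F := by
  have hsq : ∀ x : ℂ, ∫⁻ y, ‖Φ (x - y)‖ₑ ^ 2 = ∫⁻ y, ‖Φ y‖ₑ ^ 2 := fun x =>
    lintegral_sub_left_eq_self (fun y => ‖Φ y‖ₑ ^ 2) x
  refine ⟨hF, 1 + (∫⁻ y, ‖Φ y‖ₑ ^ 2) * eLpNorm F 2 volume ^ 2, ?_, fun x => ?_⟩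
  · have := lintegral_sq_kernel_ne_top Φ
    finiteness
  · have hc : Continuous fun y : ℂ => Φ (x - y) := Φ.continuous.comp (continuous_sub_left x)
    have := sq_lintegral_mul_le volume (hc.enorm.measurable.aemeasurable) hF.enorm
    rw [hsq, ← eLpNorm_two_sq volume F] at this
    set X := ∫⁻ y, ‖Φ (x - y)‖ₑ * ‖F y‖ₑ
    rcases le_total X 1 with h1 | h1
    · exact h1.trans le_self_add
    · refine (le_trans ?_ this).trans le_add_self
      calc X = X * 1 := (mul_one _).symm
        _ ≤ X * X := by gcongr
        _ = X ^ 2 := (sq X).symm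

section conv

variable {Φ Ψ : 𝓢(ℂ, ℂ)} {F G : ℂ → ℂ}

lemma continuous_kernel (Φ : 𝓢(ℂ, ℂ)) (x : ℂ) : Continuous fun y : ℂ => Φ (x - y) :=
  Φ.continuous.comp (continuous_sub_left x)

lemma IsTame.integrable (h : IsTame Φ F) (x : ℂ) : Integrable (fun y => Φ (x - y) * F y) := by
  obtain ⟨hm, M, hM, hb⟩ := h
  refine ⟨(continuous_kernel Φ x).aestronglyMeasurable.mul hm, ?_⟩
  simp_rw [HasFiniteIntegral, enorm_mul]
  exact (hb x).trans_lt hM.lt_top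

lemma enorm_conv_le (Φ : 𝓢(ℂ, ℂ)) (F : ℂ → ℂ) (x : ℂ) :
    ‖conv Φ F x‖ₑ ≤ ∫⁻ y, ‖Φ (x - y)‖ₑ * ‖F y‖ₑ :=
  (enorm_integral_le_lintegral_enorm _).trans (le_of_eq (by simp_rw [enorm_mul]))

lemma aesm_kernel_prod (Φ : 𝓢(ℂ, ℂ)) (hF : AEStronglyMeasurable F) :
    AEStronglyMeasurable (fun p : ℂ × ℂ => Φ (p.1 - p.2) * F p.2) (volume.prod volume) := by
  have h1 : Continuous fun p : ℂ × ℂ => Φ (p.1 - p.2) := by fun_prop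
  exact h1.aestronglyMeasurable.mul hF.comp_snd

lemma aesm_conv (Φ : 𝓢(ℂ, ℂ)) (hF : AEStronglyMeasurable F) : AEStronglyMeasurable (conv Φ F) :=
  (aesm_kernel_prod Φ hF).integral_prod_right'

lemma IsTame.isBdd_conv (h : IsTame Φ F) : IsBdd (conv Φ F) := by
  refine ⟨aesm_conv Φ h.1, ?_⟩
  obtain ⟨-, M, hM, hb⟩ := h
  refine ⟨M.toReal, fun x => ?_⟩
  have := (enorm_conv_le Φ F x).trans (hb x)
  rwa [← ofReal_norm, ENNReal.ofReal_le_iff_le_toReal hM] at this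

/-- Young's inequality `L¹ * L² ⊆ L²`. -/
lemma eLpNorm_conv_le (Φ : 𝓢(ℂ, ℂ)) (hF : AEStronglyMeasurable F) :
    eLpNorm (conv Φ F) 2 volume ≤ (∫⁻ y, ‖Φ y‖ₑ) * eLpNorm F 2 volume := by
  rw [← ENNReal.pow_le_pow_left_iff two_ne_zero, eLpNorm_two_sq, mul_pow, eLpNorm_two_sq]
  set N := ∫⁻ y, ‖Φ y‖ₑ
  have hs : ∀ x, ‖conv Φ F x‖ₑ ^ 2 ≤ N * ∫⁻ y, ‖Φ (x - y)‖ₑ * ‖F y‖ₑ ^ 2 := fun x => by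
    have e1 : AEMeasurable (fun y => ‖Φ (x - y)‖ₑ ^ (1 / 2 : ℝ)) :=
      ((continuous_kernel Φ x).enorm.measurable.pow_const _).aemeasurable
    have hsq : ∀ a : ℝ≥0∞, a ^ (1 / 2 : ℝ) * a ^ (1 / 2 : ℝ) = a := fun a => by
      rw [← ENNReal.rpow_add_of_nonneg _ _ (by norm_num) (by norm_num)]; norm_num
    have := sq_lintegral_mul_le volume e1 (e1.mul hF.enorm)
    simp only [mul_pow, Pi.mul_apply, ← mul_assoc, sq (_ ^ (1 / 2 : ℝ)), hsq] at this
    refine (pow_le_pow_left₀ zero_le (enorm_conv_le Φ F x) 2).trans (this.trans ?_)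
    rw [lintegral_kernel]
  have hm : AEMeasurable (fun p : ℂ × ℂ => ‖Φ (p.1 - p.2)‖ₑ * ‖F p.2‖ₑ ^ 2)
      (volume.prod volume) := by
    have h1 : Continuous fun p : ℂ × ℂ => Φ (p.1 - p.2) := by fun_prop
    exact (h1.enorm.measurable.aemeasurable).mul (hF.comp_snd.enorm.pow_const 2)
  calc ∫⁻ x, ‖conv Φ F x‖ₑ ^ 2 ≤ ∫⁻ x, N * ∫⁻ y, ‖Φ (x - y)‖ₑ * ‖F y‖ₑ ^ 2 := lintegral_mono hs
    _ = N * ∫⁻ x, ∫⁻ y, ‖Φ (x - y)‖ₑ * ‖F y‖ₑ ^ 2 :=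
        lintegral_const_mul' _ _ (lintegral_kernel_ne_top Φ)
    _ = N * ∫⁻ y, ∫⁻ x, ‖Φ (x - y)‖ₑ * ‖F y‖ₑ ^ 2 := by rw [lintegral_lintegral_swap hm]
    _ = N * ∫⁻ y, N * ‖F y‖ₑ ^ 2 := by
        congr 1
        refine lintegral_congr fun y => ?_
        rw [lintegral_mul_const' _ _ (by finiteness)]
        congr 1
        exact lintegral_sub_right_eq_self (fun x => ‖Φ x‖ₑ) y
    _ = N * (N * ∫⁻ y, ‖F y‖ₑ ^ 2) := by rw [lintegral_const_mul' _ _ (lintegral_kernel_ne_top Φ)]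
    _ = N ^ 2 * ∫⁻ y, ‖F y‖ₑ ^ 2 := by ring

/-- The convolution of two Schwartz functions. -/
def sconv (Φ Ψ : 𝓢(ℂ, ℂ)) : 𝓢(ℂ, ℂ) := SchwartzMap.convolution (ContinuousLinearMap.mul ℂ ℂ) Φ Ψ

lemma sconv_apply (Φ Ψ : 𝓢(ℂ, ℂ)) (x : ℂ) : sconv Φ Ψ x = conv Φ Ψ x := by
  rw [sconv, SchwartzMap.convolution_apply, conv, MeasureTheory.convolution_def]
  rw [← integral_sub_left_eq_self _ volume x]
  simp

lemma conv_conv (h : IsTame Ψ F) (Φ : 𝓢(ℂ, ℂ)) (x : ℂ) :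
    conv Φ (conv Ψ F) x = conv (sconv Φ Ψ) F x := by
  obtain ⟨hm, M, hM, hb⟩ := h
  have hc : Continuous fun p : ℂ × ℂ => Φ (x - p.1) * Ψ (p.1 - p.2) := by fun_prop
  have hmeas : AEStronglyMeasurable (fun p : ℂ × ℂ => Φ (x - p.1) * (Ψ (p.1 - p.2) * F p.2))
      (volume.prod volume) := by
    simp_rw [← mul_assoc]
    exact hc.aestronglyMeasurable.mul hm.comp_snd
  have hint : Integrable (fun p : ℂ × ℂ => Φ (x - p.1) * (Ψ (p.1 - p.2) * F p.2))
      (volume.prod volume) := by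
    refine ⟨hmeas, ?_⟩
    rw [HasFiniteIntegral, lintegral_prod _ hmeas.enorm]
    calc ∫⁻ y, ∫⁻ z, ‖Φ (x - y) * (Ψ (y - z) * F z)‖ₑ
        = ∫⁻ y, ‖Φ (x - y)‖ₑ * ∫⁻ z, ‖Ψ (y - z)‖ₑ * ‖F z‖ₑ := by
          refine lintegral_congr fun y => ?_
          simp_rw [enorm_mul]
          rw [lintegral_const_mul' _ _ (by finiteness)]
      _ ≤ ∫⁻ y, ‖Φ (x - y)‖ₑ * M := by gcongr with y; exact hb y
      _ = (∫⁻ y, ‖Φ y‖ₑ) * M := by rw [lintegral_mul_const' _ _ hM, lintegral_kernel]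
      _ < ⊤ := ENNReal.mul_lt_top (lintegral_kernel_ne_top Φ).lt_top hM.lt_top
  have := integral_integral_swap (f := fun y z => Φ (x - y) * (Ψ (y - z) * F z)) hint
  unfold conv
  simp_rw [← integral_const_mul]
  rw [this]
  congr 1
  ext z
  simp_rw [← mul_assoc]
  rw [integral_mul_const, sconv_apply]
  congr 1
  unfold conv
  rw [← integral_sub_right_eq_self (fun y => Φ (x - z - y) * Ψ y) z]
  simp

lemma hasFDerivAt_conv (Φ : 𝓢(ℂ, ℂ)) (hG : IsBdd G) (x : ℂ) :
    HasFDerivAt (conv Φ G) (∫ y, (G y) • fderiv ℝ Φ (x - y)) x := by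
  obtain ⟨hm, M, hM⟩ := hG
  obtain ⟨C, hC, hb⟩ := schwartz_decay Φ
  have hM0 : 0 ≤ M := (norm_nonneg _).trans (hM 0)
  have hfc : Continuous (fderiv ℝ Φ) := (Φ.smooth 1).continuous_fderiv one_ne_zero
  refine hasFDerivAt_integral_of_dominated_of_fderiv_le (Metric.ball_mem_nhds x one_pos)
    (F' := fun x y => (G y) • fderiv ℝ Φ (x - y))
    (bound := fun y => M * (C * (8 * (1 + ‖x - y‖) ^ (-(3 : ℝ)))))
    (Eventually.of_forall fun z => (continuous_kernel Φ z).aestronglyMeasurable.mul hm)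
    (IsTame.integrable (IsBdd.isTame ⟨hm, M, hM⟩ Φ) x)
    (hm.smul (hfc.comp (continuous_sub_left x)).aestronglyMeasurable)
    (Eventually.of_forall fun y z hz => ?_) ?_ (Eventually.of_forall fun y z hz => ?_)
  · rw [norm_smul]
    have h1 : ‖z - x‖ < 1 := by simpa [dist_eq_norm] using hz
    have h2 : 1 + ‖x - y‖ ≤ 2 * (1 + ‖z - y‖) := by
      have : ‖x - y‖ ≤ ‖z - y‖ + ‖z - x‖ := by
        rw [show x - y = (z - y) - (z - x) by ring]; exact norm_sub_le _ _
      linarith [norm_nonneg (z - y)]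
    have h3 : (1 + ‖z - y‖) ^ (-(3 : ℝ)) ≤ 8 * (1 + ‖x - y‖) ^ (-(3 : ℝ)) := by
      have e : ∀ s : ℝ, 0 < s → s ^ (-(3 : ℝ)) = (s ^ 3)⁻¹ := fun s hs => by
        rw [Real.rpow_neg hs.le]; norm_cast
      rw [e _ (by positivity), e _ (by positivity), ← div_eq_mul_inv, inv_eq_one_div,
        div_le_div_iff₀ (by positivity) (by positivity)]
      calc 1 * (1 + ‖x - y‖) ^ 3 ≤ 1 * (2 * (1 + ‖z - y‖)) ^ 3 := by gcongr
        _ = _ := by ring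
    gcongr
    · exact hM y
    · exact ((hb (z - y)).2).trans (by gcongr)
  · exact (((integrable_weight.comp_sub_left x).const_mul 8).const_mul C).const_mul M
  · have h1 : HasFDerivAt (fun z : ℂ => Φ (z - y)) (fderiv ℝ Φ (z - y)) z :=
      (hasFDerivAt_comp_sub y).2 (Φ.hasFDerivAt (z - y))
    exact h1.mul_const (G y)

lemma fderiv_conv (Φ : 𝓢(ℂ, ℂ)) (hG : IsBdd G) (x v : ℂ) :
    fderiv ℝ (conv Φ G) x v = conv (∂_{v} Φ) G x := by
  obtain ⟨C, hC, hb⟩ := schwartz_decay Φ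
  obtain ⟨hm, M, hM⟩ := hG
  have hM0 : 0 ≤ M := (norm_nonneg _).trans (hM 0)
  have hfc : Continuous (fderiv ℝ Φ) := (Φ.smooth 1).continuous_fderiv one_ne_zero
  rw [(hasFDerivAt_conv Φ ⟨hm, M, hM⟩ x).fderiv, ContinuousLinearMap.integral_apply, conv]
  · refine integral_congr_ae (Eventually.of_forall fun y => ?_)
    simp only [SchwartzMap.lineDerivOp_apply_eq_fderiv, smul_apply, smul_eq_mul]
    ring
  · refine Integrable.mono' (((integrable_weight.comp_sub_left x).const_mul C).const_mul M)
      (hm.smul (hfc.comp (continuous_sub_left x)).aestronglyMeasurable)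
      (Eventually.of_forall fun y => ?_)
    rw [norm_smul]
    exact mul_le_mul (hM y) (hb (x - y)).2 (norm_nonneg _) hM0

lemma differentiable_conv (Φ : 𝓢(ℂ, ℂ)) (hG : IsBdd G) : Differentiable ℝ (conv Φ G) :=
  fun x => (hasFDerivAt_conv Φ hG x).differentiableAt

lemma conv_add_left (hΦ : IsTame Φ F) (hΨ : IsTame Ψ F) (x : ℂ) :
    conv (Φ + Ψ) F x = conv Φ F x + conv Ψ F x := by
  unfold conv
  rw [← integral_add (hΦ.integrable x) (hΨ.integrable x)]
  simp [add_mul]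

lemma conv_smul_left (c : ℂ) (x : ℂ) : conv (c • Φ) F x = c * conv Φ F x := by
  unfold conv
  rw [← integral_const_mul]
  simp [mul_assoc]

end conv

/-! ### Equivariant functions on the plane -/

/-- The operator `∂₁ + s i ∂₂`. -/
def dpm (s : ℤ) (G : ℂ → ℂ) (x : ℂ) : ℂ :=
  fderiv ℝ G x 1 + s * Complex.I * fderiv ℝ G x Complex.I

/-- The operator `∂₁ + s i ∂₂` on Schwartz functions. -/
def sdpm (s : ℤ) (Φ : 𝓢(ℂ, ℂ)) : 𝓢(ℂ, ℂ) :=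
  ∂_{(1 : ℂ)} Φ + ((s : ℂ) * Complex.I) • ∂_{Complex.I} Φ

lemma sdpm_apply (s : ℤ) (Φ : 𝓢(ℂ, ℂ)) (x : ℂ) : sdpm s Φ x = dpm s Φ x := by
  simp [sdpm, dpm, SchwartzMap.lineDerivOp_apply_eq_fderiv]

lemma dpm_conv (s : ℤ) (Φ : 𝓢(ℂ, ℂ)) {G : ℂ → ℂ} (hG : IsBdd G) (x : ℂ) :
    dpm s (conv Φ G) x = conv (sdpm s Φ) G x := by
  rw [dpm, fderiv_conv Φ hG, fderiv_conv Φ hG, sdpm, conv_add_left (hG.isTame _) (hG.isTame _),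
    conv_smul_left]

/-- `G (e^{iφ} x) = e^{inφ} G x`. -/
def HasMode (n : ℤ) (G : ℂ → ℂ) : Prop := ∀ e : ℂ, ‖e‖ = 1 → ∀ x, G (e * x) = e ^ n * G x

namespace HasMode

variable {n k : ℤ} {G : ℂ → ℂ}

lemma norm_eq (hG : HasMode n G) (x : ℂ) : ‖G x‖ = ‖G (‖x‖ : ℝ)‖ := by
  rcases eq_or_ne x 0 with rfl | hx
  · simp
  · have hn : (‖x‖ : ℂ) ≠ 0 := by simpa using hx
    have he : ‖x / ‖x‖‖ = 1 := by rw [norm_div, Complex.norm_real, norm_norm, div_self (by simpa)]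
    have := hG (x / ‖x‖) he (‖x‖ : ℝ)
    rw [div_mul_cancel₀ x hn] at this
    rw [this, norm_mul, norm_zpow, he, one_zpow, one_mul]

lemma fderiv_mul (hG : HasMode n G) (hd : Differentiable ℝ G) {e : ℂ} (he : ‖e‖ = 1) (x v : ℂ) :
    fderiv ℝ G (e * x) (e * v) = e ^ n * fderiv ℝ G x v := by
  have h1 : HasFDerivAt (fun x => G (e * x))
      ((fderiv ℝ G (e * x)).comp (e • (ContinuousLinearMap.id ℝ ℂ))) x :=
    (hd (e * x)).hasFDerivAt.comp x 
      ((hasFDerivAt_id (𝕜 := ℝ) x).fun_const_smul e)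
  have h2 : HasFDerivAt (fun x => G (e * x)) (e ^ n • fderiv ℝ G x) x := by
    simp_rw [hG e he]
    exact (hd x).hasFDerivAt.const_mul (e ^ n)
  have := congrArg (fun L : ℂ →L[ℝ] ℂ => L v) (h1.unique h2)
  simpa using this

lemma dpm (hG : HasMode n G) (hd : Differentiable ℝ G) {s : ℤ} (hs : s = 1 ∨ s = -1) :
    HasMode (n + s) (dpm s G) := by
  intro e he x
  have he0 : e ≠ 0 := by rintro rfl; simp at he
  have hinv : e⁻¹ = (e.re : ℂ) - e.im * Complex.I := by
    rw [Complex.inv_eq_conj he]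
    apply Complex.ext <;> simp
  have key : ∀ w : ℂ, fderiv ℝ G (e * x) w = e ^ n * fderiv ℝ G x (e⁻¹ * w) := fun w => by
    rw [← hG.fderiv_mul hd he, mul_inv_cancel_left₀ he0]
  have lin : ∀ a b : ℝ, fderiv ℝ G x (a + b * Complex.I) =
      a * fderiv ℝ G x 1 + b * fderiv ℝ G x Complex.I := fun a b => by
    rw [show (a + b * Complex.I : ℂ) = a • (1 : ℂ) + b • Complex.I by simp, map_add, map_smul,
      map_smul]
    simp
  have e1 : fderiv ℝ G x (e⁻¹ * 1) = e.re * fderiv ℝ G x 1 - e.im * fderiv ℝ G x Complex.I := by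
    have := lin e.re (-e.im)
    rw [mul_one, hinv]
    push_cast at this
    rw [sub_eq_add_neg, ← neg_mul, this]; ring
  have e2 : fderiv ℝ G x (e⁻¹ * Complex.I) =
      e.im * fderiv ℝ G x 1 + e.re * fderiv ℝ G x Complex.I := by
    rw [← lin, hinv]; congr 1; linear_combination -(e.im : ℂ) * Complex.I_sq
  have hz : e ^ s = e.re + s * Complex.I * e.im := by
    rcases hs with rfl | rfl
    · rw [zpow_one]; push_cast; rw [one_mul, mul_comm]; exact (Complex.re_add_im e).symm
    · rw [zpow_neg_one, hinv]; push_cast; ring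
  have hs2 : (s : ℂ) * s = 1 := by rcases hs with rfl | rfl <;> norm_num
  simp only [SchrodingerMap.dpm]
  rw [key, key, e1, e2, zpow_add₀ he0, hz]
  linear_combination (e ^ n * e.im * fderiv ℝ G x Complex.I) * hs2 +
    (- e ^ n * e.im * s * s * fderiv ℝ G x Complex.I) * Complex.I_sq

lemma hasDerivAt_profile (hd : Differentiable ℝ G) (r : ℝ) :
    HasDerivAt (fun r : ℝ => G r) (fderiv ℝ G r 1) r := by
  have h1 : HasDerivAt (fun r : ℝ => (r : ℂ)) 1 r := Complex.ofRealCLM.hasDerivAt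
  exact (hd r).hasFDerivAt.comp_hasDerivAt r h1

lemma fderiv_I (hG : HasMode n G) (hd : Differentiable ℝ G) {r : ℝ} (hr : 0 < r) :
    fderiv ℝ G r Complex.I = n * Complex.I * (G r / r) := by
  have h0 : HasDerivAt (fun φ : ℝ => Complex.exp (φ * Complex.I)) Complex.I 0 := by
    have h1 : HasDerivAt (fun φ : ℝ => (φ : ℂ)) 1 0 := Complex.ofRealCLM.hasDerivAt
    simpa using (h1.mul_const Complex.I).cexp
  have h1 : HasDerivAt (fun φ : ℝ => G (Complex.exp (φ * Complex.I) * r))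
      (fderiv ℝ G r (Complex.I * r)) 0 := by
    have e : Complex.exp (((0 : ℝ) : ℂ) * Complex.I) * r = r := by simp
    exact HasFDerivAt.comp_hasDerivAt_of_eq 0 (hd r).hasFDerivAt (h0.mul_const (r : ℂ)) e.symm
  have h2 : HasDerivAt (fun φ : ℝ => G (Complex.exp (φ * Complex.I) * r))
      (n * Complex.I * G r) 0 := by
    have e : ∀ φ : ℝ, G (Complex.exp (φ * Complex.I) * r) =
        Complex.exp (φ * (n * Complex.I)) * G r := fun φ => by
      rw [hG _ (Complex.norm_exp_ofReal_mul_I φ), ← Complex.exp_int_mul]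
      congr 2; ring
    simp_rw [e]
    have h1 : HasDerivAt (fun φ : ℝ => (φ : ℂ)) 1 0 := Complex.ofRealCLM.hasDerivAt
    simpa using (h1.mul_const (n * Complex.I)).cexp.mul_const (G r)
  have h3 := h1.unique h2
  rw [show Complex.I * (r : ℂ) = r • Complex.I by simp [mul_comm], map_smul] at h3
  have hr' : (r : ℂ) ≠ 0 := by exact_mod_cast hr.ne'
  rw [Complex.real_smul] at h3
  field_simp
  linear_combination h3

/-- The profile of `(∂₁ + s i ∂₂) G` is `f' - s n f / r`. -/
lemma dpm_profile (hG : HasMode n G) (hd : Differentiable ℝ G) (s : ℤ) {r : ℝ} (hr : 0 < r) :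
    SchrodingerMap.dpm s G r = fderiv ℝ G r 1 - s * n * (G r / r) := by
  rw [SchrodingerMap.dpm, hG.fderiv_I hd hr]
  linear_combination (s * n * (G r / r)) * Complex.I_sq

lemma conv {Φ : 𝓢(ℂ, ℂ)} (hΦ : HasMode k Φ) (hG : HasMode n G) : HasMode (k + n) (conv Φ G) := by
  intro e he x
  have he0 : e ≠ 0 := by rintro rfl; simp at he
  have hmp : MeasurePreserving (fun y : ℂ => e * y) volume volume := by
    have := (rotation (⟨e, by simpa [Submonoid.unitSphere] using he⟩ : Circle)).measurePreserving
    exact this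
  have hme : MeasurableEmbedding (fun y : ℂ => e * y) :=
    (Homeomorph.mulLeft₀ e he0).measurableEmbedding
  rw [SchrodingerMap.conv, SchrodingerMap.conv, ← hmp.integral_comp hme, ← integral_const_mul]
  refine integral_congr_ae (Eventually.of_forall fun y => ?_)
  simp only
  rw [← mul_sub, hΦ e he, hG e he, zpow_add₀ he0]
  ring

end HasMode

lemma HasMode.sdpm {n s : ℤ} {Φ : 𝓢(ℂ, ℂ)} (hΦ : HasMode n Φ) (hs : s = 1 ∨ s = -1) :
    HasMode (n + s) (sdpm s Φ) := by
  have := hΦ.dpm Φ.differentiable hs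
  intro e he x
  rw [sdpm_apply, sdpm_apply, this e he]

/-! ### Polar coordinates -/

lemma lintegral_comp_norm {φ : ℝ → ℝ≥0∞} (hφ : AEMeasurable φ (volume.restrict (Ioi 0))) :
    ∫⁻ x : ℂ, φ ‖x‖ = ENNReal.ofReal (2 * Real.pi) * ∫⁻ r, φ r ∂radialMeasure := by
  rw [← Complex.lintegral_comp_polarCoord_symm, lintegral_radialMeasure]
  have e : polarCoord.target = Ioi (0 : ℝ) ×ˢ Ioo (-Real.pi) Real.pi := rfl
  rw [e]
  have : ∫⁻ p in Ioi (0 : ℝ) ×ˢ Ioo (-Real.pi) Real.pi,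
      ENNReal.ofReal p.1 • φ ‖Complex.polarCoord.symm p‖ =
      ∫⁻ p in Ioi (0 : ℝ) ×ˢ Ioo (-Real.pi) Real.pi, ENNReal.ofReal p.1 * φ p.1 := by
    refine setLIntegral_congr_fun (measurableSet_Ioi.prod measurableSet_Ioo) fun p hp => ?_
    rw [Complex.norm_polarCoord_symm, abs_of_pos hp.1, smul_eq_mul]
  rw [this, Measure.volume_eq_prod, ← Measure.prod_restrict, lintegral_prod]
  · simp_rw [lintegral_const]
    rw [lintegral_mul_const' _ _ (by simp), Measure.restrict_apply_univ, Real.volume_Ioo, mul_comm]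
    congr 2
    ring
  · exact (ENNReal.measurable_ofReal.aemeasurable.mul hφ).comp_fst

lemma quasiMeasurePreserving_norm :
    Measure.QuasiMeasurePreserving (fun x : ℂ => ‖x‖) volume radialMeasure := by
  refine ⟨measurable_norm, Measure.AbsolutelyContinuous.mk fun s hs h0 => ?_⟩
  rw [Measure.map_apply measurable_norm hs]
  have h := lintegral_comp_norm (φ := s.indicator 1) ((measurable_one.indicator hs).aemeasurable)
  rw [lintegral_indicator_one hs, h0, mul_zero] at h
  rw [← lintegral_indicator_one (measurable_norm hs)]
  exact h

lemma measurable_kernel_norm_ae {f : ℝ → ℂ} (hf : AEStronglyMeasurable f radialMeasure) :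
    AEStronglyMeasurable (fun x : ℂ => f ‖x‖) :=
  hf.comp_quasiMeasurePreserving quasiMeasurePreserving_norm

/-- The constant `√(2π)` relating radial and planar `L²` norms. -/
def polarConst : ℝ≥0∞ := ENNReal.ofReal (√(2 * Real.pi))

lemma polarConst_ne_top : polarConst ≠ ⊤ := ENNReal.ofReal_ne_top

lemma polarConst_ne_zero : polarConst ≠ 0 := by
  simp [polarConst, Real.pi_pos]

lemma eLpNorm_of_norm_eq {G : ℂ → ℂ} {f : ℝ → ℂ} (hf : AEStronglyMeasurable f radialMeasure)
    (h : ∀ᵐ x : ℂ, ‖G x‖ = ‖f ‖x‖‖) : eLpNorm G 2 volume = polarConst * radNorm f := by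
  have hsq : eLpNorm G 2 volume ^ 2 = (polarConst * radNorm f) ^ 2 := by
    rw [eLpNorm_two_sq, mul_pow, radNorm, eLpNorm_two_sq, polarConst,
      ← ENNReal.ofReal_pow (by positivity), Real.sq_sqrt (by positivity),
      ← lintegral_comp_norm (φ := fun r => ‖f r‖ₑ ^ 2)
        ((aemeasurable_restrict_of_aesm hf).enorm.pow_const 2)]
    refine lintegral_congr_ae (h.mono fun x hx => ?_)
    simp only
    rw [← ofReal_norm, ← ofReal_norm (f ‖x‖), hx]
  exact le_antisymm ((ENNReal.pow_le_pow_left_iff two_ne_zero).1 hsq.le)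
    ((ENNReal.pow_le_pow_left_iff two_ne_zero).1 hsq.ge)

lemma HasMode.eLpNorm_eq {n : ℤ} {G : ℂ → ℂ} (hG : HasMode n G)
    (hf : AEStronglyMeasurable (fun r : ℝ => G r) radialMeasure) :
    eLpNorm G 2 volume = polarConst * radNorm (fun r : ℝ => G r) :=
  eLpNorm_of_norm_eq hf (Eventually.of_forall hG.norm_eq)

/-- The function `e^{inθ} f(r)`. -/
def modeLift (n : ℤ) (f : ℝ → ℂ) (x : ℂ) : ℂ := (x / ‖x‖) ^ n * f ‖x‖

lemma hasMode_modeLift (n : ℤ) (f : ℝ → ℂ) : HasMode n (modeLift n f) := by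
  intro e he x
  rw [modeLift, modeLift, norm_mul, he, one_mul, mul_div_assoc, mul_zpow, mul_assoc]

lemma modeLift_ofReal (n : ℤ) (f : ℝ → ℂ) {r : ℝ} (hr : 0 < r) : modeLift n f r = f r := by
  have : (r : ℂ) ≠ 0 := by exact_mod_cast hr.ne'
  rw [modeLift, Complex.norm_real, Real.norm_of_nonneg hr.le, div_self this, one_zpow, one_mul]

lemma norm_modeLift (n : ℤ) (f : ℝ → ℂ) {x : ℂ} (hx : x ≠ 0) : ‖modeLift n f x‖ = ‖f ‖x‖‖ := by
  rw [modeLift, norm_mul, norm_zpow, norm_div, Complex.norm_real, norm_norm,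
    div_self (by simpa), one_zpow, one_mul]

lemma ae_ne_zero : ∀ᵐ x : ℂ, x ≠ 0 := by
  rw [ae_iff]; simp

lemma aesm_modeLift (n : ℤ) {f : ℝ → ℂ} (hf : AEStronglyMeasurable f radialMeasure) :
    AEStronglyMeasurable (modeLift n f) := by
  refine AEStronglyMeasurable.mul ?_ (measurable_kernel_norm_ae hf)
  refine Measurable.aestronglyMeasurable ?_
  exact (measurable_id.div (Complex.measurable_ofReal.comp measurable_norm)).pow_const n

lemma eLpNorm_modeLift (n : ℤ) {f : ℝ → ℂ} (hf : AEStronglyMeasurable f radialMeasure) :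
    eLpNorm (modeLift n f) 2 volume = polarConst * radNorm f :=
  eLpNorm_of_norm_eq hf (ae_ne_zero.mono fun _ hx => norm_modeLift n f hx)

lemma modeLift_polar (n : ℤ) (f : ℝ → ℂ) {r θ : ℝ} (hr : 0 < r) :
    modeLift n f (r * Complex.exp (θ * Complex.I)) = Complex.exp (θ * Complex.I) ^ n * f r := by
  rw [mul_comm, hasMode_modeLift n f _ (Complex.norm_exp_ofReal_mul_I θ), modeLift_ofReal n f hr]

/-! ### Integration by parts against equivariant functions -/

lemma ACDeriv.integral_Ioi_eq_zero {b b' : ℝ → ℂ} (hb : ACDeriv b b')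
    (hi : IntegrableOn b' (Ioi 0)) (h0 : Tendsto b (𝓝[>] 0) (𝓝 0)) (h1 : Tendsto b atTop (𝓝 0)) :
    ∫ r in Ioi (0 : ℝ), b' r = 0 := by
  set S : ℕ → Set ℝ := fun n => Ioc ((n : ℝ) + 1)⁻¹ (n + 1) with hS
  have hmono : Monotone S := fun m n hmn => by
    have : (m : ℝ) ≤ n := by exact_mod_cast hmn
    refine Ioc_subset_Ioc ?_ (by linarith)
    gcongr
  have hU : ⋃ n, S n = Ioi 0 := by
    ext x
    simp only [hS, mem_iUnion, mem_Ioc, mem_Ioi]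
    constructor
    · rintro ⟨n, hn, -⟩; exact lt_trans (by positivity) hn
    · intro hx
      obtain ⟨n, hn⟩ := exists_nat_ge (max x x⁻¹)
      refine ⟨n, ?_, ?_⟩
      · rw [inv_lt_comm₀ (by positivity) hx]
        linarith [le_max_right x x⁻¹]
      · linarith [le_max_left x x⁻¹]
  have ht := tendsto_setIntegral_of_monotone (fun n => measurableSet_Ioc) hmono
    (f := b') (μ := volume) (by rw [hU]; exact hi)
  rw [hU] at ht
  have e : ∀ n : ℕ, ∫ r in S n, b' r = b (n + 1) - b ((n : ℝ) + 1)⁻¹ := fun n => by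
    have hle : ((n : ℝ) + 1)⁻¹ ≤ n + 1 := by
      have : (0 : ℝ) ≤ n := Nat.cast_nonneg n
      exact (inv_le_one_of_one_le₀ (by linarith)).trans (by linarith)
    rw [hS, ← intervalIntegral.integral_of_le hle, hb.integral_eq (by positivity) (by positivity)]
  rw [tendsto_congr e] at ht
  have ha : Tendsto (fun n : ℕ => (n : ℝ) + 1) atTop atTop :=
    tendsto_atTop_add_const_right _ _ tendsto_natCast_atTop_atTop
  have hz : Tendsto (fun n : ℕ => ((n : ℝ) + 1)⁻¹) atTop (𝓝[>] 0) :=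
    tendsto_inv_atTop_nhdsGT_zero.comp ha
  have := (h1.comp ha).sub (h0.comp hz)
  rw [sub_zero] at this
  exact tendsto_nhds_unique ht this

/-- `C¹` functions with cubic decay. -/
structure IsDecaying (k : ℂ → ℂ) : Prop where
  diff : ContDiff ℝ 1 k
  decay : ∃ C : ℝ, 0 ≤ C ∧ ∀ x, ‖k x‖ ≤ C * (1 + ‖x‖) ^ (-(3 : ℝ)) ∧
    ‖fderiv ℝ k x‖ ≤ C * (1 + ‖x‖) ^ (-(3 : ℝ))

lemma rpow_neg_three {a : ℝ} (ha : 0 < a) : a ^ (-(3 : ℝ)) = (a ^ 3)⁻¹ := by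
  rw [Real.rpow_neg ha.le]; norm_cast

lemma isDecaying_kernel (Φ : 𝓢(ℂ, ℂ)) (x : ℂ) : IsDecaying (fun y => Φ (x - y)) := by
  obtain ⟨C, hC, hb⟩ := schwartz_decay Φ
  refine ⟨(Φ.smooth 1).comp (contDiff_const.sub contDiff_id), C * (1 + ‖x‖) ^ 3, by positivity,
    fun y => ?_⟩
  have hd : fderiv ℝ (fun y => Φ (x - y)) y = - fderiv ℝ Φ (x - y) := by
    have h1 : HasFDerivAt (fun y : ℂ => x - y) (-ContinuousLinearMap.id ℝ ℂ) y := by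
      simpa using (hasFDerivAt_id (𝕜 := ℝ) y).const_sub x
    have := (Φ.hasFDerivAt (x - y)).comp y h1
    rw [show (fun y => Φ (x - y)) = Φ ∘ (fun y => x - y) from rfl, this.fderiv]
    ext v; simp
  have hw : (1 + ‖x - y‖) ^ (-(3 : ℝ)) ≤ (1 + ‖x‖) ^ 3 * (1 + ‖y‖) ^ (-(3 : ℝ)) := by
    rw [rpow_neg_three (by positivity), rpow_neg_three (by positivity), ← div_eq_mul_inv,
      inv_eq_one_div, div_le_div_iff₀ (by positivity) (by positivity), one_mul, ← mul_pow]
    have : ‖y‖ ≤ ‖x‖ + ‖x - y‖ := by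
      rw [show y = x - (x - y) by ring]
      exact (norm_sub_le _ _).trans (by simp)
    gcongr
    nlinarith [norm_nonneg x, norm_nonneg (x - y)]
  rw [hd, norm_neg, mul_assoc]
  exact ⟨(hb (x - y)).1.trans (by gcongr), (hb (x - y)).2.trans (by gcongr)⟩

lemma dpm_kernel (s : ℤ) (Φ : 𝓢(ℂ, ℂ)) (x y : ℂ) :
    dpm s (fun y => Φ (x - y)) y = - sdpm s Φ (x - y) := by
  have h1 : HasFDerivAt (fun y : ℂ => x - y) (-ContinuousLinearMap.id ℝ ℂ) y := by
    simpa using (hasFDerivAt_id (𝕜 := ℝ) y).const_sub x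
  have := (Φ.hasFDerivAt (x - y)).comp y h1
  rw [sdpm_apply, dpm, dpm, show (fun y => Φ (x - y)) = Φ ∘ (fun y => x - y) from rfl, this.fderiv]
  simp only [ContinuousLinearMap.comp_apply, neg_apply,
    ContinuousLinearMap.id_apply, map_neg]
  ring

/-- `∂₁ + s i ∂₂` in a rotated frame. -/
lemma rotate_dpm (L : ℂ →L[ℝ] ℂ) {e : ℂ} (he : ‖e‖ = 1) {s : ℤ} (hs : s = 1 ∨ s = -1) :
    e ^ s * (L e + s * Complex.I * L (Complex.I * e)) = L 1 + s * Complex.I * L Complex.I := by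
  have hre : ∀ a b : ℝ, L (a + b * Complex.I) = a * L 1 + b * L Complex.I := fun a b => by
    rw [show (a + b * Complex.I : ℂ) = a • (1 : ℂ) + b • Complex.I by simp, map_add, map_smul,
      map_smul]
    simp
  have hinv : e⁻¹ = (e.re : ℂ) - e.im * Complex.I := by
    rw [Complex.inv_eq_conj he]
    apply Complex.ext <;> simp
  have hsq : (e.re : ℂ) ^ 2 + (e.im : ℂ) ^ 2 = 1 := by
    have : e.re ^ 2 + e.im ^ 2 = 1 := by
      have h := Complex.normSq_apply e
      rw [Complex.normSq_eq_norm_sq, he] at h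
      nlinarith
    exact_mod_cast this
  have e1 : L e = e.re * L 1 + e.im * L Complex.I := by
    rw [← hre, Complex.re_add_im]
  have e2 : L (Complex.I * e) = -e.im * L 1 + e.re * L Complex.I := by
    have := hre (-e.im) e.re
    push_cast at this
    rw [← this]
    congr 1
    conv_lhs => rw [← Complex.re_add_im e]
    linear_combination (e.im : ℂ) * Complex.I_sq
  have hz : e ^ s = e.re + s * Complex.I * e.im := by
    rcases hs with rfl | rfl
    · rw [zpow_one]; push_cast; rw [one_mul, mul_comm]; exact (Complex.re_add_im e).symm
    · rw [zpow_neg_one, hinv]; push_cast; ring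
  have hs2 : (s : ℂ) * s = 1 := by rcases hs with rfl | rfl <;> norm_num
  rw [e1, e2, hz]
  have hsI : (s : ℂ) * s * Complex.I ^ 2 = -1 := by rw [hs2, Complex.I_sq]; ring
  linear_combination (L 1 + s * Complex.I * L Complex.I) * hsq +
    (-(e.im : ℂ) ^ 2 * L 1 + e.re * e.im * L Complex.I) * hsI

section Ibp

variable {k : ℂ → ℂ} {n s : ℤ} {g g' : ℝ → ℂ} {M : ℝ}

/-- The radial part of `r (k D F + (D k) F)`, as a derivative in `r`. -/
def polarRad (k : ℂ → ℂ) (p : ℤ) (g g' : ℝ → ℂ) (r θ : ℝ) : ℂ :=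
  Complex.exp (θ * Complex.I) ^ p *
    ((k (r * Complex.exp (θ * Complex.I)) +
      r * fderiv ℝ k (r * Complex.exp (θ * Complex.I)) (Complex.exp (θ * Complex.I))) * g r +
      r * k (r * Complex.exp (θ * Complex.I)) * g' r)

/-- The angular part of `r (k D F + (D k) F)`, as a derivative in `θ`. -/
def polarAng (k : ℂ → ℂ) (p s : ℤ) (g : ℝ → ℂ) (r θ : ℝ) : ℂ :=
  Complex.exp (θ * Complex.I) ^ p * (s * Complex.I * g r) *
    (r * fderiv ℝ k (r * Complex.exp (θ * Complex.I)) (Complex.I * Complex.exp (θ * Complex.I)) +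
      p * Complex.I * k (r * Complex.exp (θ * Complex.I)))

lemma polar_identity (hs : s = 1 ∨ s = -1) {r : ℝ} (hr : 0 < r) (θ : ℝ) :
    polarRad k (n + s) g g' r θ + polarAng k (n + s) s g r θ =
      r * (k (r * Complex.exp (θ * Complex.I)) *
        modeLift (n + s) (fun r => g' r - s * n * (g r / r)) (r * Complex.exp (θ * Complex.I)) +
        dpm s k (r * Complex.exp (θ * Complex.I)) *
          modeLift n g (r * Complex.exp (θ * Complex.I))) := by
  have he := Complex.norm_exp_ofReal_mul_I θ
  rw [modeLift_polar _ _ hr, modeLift_polar _ _ hr, polarRad, polarAng, dpm,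
    ← rotate_dpm (fderiv ℝ k (r * Complex.exp (θ * Complex.I))) he hs]
  have hr' : (r : ℂ) ≠ 0 := by exact_mod_cast hr.ne'
  have hs2 : (s : ℂ) * s = 1 := by rcases hs with rfl | rfl <;> norm_num
  rw [zpow_add₀ (Complex.exp_ne_zero _)]
  set e := Complex.exp (θ * Complex.I)
  push_cast
  field_simp
  linear_combination (e ^ n * e ^ s * k (r * e) * g r * s * (n + s)) * Complex.I_sq -
    (e ^ n * e ^ s * k (r * e) * g r) * hs2

lemma hasDerivAt_exp_zpow (p : ℤ) (θ : ℝ) :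
    HasDerivAt (fun θ : ℝ => Complex.exp (θ * Complex.I) ^ p)
      (p * Complex.I * Complex.exp (θ * Complex.I) ^ p) θ := by
  have e : ∀ φ : ℝ, Complex.exp (φ * Complex.I) ^ p = Complex.exp (φ * (p * Complex.I)) := fun φ => by
    rw [← Complex.exp_int_mul]; congr 1; ring
  simp_rw [e]
  have h1 : HasDerivAt (fun φ : ℝ => (φ : ℂ)) 1 θ := Complex.ofRealCLM.hasDerivAt
  refine (h1.mul_const (p * Complex.I)).cexp.congr_deriv ?_
  ring

lemma continuous_exp_zpow (p : ℤ) : Continuous (fun θ : ℝ => Complex.exp (θ * Complex.I) ^ p) :=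
  continuous_iff_continuousAt.2 fun θ => (hasDerivAt_exp_zpow p θ).continuousAt

lemma integral_polarAng (hk : ContDiff ℝ 1 k) (p s : ℤ) (g : ℝ → ℂ) (r : ℝ) :
    ∫ θ in Ioo (-Real.pi) Real.pi, polarAng k p s g r θ = 0 := by
  rw [← integral_Ioc_eq_integral_Ioo, ← intervalIntegral.integral_of_le (by linarith [Real.pi_pos])]
  have h1 : ∀ θ : ℝ, HasDerivAt (fun θ : ℝ => (r : ℂ) * Complex.exp (θ * Complex.I))
      (r * (Complex.I * Complex.exp (θ * Complex.I))) θ := fun θ => by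
    have h := (hasDerivAt_exp_zpow 1 θ).const_mul (r : ℂ)
    simpa using h
  have h2 : ∀ θ : ℝ, HasDerivAt (fun θ : ℝ => Complex.exp (θ * Complex.I) ^ p *
      (s * Complex.I * g r) * k (r * Complex.exp (θ * Complex.I))) (polarAng k p s g r θ) θ :=
    fun θ => by
    have h3 := ((hk.differentiable one_ne_zero (r * Complex.exp (θ * Complex.I))).hasFDerivAt).comp_hasDerivAt
      θ (h1 θ)
    simp only [Function.comp_def] at h3
    refine (((hasDerivAt_exp_zpow p θ).mul_const (s * Complex.I * g r)).mul h3).congr_deriv ?_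
    rw [polarAng, show (r : ℂ) * (Complex.I * Complex.exp (θ * Complex.I)) =
      r • (Complex.I * Complex.exp (θ * Complex.I)) by simp, map_smul, Complex.real_smul]
    ring
  have hc : Continuous (polarAng k p s g r) := by
    have h3 := hk.continuous
    have h4 := hk.continuous_fderiv one_ne_zero
    have h5 := continuous_exp_zpow p
    unfold polarAng
    refine (h5.mul continuous_const).mul (Continuous.add ?_ ?_)
    · exact continuous_const.mul ((h4.comp (by fun_prop)).clm_apply (by fun_prop))
    · exact continuous_const.mul (h3.comp (by fun_prop))
  rw [intervalIntegral.integral_eq_sub_of_hasDerivAt (fun θ _ => h2 θ) (hc.intervalIntegrable _ _)]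
  simp [Complex.exp_neg]

lemma isDecaying_bounds (hk : IsDecaying k) : ∃ C : ℝ, 0 ≤ C ∧ ∀ r : ℝ, 0 < r → ∀ e : ℂ, ‖e‖ = 1 →
    ∀ v : ℂ, ‖v‖ = 1 → ‖k (r * e)‖ ≤ C * ((1 + r) ^ 2)⁻¹ ∧
      ‖r * k (r * e)‖ ≤ C * ((1 + r) ^ 2)⁻¹ ∧
      ‖r * fderiv ℝ k (r * e) v‖ ≤ C * ((1 + r) ^ 2)⁻¹ := by
  obtain ⟨-, C, hC, hb⟩ := hk
  refine ⟨C, hC, fun r hr e he v hv => ?_⟩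
  have hn : ‖(r : ℂ) * e‖ = r := by
    rw [norm_mul, he, mul_one, Complex.norm_real, Real.norm_of_nonneg hr.le]
  have := hb (r * e)
  rw [hn, rpow_neg_three (by positivity)] at this
  have h1 : ((1 + r) ^ 3)⁻¹ ≤ ((1 + r) ^ 2)⁻¹ := by
    have : (1 + r) ^ 2 ≤ (1 + r) ^ 3 := pow_le_pow_right₀ (by linarith) (by norm_num)
    gcongr
  have h2 : r * ((1 + r) ^ 3)⁻¹ ≤ ((1 + r) ^ 2)⁻¹ := by
    rw [← div_eq_mul_inv, div_le_iff₀ (by positivity)]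
    have : ((1 + r) ^ 2)⁻¹ * (1 + r) ^ 3 = 1 + r := by field_simp
    linarith
  have hr' : ‖(r : ℂ)‖ = r := by rw [Complex.norm_real, Real.norm_of_nonneg hr.le]
  refine ⟨this.1.trans (by gcongr), ?_, ?_⟩
  · rw [norm_mul, hr']
    calc r * ‖k (r * e)‖ ≤ r * (C * ((1 + r) ^ 3)⁻¹) := by gcongr; exact this.1
      _ = C * (r * ((1 + r) ^ 3)⁻¹) := by ring
      _ ≤ _ := by gcongr
  · rw [norm_mul, hr']
    calc r * ‖fderiv ℝ k (r * e) v‖ ≤ r * (C * ((1 + r) ^ 3)⁻¹) := by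
          gcongr
          refine (ContinuousLinearMap.le_opNorm _ _).trans ?_
          rw [hv, mul_one]; exact this.2
      _ = C * (r * ((1 + r) ^ 3)⁻¹) := by ring
      _ ≤ _ := by gcongr

lemma integral_polarRad (hk : IsDecaying k) (p : ℤ) (hg : ACDeriv g g')
    (hM : ∀ r, 0 < r → ‖g r‖ ≤ M) (θ : ℝ)
    (hi : IntegrableOn (fun r => polarRad k p g g' r θ) (Ioi 0)) :
    ∫ r in Ioi (0 : ℝ), polarRad k p g g' r θ = 0 := by
  obtain ⟨C, hC, hb⟩ := isDecaying_bounds hk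
  have hM0 : 0 ≤ M := (norm_nonneg _).trans (hM 1 one_pos)
  set e := Complex.exp (θ * Complex.I) with he
  have he1 : ‖e‖ = 1 := Complex.norm_exp_ofReal_mul_I θ
  have h1 : ∀ r : ℝ, HasDerivAt (fun r : ℝ => (r : ℂ) * e) e r := fun r => by
    have h1 : HasDerivAt (fun r : ℝ => (r : ℂ)) 1 r := Complex.ofRealCLM.hasDerivAt
    simpa using h1.mul_const e
  have h2 : ∀ r : ℝ, HasDerivAt (fun r : ℝ => (r : ℂ) * k (r * e))
      (k (r * e) + r * fderiv ℝ k (r * e) e) r := fun r => by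
    have h1' : HasDerivAt (fun r : ℝ => (r : ℂ)) 1 r := Complex.ofRealCLM.hasDerivAt
    have h3 := ((hk.diff.differentiable one_ne_zero (r * e)).hasFDerivAt).comp_hasDerivAt r (h1 r)
    simp only [Function.comp_def] at h3
    exact (h1'.mul h3).congr_deriv (by ring)
  have hc : Continuous (fun r : ℝ => k (r * e) + r * fderiv ℝ k (r * e) e) := by
    have h3 := hk.diff.continuous
    have h4 := hk.diff.continuous_fderiv one_ne_zero
    refine (h3.comp (by fun_prop)).add (Continuous.mul (by fun_prop) ?_)
    exact (h4.comp (by fun_prop)).clm_apply continuous_const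
  have hac := ((ACDeriv.of_hasDerivAt (fun r _ => h2 r) hc.continuousOn).mul hg).const_mul (e ^ p)
  have hbound : ∀ r : ℝ, 0 < r → ‖e ^ p * (r * k (r * e) * g r)‖ ≤ C * ((1 + r) ^ 2)⁻¹ * M :=
    fun r hr => by
    rw [norm_mul, norm_zpow, he1, one_zpow, one_mul, norm_mul]
    exact mul_le_mul (hb r hr e he1 1 (by simp)).2.1 (hM r hr) (norm_nonneg _) (by positivity)
  refine hac.integral_Ioi_eq_zero hi ?_ ?_
  · have hcont : Continuous fun r : ℝ => ‖(r : ℂ) * k (r * e)‖ * M := by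
      have h3 := hk.diff.continuous
      exact (((Complex.continuous_ofReal).mul (h3.comp (by fun_prop))).norm).mul continuous_const
    have h0 := hcont.tendsto 0
    simp only [Complex.ofReal_zero, zero_mul, norm_zero] at h0
    refine squeeze_zero_norm' ?_ (h0.mono_left nhdsWithin_le_nhds)
    filter_upwards [self_mem_nhdsWithin] with r hr
    rw [norm_mul, norm_zpow, he1, one_zpow, one_mul, norm_mul]
    gcongr
    exact hM r hr
  · have h0 : Tendsto (fun r : ℝ => C * ((1 + r) ^ 2)⁻¹ * M) atTop (𝓝 (C * 0 * M)) := by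
      refine (Tendsto.const_mul C ?_).mul_const M
      refine tendsto_inv_atTop_zero.comp ((tendsto_pow_atTop two_ne_zero).comp ?_)
      exact tendsto_atTop_add_const_left _ _ tendsto_id
    rw [mul_zero, zero_mul] at h0
    refine squeeze_zero_norm' ?_ h0
    filter_upwards [eventually_gt_atTop 0] with r hr
    exact hbound r hr

end Ibp

lemma integrableOn_weight : IntegrableOn (fun r : ℝ => ((1 + r) ^ 2)⁻¹) (Ioi 0) := by
  have h := integrable_one_add_norm (E := ℝ) (μ := volume) (r := 2) (by simp)
  refine h.integrableOn.congr_fun (fun r hr => ?_) measurableSet_Ioi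
  have hr : 0 < r := hr
  simp only [Real.norm_of_nonneg hr.le]
  rw [Real.rpow_neg (by positivity)]
  norm_cast

lemma radNorm_weight_ne_top : radNorm (fun r => ((((1 + r) ^ 2)⁻¹ : ℝ) : ℂ)) ≠ ⊤ := by
  have h : radNorm (fun r => ((((1 + r) ^ 2)⁻¹ : ℝ) : ℂ)) ^ 2 ≠ ⊤ := by
    rw [radNorm_sq]
    refine ne_top_of_le_ne_top integrableOn_weight.2.ne ?_
    refine setLIntegral_mono' measurableSet_Ioi fun r hr => ?_
    have hr : 0 < r := hr
    rw [← ofReal_norm, ← ofReal_norm, Complex.norm_real, ← ENNReal.ofReal_pow (norm_nonneg _),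
      ← ENNReal.ofReal_mul hr.le]
    refine ENNReal.ofReal_le_ofReal ?_
    have h0 : (0 : ℝ) ≤ ((1 + r) ^ 2)⁻¹ := by positivity
    rw [Real.norm_of_nonneg h0]
    have : r * ((1 + r) ^ 2)⁻¹ ≤ 1 := by
      rw [← div_eq_mul_inv, div_le_one (by positivity)]; nlinarith
    calc r * ((1 + r) ^ 2)⁻¹ ^ 2 = (r * ((1 + r) ^ 2)⁻¹) * ((1 + r) ^ 2)⁻¹ := by ring
      _ ≤ 1 * ((1 + r) ^ 2)⁻¹ := by gcongr
      _ = _ := one_mul _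
  contrapose! h
  rw [h]; simp

lemma integrableOn_weight_mul {f : ℝ → ℂ} (hf : AEStronglyMeasurable f radialMeasure)
    (h : radNorm f ≠ ⊤) (a b : ℝ) :
    IntegrableOn (fun r => ((1 + r) ^ 2)⁻¹ * (a + b * (r * ‖f r‖))) (Ioi 0) := by
  have hm : AEStronglyMeasurable (fun r => ((((1 + r) ^ 2)⁻¹ : ℝ) : ℂ)) radialMeasure := by
    refine aestronglyMeasurable_of_continuousOn (Complex.continuous_ofReal.comp_continuousOn ?_)
    exact ContinuousOn.inv₀ (by fun_prop) fun r hr => by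
      have : 0 < r := hr
      positivity
  obtain ⟨i1, -⟩ := integrable_radial_mul hm hf radNorm_weight_ne_top h
  have i2 : IntegrableOn (fun r : ℝ => a * ((1 + r) ^ 2)⁻¹ +
      b * ‖(((((1 + r) ^ 2)⁻¹ : ℝ) : ℂ)) * f r * r‖) (Ioi 0) :=
    (integrableOn_weight.const_mul a).add (i1.norm.const_mul b)
  refine i2.congr_fun (fun r hr => ?_)
    measurableSet_Ioi
  have hr : 0 < r := hr
  have h0 : (0 : ℝ) ≤ ((1 + r) ^ 2)⁻¹ := by positivity
  simp only [norm_mul, Complex.norm_real, Real.norm_of_nonneg h0,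
    Real.norm_of_nonneg hr.le]
  ring

section Ibp

variable {k : ℂ → ℂ} {n s : ℤ} {g g' : ℝ → ℂ} {M : ℝ}

lemma integrable_polar (hk : IsDecaying k) (p s : ℤ) (hg : ACDeriv g g')
    (hM : ∀ r, 0 < r → ‖g r‖ ≤ M) (hN : radNorm g' ≠ ⊤) :
    Integrable (fun q : ℝ × ℝ => polarRad k p g g' q.1 q.2)
      ((volume.restrict (Ioi 0)).prod (volume.restrict (Ioo (-Real.pi) Real.pi))) ∧
    Integrable (fun q : ℝ × ℝ => polarAng k p s g q.1 q.2)
      ((volume.restrict (Ioi 0)).prod (volume.restrict (Ioo (-Real.pi) Real.pi))) := by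
  obtain ⟨C, hC, hb⟩ := isDecaying_bounds hk
  have hM0 : 0 ≤ M := (norm_nonneg _).trans (hM 1 one_pos)
  have hpos : ∀ᵐ q : ℝ × ℝ ∂((volume.restrict (Ioi 0)).prod
      (volume.restrict (Ioo (-Real.pi) Real.pi))), 0 < q.1 := by
    rw [Measure.prod_restrict, ae_restrict_iff' (measurableSet_Ioi.prod measurableSet_Ioo)]
    exact Eventually.of_forall fun q hq => hq.1
  have hgm : AEStronglyMeasurable g (volume.restrict (Ioi 0)) :=
    (aemeasurable_restrict_of_aesm hg.aesm).aestronglyMeasurable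
  have hgm' : AEStronglyMeasurable g' (volume.restrict (Ioi 0)) :=
    (aemeasurable_restrict_of_aesm hg.aesm_deriv).aestronglyMeasurable
  have c1 : Continuous fun q : ℝ × ℝ => k (q.1 * Complex.exp (q.2 * Complex.I)) :=
    hk.diff.continuous.comp (by fun_prop)
  have c2 : Continuous fun q : ℝ × ℝ => fderiv ℝ k (q.1 * Complex.exp (q.2 * Complex.I)) :=
    (hk.diff.continuous_fderiv one_ne_zero).comp (by fun_prop)
  have c3 : Continuous fun q : ℝ × ℝ => Complex.exp (q.2 * Complex.I) ^ p :=
    (continuous_exp_zpow p).comp continuous_snd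
  have c4 : Continuous fun q : ℝ × ℝ => Complex.exp (q.2 * Complex.I) := by fun_prop
  have c5 : Continuous fun q : ℝ × ℝ => (q.1 : ℂ) := by fun_prop
  have hE : ∀ θ : ℝ, ‖Complex.exp (θ * Complex.I)‖ = 1 := Complex.norm_exp_ofReal_mul_I
  have hfin : IsFiniteMeasure (volume.restrict (Ioo (-Real.pi) Real.pi)) := inferInstance
  constructor
  · refine Integrable.mono' ((integrableOn_weight_mul hg.aesm_deriv hN (2 * C * M) C).comp_fst _) ?_ ?_
    · have m1 := (c1.add (c5.mul (c2.clm_apply c4))).aestronglyMeasurable (μ :=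
        (volume.restrict (Ioi 0)).prod (volume.restrict (Ioo (-Real.pi) Real.pi)))
      have m2 := (c5.mul c1).aestronglyMeasurable (μ :=
        (volume.restrict (Ioi 0)).prod (volume.restrict (Ioo (-Real.pi) Real.pi)))
      exact c3.aestronglyMeasurable.mul ((m1.mul hgm.comp_fst).add (m2.mul hgm'.comp_fst))
    · filter_upwards [hpos] with q hq
      obtain ⟨b1, b2, b3⟩ := hb q.1 hq _ (hE q.2) _ (hE q.2)
      rw [polarRad, norm_mul, norm_zpow, hE, one_zpow, one_mul]
      have hn : ‖(q.1 : ℂ)‖ = q.1 := by rw [Complex.norm_real, Real.norm_of_nonneg hq.le]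
      calc _ ≤ (‖k (q.1 * Complex.exp (q.2 * Complex.I))‖ + ‖(q.1 : ℂ) *
            fderiv ℝ k (q.1 * Complex.exp (q.2 * Complex.I)) (Complex.exp (q.2 * Complex.I))‖) * ‖g q.1‖
            + ‖(q.1 : ℂ)‖ * ‖k (q.1 * Complex.exp (q.2 * Complex.I))‖ * ‖g' q.1‖ := by
            refine (norm_add_le _ _).trans ?_
            rw [norm_mul, norm_mul, norm_mul]
            gcongr
            exact norm_add_le _ _
        _ ≤ (C * ((1 + q.1) ^ 2)⁻¹ + C * ((1 + q.1) ^ 2)⁻¹) * M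
            + q.1 * (C * ((1 + q.1) ^ 2)⁻¹) * ‖g' q.1‖ := by
            rw [hn]
            gcongr
            exact hM _ hq
        _ = _ := by ring
  · refine Integrable.mono' ((integrableOn_weight.const_mul
      (|(s : ℝ)| * M * (C + |(p : ℝ)| * C))).comp_fst _) ?_ ?_
    · have m1 := (c5.mul (c2.clm_apply (continuous_const (y := Complex.I) |>.mul c4))).add
        ((continuous_const (y := (p : ℂ) * Complex.I)).mul c1)
      exact (c3.aestronglyMeasurable.mul (hgm.comp_fst.const_mul _)).mul m1.aestronglyMeasurable
    · filter_upwards [hpos] with q hq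
      obtain ⟨b1, b2, b3⟩ := hb q.1 hq _ (hE q.2) (Complex.I * Complex.exp (q.2 * Complex.I))
        (by rw [norm_mul, hE]; simp)
      rw [polarAng, norm_mul, norm_mul, norm_zpow, hE, one_zpow, one_mul]
      have e1 : ‖(s : ℂ) * Complex.I * g q.1‖ ≤ |(s : ℝ)| * M := by
        rw [norm_mul, norm_mul, Complex.norm_I, mul_one, Complex.norm_intCast]
        gcongr
        exact hM _ hq
      have e2 : ‖(p : ℂ) * Complex.I * k (q.1 * Complex.exp (q.2 * Complex.I))‖ ≤
          |(p : ℝ)| * (C * ((1 + q.1) ^ 2)⁻¹) := by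
        rw [norm_mul, norm_mul, Complex.norm_I, mul_one, Complex.norm_intCast]
        gcongr
      calc _ ≤ |(s : ℝ)| * M * (C * ((1 + q.1) ^ 2)⁻¹ + |(p : ℝ)| * (C * ((1 + q.1) ^ 2)⁻¹)) := by
            gcongr
            exact (norm_add_le _ _).trans (add_le_add b3 e2)
        _ = _ := by ring

lemma enorm_modeLift_le (p : ℤ) (f : ℝ → ℂ) (x : ℂ) (hx : x ≠ 0) :
    ‖modeLift p f x‖ₑ = ‖f ‖x‖‖ₑ := by
  rw [← ofReal_norm, norm_modeLift p f hx, ofReal_norm]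

/-- Integration by parts for `∂₁ + s i ∂₂` against `e^{inθ} g(r)`. -/
lemma ibp (hk : IsDecaying k) (hs : s = 1 ∨ s = -1) (hg : ACDeriv g g')
    (hM : ∀ r, 0 < r → ‖g r‖ ≤ M) (hN : radNorm g' ≠ ⊤) :
    Integrable (fun y => k y * modeLift (n + s) (fun r => g' r - s * n * (g r / r)) y) ∧
    ∫ y, k y * modeLift (n + s) (fun r => g' r - s * n * (g r / r)) y =
      - ∫ y, dpm s k y * modeLift n g y := by
  have hM0 : 0 ≤ M := (norm_nonneg _).trans (hM 1 one_pos)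
  obtain ⟨hA, hB⟩ := integrable_polar hk (n + s) s hg hM hN
  obtain ⟨C, hC, hb⟩ := hk.decay
  set D : ℝ → ℂ := fun r => g' r - s * n * (g r / r) with hD
  have hDm : AEStronglyMeasurable D radialMeasure :=
    hg.aesm_deriv.sub ((aesm_div hg.aesm).const_mul _)
  have i1 : Integrable (fun y => k y * modeLift (n + s) D y) := by
    refine ⟨hk.diff.continuous.aestronglyMeasurable.mul (aesm_modeLift _ hDm), ?_⟩
    have hint := (integrableOn_weight_mul hg.aesm_deriv hN (|(s : ℝ)| * |(n : ℝ)| * M) 1).const_mul C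
    have hmw : AEMeasurable (fun r : ℝ => ENNReal.ofReal (C * ((1 + r) ^ 2)⁻¹) * ‖D r‖ₑ)
        (volume.restrict (Ioi 0)) := by
      refine AEMeasurable.mul ?_ (aemeasurable_restrict_of_aesm hDm).enorm
      exact (by fun_prop : Measurable fun r : ℝ => ENNReal.ofReal (C * ((1 + r) ^ 2)⁻¹)).aemeasurable
    calc ∫⁻ y, ‖k y * modeLift (n + s) D y‖ₑ
        ≤ ∫⁻ y : ℂ, ENNReal.ofReal (C * ((1 + ‖y‖) ^ 2)⁻¹) * ‖D ‖y‖‖ₑ := by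
          refine lintegral_mono_ae (ae_ne_zero.mono fun y hy => ?_)
          rw [enorm_mul, enorm_modeLift_le _ _ _ hy, ← ofReal_norm]
          gcongr
          refine (hb y).1.trans ?_
          rw [rpow_neg_three (by positivity)]
          have : (1 + ‖y‖) ^ 2 ≤ (1 + ‖y‖) ^ 3 :=
            pow_le_pow_right₀ (by linarith [norm_nonneg y]) (by norm_num)
          gcongr
      _ = ENNReal.ofReal (2 * Real.pi) * ∫⁻ r, ENNReal.ofReal (C * ((1 + r) ^ 2)⁻¹) * ‖D r‖ₑ
            ∂radialMeasure := lintegral_comp_norm hmw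
      _ ≤ ENNReal.ofReal (2 * Real.pi) * ∫⁻ r in Ioi 0, ‖C * (((1 + r) ^ 2)⁻¹ *
            (|(s : ℝ)| * |(n : ℝ)| * M + 1 * (r * ‖g' r‖)))‖ₑ := by
          rw [lintegral_radialMeasure]
          gcongr ENNReal.ofReal (2 * Real.pi) * ?_
          refine setLIntegral_mono' measurableSet_Ioi fun r hr => ?_
          have hr : 0 < r := hr
          rw [← ofReal_norm, ← ofReal_norm, ← ENNReal.ofReal_mul (by positivity),
            ← ENNReal.ofReal_mul hr.le]
          refine ENNReal.ofReal_le_ofReal ?_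
          rw [Real.norm_of_nonneg (by positivity)]
          have e1 : r * ‖D r‖ ≤ |(s : ℝ)| * |(n : ℝ)| * M + r * ‖g' r‖ := by
            calc r * ‖D r‖ ≤ r * (‖g' r‖ + |(s : ℝ)| * |(n : ℝ)| * (‖g r‖ / r)) := by
                  gcongr
                  refine (norm_sub_le _ _).trans (add_le_add le_rfl (le_of_eq ?_))
                  rw [norm_mul, norm_mul, norm_div, Complex.norm_real, Real.norm_of_nonneg hr.le,
                    Complex.norm_intCast, Complex.norm_intCast]
              _ = |(s : ℝ)| * |(n : ℝ)| * ‖g r‖ + r * ‖g' r‖ := by field_simp; ring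
              _ ≤ _ := by gcongr; exact hM r hr
          calc r * (C * ((1 + r) ^ 2)⁻¹ * ‖D r‖) = C * (((1 + r) ^ 2)⁻¹ * (r * ‖D r‖)) := by ring
            _ ≤ _ := by rw [one_mul]; gcongr
      _ < ⊤ := ENNReal.mul_lt_top ENNReal.ofReal_lt_top hint.2
  have i2 : Integrable (fun y => dpm s k y * modeLift n g y) := by
    have hdc : Continuous (dpm s k) := by
      have := hk.diff.continuous_fderiv one_ne_zero
      exact (this.clm_apply continuous_const).add
        (continuous_const.mul (this.clm_apply continuous_const))
    refine Integrable.mono' ((integrable_weight.const_mul (2 * C)).mul_const M)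
      (hdc.aestronglyMeasurable.mul (aesm_modeLift _ hg.aesm)) (ae_ne_zero.mono fun y hy => ?_)
    rw [norm_mul, norm_modeLift _ _ hy]
    have hs1 : ‖(s : ℂ)‖ = 1 := by rcases hs with rfl | rfl <;> simp
    have h1 : ∀ v : ℂ, ‖v‖ = 1 → ‖fderiv ℝ k y v‖ ≤ C * (1 + ‖y‖) ^ (-(3 : ℝ)) := fun v hv => by
      refine (ContinuousLinearMap.le_opNorm _ _).trans ?_
      rw [hv, mul_one]; exact (hb y).2
    have h2 : ‖dpm s k y‖ ≤ 2 * C * (1 + ‖y‖) ^ (-(3 : ℝ)) := by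
      refine (norm_add_le _ _).trans ?_
      rw [norm_mul, norm_mul, hs1, Complex.norm_I, one_mul, one_mul]
      linarith [h1 1 (by simp), h1 Complex.I (by simp)]
    exact mul_le_mul h2 (hM _ (by simpa using hy)) (norm_nonneg _) (by positivity)
  refine ⟨i1, ?_⟩
  have hz : ∫ y, (k y * modeLift (n + s) D y + dpm s k y * modeLift n g y) = 0 := by
    rw [← Complex.integral_comp_polarCoord_symm]
    have e : polarCoord.target = Ioi (0 : ℝ) ×ˢ Ioo (-Real.pi) Real.pi := rfl
    rw [e]
    have : ∫ p in Ioi (0 : ℝ) ×ˢ Ioo (-Real.pi) Real.pi,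
        p.1 • (k (Complex.polarCoord.symm p) * modeLift (n + s) D (Complex.polarCoord.symm p) +
          dpm s k (Complex.polarCoord.symm p) * modeLift n g (Complex.polarCoord.symm p)) =
        ∫ p in Ioi (0 : ℝ) ×ˢ Ioo (-Real.pi) Real.pi,
          (polarRad k (n + s) g g' p.1 p.2 + polarAng k (n + s) s g p.1 p.2) := by
      refine setIntegral_congr_fun (measurableSet_Ioi.prod measurableSet_Ioo) fun p hp => ?_
      have e : Complex.polarCoord.symm p = p.1 * Complex.exp (p.2 * Complex.I) := by
        rw [Complex.polarCoord_symm_apply, Complex.exp_mul_I]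
        push_cast; rfl
      rw [polar_identity hs hp.1, e, Complex.real_smul]
    rw [this, Measure.volume_eq_prod, ← Measure.prod_restrict, integral_add hA hB]
    have eA : ∫ q : ℝ × ℝ, polarRad k (n + s) g g' q.1 q.2 ∂((volume.restrict (Ioi 0)).prod
        (volume.restrict (Ioo (-Real.pi) Real.pi))) = 0 := by
      rw [integral_prod_symm _ hA]
      refine integral_eq_zero_of_ae ?_
      filter_upwards [hA.prod_left_ae] with θ hθ
      exact integral_polarRad hk _ hg hM θ hθ
    have eB : ∫ q : ℝ × ℝ, polarAng k (n + s) s g q.1 q.2 ∂((volume.restrict (Ioi 0)).prod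
        (volume.restrict (Ioo (-Real.pi) Real.pi))) = 0 := by
      rw [integral_prod _ hB]
      exact integral_eq_zero_of_ae (Eventually.of_forall fun r =>
        integral_polarAng hk.diff _ _ _ r)
    rw [eA, eB, add_zero]
  rw [integral_add i1 i2] at hz
  exact eq_neg_of_add_eq_zero_left hz

/-- `Φ * (D F) = (D Φ) * F` for `F = e^{inθ} g(r)`. -/
lemma conv_dpm (Φ : 𝓢(ℂ, ℂ)) (hs : s = 1 ∨ s = -1) (hg : ACDeriv g g')
    (hM : ∀ r, 0 < r → ‖g r‖ ≤ M) (hN : radNorm g' ≠ ⊤) (x : ℂ) :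
    Integrable (fun y => Φ (x - y) * modeLift (n + s) (fun r => g' r - s * n * (g r / r)) y) ∧
    conv Φ (modeLift (n + s) (fun r => g' r - s * n * (g r / r))) x =
      conv (sdpm s Φ) (modeLift n g) x := by
  obtain ⟨i, e⟩ := ibp (n := n) (isDecaying_kernel Φ x) hs hg hM hN
  refine ⟨i, e.trans ?_⟩
  rw [conv, ← integral_neg]
  refine integral_congr_ae (Eventually.of_forall fun y => ?_)
  simp only
  rw [dpm_kernel]
  ring

end Ibp

/-! ### Littlewood-Paley kernels -/

/-- Smooth functions with compact support in `(0, ∞)`. -/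
structure IsSymbol (q : ℝ → ℝ) : Prop where
  smooth : ContDiff ℝ ∞ q
  supp : ∃ a b : ℝ, 0 < a ∧ ∀ s, q s ≠ 0 → a ≤ s ∧ s ≤ b

namespace IsSymbol

variable {q : ℝ → ℝ}

lemma of_tsupport {a b : ℝ} (ha : 0 < a) (hq : ContDiff ℝ ∞ q) (h : tsupport q ⊆ Ioo a b) :
    IsSymbol q :=
  ⟨hq, a, b, ha, fun _ hs => ⟨(h (subset_tsupport q hs)).1.le, (h (subset_tsupport q hs)).2.le⟩⟩

lemma scale (hq : IsSymbol q) {c : ℝ} (hc : 0 < c) : IsSymbol (fun s => q (s / c)) := by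
  obtain ⟨h1, a, b, ha, h2⟩ := hq
  refine ⟨h1.comp (contDiff_id.div_const c), c * a, c * b, by positivity, fun s hs => ?_⟩
  obtain ⟨h3, h4⟩ := h2 _ hs
  rw [le_div_iff₀ hc] at h3
  rw [div_le_iff₀ hc] at h4
  constructor <;> linarith

lemma neg_div_sq (hq : IsSymbol q) : IsSymbol (fun s => -q s / s ^ 2) := by
  obtain ⟨h1, a, b, ha, h2⟩ := hq
  refine ⟨contDiff_iff_contDiffAt.2 fun s => ?_, a, b, ha, fun s hs => h2 s fun h0 => hs (by simp [h0])⟩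
  rcases lt_or_ge s a with hsa | hsa
  · have : (fun s => -q s / s ^ 2) =ᶠ[𝓝 s] fun _ => 0 := by
      filter_upwards [Iio_mem_nhds hsa] with x hx
      have : q x = 0 := by
        by_contra h
        exact absurd (h2 x h).1 (not_le.2 hx)
      simp [this]
    exact contDiffAt_const.congr_of_eventuallyEq this
  · exact h1.contDiffAt.neg.div (contDiffAt_id.pow 2) (pow_ne_zero 2 (ha.trans_le hsa).ne')

lemma contDiff_radial (hq : IsSymbol q) :
    ContDiff ℝ ∞ (fun ξ : ℂ => (q (2 * Real.pi * ‖ξ‖) : ℂ)) := by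
  obtain ⟨h1, a, b, ha, h2⟩ := hq
  refine Complex.ofRealCLM.contDiff.comp (contDiff_iff_contDiffAt.2 fun ξ => ?_)
  rcases eq_or_ne ξ 0 with rfl | hξ
  · have : (fun ξ : ℂ => q (2 * Real.pi * ‖ξ‖)) =ᶠ[𝓝 0] fun _ => 0 := by
      have ho : IsOpen {ξ : ℂ | 2 * Real.pi * ‖ξ‖ < a} :=
        isOpen_lt (by fun_prop) continuous_const
      filter_upwards [ho.mem_nhds (by simpa using ha)] with x hx
      by_contra h
      exact absurd (h2 _ h).1 (not_le.2 hx)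
    exact contDiffAt_const.congr_of_eventuallyEq this
  · exact h1.contDiffAt.comp ξ (contDiffAt_const.mul (contDiffAt_norm ℝ hξ))

lemma hasCompactSupport_radial (hq : IsSymbol q) :
    HasCompactSupport (fun ξ : ℂ => (q (2 * Real.pi * ‖ξ‖) : ℂ)) := by
  obtain ⟨h1, a, b, ha, h2⟩ := hq
  refine HasCompactSupport.intro (isCompact_closedBall (0 : ℂ) (b / (2 * Real.pi))) fun ξ hξ => ?_
  have hpi := Real.pi_pos
  rw [Metric.mem_closedBall, dist_zero_right, not_le, div_lt_iff₀ (by positivity)] at hξ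
  by_contra h
  have := (h2 _ (by simpa using h)).2
  linarith

/-- The radial Schwartz function `q(2π|ξ|)`. -/
def symb (hq : IsSymbol q) : 𝓢(ℂ, ℂ) :=
  HasCompactSupport.toSchwartzMap hq.hasCompactSupport_radial hq.contDiff_radial

lemma symb_apply (hq : IsSymbol q) (ξ : ℂ) : hq.symb ξ = q (2 * Real.pi * ‖ξ‖) := rfl

/-- The kernel of the Fourier multiplier `q(|D|)`. -/
def ker (hq : IsSymbol q) : 𝓢(ℂ, ℂ) := 𝓕⁻ hq.symb

lemma fourier_ker (hq : IsSymbol q) : 𝓕 hq.ker = hq.symb := FourierTransform.fourier_fourierInv_eq _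

lemma ker_apply (hq : IsSymbol q) (x : ℂ) :
    hq.ker x = 𝓕⁻ (fun ξ : ℂ => (q (2 * Real.pi * ‖ξ‖) : ℂ)) x := by
  rw [ker, SchwartzMap.fourierInv_coe]; rfl

lemma ker_neg (hq : IsSymbol q) (x : ℂ) : hq.ker (-x) = hq.ker x := by
  rw [ker_apply, ker_apply]
  have := Real.fourierInv_comp_linearIsometry (LinearIsometryEquiv.neg ℝ (E := ℂ))
    (fun ξ : ℂ => (q (2 * Real.pi * ‖ξ‖) : ℂ)) x
  simp only [LinearIsometryEquiv.coe_neg] at this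
  exact this.symm.trans (congrArg (fun g : ℂ → ℂ => 𝓕⁻ g x) (funext fun ξ => by simp))

lemma ker_im (hq : IsSymbol q) (x : ℂ) : ((hq.ker x).re : ℂ) = hq.ker x := by
  refine Complex.conj_eq_iff_re.1 (Eq.trans ?_ (hq.ker_neg x))
  rw [ker_apply, ker_apply, Real.fourierInv_eq', Real.fourierInv_eq', ← integral_conj]
  congr 1
  funext ξ
  simp only [smul_eq_mul, map_mul, Complex.conj_ofReal, ← Complex.exp_conj, Complex.conj_I,
    inner_neg_right]
  congr 2
  push_cast; ring

lemma hasMode_ker (hq : IsSymbol q) : HasMode 0 hq.ker := by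
  intro e he x
  rw [zpow_zero, one_mul, ker_apply, ker_apply]
  have := Real.fourierInv_comp_linearIsometry
    (rotation (⟨e, by simpa [Submonoid.unitSphere] using he⟩ : Circle))
    (fun ξ : ℂ => (q (2 * Real.pi * ‖ξ‖) : ℂ)) x
  exact this.symm.trans (congrArg (fun g : ℂ → ℂ => 𝓕⁻ g x) (funext fun ξ => by
    rw [Function.comp_apply, LinearIsometryEquiv.norm_map]))

end IsSymbol

lemma fourier_injective {Φ Ψ : 𝓢(ℂ, ℂ)} (h : 𝓕 Φ = 𝓕 Ψ) : Φ = Ψ := by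
  rw [← FourierTransform.fourierInv_fourier_eq (F := 𝓢(ℂ, ℂ)) Φ, h,
    FourierTransform.fourierInv_fourier_eq]

lemma fourier_sconv (Φ Ψ : 𝓢(ℂ, ℂ)) (ξ : ℂ) : 𝓕 (sconv Φ Ψ) ξ = 𝓕 Φ ξ * 𝓕 Ψ ξ := by
  rw [sconv, SchwartzMap.fourier_convolution]; rfl

lemma fourier_sdpm (s : ℤ) (Φ : 𝓢(ℂ, ℂ)) (ξ : ℂ) :
    𝓕 (sdpm s Φ) ξ = 2 * Real.pi * Complex.I * (ξ.re + s * Complex.I * ξ.im) * 𝓕 Φ ξ := by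
  have h1 : (inner ℝ · (1 : ℂ) : ℂ → ℝ).HasTemperateGrowth := by fun_prop
  have h2 : (inner ℝ · Complex.I : ℂ → ℝ).HasTemperateGrowth := by fun_prop
  rw [sdpm, FourierTransform.fourier_add, FourierTransform.fourier_smul,
    SchwartzMap.fourier_lineDerivOp_eq, SchwartzMap.fourier_lineDerivOp_eq]
  rw [add_apply, smul_apply, smul_apply, smul_apply, SchwartzMap.smulLeftCLM_apply_apply h1,
    SchwartzMap.smulLeftCLM_apply_apply h2]
  simp only [smul_eq_mul, Complex.inner, Complex.real_smul]
  simp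
  ring

lemma IsSymbol.sdpm_sdpm_ker {q : ℝ → ℝ} (hq : IsSymbol q) {s : ℤ} (hs : s = 1 ∨ s = -1) :
    sdpm s (sdpm (-s) hq.neg_div_sq.ker) = hq.ker := by
  refine fourier_injective ?_
  ext ξ
  rw [fourier_sdpm, fourier_sdpm, IsSymbol.fourier_ker, IsSymbol.fourier_ker,
    IsSymbol.symb_apply, IsSymbol.symb_apply]
  rcases eq_or_ne ξ 0 with rfl | hξ
  · have : q 0 = 0 := by
      obtain ⟨-, a, b, ha, h2⟩ := hq
      by_contra h
      exact absurd (h2 0 h).1 (not_le.2 ha)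
    simp [this]
  · have hs2 : (s : ℂ) * s = 1 := by rcases hs with rfl | rfl <;> norm_num
    have hn : ((‖ξ‖ : ℝ) : ℂ) ^ 2 = (ξ.re : ℂ) ^ 2 + (ξ.im : ℂ) ^ 2 := by
      rw [← Complex.ofReal_pow, ← Complex.normSq_eq_norm_sq, Complex.normSq_apply]
      push_cast; ring
    have hn0 : ((‖ξ‖ : ℝ) : ℂ) ≠ 0 := by simpa using hξ
    have hpi : (Real.pi : ℂ) ≠ 0 := by exact_mod_cast Real.pi_ne_zero
    push_cast
    have hn1 : (ξ.re : ℂ) ^ 2 + (ξ.im : ℂ) ^ 2 ≠ 0 := by rw [← hn]; exact pow_ne_zero 2 hn0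
    rw [mul_pow, hn]
    field_simp
    have hI4 : Complex.I ^ 4 = 1 := Complex.I_pow_four
    linear_combination (-(ξ.re : ℂ) ^ 2 * q (2 * Real.pi * ‖ξ‖)) * Complex.I_sq +
      (ξ.im : ℂ) ^ 2 * q (2 * Real.pi * ‖ξ‖) * s * s * hI4 + (ξ.im : ℂ) ^ 2 *
      q (2 * Real.pi * ‖ξ‖) * hs2

lemma IsSymbol.sconv_ker {q p : ℝ → ℝ} (hq : IsSymbol q) (hp : IsSymbol p)
    (h : ∀ s, p s * q s = q s) : sconv hp.ker hq.ker = hq.ker := by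
  refine fourier_injective ?_
  ext ξ
  rw [fourier_sconv, IsSymbol.fourier_ker, IsSymbol.fourier_ker, IsSymbol.symb_apply,
    IsSymbol.symb_apply]
  exact_mod_cast h _

/-! ### Dilations of kernels -/

/-- The dilation `c² Φ(c x)`, which preserves the `L¹` norm. -/
def dil (c : ℝˣ) (Φ : 𝓢(ℂ, ℂ)) : 𝓢(ℂ, ℂ) :=
  ((c : ℝ) : ℂ) ^ 2 • SchwartzMap.compCLMOfContinuousLinearEquiv ℂ
    (ContinuousLinearEquiv.smulLeft c : ℂ ≃L[ℝ] ℂ) Φ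

lemma dil_apply (c : ℝˣ) (Φ : 𝓢(ℂ, ℂ)) (x : ℂ) : dil c Φ x = (c : ℝ) ^ 2 * Φ ((c : ℝ) * x) := by
  simp [dil, Units.smul_def]

lemma sdpm_dil (s : ℤ) (c : ℝˣ) (Φ : 𝓢(ℂ, ℂ)) :
    sdpm s (dil c Φ) = ((c : ℝ) : ℂ) • dil c (sdpm s Φ) := by
  ext x
  have hd : ∀ v : ℂ, fderiv ℝ (dil c Φ) x v = (c : ℝ) ^ 3 * fderiv ℝ Φ ((c : ℝ) * x) v := fun v => by
    have h1 : HasFDerivAt (fun y : ℂ => ((c : ℝ) : ℂ) * y)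
        (((c : ℝ) : ℂ) • ContinuousLinearMap.id ℝ ℂ) x :=
      (hasFDerivAt_id (𝕜 := ℝ) x).fun_const_smul ((c : ℝ) : ℂ)
    have h2 := ((Φ.hasFDerivAt ((c : ℝ) * x)).comp x h1).const_mul (((c : ℝ) : ℂ) ^ 2)
    have e : (dil c Φ : ℂ → ℂ) = fun y => ((c : ℝ) : ℂ) ^ 2 * (Φ ∘ fun y => ((c : ℝ) : ℂ) * y) y := by
      ext y; rw [dil_apply]; rfl
    rw [e, h2.fderiv]
    simp only [smul_apply, ContinuousLinearMap.comp_apply, ContinuousLinearMap.id_apply, smul_eq_mul]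
    rw [show ((c : ℝ) : ℂ) * v = (c : ℝ) • v by simp, map_smul, Complex.real_smul]
    ring
  rw [sdpm_apply, dpm, hd, hd, smul_apply, dil_apply, sdpm_apply, dpm, smul_eq_mul]
  ring

lemma lintegral_dil (c : ℝˣ) (Φ : 𝓢(ℂ, ℂ)) : ∫⁻ x, ‖dil c Φ x‖ₑ = ∫⁻ x, ‖Φ x‖ₑ := by
  have hc : (c : ℝ) ≠ 0 := c.ne_zero
  have h := lintegral_map_equiv (μ := (volume : Measure ℂ)) (fun x : ℂ => ‖Φ x‖ₑ)
    (Homeomorph.smulOfNeZero (c : ℝ) hc).toMeasurableEquiv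
  have e : ∀ x : ℂ, (Homeomorph.smulOfNeZero (c : ℝ) hc).toMeasurableEquiv x = (c : ℝ) • x :=
    fun _ => rfl
  have e' : ((Homeomorph.smulOfNeZero (c : ℝ) hc).toMeasurableEquiv : ℂ → ℂ) =
    fun x => (c : ℝ) • x := rfl
  simp_rw [e, e', Measure.map_addHaar_smul volume hc] at h
  rw [lintegral_smul_measure] at h
  simp_rw [dil_apply, enorm_mul, ← Complex.real_smul]
  rw [lintegral_const_mul' _ _ (by finiteness), ← h, Complex.finrank_real_complex, smul_eq_mul,
    ← mul_assoc, ← ofReal_norm, ← ENNReal.ofReal_mul (norm_nonneg _)]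
  have : ‖((c : ℝ) : ℂ) ^ 2‖ * |((c : ℝ) ^ 2)⁻¹| = 1 := by
    rw [norm_pow, Complex.norm_real, Real.norm_eq_abs, abs_inv, abs_pow]
    exact mul_inv_cancel₀ (pow_ne_zero 2 (abs_ne_zero.2 hc))
  rw [this, ENNReal.ofReal_one, one_mul]

lemma IsSymbol.ker_scale {q : ℝ → ℝ} (hq : IsSymbol q) (c : ℝˣ) (hc : 0 < (c : ℝ)) :
    (hq.scale hc).ker = dil c hq.ker := by
  ext x
  rw [dil_apply, ker_apply, ker_apply, Real.fourierInv_eq', Real.fourierInv_eq']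
  have h := Measure.integral_comp_smul (volume : Measure ℂ) (fun v : ℂ =>
    Complex.exp (((2 * Real.pi * ⟪v, x⟫ : ℝ) : ℂ) * Complex.I) •
      (q (2 * Real.pi * ‖v‖ / (c : ℝ)) : ℂ)) (c : ℝ)
  rw [Complex.finrank_real_complex, abs_of_nonneg (by positivity), Complex.real_smul] at h
  have hc' : ((c : ℝ) : ℂ) ≠ 0 := by exact_mod_cast hc.ne'
  have h2 : ∀ I : ℂ, ((c : ℝ) : ℂ) ^ 2 * (((((c : ℝ) ^ 2)⁻¹ : ℝ) : ℂ) * I) = I := fun I => by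
    push_cast; field_simp
  rw [← h2 (∫ v : ℂ, _), ← h]
  congr 2
  funext v
  have e : ((c : ℝ) : ℂ) * x = (c : ℝ) • x := by simp
  rw [norm_smul, Real.norm_of_nonneg hc.le, real_inner_smul_left, e,
    real_inner_smul_right, mul_left_comm _ (c : ℝ) ‖v‖, mul_div_cancel_left₀ _ hc.ne']

lemma conv_dil_sconv (c : ℝˣ) (Φ Ψ : 𝓢(ℂ, ℂ)) :
    sconv (dil c Φ) (dil c Ψ) = dil c (sconv Φ Ψ) := by
  ext x
  have hc' : ((c : ℝ) : ℂ) ≠ 0 := by exact_mod_cast c.ne_zero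
  rw [dil_apply, sconv_apply, sconv_apply, conv, conv]
  have h := Measure.integral_comp_smul (volume : Measure ℂ) (fun y : ℂ =>
    Φ ((c : ℝ) * x - y) * Ψ y) (c : ℝ)
  rw [Complex.finrank_real_complex, abs_of_nonneg (by positivity), Complex.real_smul] at h
  have h2 : ∀ I : ℂ, ((c : ℝ) : ℂ) ^ 2 * (((((c : ℝ) ^ 2)⁻¹ : ℝ) : ℂ) * I) = I := fun I => by
    push_cast; field_simp
  rw [← h2 (∫ y : ℂ, Φ ((c : ℝ) * x - y) * Ψ y), ← h, ← mul_assoc, ← integral_const_mul]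
  congr 1
  funext y
  rw [dil_apply, dil_apply, Complex.real_smul, ← mul_sub]
  ring

lemma HasMode.dil {n : ℤ} {Φ : 𝓢(ℂ, ℂ)} (hΦ : HasMode n Φ) (c : ℝˣ) :
    HasMode n (SchrodingerMap.dil c Φ) := by
  intro e he x
  rw [dil_apply, dil_apply, mul_left_comm, hΦ e he]
  ring

/-- The unit `2^k`. -/
def twoPow (k : ℤ) : ℝˣ := Units.mk0 ((2 : ℝ) ^ k) (by positivity)

lemma twoPow_coe (k : ℤ) : ((twoPow k : ℝˣ) : ℝ) = 2 ^ k := rfl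

lemma IsDyadicCutoff.isSymbol {m : ℝ → ℝ} (hm : IsDyadicCutoff m) : IsSymbol m :=
  .of_tsupport (by norm_num) hm.smooth hm.support

/-- The kernel of `P_k`. -/
def IsDyadicCutoff.kernel {m : ℝ → ℝ} (hm : IsDyadicCutoff m) (k : ℤ) : 𝓢(ℂ, ℂ) :=
  dil (twoPow k) hm.isSymbol.ker

lemma IsDyadicCutoff.kernel_eq {m : ℝ → ℝ} (hm : IsDyadicCutoff m) (k : ℤ) :
    hm.kernel k = (hm.isSymbol.scale (show (0 : ℝ) < 2 ^ k by positivity)).ker :=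
  (hm.isSymbol.ker_scale (twoPow k) (by rw [twoPow_coe]; positivity)).symm

lemma IsDyadicCutoff.lpKernel_eq {m : ℝ → ℝ} (hm : IsDyadicCutoff m) (k : ℤ) (x : ℂ) :
    (lpKernel m k x : ℂ) = hm.kernel k x := by
  rw [hm.kernel_eq, ← IsSymbol.ker_im, IsSymbol.ker_apply]
  rfl

lemma IsDyadicCutoff.lpProj_eq {m : ℝ → ℝ} (hm : IsDyadicCutoff m) (k : ℤ) (F : ℂ → ℂ) :
    lpProj m k F = conv (hm.kernel k) F := by
  funext x
  rw [lpProj, MeasureTheory.convolution_def, conv, ← integral_sub_left_eq_self _ volume x]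
  congr 1
  funext y
  rw [ContinuousLinearMap.lsmul_apply, Complex.real_smul, hm.lpKernel_eq, sub_sub_cancel]

/-! ### Convergence of the Littlewood-Paley decomposition -/

lemma integral_mul_conv {Φ χ : 𝓢(ℂ, ℂ)} {G : ℂ → ℂ} (hΦ : ∀ x, Φ (-x) = Φ x) (hG : IsTame Φ G) :
    ∫ x, χ x * conv Φ G x = ∫ y, sconv Φ χ y * G y := by
  obtain ⟨hm, M, hM, hb⟩ := hG
  have hc : Continuous fun p : ℂ × ℂ => χ p.1 * Φ (p.1 - p.2) := by fun_prop
  have hmeas : AEStronglyMeasurable (fun p : ℂ × ℂ => χ p.1 * (Φ (p.1 - p.2) * G p.2))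
      (volume.prod volume) := by
    simp_rw [← mul_assoc]
    exact hc.aestronglyMeasurable.mul hm.comp_snd
  have hint : Integrable (fun p : ℂ × ℂ => χ p.1 * (Φ (p.1 - p.2) * G p.2))
      (volume.prod volume) := by
    refine ⟨hmeas, ?_⟩
    rw [HasFiniteIntegral, lintegral_prod _ hmeas.enorm]
    calc ∫⁻ y, ∫⁻ z, ‖χ y * (Φ (y - z) * G z)‖ₑ
        = ∫⁻ y, ‖χ y‖ₑ * ∫⁻ z, ‖Φ (y - z)‖ₑ * ‖G z‖ₑ := by
          refine lintegral_congr fun y => ?_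
          simp_rw [enorm_mul]
          rw [lintegral_const_mul' _ _ (by finiteness)]
      _ ≤ ∫⁻ y, ‖χ y‖ₑ * M := by gcongr with y; exact hb y
      _ = (∫⁻ y, ‖χ y‖ₑ) * M := lintegral_mul_const' _ _ hM
      _ < ⊤ := ENNReal.mul_lt_top (lintegral_kernel_ne_top χ).lt_top hM.lt_top
  have := integral_integral_swap (f := fun x y => χ x * (Φ (x - y) * G y)) hint
  unfold conv
  simp_rw [← integral_const_mul]
  rw [this]
  congr 1
  funext y
  simp_rw [← mul_assoc]
  rw [integral_mul_const, sconv_apply, conv]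
  congr 2
  funext x
  rw [← hΦ (y - x), neg_sub, mul_comm]

lemma IsDyadicCutoff.sum_bound {m : ℝ → ℝ} (hm : IsDyadicCutoff m) :
    ∃ C : ℝ, 0 ≤ C ∧ ∀ (T : Finset ℤ) (s : ℝ), 0 < s → |∑ k ∈ T, m (s / 2 ^ k)| ≤ C := by
  have hcs : HasCompactSupport m := HasCompactSupport.of_support_subset_isCompact isCompact_Icc
    ((subset_tsupport m).trans (hm.support.trans Ioo_subset_Icc_self))
  obtain ⟨C, hC⟩ := hcs.exists_bound_of_continuous hm.smooth.continuous
  have hC0 : 0 ≤ C := (norm_nonneg _).trans (hC 0)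
  refine ⟨3 * C, by positivity, fun T s hs => ?_⟩
  set k0 := Int.log 2 s
  have l1 : (2 : ℝ) ^ k0 ≤ s := by
    have := Int.zpow_log_le_self (b := 2) (R := ℝ) (r := s) (by norm_num) hs
    exact_mod_cast this
  have l2 : s < (2 : ℝ) ^ (k0 + 1) := by
    have := Int.lt_zpow_succ_log_self (b := 2) (R := ℝ) (by norm_num) s
    exact_mod_cast this
  have hsupp : ∀ k ∈ T, m (s / 2 ^ k) ≠ 0 → k ∈ Finset.Icc k0 (k0 + 2) := fun k _ hk => by
    obtain ⟨h1, h2⟩ := hm.support (subset_tsupport m hk)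
    have hp : (0 : ℝ) < 2 ^ k := by positivity
    rw [lt_div_iff₀ hp] at h1
    rw [div_lt_iff₀ hp] at h2
    have e1 : (2 : ℝ) ^ (k0) < 2 ^ (k + 1) := by rw [zpow_add_one₀ two_ne_zero]; linarith
    have e2 : (2 : ℝ) ^ k < 2 ^ (k0 + 3) := by
      have : (2 : ℝ) ^ (k0 + 3) = 2 ^ (k0 + 1) * 4 := by
        rw [show k0 + 3 = (k0 + 1) + 2 by ring, zpow_add₀ two_ne_zero]; norm_num
      linarith
    have e1' := (zpow_lt_zpow_iff_right₀ (one_lt_two)).1 e1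
    have e2' := (zpow_lt_zpow_iff_right₀ (one_lt_two)).1 e2
    rw [Finset.mem_Icc]; omega
  calc |∑ k ∈ T, m (s / 2 ^ k)|
      = |∑ k ∈ T with m (s / 2 ^ k) ≠ 0, m (s / 2 ^ k)| := by rw [Finset.sum_filter_ne_zero]
    _ ≤ ∑ k ∈ T with m (s / 2 ^ k) ≠ 0, |m (s / 2 ^ k)| := Finset.abs_sum_le_sum_abs _ _
    _ ≤ ∑ k ∈ Finset.Icc k0 (k0 + 2), |m (s / 2 ^ k)| := by
        refine Finset.sum_le_sum_of_subset_of_nonneg (fun k hk => ?_) fun _ _ _ => abs_nonneg _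
        rw [Finset.mem_filter] at hk
        exact hsupp k hk.1 hk.2
    _ ≤ ∑ k ∈ Finset.Icc k0 (k0 + 2), C := Finset.sum_le_sum fun k _ => hC _
    _ = 3 * C := by
        rw [Finset.sum_const, Int.card_Icc, nsmul_eq_mul]
        congr 1
        rw [show k0 + 2 + 1 - k0 = 3 by ring]; rfl

lemma eLpNorm_schwartz_sq (Φ : 𝓢(ℂ, ℂ)) :
    eLpNorm Φ 2 volume ^ 2 = ENNReal.ofReal (∫ ξ, ‖𝓕 Φ ξ‖ ^ 2) := by
  rw [SchwartzMap.integral_norm_sq_fourier, eLpNorm_two_sq,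
    ofReal_integral_eq_lintegral_ofReal]
  · refine lintegral_congr fun x => ?_
    rw [ENNReal.ofReal_pow (norm_nonneg _), ofReal_norm]
  · exact (memLp_two_iff_integrable_sq_norm Φ.continuous.aestronglyMeasurable).1 (Φ.memLp 2)
  · exact Eventually.of_forall fun x => by positivity

lemma fourier_sum_sconv {m : ℝ → ℝ} (hm : IsDyadicCutoff m) (χ : 𝓢(ℂ, ℂ)) (T : Finset ℤ) (ξ : ℂ) :
    𝓕 (∑ k ∈ T, sconv (hm.kernel k) χ - χ) ξ =
      ((∑ k ∈ T, m (2 * Real.pi * ‖ξ‖ / 2 ^ k) - 1 : ℝ) : ℂ) * 𝓕 χ ξ := by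
  have h1 : 𝓕 (∑ k ∈ T, sconv (hm.kernel k) χ - χ) = ∑ k ∈ T, 𝓕 (sconv (hm.kernel k) χ) - 𝓕 χ := by
    have := map_sub (FourierTransform.fourierCLM ℂ 𝓢(ℂ, ℂ)) (∑ k ∈ T, sconv (hm.kernel k) χ) χ
    rw [map_sum] at this
    exact this
  rw [h1, sub_apply, sum_apply]
  simp_rw [fourier_sconv, hm.kernel_eq, IsSymbol.fourier_ker, IsSymbol.symb_apply]
  push_cast
  rw [← Finset.sum_mul]
  ring

lemma tendsto_sum_sconv {m : ℝ → ℝ} (hm : IsDyadicCutoff m) (χ : 𝓢(ℂ, ℂ)) :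
    Tendsto (fun T : Finset ℤ => eLpNorm (∑ k ∈ T, sconv (hm.kernel k) χ - χ : 𝓢(ℂ, ℂ)) 2 volume)
      atTop (𝓝 0) := by
  obtain ⟨C, hC0, hC⟩ := hm.sum_bound
  have hsq : Integrable (fun ξ => ‖𝓕 χ ξ‖ ^ 2) :=
    (memLp_two_iff_integrable_sq_norm (𝓕 χ).continuous.aestronglyMeasurable).1 ((𝓕 χ).memLp 2)
  have key : Tendsto (fun T : Finset ℤ => ∫ ξ, ‖𝓕 (∑ k ∈ T, sconv (hm.kernel k) χ - χ) ξ‖ ^ 2)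
      atTop (𝓝 (∫ _ : ℂ, (0 : ℝ))) := by
    refine tendsto_integral_filter_of_dominated_convergence (fun ξ => (C + 1) ^ 2 * ‖𝓕 χ ξ‖ ^ 2)
      (Eventually.of_forall fun T => ?_) (Eventually.of_forall fun T => ?_) (hsq.const_mul _) ?_
    · exact ((𝓕 (∑ k ∈ T, sconv (hm.kernel k) χ - χ)).continuous.norm.pow 2).aestronglyMeasurable
    · refine ae_ne_zero.mono fun ξ hξ => ?_
      rw [fourier_sum_sconv, Real.norm_of_nonneg (by positivity), norm_mul, mul_pow,
        Complex.norm_real]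
      have hs : 0 < 2 * Real.pi * ‖ξ‖ := by have := Real.pi_pos; positivity
      gcongr
      refine (norm_sub_le _ _).trans ?_
      simpa using hC T _ hs
    · refine ae_ne_zero.mono fun ξ hξ => ?_
      have hs : 0 < 2 * Real.pi * ‖ξ‖ := by have := Real.pi_pos; positivity
      have h1 := hm.hasSum _ hs
      have h2 : Tendsto (fun T : Finset ℤ => ‖((∑ k ∈ T, m (2 * Real.pi * ‖ξ‖ / 2 ^ k) - 1 : ℝ) : ℂ)
          * 𝓕 χ ξ‖ ^ 2) atTop (𝓝 (‖((1 - 1 : ℝ) : ℂ) * 𝓕 χ ξ‖ ^ 2)) := by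
        have h3 : Tendsto (fun T : Finset ℤ => ∑ k ∈ T, m (2 * Real.pi * ‖ξ‖ / 2 ^ k)) atTop
          (𝓝 1) := h1
        exact ((((Complex.continuous_ofReal.tendsto _).comp (h3.sub_const 1)).mul_const _).norm).pow 2
      simp_rw [fourier_sum_sconv]
      simpa using h2
  have h0 := ENNReal.tendsto_ofReal key
  rw [integral_zero, ENNReal.ofReal_zero] at h0
  simp_rw [← eLpNorm_schwartz_sq] at h0
  have h1 := ((ENNReal.continuous_rpow_const (y := 1 / 2)).tendsto 0).comp h0
  have e : ∀ x : ℝ≥0∞, (x ^ 2) ^ (1 / 2 : ℝ) = x := fun x => by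
    rw [← ENNReal.rpow_natCast, ← ENNReal.rpow_mul]; norm_num
  rw [ENNReal.zero_rpow_of_pos (by norm_num)] at h1
  exact h1.congr fun T => e _

lemma enorm_integral_mul_le {F G : ℂ → ℂ} (hF : AEStronglyMeasurable F)
    (hG : AEStronglyMeasurable G) :
    ∫⁻ x, ‖F x * G x‖ₑ ≤ eLpNorm F 2 volume * eLpNorm G 2 volume := by
  rw [← ENNReal.pow_le_pow_left_iff two_ne_zero, mul_pow, eLpNorm_two_sq, eLpNorm_two_sq]
  simp_rw [enorm_mul]
  exact sq_lintegral_mul_le volume hF.enorm hG.enorm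

lemma exists_schwartz_of_real {g : ℂ → ℝ} (hg : ContDiff ℝ ∞ g) (hgs : HasCompactSupport g) :
    ∃ χ : 𝓢(ℂ, ℂ), ∀ x, χ x = (g x : ℂ) :=
  ⟨HasCompactSupport.toSchwartzMap (f := fun x => (g x : ℂ))
    (hgs.comp_left Complex.ofReal_zero) (Complex.ofRealCLM.contDiff.comp hg), fun _ => rfl⟩

lemma eLpNorm_schwartz_ne_top (Φ : 𝓢(ℂ, ℂ)) : eLpNorm Φ 2 (volume : Measure ℂ) ≠ ⊤ := by
  have h : MemLp Φ 2 (volume : Measure ℂ) := Φ.memLp 2 volume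
  exact h.2.ne

lemma aesm_schwartz (Φ : 𝓢(ℂ, ℂ)) : AEStronglyMeasurable Φ (volume : Measure ℂ) :=
  Φ.continuous.aestronglyMeasurable

lemma hasSum_integral_mul {ι : Type} [Countable ι] {Q : ι → ℂ → ℂ} {S χ : ℂ → ℂ} (hmeas : ∀ k, AEStronglyMeasurable (Q k))
    (hχm : AEStronglyMeasurable χ) (hχ2 : eLpNorm χ 2 volume ≠ ⊤)
    (hs : ∑' k, eLpNorm (Q k) 2 volume ≠ ⊤)
    (hSs : ∀ᵐ x : ℂ, HasSum (fun k => Q k x) (S x)) :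
    HasSum (fun k => ∫ x, χ x * Q k x) (∫ x, χ x * S x) := by
  have hle : ∑' k, ∫⁻ x, ‖χ x * Q k x‖ₑ ≠ ⊤ := by
    refine ne_top_of_le_ne_top ?_
      (ENNReal.tsum_le_tsum fun k => enorm_integral_mul_le hχm (hmeas k))
    rw [ENNReal.tsum_mul_left]
    exact ENNReal.mul_ne_top hχ2 hs
  have hi : ∀ k, AEStronglyMeasurable (fun x => χ x * Q k x) := fun k => hχm.mul (hmeas k)
  have hsum : Summable fun k => ∫ x, ‖χ x * Q k x‖ :=
    (ENNReal.summable_toReal hle).congr fun k => by rw [integral_norm_eq_lintegral_enorm (hi k)]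
  have h := hasSum_integral_of_summable_integral_norm
    (fun k => ⟨hi k, ((ENNReal.le_tsum k).trans_lt hle.lt_top)⟩) hsum
  have e : ∫ x, χ x * S x = ∫ x, ∑' k, χ x * Q k x :=
    integral_congr_ae (hSs.mono fun x hx => (hx.mul_left (χ x)).tsum_eq.symm)
  rwa [e]

lemma integrable_schwartz_mul {G : ℂ → ℂ} (hG : AEStronglyMeasurable G)
    (hG2 : eLpNorm G 2 volume ≠ ⊤) (Φ : 𝓢(ℂ, ℂ)) : Integrable (fun y => Φ y * G y) := by
  refine ⟨(aesm_schwartz Φ).mul hG, ?_⟩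
  exact (enorm_integral_mul_le (aesm_schwartz Φ) hG).trans_lt
    (ENNReal.mul_lt_top (eLpNorm_schwartz_ne_top Φ).lt_top hG2.lt_top)

lemma enorm_sum_integral_sub_le {G : ℂ → ℂ} (hG : AEStronglyMeasurable G)
    (hG2 : eLpNorm G 2 volume ≠ ⊤) (Ψ : ℤ → 𝓢(ℂ, ℂ)) (χ : 𝓢(ℂ, ℂ)) (T : Finset ℤ) :
    ‖(∑ k ∈ T, ∫ y, Ψ k y * G y) - ∫ y, χ y * G y‖ₑ ≤
      eLpNorm (∑ k ∈ T, Ψ k - χ : 𝓢(ℂ, ℂ)) 2 volume * eLpNorm G 2 volume := by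
  have hi := integrable_schwartz_mul hG hG2
  rw [← integral_finsetSum T fun k _ => hi (Ψ k),
    ← integral_sub (integrable_finsetSum T fun k _ => hi (Ψ k)) (hi χ)]
  refine (enorm_integral_le_lintegral_enorm _).trans ?_
  refine le_trans (le_of_eq ?_) (enorm_integral_mul_le
    (aesm_schwartz (∑ k ∈ T, Ψ k - χ)) hG)
  refine lintegral_congr fun x => ?_
  rw [sub_apply, sum_apply, sub_mul, Finset.sum_mul]

lemma IsDyadicCutoff.integral_mul_eq {m : ℝ → ℝ} (hm : IsDyadicCutoff m) {G S : ℂ → ℂ}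
    (hG : AEStronglyMeasurable G) (hG2 : eLpNorm G 2 volume ≠ ⊤)
    (hs : ∑' k : ℤ, eLpNorm (conv (hm.kernel k) G) 2 volume ≠ ⊤)
    (hSs : ∀ᵐ x : ℂ, HasSum (fun k : ℤ => conv (hm.kernel k) G x) (S x)) (χ : 𝓢(ℂ, ℂ)) :
    ∫ x, χ x * S x = ∫ x, χ x * G x := by
  have h1 := hasSum_integral_mul (fun k => aesm_conv (hm.kernel k) hG)
    (aesm_schwartz χ) (eLpNorm_schwartz_ne_top χ) hs hSs
  have h2 : ∀ k, ∫ x, χ x * conv (hm.kernel k) G x = ∫ y, sconv (hm.kernel k) χ y * G y :=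
    fun k => integral_mul_conv (fun x => by rw [hm.kernel_eq, IsSymbol.ker_neg])
      (isTame_of_L2 hG hG2 _)
  simp_rw [h2] at h1
  refine tendsto_nhds_unique h1 ?_
  rw [tendsto_iff_edist_tendsto_0]
  have h3 := ENNReal.Tendsto.mul_const (tendsto_sum_sconv hm χ) (b := eLpNorm G 2 volume)
    (Or.inr hG2)
  rw [zero_mul] at h3
  refine tendsto_of_tendsto_of_tendsto_of_le_of_le tendsto_const_nhds h3 (fun _ => zero_le)
    fun T => ?_
  simp only
  rw [edist_eq_enorm_sub]
  exact enorm_sum_integral_sub_le hG hG2 _ χ T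

lemma IsDyadicCutoff.hasSum_conv {m : ℝ → ℝ} (hm : IsDyadicCutoff m) {G : ℂ → ℂ}
    (hG : AEStronglyMeasurable G) (hG2 : eLpNorm G 2 volume ≠ ⊤)
    (hs : ∑' k : ℤ, eLpNorm (conv (hm.kernel k) G) 2 volume ≠ ⊤) :
    ∀ᵐ x : ℂ, HasSum (fun k : ℤ => conv (hm.kernel k) G x) (G x) := by
  have hmeas : ∀ k, AEStronglyMeasurable (conv (hm.kernel k) G) := fun k => aesm_conv _ hG
  have hsum := ae_summable_of_tsum_eLpNorm hmeas hs
  set S : ℂ → ℂ := fun x => ∑' k : ℤ, conv (hm.kernel k) G x with hS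
  have hSs : ∀ᵐ x : ℂ, HasSum (fun k : ℤ => conv (hm.kernel k) G x) (S x) :=
    hsum.mono fun x hx => hx.of_norm.hasSum
  have hSm : AEStronglyMeasurable S := by
    refine aestronglyMeasurable_of_tendsto_ae (atTop : Filter (Finset ℤ))
      (f := fun T x => ∑ k ∈ T, conv (hm.kernel k) G x) (fun T => ?_) hSs
    exact Finset.aestronglyMeasurable_fun_sum T fun k _ => hmeas k
  have hS2 : eLpNorm S 2 volume ≠ ⊤ := ne_top_of_le_ne_top hs (eLpNorm_le_tsum_of_hasSum hmeas hSs)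
  have hloc : ∀ {H : ℂ → ℂ}, AEStronglyMeasurable H → eLpNorm H 2 volume ≠ ⊤ →
      LocallyIntegrable H volume := fun h1 h2 =>
    MemLp.locallyIntegrable ⟨h1, h2.lt_top⟩ (by norm_num)
  have hSG : ∀ᵐ x : ℂ, S x = G x := by
    refine ae_eq_of_integral_contDiff_smul_eq (hloc hSm hS2) (hloc hG hG2) fun g hg hgs => ?_
    obtain ⟨χ, hχa⟩ := exists_schwartz_of_real hg hgs
    simp_rw [Complex.real_smul, ← hχa]
    exact hm.integral_mul_eq hG hG2 hs hSs χ
  filter_upwards [hSs, hSG] with x h1 h2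
  rwa [← h2]

/-! ### Littlewood-Paley estimates for atoms -/

lemma eLpNorm_conv_dil_le (c : ℝˣ) (Φ : 𝓢(ℂ, ℂ)) {F : ℂ → ℂ} (hF : AEStronglyMeasurable F) :
    eLpNorm (conv (dil c Φ) F) 2 volume ≤ (∫⁻ y, ‖Φ y‖ₑ) * eLpNorm F 2 volume := by
  rw [← lintegral_dil c]
  exact eLpNorm_conv_le _ hF

lemma enorm_coe_unit {c : ℝˣ} (hc : 0 < (c : ℝ)) : ‖((c : ℝ) : ℂ)‖ₑ = ENNReal.ofReal c := by
  rw [← ofReal_norm, Complex.norm_real, Real.norm_of_nonneg hc.le]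

lemma conv_sdpm_dil (s : ℤ) (c : ℝˣ) (Φ : 𝓢(ℂ, ℂ)) (F : ℂ → ℂ) :
    conv (sdpm s (dil c Φ)) F = ((c : ℝ) : ℂ) • conv (dil c (sdpm s Φ)) F := by
  funext x
  rw [sdpm_dil, conv_smul_left, Pi.smul_apply, smul_eq_mul]

lemma eLpNorm_conv_sdpm_dil (s : ℤ) {c : ℝˣ} (hc : 0 < (c : ℝ)) (Φ : 𝓢(ℂ, ℂ)) (F : ℂ → ℂ) :
    eLpNorm (conv (sdpm s (dil c Φ)) F) 2 volume =
      ENNReal.ofReal c * eLpNorm (conv (dil c (sdpm s Φ)) F) 2 volume := by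
  rw [conv_sdpm_dil, eLpNorm_const_smul, enorm_coe_unit hc]

lemma eLpNorm_conv_sdpm_dil_le (s : ℤ) {c : ℝˣ} (hc : 0 < (c : ℝ)) (Φ : 𝓢(ℂ, ℂ)) {F : ℂ → ℂ}
    (hF : AEStronglyMeasurable F) :
    eLpNorm (conv (sdpm s (dil c Φ)) F) 2 volume ≤
      ENNReal.ofReal c * ((∫⁻ y, ‖sdpm s Φ y‖ₑ) * eLpNorm F 2 volume) := by
  rw [eLpNorm_conv_sdpm_dil s hc]
  gcongr
  exact eLpNorm_conv_dil_le c _ hF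

lemma IsAtom.norm_bound {t : ℝ} {A : ℝ≥0∞} {f : ℝ → ℂ} (hf : IsAtom t A f) :
    ∃ M : ℝ, ∀ r, 0 < r → ‖f r‖ ≤ M := by
  refine ⟨(ENNReal.ofReal t⁻¹ * (2 * A)).toReal, fun r hr => ?_⟩
  have h := (mul_le_iff_le_inv hf.pos).1 (hf.enorm_le hr)
  rw [← ofReal_norm] at h
  exact (ENNReal.ofReal_le_iff_le_toReal
    (ENNReal.mul_ne_top (by finiteness) (ENNReal.mul_ne_top (by simp) hf.ne_top))).1 h

lemma IsAtom.conv_high {t : ℝ} {A : ℝ≥0∞} {f : ℝ → ℂ} (hf : IsAtom t A f) {s : ℤ}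
    (hs : s = 1 ∨ s = -1) (n : ℤ) (Ω : 𝓢(ℂ, ℂ)) {c : ℝˣ} (hc : 0 < (c : ℝ)) :
    ENNReal.ofReal (c * t) * eLpNorm (conv (dil c (sdpm s Ω)) (modeLift n f)) 2 volume ≤
      (∫⁻ y, ‖Ω y‖ₑ) * (polarConst * ((1 + ‖(n : ℂ)‖ₑ) * A)) := by
  have ht := hf.pos
  obtain ⟨M, hM⟩ := hf.norm_bound
  have hd : radNorm (deriv f) ≠ ⊤ := ne_top_of_le_ne_top
    (ENNReal.mul_ne_top (by finiteness) hf.ne_top) ((mul_le_iff_le_inv ht).1 hf.deriv_le)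
  have e : conv (sdpm s (dil c Ω)) (modeLift n f) =
      conv (dil c Ω) (modeLift (n + s) (fun r => deriv f r - s * n * (f r / r))) :=
    funext fun x => ((conv_dpm (dil c Ω) hs hf.acDeriv hM hd x).2).symm
  have hdm := hf.acDeriv.aesm_deriv
  have hfm := (aesm_div hf.aesm).const_mul ((s : ℂ) * n)
  rw [ENNReal.ofReal_mul hc.le, mul_right_comm, ← eLpNorm_conv_sdpm_dil s hc, e, mul_comm]
  have h1 := eLpNorm_conv_dil_le c Ω (aesm_modeLift (n + s) (hdm.sub hfm))
  rw [eLpNorm_modeLift _ (hdm.sub hfm)] at h1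
  have h2 : ENNReal.ofReal t * radNorm (fun r => deriv f r - s * n * (f r / r)) ≤
      (1 + ‖(n : ℂ)‖ₑ) * A := by
    have hs1 : ‖(s : ℂ)‖ₑ = 1 := by rcases hs with rfl | rfl <;> simp
    have h3 : radNorm (fun r => (s : ℂ) * n * (f r / r)) = ‖(n : ℂ)‖ₑ * radNorm (fun r => f r / r) := by
      rw [radNorm_const_mul, enorm_mul, hs1, one_mul]
    calc ENNReal.ofReal t * radNorm (fun r => deriv f r - s * n * (f r / r))
        ≤ ENNReal.ofReal t * (radNorm (deriv f) + ‖(n : ℂ)‖ₑ * radNorm (fun r => f r / r)) := by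
          rw [← h3]; gcongr; exact radNorm_sub_le hdm hfm
      _ = ENNReal.ofReal t * radNorm (deriv f) +
          ‖(n : ℂ)‖ₑ * (ENNReal.ofReal t * radNorm (fun r => f r / r)) := by ring
      _ ≤ A + ‖(n : ℂ)‖ₑ * A := by gcongr; exacts [hf.deriv_le, hf.div_le]
      _ = (1 + ‖(n : ℂ)‖ₑ) * A := by ring
  calc ENNReal.ofReal t * eLpNorm (conv (dil c Ω) (modeLift (n + s)
        (fun r => deriv f r - s * n * (f r / r)))) 2 volume
      ≤ ENNReal.ofReal t * ((∫⁻ y, ‖Ω y‖ₑ) *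
        (polarConst * radNorm (fun r => deriv f r - s * n * (f r / r)))) := by gcongr; exact h1
    _ = (∫⁻ y, ‖Ω y‖ₑ) * (polarConst *
        (ENNReal.ofReal t * radNorm (fun r => deriv f r - s * n * (f r / r)))) := by ring
    _ ≤ _ := by gcongr

lemma conv_modeLift_deriv {n : ℤ} (hn : n ≠ 0) (Φ : 𝓢(ℂ, ℂ)) {g f : ℝ → ℂ} {M : ℝ}
    (hg : ACDeriv g f) (hM : ∀ r, 0 < r → ‖g r‖ ≤ M) (hN : radNorm f ≠ ⊤) :
    conv Φ (modeLift n f) =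
      (((n : ℂ) + 1) / (2 * n)) • conv (sdpm 1 Φ) (modeLift (n - 1) g) +
      (((n : ℂ) - 1) / (2 * n)) • conv (sdpm (-1) Φ) (modeLift (n + 1) g) := by
  funext x
  obtain ⟨i1, e1⟩ := conv_dpm (n := n - 1) Φ (Or.inl rfl) hg hM hN x
  obtain ⟨i2, e2⟩ := conv_dpm (n := n + 1) Φ (Or.inr rfl) hg hM hN x
  simp only [Pi.add_apply, Pi.smul_apply, smul_eq_mul]
  rw [← e1, ← e2, conv, conv, conv, ← integral_const_mul, ← integral_const_mul,
    ← integral_add (i1.const_mul _) (i2.const_mul _)]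
  refine integral_congr_ae (Eventually.of_forall fun y => ?_)
  have hn' : (n : ℂ) ≠ 0 := by exact_mod_cast hn
  simp only [modeLift, sub_add_cancel, add_neg_cancel_right]
  push_cast
  field_simp
  ring

lemma IsAtom.conv_low {t : ℝ} {A : ℝ≥0∞} {f : ℝ → ℂ} (hf : IsAtom t A f) {n : ℤ} (hn : n ≠ 0)
    (Λ : 𝓢(ℂ, ℂ)) {c : ℝˣ} (hc : 0 < (c : ℝ)) :
    eLpNorm (conv (dil c Λ) (modeLift n f)) 2 volume ≤ ENNReal.ofReal (c * t) *
      ((‖((n : ℂ) + 1) / (2 * n)‖ₑ * (∫⁻ y, ‖sdpm 1 Λ y‖ₑ) +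
        ‖((n : ℂ) - 1) / (2 * n)‖ₑ * (∫⁻ y, ‖sdpm (-1) Λ y‖ₑ)) * (polarConst * A)) := by
  obtain ⟨g, hg, hgn, hgb, -⟩ := hf.exists_prim
  have hM : ∀ r, 0 < r → ‖g r‖ ≤ (3 * A).toReal := fun r hr => by
    have := hgb r hr
    rw [← ofReal_norm] at this
    exact (ENNReal.ofReal_le_iff_le_toReal (ENNReal.mul_ne_top (by simp) hf.ne_top)).1 this
  have hN : radNorm f ≠ ⊤ := ne_top_of_le_ne_top hf.ne_top hf.norm_le
  rw [conv_modeLift_deriv hn _ hg hM hN]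
  have h1 := eLpNorm_conv_sdpm_dil_le 1 hc Λ (aesm_modeLift (n - 1) hg.aesm)
  have h2 := eLpNorm_conv_sdpm_dil_le (-1) hc Λ (aesm_modeLift (n + 1) hg.aesm)
  rw [eLpNorm_modeLift _ hg.aesm] at h1 h2
  refine (eLpNorm_add_le ((aesm_conv _ (aesm_modeLift _ hg.aesm)).const_smul _)
    ((aesm_conv _ (aesm_modeLift _ hg.aesm)).const_smul _) (by norm_num)).trans ?_
  rw [eLpNorm_const_smul, eLpNorm_const_smul]
  set a := ‖((n : ℂ) + 1) / (2 * n)‖ₑ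
  set b := ‖((n : ℂ) - 1) / (2 * n)‖ₑ
  set I := ∫⁻ y, ‖sdpm 1 Λ y‖ₑ
  set J := ∫⁻ y, ‖sdpm (-1) Λ y‖ₑ
  calc _ ≤ a * (ENNReal.ofReal c * (I * (polarConst * (ENNReal.ofReal t * A)))) +
        b * (ENNReal.ofReal c * (J * (polarConst * (ENNReal.ofReal t * A)))) := by
          gcongr
          · exact h1.trans (by gcongr)
          · exact h2.trans (by gcongr)
    _ = _ := by rw [ENNReal.ofReal_mul hc.le]; ring

lemma tsum_dyadic_min_le : ∃ S : ℝ≥0∞, S ≠ ⊤ ∧ ∀ t : ℝ, 0 < t →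
    ∑' k : ℤ, min (ENNReal.ofReal (twoPow k * t)) (ENNReal.ofReal (twoPow k * t)⁻¹) ≤ S := by
  have hsum : Summable fun j : ℤ => (2 : ℝ) * (1 / 2) ^ j.natAbs := by
    refine Summable.mul_left 2 (Summable.of_nat_of_neg ?_ ?_) <;>
    simpa using summable_geometric_two
  refine ⟨∑' j : ℤ, ENNReal.ofReal (2 * (1 / 2) ^ j.natAbs), hsum.tsum_ofReal_ne_top, fun t ht => ?_⟩
  set k0 := Int.log 2 t⁻¹
  have l1 : (2 : ℝ) ^ k0 ≤ t⁻¹ := by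
    have := Int.zpow_log_le_self (b := 2) (R := ℝ) (r := t⁻¹) (by norm_num) (by positivity)
    exact_mod_cast this
  have l2 : t⁻¹ < (2 : ℝ) ^ (k0 + 1) := by
    have := Int.lt_zpow_succ_log_self (b := 2) (R := ℝ) (by norm_num) t⁻¹
    exact_mod_cast this
  rw [← (Equiv.addRight k0).tsum_eq]
  refine ENNReal.tsum_le_tsum fun j => ?_
  simp only [Equiv.coe_addRight, twoPow_coe]
  have hk0 : (0 : ℝ) < 2 ^ k0 := by positivity
  rw [zpow_add_one₀ two_ne_zero] at l2
  have m1 : (2 : ℝ) ^ k0 * t ≤ 1 := by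
    calc (2 : ℝ) ^ k0 * t ≤ t⁻¹ * t := by gcongr
      _ = 1 := inv_mul_cancel₀ ht.ne'
  have m2 : 1 ≤ 2 * ((2 : ℝ) ^ k0 * t) := by
    calc (1 : ℝ) = t⁻¹ * t := (inv_mul_cancel₀ ht.ne').symm
      _ ≤ (2 ^ k0 * 2) * t := by gcongr
      _ = _ := by ring
  rw [zpow_add₀ two_ne_zero]
  rcases le_total 0 j with hj | hj
  · obtain ⟨n, rfl⟩ := Int.eq_ofNat_of_zero_le hj
    refine (min_le_right _ _).trans (ENNReal.ofReal_le_ofReal ?_)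
    rw [Int.natAbs_natCast, zpow_natCast, one_div, inv_pow, ← div_eq_mul_inv,
      inv_le_comm₀ (by positivity) (by positivity), inv_div, mul_assoc, div_le_iff₀ two_pos]
    have : (0 : ℝ) < 2 ^ n := by positivity
    nlinarith
  · obtain ⟨n, rfl⟩ := Int.eq_ofNat_of_zero_le (neg_nonneg.2 hj) |>.imp fun n h => neg_eq_iff_eq_neg.1 h
    refine (min_le_left _ _).trans (ENNReal.ofReal_le_ofReal ?_)
    rw [Int.natAbs_neg, Int.natAbs_natCast, zpow_neg, zpow_natCast, one_div, inv_pow, mul_assoc]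
    have : (0 : ℝ) < (2 ^ n)⁻¹ := by positivity
    nlinarith

lemma exists_atom_conv_le {s : ℤ} (hs : s = 1 ∨ s = -1) {n : ℤ} (hn : n ≠ 0) (Ω : 𝓢(ℂ, ℂ)) :
    ∃ C : ℝ≥0∞, C ≠ ⊤ ∧ ∀ (t : ℝ) (A : ℝ≥0∞) (f : ℝ → ℂ), IsAtom t A f →
      ∑' k : ℤ, eLpNorm (conv (dil (twoPow k) (sdpm s Ω)) (modeLift n f)) 2 volume ≤ C * A := by
  obtain ⟨S, hS, hSt⟩ := tsum_dyadic_min_le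
  set C1 := (∫⁻ y, ‖Ω y‖ₑ) * (polarConst * (1 + ‖(n : ℂ)‖ₑ)) with hC1
  set C2 := (‖((n : ℂ) + 1) / (2 * n)‖ₑ * (∫⁻ y, ‖sdpm 1 (sdpm s Ω) y‖ₑ) +
    ‖((n : ℂ) - 1) / (2 * n)‖ₑ * (∫⁻ y, ‖sdpm (-1) (sdpm s Ω) y‖ₑ)) * polarConst with hC2
  have f1 : C1 ≠ ⊤ := by
    have := lintegral_kernel_ne_top Ω
    have := polarConst_ne_top
    finiteness
  have f2 : C2 ≠ ⊤ := by
    have := lintegral_kernel_ne_top (sdpm 1 (sdpm s Ω))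
    have := lintegral_kernel_ne_top (sdpm (-1) (sdpm s Ω))
    have := polarConst_ne_top
    finiteness
  refine ⟨(C1 + C2) * S, by finiteness, fun t A f hf => ?_⟩
  have hk : ∀ k : ℤ, eLpNorm (conv (dil (twoPow k) (sdpm s Ω)) (modeLift n f)) 2 volume ≤
      ((C1 + C2) * A) * min (ENNReal.ofReal (twoPow k * t)) (ENNReal.ofReal (twoPow k * t)⁻¹) := by
    intro k
    have hc : (0 : ℝ) < (twoPow k : ℝˣ) := by rw [twoPow_coe]; positivity
    have hct := mul_pos hc hf.pos
    rw [mul_min]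
    refine le_min ((hf.conv_low hn _ hc).trans ?_) ?_
    · rw [mul_comm (ENNReal.ofReal _), ← mul_assoc, ← hC2]
      gcongr
      exact le_add_self
    · have h := (mul_le_iff_le_inv hct).1 (hf.conv_high hs n Ω hc)
      refine h.trans ?_
      rw [mul_comm, ← mul_assoc polarConst, ← mul_assoc, ← hC1]
      gcongr
      exact le_self_add
  calc _ ≤ ∑' k : ℤ, ((C1 + C2) * A) *
        min (ENNReal.ofReal (twoPow k * t)) (ENNReal.ofReal (twoPow k * t)⁻¹) :=
          ENNReal.tsum_le_tsum hk
    _ = ((C1 + C2) * A) * ∑' k : ℤ,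
        min (ENNReal.ofReal (twoPow k * t)) (ENNReal.ofReal (twoPow k * t)⁻¹) := ENNReal.tsum_mul_left
    _ ≤ ((C1 + C2) * A) * S := by gcongr; exact hSt t hf.pos
    _ = _ := by ring

lemma ae_comp_norm {P : ℝ → Prop} (h : ∀ᵐ r : ℝ, 0 < r → P r) : ∀ᵐ x : ℂ, P ‖x‖ :=
  quasiMeasurePreserving_norm.ae (ae_radialMeasure_iff.2 h)

lemma hasSum_conv_modeLift {ι : Type} [Countable ι] {F : ι → ℝ → ℂ} {f : ℝ → ℂ}
    (hF : ∀ i, AEStronglyMeasurable (F i) radialMeasure) (hs : ∑' i, radNorm (F i) ≠ ⊤)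
    (h : ∀ᵐ r : ℝ, 0 < r → HasSum (fun i => F i r) (f r)) (n : ℤ) (Φ : 𝓢(ℂ, ℂ)) (x : ℂ) :
    HasSum (fun i => conv Φ (modeLift n (F i)) x) (conv Φ (modeLift n f) x) := by
  refine hasSum_integral_mul (χ := fun y => Φ (x - y)) (fun i => aesm_modeLift n (hF i))
    (continuous_kernel Φ x).aestronglyMeasurable ?_ ?_ ?_
  · have h1 : eLpNorm (fun y => Φ (x - y)) 2 volume ^ 2 ≠ ⊤ := by
      rw [eLpNorm_two_sq, lintegral_sub_left_eq_self (fun y => ‖Φ y‖ₑ ^ 2) x]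
      exact lintegral_sq_kernel_ne_top Φ
    exact fun h => h1 (by rw [h]; rfl)
  · simp_rw [eLpNorm_modeLift n (hF _)]
    rw [ENNReal.tsum_mul_left]
    exact ENNReal.mul_ne_top polarConst_ne_top hs
  · exact (ae_comp_norm h).mono fun y hy => hy.mul_left _

lemma exists_besov_conv_le {s : ℤ} (hs : s = 1 ∨ s = -1) {n : ℤ} (hn : n ≠ 0) (Ω : 𝓢(ℂ, ℂ)) :
    ∃ C : ℝ≥0∞, C ≠ ⊤ ∧ ∀ (f : ℝ → ℂ) (B : ℝ≥0∞), B ≠ ⊤ → IsBesov f B →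
      ∑' k : ℤ, eLpNorm (conv (dil (twoPow k) (sdpm s Ω)) (modeLift n f)) 2 volume ≤ C * B := by
  obtain ⟨C, hC, h⟩ := exists_atom_conv_le hs hn Ω
  refine ⟨C, hC, fun f B hB ⟨ι, _, F, t, A, hF, hA, hsum⟩ => ?_⟩
  have hs : ∑' i, radNorm (F i) ≠ ⊤ := ne_top_of_le_ne_top hB
    ((ENNReal.tsum_le_tsum fun i => (hF i).norm_le).trans hA)
  have h1 : ∀ k : ℤ, eLpNorm (conv (dil (twoPow k) (sdpm s Ω)) (modeLift n f)) 2 volume ≤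
      ∑' i, eLpNorm (conv (dil (twoPow k) (sdpm s Ω)) (modeLift n (F i))) 2 volume := fun k =>
    eLpNorm_le_tsum_of_hasSum (fun i => aesm_conv _ (aesm_modeLift n (hF i).aesm))
      (Eventually.of_forall fun x => hasSum_conv_modeLift (fun i => (hF i).aesm) hs hsum n _ x)
  calc _ ≤ ∑' (k : ℤ) (i), eLpNorm (conv (dil (twoPow k) (sdpm s Ω)) (modeLift n (F i))) 2 volume :=
        ENNReal.tsum_le_tsum h1
    _ = ∑' (i) (k : ℤ), eLpNorm (conv (dil (twoPow k) (sdpm s Ω)) (modeLift n (F i))) 2 volume :=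
        ENNReal.tsum_comm
    _ ≤ ∑' i, C * A i := ENNReal.tsum_le_tsum fun i => h _ _ _ (hF i)
    _ = C * ∑' i, A i := ENNReal.tsum_mul_left
    _ ≤ C * B := by gcongr

/-! ### Littlewood-Paley characterization of the radial Besov space -/

lemma IsDyadicCutoff.exists_symbol {m : ℝ → ℝ} (hm : IsDyadicCutoff m) :
    ∃ M : ℝ → ℝ, IsSymbol M ∧ ∀ s, M s * m s = m s := by
  let b : ContDiffBump (9 / 8 : ℝ) := ⟨7 / 8, 1, by norm_num, by norm_num⟩
  refine ⟨b, .of_tsupport (a := 1 / 16) (b := 3) (by norm_num) b.contDiff ?_, fun s => ?_⟩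
  · rw [b.tsupport_eq, Real.closedBall_eq_Icc]
    exact fun x hx => ⟨by have := hx.1; norm_num at this; linarith,
      by have := hx.2; norm_num at this; linarith⟩
  · by_cases h : m s = 0
    · rw [h, mul_zero]
    · have hs := hm.support (subset_tsupport m h)
      rw [b.one_of_mem_closedBall, one_mul]
      rw [Real.closedBall_eq_Icc]
      exact ⟨by have := hs.1; norm_num; linarith, by have := hs.2; norm_num; linarith⟩

lemma HasMode.radNorm_eq {n : ℤ} {G : ℂ → ℂ} (hG : HasMode n G) (hc : Continuous G) :
    radNorm (fun r : ℝ => G r) = polarConst⁻¹ * eLpNorm G 2 volume := by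
  rw [hG.eLpNorm_eq (aestronglyMeasurable_of_continuousOn (by fun_prop)), ← mul_assoc,
    ENNReal.inv_mul_cancel polarConst_ne_zero polarConst_ne_top, one_mul]

lemma exists_atom_of_conv {M : ℝ → ℝ} (hM : IsSymbol M) {n : ℤ} (hn : n ≠ 0) :
    ∃ D : ℝ≥0∞, D ≠ ⊤ ∧ ∀ (c : ℝˣ) (G : ℂ → ℂ), 0 < (c : ℝ) → HasMode n G → IsBdd G →
      eLpNorm G 2 volume ≠ ⊤ → conv (dil c hM.ker) G = G →
      IsAtom (c : ℝ)⁻¹ (D * eLpNorm G 2 volume) (fun r => G r) := by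
  set L1 := ∫⁻ y, ‖sdpm 1 hM.ker y‖ₑ with hL1
  set L2 := ∫⁻ y, ‖sdpm (-1) hM.ker y‖ₑ with hL2
  set Θ := sdpm (-1) hM.neg_div_sq.ker with hΘ
  set L3 := ∫⁻ y, ‖Θ y‖ₑ with hL3
  set p := polarConst⁻¹ with hp
  set D := p * (1 + (L1 + L2) * (‖(1 / 2 : ℂ)‖ₑ + ‖(1 / (2 * n) : ℂ)‖ₑ) +
    L3 * (1 + ‖((n : ℂ) - 1)‖ₑ)) with hD
  have hDtop : D ≠ ⊤ := by
    have h1 : L1 ≠ ⊤ := lintegral_kernel_ne_top _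
    have h2 : L2 ≠ ⊤ := lintegral_kernel_ne_top _
    have h3 : L3 ≠ ⊤ := lintegral_kernel_ne_top _
    have h4 : p ≠ ⊤ := ENNReal.inv_ne_top.2 polarConst_ne_zero
    finiteness
  refine ⟨2 * D, by finiteness, fun c G hc hG hb hG2 hconv => ?_⟩
  have hn' : (n : ℂ) ≠ 0 := by exact_mod_cast hn
  have hcc : ((c : ℝ) : ℂ) ≠ 0 := by exact_mod_cast hc.ne'
  have hd : Differentiable ℝ G := by rw [← hconv]; exact differentiable_conv _ hb
  have hdpm : ∀ s, dpm s G = conv (sdpm s (dil c hM.ker)) G := fun s => by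
    conv_lhs => rw [← hconv]
    exact funext fun x => dpm_conv s _ hb x
  have hcont : ∀ s, Continuous (dpm s G) := fun s => by
    rw [hdpm]; exact (differentiable_conv _ hb).continuous
  set g := eLpNorm G 2 volume with hg
  have hN : ∀ s : ℤ, s = 1 ∨ s = -1 → radNorm (fun r : ℝ => dpm s G r) ≤
      p * (ENNReal.ofReal c * ((∫⁻ y, ‖sdpm s hM.ker y‖ₑ) * g)) := fun s hs => by
    rw [(hG.dpm hd hs).radNorm_eq (hcont s), hdpm]
    gcongr
    exact eLpNorm_conv_sdpm_dil_le s hc _ hb.1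
  have hN1 := hN 1 (Or.inl rfl)
  have hN2 := hN (-1) (Or.inr rfl)
  have hm : ∀ s, AEStronglyMeasurable (fun r : ℝ => dpm s G r) radialMeasure := fun s =>
    aestronglyMeasurable_of_continuousOn
      ((hcont s).comp Complex.continuous_ofReal).continuousOn
  have hf' : ∀ r : ℝ, fderiv ℝ G r 1 = 1 / 2 * (dpm 1 G r + dpm (-1) G r) := fun r => by
    rw [dpm, dpm]; push_cast; ring
  have hdiv : ∀ r : ℝ, 0 < r → G r / r = 1 / (2 * n) * (dpm (-1) G r - dpm 1 G r) := fun r hr => by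
    rw [hG.dpm_profile hd _ hr, hG.dpm_profile hd _ hr]
    push_cast
    field_simp
    ring
  have hder : ∀ r : ℝ, HasDerivAt (fun r : ℝ => G r) (1 / 2 * (dpm 1 G r + dpm (-1) G r)) r :=
    fun r => by rw [← hf']; exact HasMode.hasDerivAt_profile hd r
  have hac : ACDeriv (fun r : ℝ => G r) (fun r => 1 / 2 * (dpm 1 G r + dpm (-1) G r)) :=
    .of_hasDerivAt (fun r _ => hder r) (by
      have h1 := (hcont 1).comp Complex.continuous_ofReal
      have h2 := (hcont (-1)).comp Complex.continuous_ofReal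
      exact (continuous_const.mul (h1.add h2)).continuousOn)
  -- the primitive
  set Γ := conv (dil c Θ) G with hΓ
  have hΓb : IsBdd Γ := (hb.isTame _).isBdd_conv
  have hΓd : Differentiable ℝ Γ := differentiable_conv _ hb
  have hΓm : HasMode (n - 1) Γ := by
    have h1 : HasMode (0 + -1) (dil c Θ) :=
      (hM.neg_div_sq.hasMode_ker.sdpm (Or.inr rfl)).dil c
    have := h1.conv hG
    rwa [show (0 + -1 + n : ℤ) = n - 1 by ring] at this
  have hΓG : ∀ x, G x = (c : ℝ)⁻¹ * dpm 1 Γ x := fun x => by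
    have h1 : dil c hM.ker = dil c (sdpm 1 Θ) := by
      rw [hΘ, hM.sdpm_sdpm_ker (s := 1) (Or.inl rfl)]
    rw [hΓ, dpm_conv 1 _ hb, conv_sdpm_dil, Pi.smul_apply, smul_eq_mul, ← h1, hconv, ← mul_assoc,
      Complex.ofReal_inv, inv_mul_cancel₀ hcc, one_mul]
  have hΓN : radNorm (fun r : ℝ => Γ r) ≤ p * (L3 * g) := by
    rw [hΓm.radNorm_eq hΓd.continuous]
    gcongr
    exact eLpNorm_conv_dil_le c _ hb.1
  have hΓc : Continuous (fun r : ℝ => Γ r) := hΓd.continuous.comp Complex.continuous_ofReal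
  have hΓac : ACDeriv (fun r : ℝ => ((c : ℝ) : ℂ)⁻¹ * Γ r)
      (fun r => ((c : ℝ) : ℂ)⁻¹ * fderiv ℝ Γ r 1) := by
    refine ACDeriv.const_mul _ (.of_hasDerivAt (fun r _ => HasMode.hasDerivAt_profile hΓd r) ?_)
    have : ∀ r : ℝ, fderiv ℝ Γ r 1 = conv (∂_{(1 : ℂ)} (dil c Θ)) G r := fun r =>
      fderiv_conv _ hb _ _
    simp_rw [this]
    exact ((differentiable_conv _ hb).continuous.comp Complex.continuous_ofReal).continuousOn
  have hci : ‖((c : ℝ) : ℂ)⁻¹‖ₑ = ENNReal.ofReal (c : ℝ)⁻¹ := by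
    rw [← ofReal_norm, norm_inv, Complex.norm_real, Real.norm_of_nonneg hc.le]
  have hpad : ∀ {X Y : ℝ≥0∞}, X ≤ Y → Y ≤ D * g → X ≤ 2 * (D * g) := fun h1 h2 =>
    (h1.trans h2).trans (le_mul_of_one_le_left zero_le one_le_two)
  have key : ∀ {x : ℝ≥0∞}, x ≤ (1 + (L1 + L2) * (‖(1 / 2 : ℂ)‖ₑ + ‖(1 / (2 * n) : ℂ)‖ₑ) +
      L3 * (1 + ‖((n : ℂ) - 1)‖ₑ)) → p * (x * g) ≤ D * g := fun h => by
    rw [hD, ← mul_assoc]; gcongr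
  rw [mul_assoc]
  have hti : ∀ X : ℝ≥0∞, ENNReal.ofReal (c : ℝ)⁻¹ * (ENNReal.ofReal c * X) = X := fun X =>
    ofReal_mul_inv_cancel hc X
  have hsum2 : p * (ENNReal.ofReal c * (L1 * g)) + p * (ENNReal.ofReal c * (L2 * g)) =
      ENNReal.ofReal c * (p * ((L1 + L2) * g)) := by ring
  refine IsAtom.of_split (g := fun r => ((c : ℝ) : ℂ)⁻¹ * Γ r)
    (k := fun r => ((c : ℝ) : ℂ)⁻¹ * fderiv ℝ Γ r 1)
    (h := fun r => -(((c : ℝ) : ℂ)⁻¹ * ((n : ℂ) - 1)) * (Γ r / r)) (inv_pos.2 hc)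
    (ENNReal.mul_ne_top hDtop hG2) hac.ac ?_ ?_ ?_ hΓac ?_ ?_ ?_ ?_
  · rw [hG.radNorm_eq hd.continuous]
    refine hpad le_rfl ?_
    simpa only [one_mul] using key (x := 1) (le_self_add.trans le_self_add)
  · rw [show deriv (fun r : ℝ => G r) = fun r : ℝ => 1 / 2 * (dpm 1 G r + dpm (-1) G r) from
      funext fun r => (hder r).deriv, radNorm_const_mul]
    have h1 := (radNorm_add_le (hm 1) (hm (-1))).trans (add_le_add hN1 hN2)
    rw [hsum2] at h1
    refine hpad (mul_le_mul_right (mul_le_mul_right h1 _) _) ?_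
    rw [mul_left_comm, hti, mul_left_comm, ← mul_assoc ‖(1 / 2 : ℂ)‖ₑ]
    refine key ?_
    rw [mul_comm]
    exact (mul_le_mul_right le_self_add _).trans (le_add_self.trans le_self_add)
  · rw [radNorm_congr (g := fun r => 1 / (2 * n) * (dpm (-1) G r - dpm 1 G r))
      (Eventually.of_forall hdiv), radNorm_const_mul]
    have h1 := (radNorm_sub_le (hm (-1)) (hm 1)).trans (add_le_add hN2 hN1)
    rw [add_comm, hsum2] at h1
    refine hpad (mul_le_mul_right (mul_le_mul_right h1 _) _) ?_
    rw [mul_left_comm, hti, mul_left_comm, ← mul_assoc ‖(1 / (2 * n) : ℂ)‖ₑ]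
    refine key ?_
    rw [mul_comm]
    exact (mul_le_mul_right le_add_self _).trans (le_add_self.trans le_self_add)
  · rw [radNorm_const_mul, hci]
    gcongr
    exact hΓN.trans (key ((le_mul_of_one_le_right zero_le le_self_add).trans le_add_self))
  · exact (aesm_div (aestronglyMeasurable_of_continuousOn hΓc.continuousOn)).const_mul _
  · have e : ∀ᵐ r : ℝ, 0 < r → (r : ℂ) * (-(((c : ℝ) : ℂ)⁻¹ * ((n : ℂ) - 1)) * (Γ r / r)) =
        -(((c : ℝ) : ℂ)⁻¹ * ((n : ℂ) - 1)) * Γ r := Eventually.of_forall fun r hr => by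
      have : (r : ℂ) ≠ 0 := by exact_mod_cast hr.ne'
      field_simp
    rw [radNorm_congr e, radNorm_const_mul, enorm_neg, enorm_mul, hci, mul_assoc]
    refine mul_le_mul_right ?_ _
    refine (mul_le_mul_right hΓN _).trans ?_
    rw [mul_left_comm, ← mul_assoc ‖(n : ℂ) - 1‖ₑ]
    refine key ?_
    rw [mul_comm]
    exact (mul_le_mul_right le_add_self _).trans le_add_self
  · refine Eventually.of_forall fun r hr => ?_
    rw [hΓG, hΓm.dpm_profile hΓd 1 hr]
    push_cast
    ring

lemma ae_of_comp_norm {D : ℝ → ℂ} (hD : AEStronglyMeasurable D radialMeasure)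
    (h : ∀ᵐ x : ℂ, D ‖x‖ = 0) : ∀ᵐ r : ℝ, 0 < r → D r = 0 := by
  have h0 : radNorm D = 0 := by
    have h1 := eLpNorm_modeLift 0 hD
    rw [eLpNorm_congr_ae (g := fun _ => 0), eLpNorm_zero'] at h1
    · exact (mul_eq_zero.1 h1.symm).resolve_left polarConst_ne_zero
    · exact h.mono fun x hx => by rw [modeLift, hx, mul_zero]
  rw [← ae_radialMeasure_iff]
  exact (eLpNorm_eq_zero_iff hD (by norm_num)).1 h0

lemma IsDyadicCutoff.hasMode_conv {m : ℝ → ℝ} (hm : IsDyadicCutoff m) {n : ℤ} {F : ℂ → ℂ}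
    (hF : HasMode n F) (k : ℤ) : HasMode n (conv (hm.kernel k) F) := by
  have := (hm.isSymbol.hasMode_ker.dil (twoPow k)).conv hF
  rwa [zero_add] at this

lemma IsDyadicCutoff.exists_besov_of_conv {m : ℝ → ℝ} (hm : IsDyadicCutoff m) {n : ℤ}
    (hn : n ≠ 0) : ∃ C : ℝ≥0∞, C ≠ ⊤ ∧ ∀ ψ : ℝ → ℂ, AEStronglyMeasurable ψ radialMeasure →
      radNorm ψ ≠ ⊤ → ∑' k : ℤ, eLpNorm (conv (hm.kernel k) (modeLift n ψ)) 2 volume ≠ ⊤ →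
      IsBesov ψ (C * ∑' k : ℤ, eLpNorm (conv (hm.kernel k) (modeLift n ψ)) 2 volume) := by
  obtain ⟨M, hM, hMm⟩ := hm.exists_symbol
  obtain ⟨D, hD, h⟩ := exists_atom_of_conv hM hn
  refine ⟨D, hD, fun ψ hψ hψ2 hs => ?_⟩
  have hF := aesm_modeLift n hψ
  have hF2 : eLpNorm (modeLift n ψ) 2 volume ≠ ⊤ := by
    rw [eLpNorm_modeLift n hψ]; exact ENNReal.mul_ne_top polarConst_ne_top hψ2
  have htame := isTame_of_L2 hF hF2
  set G : ℤ → ℂ → ℂ := fun k => conv (hm.kernel k) (modeLift n ψ) with hGdef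
  have hmode : ∀ k, HasMode n (G k) := fun k => hm.hasMode_conv (hasMode_modeLift n ψ) k
  have hrep : ∀ k, conv (dil (twoPow k) hM.ker) (G k) = G k := fun k => funext fun x => by
    rw [hGdef, conv_conv (htame _), IsDyadicCutoff.kernel, conv_dil_sconv,
      hm.isSymbol.sconv_ker hM hMm]
    rfl
  have hat : ∀ k, IsAtom ((twoPow k : ℝˣ) : ℝ)⁻¹ (D * eLpNorm (G k) 2 volume) (fun r => G k r) :=
    fun k => h _ _ (by rw [twoPow_coe]; positivity) (hmode k) ((htame _).isBdd_conv)
      (ne_top_of_le_ne_top hs (ENNReal.le_tsum k)) (hrep k)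
  rw [← ENNReal.tsum_mul_left]
  have hs' : ∑' k, D * eLpNorm (G k) 2 volume ≠ ⊤ := by
    rw [ENNReal.tsum_mul_left]; exact ENNReal.mul_ne_top hD hs
  refine IsBesov.of_hasSum (fun k => (hat k).isBesov) hs' ?_
  have hsum := ae_summable_atoms hat hs'
  have hae : ∀ᵐ r : ℝ, 0 < r → HasSum (fun k => G k r) (∑' k, G k r) :=
    hsum.mono fun r hr h0 => (hr h0).of_norm.hasSum
  have hm' : AEStronglyMeasurable (fun r : ℝ => ∑' k, G k r) radialMeasure :=
    aestronglyMeasurable_of_tendsto_ae (atTop : Filter (Finset ℤ))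
      (f := fun T (r : ℝ) => ∑ k ∈ T, G k r)
      (fun T => Finset.aestronglyMeasurable_fun_sum T fun k _ => (hat k).aesm)
      (ae_radialMeasure_iff.2 hae)
  have hz := ae_of_comp_norm (D := fun r => (∑' k, G k r) - ψ r) (hm'.sub hψ) (by
    filter_upwards [hm.hasSum_conv hF hF2 hs, ae_ne_zero] with x hx hx0
    have hx1 : ((x / ‖x‖) ^ n : ℂ) ≠ 0 :=
      zpow_ne_zero _ (div_ne_zero hx0 (by simpa using hx0))
    have he : ‖x / (‖x‖ : ℂ)‖ = 1 := by
      rw [norm_div, Complex.norm_real, norm_norm, div_self (norm_ne_zero_iff.2 hx0)]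
    have h1 : ∀ k, G k x = (x / ‖x‖) ^ n * G k (‖x‖ : ℝ) := fun k => by
      conv_lhs => rw [← div_mul_cancel₀ x (show ((‖x‖ : ℝ) : ℂ) ≠ 0 by simpa using hx0)]
      exact hmode k _ he _
    have h2 : HasSum (fun k => (x / ‖x‖) ^ n * G k (‖x‖ : ℝ)) ((x / ‖x‖) ^ n * ψ ‖x‖) := by
      simp_rw [← h1]; exact hx
    rw [hasSum_mul_left_iff hx1] at h2
    rw [h2.tsum_eq, sub_self])
  filter_upwards [hae, hz] with r h1 h2 hr
  rw [← sub_eq_zero.1 (h2 hr)]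
  exact h1 hr

/-! ### The norms `X` and `LX` in terms of radial profiles -/

/-- The `Ḃ¹_{2,1}` norm of a scalar function. -/
def scalarX (m : ℝ → ℝ) (F : ℂ → ℂ) : ℝ≥0∞ :=
  ∑' k : ℤ, (2 : ℝ≥0∞) ^ k * eLpNorm (lpProj m k F) 2 volume

lemma ofReal_twoPow (k : ℤ) : ENNReal.ofReal (twoPow k : ℝˣ) = (2 : ℝ≥0∞) ^ k := by
  rw [twoPow_coe, ENNReal.ofReal, Real.toNNReal_zpow two_pos.le, ENNReal.coe_zpow (by simp)]
  simp

lemma isBdd_modeLift (n : ℤ) {f f' : ℝ → ℂ} {M : ℝ} (hf : ACDeriv f f')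
    (hM : ∀ r, 0 < r → ‖f r‖ ≤ M) : IsBdd (modeLift n f) := by
  refine ⟨aesm_modeLift n hf.aesm, max M ‖f 0‖, fun x => ?_⟩
  rcases eq_or_ne x 0 with rfl | hx
  · refine le_max_of_le_right ?_
    rw [modeLift, norm_mul, norm_zero]
    refine mul_le_of_le_one_left (norm_nonneg _) ?_
    rcases eq_or_ne n 0 with rfl | hn
    · simp
    · rw [zero_div, zero_zpow n hn]; simp
  · rw [norm_modeLift n f hx]
    exact (hM _ (norm_pos_iff.2 hx)).trans (le_max_left _ _)

/-- A bounded absolutely continuous profile with derivative in `L²`. -/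
structure IsProfile (f f' : ℝ → ℂ) : Prop where
  ac : ACDeriv f f'
  bound : ∃ M : ℝ, ∀ r, 0 < r → ‖f r‖ ≤ M
  deriv : radNorm f' ≠ ⊤

namespace IsProfile

variable {m : ℝ → ℝ} {n s : ℤ} {f f' : ℝ → ℂ}

lemma isBdd (hf : IsProfile f f') (n : ℤ) : IsBdd (modeLift n f) := by
  obtain ⟨M, hM⟩ := hf.bound
  exact isBdd_modeLift n hf.ac hM

lemma conv_dpm (hf : IsProfile f f') (Φ : 𝓢(ℂ, ℂ)) (hs : s = 1 ∨ s = -1) (n : ℤ) :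
    conv Φ (modeLift (n + s) (fun r => f' r - s * n * (f r / r))) =
      conv (sdpm s Φ) (modeLift n f) := by
  obtain ⟨M, hM⟩ := hf.bound
  exact funext fun x => (SchrodingerMap.conv_dpm Φ hs hf.ac hM hf.deriv x).2

end IsProfile

lemma IsDyadicCutoff.exists_besov_of_scalarX {m : ℝ → ℝ} (hm : IsDyadicCutoff m) {n s : ℤ}
    (hs : s = 1 ∨ s = -1) (hn : n + s ≠ 0) : ∃ C : ℝ≥0∞, C ≠ ⊤ ∧ ∀ f f' : ℝ → ℂ, IsProfile f f' →
      radNorm (fun r => f' r - s * n * (f r / r)) ≠ ⊤ → scalarX m (modeLift n f) ≠ ⊤ →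
      IsBesov (fun r => f' r - s * n * (f r / r)) (C * scalarX m (modeLift n f)) := by
  obtain ⟨M, hM, hMm⟩ := hm.exists_symbol
  obtain ⟨D, hD, h⟩ := hm.exists_besov_of_conv hn
  refine ⟨D * ∫⁻ y, ‖sdpm s hM.ker y‖ₑ, ENNReal.mul_ne_top hD (lintegral_kernel_ne_top _),
    fun f f' hf hN hX => ?_⟩
  set a := fun r => f' r - s * n * (f r / r) with ha
  have hF := hf.isBdd n
  have ham : AEStronglyMeasurable a radialMeasure :=
    hf.ac.aesm_deriv.sub ((aesm_div hf.ac.aesm).const_mul _)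
  have hk : ∀ k : ℤ, eLpNorm (conv (hm.kernel k) (modeLift (n + s) a)) 2 volume ≤
      (∫⁻ y, ‖sdpm s hM.ker y‖ₑ) *
        ((2 : ℝ≥0∞) ^ k * eLpNorm (lpProj m k (modeLift n f)) 2 volume) := fun k => by
    have hc : (0 : ℝ) < (twoPow k : ℝˣ) := by rw [twoPow_coe]; positivity
    have hG : IsBdd (conv (hm.kernel k) (modeLift n f)) := (hF.isTame _).isBdd_conv
    have e1 : conv (dil (twoPow k) hM.ker) (conv (hm.kernel k) (modeLift n f)) =
        conv (hm.kernel k) (modeLift n f) := funext fun x => by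
      rw [conv_conv (hF.isTame _), IsDyadicCutoff.kernel, conv_dil_sconv,
        hm.isSymbol.sconv_ker hM hMm]
    have e2 : conv (sdpm s (hm.kernel k)) (modeLift n f) =
        conv (sdpm s (dil (twoPow k) hM.ker)) (conv (hm.kernel k) (modeLift n f)) := by
      funext x
      rw [← dpm_conv s _ hF, ← dpm_conv s _ hG, e1]
    rw [ha, hf.conv_dpm _ hs, e2, hm.lpProj_eq, ← ofReal_twoPow]
    refine (eLpNorm_conv_sdpm_dil_le s hc _ hG.1).trans (le_of_eq ?_)
    ring
  have hle := (ENNReal.tsum_le_tsum hk).trans_eq ENNReal.tsum_mul_left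
  rw [mul_assoc]
  refine (h a ham hN (ne_top_of_le_ne_top ?_ hle)).mono (mul_le_mul_right hle _)
  exact ENNReal.mul_ne_top (lintegral_kernel_ne_top _) hX

lemma IsDyadicCutoff.exists_scalarX_le {m : ℝ → ℝ} (hm : IsDyadicCutoff m) {n s : ℤ}
    (hs : s = 1 ∨ s = -1) (hn : n + s ≠ 0) : ∃ C : ℝ≥0∞, C ≠ ⊤ ∧ ∀ (f f' : ℝ → ℂ) (B : ℝ≥0∞),
      IsProfile f f' → B ≠ ⊤ → IsBesov (fun r => f' r - s * n * (f r / r)) B →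
      scalarX m (modeLift n f) ≤ C * B := by
  have hs' : -s = 1 ∨ -s = -1 := by omega
  obtain ⟨C, hC, h⟩ := exists_besov_conv_le hs' hn hm.isSymbol.neg_div_sq.ker
  refine ⟨C, hC, fun f f' B hf hB ha => ?_⟩
  refine le_trans (le_of_eq (tsum_congr fun k => ?_)) (h _ _ hB ha)
  have hc : (0 : ℝ) < (twoPow k : ℝˣ) := by rw [twoPow_coe]; positivity
  rw [hf.conv_dpm _ hs, eLpNorm_conv_sdpm_dil s hc, hm.isSymbol.sdpm_sdpm_ker hs, hm.lpProj_eq,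
    ofReal_twoPow]
  rfl

/-! ### The space `LX` -/

lemma equivariantLift_eq (f : ℝ → ℂ) {x : ℂ} (hx : x ≠ 0) :
    equivariantLift f x = modeLift 2 f x := by
  have h0 : ((‖x‖ : ℝ) : ℂ) ≠ 0 := by simpa using hx
  have h1 : x / (‖x‖ : ℂ) = Complex.exp (Complex.arg x * Complex.I) := by
    rw [div_eq_iff h0, mul_comm]
    exact (Complex.norm_mul_exp_arg_mul_I x).symm
  rw [equivariantLift, modeLift, h1, ← Complex.exp_int_mul]
  congr 2
  push_cast; ring

lemma conv_congr_ae (Φ : 𝓢(ℂ, ℂ)) {F G : ℂ → ℂ} (h : F =ᵐ[volume] G) : conv Φ F = conv Φ G :=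
  funext fun x => integral_congr_ae (h.mono fun y hy => by simp only; rw [hy])

lemma IsDyadicCutoff.normLX_eq {m : ℝ → ℝ} (hm : IsDyadicCutoff m) {ψ : ℝ → ℂ}
    (hψ : MemLp ψ 2 radialMeasure) :
    polarConst * normLX m ψ = ∑' k : ℤ, eLpNorm (conv (hm.kernel k) (modeLift 2 ψ)) 2 volume := by
  rw [normLX, ← ENNReal.tsum_mul_left]
  refine tsum_congr fun k => ?_
  have hF := aesm_modeLift 2 hψ.1
  have hF2 : eLpNorm (modeLift 2 ψ) 2 volume ≠ ⊤ := by
    rw [eLpNorm_modeLift 2 hψ.1]; exact ENNReal.mul_ne_top polarConst_ne_top hψ.2.ne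
  have e1 : lpProj m k (equivariantLift ψ) = conv (hm.kernel k) (modeLift 2 ψ) := by
    rw [hm.lpProj_eq]
    exact conv_congr_ae _ (ae_ne_zero.mono fun x hx => equivariantLift_eq ψ hx)
  have e2 : lpProjE m k ψ = fun r : ℝ => conv (hm.kernel k) (modeLift 2 ψ) r := by
    funext r; rw [lpProjE, e1]
  have hmode := hm.hasMode_conv (hasMode_modeLift 2 ψ) k
  rw [e2]
  obtain ⟨M, hM, hMm⟩ := hm.exists_symbol
  have hc : Continuous (conv (hm.kernel k) (modeLift 2 ψ)) := by
    have htame := isTame_of_L2 hF hF2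
    have hrep : conv (dil (twoPow k) hM.ker) (conv (hm.kernel k) (modeLift 2 ψ)) =
        conv (hm.kernel k) (modeLift 2 ψ) := funext fun x => by
      rw [conv_conv (htame _), IsDyadicCutoff.kernel, conv_dil_sconv,
        hm.isSymbol.sconv_ker hM hMm]
    rw [← hrep]
    exact (differentiable_conv _ (htame _).isBdd_conv).continuous
  exact (hmode.eLpNorm_eq (aestronglyMeasurable_of_continuousOn (by fun_prop))).symm

lemma IsDyadicCutoff.exists_normLX_le {m : ℝ → ℝ} (hm : IsDyadicCutoff m) :
    ∃ C : ℝ≥0∞, C ≠ ⊤ ∧ ∀ (ψ : ℝ → ℂ) (B : ℝ≥0∞), B ≠ ⊤ → IsBesov ψ B →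
      MemLX m ψ ∧ normLX m ψ ≤ C * B := by
  obtain ⟨C, hC, h⟩ := exists_besov_conv_le (s := 1) (Or.inl rfl) (n := 2) (by norm_num)
    (sdpm (-1) hm.isSymbol.neg_div_sq.ker)
  rw [hm.isSymbol.sdpm_sdpm_ker (s := 1) (Or.inl rfl)] at h
  have hC' : polarConst⁻¹ * C ≠ ⊤ :=
    ENNReal.mul_ne_top (ENNReal.inv_ne_top.2 polarConst_ne_zero) hC
  refine ⟨polarConst⁻¹ * C, hC', fun ψ B hB hψ => ?_⟩
  have hL2 : MemLp ψ 2 radialMeasure := ⟨hψ.aesm, hψ.radNorm_le.trans_lt hB.lt_top⟩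
  have h1 := h ψ B hB hψ
  have h2 : normLX m ψ ≤ polarConst⁻¹ * C * B := by
    rw [mul_assoc, ← ENNReal.mul_le_iff_le_inv polarConst_ne_zero polarConst_ne_top,
      hm.normLX_eq hL2]
    exact h1
  exact ⟨⟨hL2, h2.trans_lt (ENNReal.mul_lt_top hC'.lt_top hB.lt_top)⟩, h2⟩

lemma IsDyadicCutoff.exists_besov_of_memLX {m : ℝ → ℝ} (hm : IsDyadicCutoff m) :
    ∃ C : ℝ≥0∞, C ≠ ⊤ ∧ ∀ ψ : ℝ → ℂ, MemLX m ψ → IsBesov ψ (C * normLX m ψ) := by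
  obtain ⟨C, hC, h⟩ := hm.exists_besov_of_conv (n := 2) (by norm_num)
  refine ⟨C * polarConst, ENNReal.mul_ne_top hC polarConst_ne_top, fun ψ hψ => ?_⟩
  have := h ψ hψ.1.1 hψ.1.2.ne (by
    rw [← hm.normLX_eq hψ.1]; exact ENNReal.mul_ne_top polarConst_ne_top hψ.2.ne)
  rwa [← hm.normLX_eq hψ.1, ← mul_assoc] at this

/-! ### Vector valued functions -/

/-- The horizontal part of a vector, as a complex number. -/
def horL : E3 →L[ℝ] ℂ :=
  (Complex.ofRealCLM.comp (EuclideanSpace.proj (0 : Fin 3))) +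
    (Complex.I • Complex.ofRealCLM).comp (EuclideanSpace.proj (1 : Fin 3))

/-- The vertical part of a vector, as a complex number. -/
def verL : E3 →L[ℝ] ℂ := Complex.ofRealCLM.comp (EuclideanSpace.proj (2 : Fin 3))

lemma horL_apply (p : E3) : horL p = p 0 + Complex.I * p 1 := rfl

lemma verL_apply (p : E3) : verL p = p 2 := rfl

lemma norm_sq_horL_add (p : E3) : ‖horL p‖ ^ 2 + ‖verL p‖ ^ 2 = ‖p‖ ^ 2 := by
  rw [EuclideanSpace.norm_sq_eq, Fin.sum_univ_three, horL_apply, verL_apply,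
    ← Complex.normSq_eq_norm_sq, Complex.normSq_apply]
  simp [sq]

lemma norm_horL_le (p : E3) : ‖horL p‖ ≤ ‖p‖ := by
  have := norm_sq_horL_add p
  exact abs_le_of_sq_le_sq' (by nlinarith [sq_nonneg ‖verL p‖]) (norm_nonneg _) |>.2

lemma norm_verL_le (p : E3) : ‖verL p‖ ≤ ‖p‖ := by
  have := norm_sq_horL_add p
  exact abs_le_of_sq_le_sq' (by nlinarith [sq_nonneg ‖horL p‖]) (norm_nonneg _) |>.2

lemma norm_le_horL_add (p : E3) : ‖p‖ ≤ ‖horL p‖ + ‖verL p‖ := by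
  have := norm_sq_horL_add p
  refine abs_le_of_sq_le_sq' ?_ (by positivity) |>.2
  nlinarith [norm_nonneg (horL p), norm_nonneg (verL p)]

lemma IsDyadicCutoff.lpProj_comp {m : ℝ → ℝ} (hm : IsDyadicCutoff m) (k : ℤ) {f : ℂ → E3}
    (hf : AEStronglyMeasurable f) {M : ℝ} (hM : ∀ x, ‖f x‖ ≤ M) (L : E3 →L[ℝ] ℂ) (x : ℂ) :
    L (lpProj m k f x) = lpProj m k (fun y => L (f y)) x := by
  rw [lpProj, lpProj, MeasureTheory.convolution_def, MeasureTheory.convolution_def]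
  have hK : Integrable (lpKernel m k) := by
    have h1 : Integrable (hm.kernel k) := SchwartzMap.integrable _
    have : lpKernel m k = fun x => (hm.kernel k x).re := funext fun x => by
      rw [← hm.lpKernel_eq, Complex.ofReal_re]
    rw [this]
    exact h1.re
  have hint : Integrable (fun t => (ContinuousLinearMap.lsmul ℝ ℝ) (lpKernel m k t) (f (x - t))) := by
    have hfm : AEStronglyMeasurable (fun t => f (x - t)) :=
      hf.comp_quasiMeasurePreserving (quasiMeasurePreserving_sub_left volume x)
    exact hK.smul_bdd (f := fun t => f (x - t)) M hfm (Eventually.of_forall fun t => hM _)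
  rw [← L.integral_comp_comm hint]
  congr 1
  funext t
  simp

lemma aesm_lpProj {m : ℝ → ℝ} (hm : IsDyadicCutoff m) (k : ℤ) {F : ℂ → ℂ}
    (hF : AEStronglyMeasurable F) : AEStronglyMeasurable (lpProj m k F) := by
  rw [hm.lpProj_eq]; exact aesm_conv _ hF

lemma IsDyadicCutoff.scalarX_le {m : ℝ → ℝ} (hm : IsDyadicCutoff m) {f : ℂ → E3}
    (hf : AEStronglyMeasurable f) {M : ℝ} (hM : ∀ x, ‖f x‖ ≤ M) {L : E3 →L[ℝ] ℂ}
    (hL : ∀ p, ‖L p‖ ≤ ‖p‖) : scalarX m (fun y => L (f y)) ≤ normX m f := by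
  refine ENNReal.tsum_le_tsum fun k => mul_le_mul_right (eLpNorm_mono fun x => ?_) _
  rw [← hm.lpProj_comp k hf hM]
  exact hL _

lemma IsDyadicCutoff.normX_le {m : ℝ → ℝ} (hm : IsDyadicCutoff m) {f : ℂ → E3}
    (hf : AEStronglyMeasurable f) {M : ℝ} (hM : ∀ x, ‖f x‖ ≤ M) :
    normX m f ≤ scalarX m (fun y => horL (f y)) + scalarX m (fun y => verL (f y)) := by
  rw [normX, scalarX, scalarX, ← ENNReal.tsum_add]
  refine ENNReal.tsum_le_tsum fun k => ?_
  rw [← mul_add]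
  refine mul_le_mul_right ?_ _
  have h1 := (aesm_lpProj hm k (horL.continuous.comp_aestronglyMeasurable hf)).norm
  have h2 := (aesm_lpProj hm k (verL.continuous.comp_aestronglyMeasurable hf)).norm
  have h3 := eLpNorm_add_le (p := 2) h1 h2 (by norm_num)
  rw [eLpNorm_norm, eLpNorm_norm] at h3
  refine (eLpNorm_mono_real fun x => ?_).trans h3
  refine (norm_le_horL_add _).trans (le_of_eq ?_)
  rw [hm.lpProj_comp k hf hM, hm.lpProj_comp k hf hM]
  rfl

open scoped ComplexConjugate

/-! ### Frames -/

lemma IsBesov.half {f : ℝ → ℂ} {B : ℝ≥0∞} (hf : IsBesov f B) :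
    IsBesov (fun r => f r / 2) (3 * B) := by
  have h1 : IsMult (fun _ => (1 / 2 : ℂ)) 1 := (IsMult.const _).mono (by
    rw [← ofReal_norm, ENNReal.ofReal_le_one]; norm_num)
  refine ((hf.mul h1 (by simp)).mono (by simp)).congr (Eventually.of_forall fun r _ => ?_)
  ring

/-- The rows `(W j, U j)` of a moving orthonormal frame of `ℝ³` in the Coulomb gauge, where `U` is
the map, `W = v + i w` its tangent frame and `q` its derivative read in the frame. -/
structure IsFrame (W U : Fin 3 → ℝ → ℂ) (q : ℝ → ℂ) : Prop where
  real : ∀ j r, 0 < r → conj (U j r) = U j r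
  acU : ∀ j, ACDeriv (U j) (fun r => (conj (q r) * W j r + q r * conj (W j r)) / 2)
  acW : ∀ j, ACDeriv (W j) (fun r => -(q r * U j r))
  orth : ∀ r, 0 < r → ∀ i j,
    (W i r * conj (W j r) + conj (W i r) * W j r) / 2 + U i r * U j r = if i = j then 1 else 0
  unit : ∀ r, 0 < r → U 0 r * U 0 r + U 1 r * U 1 r + U 2 r * U 2 r = 1
  dot : ∀ r, 0 < r → W 0 r * U 0 r + W 1 r * U 1 r + W 2 r * U 2 r = 0
  sq : ∀ r, 0 < r → W 0 r * W 0 r + W 1 r * W 1 r + W 2 r * W 2 r = 0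
  nsq : ∀ r, 0 < r → W 0 r * conj (W 0 r) + W 1 r * conj (W 1 r) + W 2 r * conj (W 2 r) = 2
  radNorm_le : radNorm q ≤ 6

namespace IsFrame

variable {W U V Q : Fin 3 → ℝ → ℂ} {q q₀ : ℝ → ℂ}

lemma norm_sq_add (h : IsFrame W U q) (j : Fin 3) {r : ℝ} (hr : 0 < r) :
    ‖W j r‖ ^ 2 + ‖U j r‖ ^ 2 = 1 := by
  have h1 := h.orth r hr j j
  rw [if_pos rfl] at h1
  have h2 : (((‖W j r‖ ^ 2 + ‖U j r‖ ^ 2 : ℝ)) : ℂ) = 1 := by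
    push_cast
    rw [← Complex.mul_conj', ← Complex.mul_conj', h.real j r hr, ← h1]
    ring
  exact_mod_cast h2

lemma norm_W_le (h : IsFrame W U q) (j : Fin 3) {r : ℝ} (hr : 0 < r) : ‖W j r‖ ≤ 1 := by
  nlinarith [h.norm_sq_add j hr, norm_nonneg (W j r), sq_nonneg ‖U j r‖]

lemma norm_U_le (h : IsFrame W U q) (j : Fin 3) {r : ℝ} (hr : 0 < r) : ‖U j r‖ ≤ 1 := by
  nlinarith [h.norm_sq_add j hr, norm_nonneg (U j r), sq_nonneg ‖W j r‖]

lemma enorm_le_six {z : ℂ} (h : ‖z‖ ≤ 1) : ‖z‖ₑ ≤ 6 := by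
  rw [← ofReal_norm]
  exact (ENNReal.ofReal_le_one.2 h).trans (by norm_num)

lemma isMult_W (h : IsFrame W U q) (j : Fin 3) : IsMult (W j) 6 := by
  refine .of_acDeriv (h.acW j) (fun r hr => enorm_le_six (h.norm_W_le j hr)) ?_
  refine (radNorm_mono (Eventually.of_forall fun r hr => ?_)).trans h.radNorm_le
  rw [norm_neg, norm_mul]
  exact mul_le_of_le_one_right (norm_nonneg _) (h.norm_U_le j hr)

lemma radNorm_deriv (h : IsFrame W U q) (j : Fin 3) :
    radNorm (fun r => (conj (q r) * W j r + q r * conj (W j r)) / 2) ≤ 6 := by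
  refine (radNorm_mono (Eventually.of_forall fun r hr => ?_)).trans h.radNorm_le
  rw [norm_div, Complex.norm_two, div_le_iff₀ two_pos]
  refine (norm_add_le _ _).trans ?_
  rw [norm_mul, norm_mul, RCLike.norm_conj, RCLike.norm_conj]
  nlinarith [h.norm_W_le j hr, norm_nonneg (q r)]

lemma isMult_U (h : IsFrame W U q) (j : Fin 3) : IsMult (U j) 6 :=
  .of_acDeriv (h.acU j) (fun _ hr => enorm_le_six (h.norm_U_le j hr)) (h.radNorm_deriv j)

/-- The derivative of the map is recovered from the derivatives of its coordinates. -/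
lemma sum_deriv (h : IsFrame W U q) {r : ℝ} (hr : 0 < r) :
    ∑ j, W j r * ((conj (q r) * W j r + q r * conj (W j r)) / 2) = q r := by
  rw [Fin.sum_univ_three]
  linear_combination (conj (q r) / 2) * h.sq r hr + (q r / 2) * h.nsq r hr

/-- The (deviation from the identity of the) matrix which sends the frame `(V, Q)` to `(W, U)`. -/
def transition (W U V Q : Fin 3 → ℝ → ℂ) (i j : Fin 3) (r : ℝ) : ℂ :=
  (W i r * conj (V j r) + conj (W i r) * V j r) / 2 + U i r * Q j r - if i = j then 1 else 0

/-- The derivative of the transition matrix. -/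
def transitionDeriv (W U V Q : Fin 3 → ℝ → ℂ) (q q₀ : ℝ → ℂ) (i j : Fin 3) (r : ℝ) : ℂ :=
  ((W i r * Q j r - U i r * V j r) * conj (q r - q₀ r) +
    (conj (W i r) * Q j r - U i r * conj (V j r)) * (q r - q₀ r)) / 2

lemma acDeriv_transition (h : IsFrame W U q) (h' : IsFrame V Q q₀) (i j : Fin 3) :
    ACDeriv (transition W U V Q i j) (transitionDeriv W U V Q q q₀ i j) := by
  have h1 := ((((h.acW i).mul (h'.acW j).conj).add ((h.acW i).conj.mul (h'.acW j))).const_mul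
    (1 / 2)).add ((h.acU i).mul (h'.acU j))
  refine ((h1.sub (ACDeriv.const (if i = j then 1 else 0))).congr_deriv
    (Eventually.of_forall fun r hr => ?_)).congr fun r _ => ?_
  · simp only [transitionDeriv, map_neg, map_mul, map_sub]
    rw [h.real i r hr, h'.real j r hr]
    ring
  · rw [transition]; ring

lemma isBesov_transitionDeriv (h : IsFrame W U q) (h' : IsFrame V Q q₀) {B : ℝ≥0∞}
    (hB : IsBesov (fun r => q r - q₀ r) B) (i j : Fin 3) :
    IsBesov (transitionDeriv W U V Q q q₀ i j) (5000 * B) := by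
  have m1 := ((h.isMult_W i).mul (h'.isMult_U j) (by simp) (by simp)).sub
    ((h.isMult_U i).mul (h'.isMult_W j) (by simp) (by simp))
  have m2 := ((h.isMult_W i).conj.mul (h'.isMult_U j) (by simp) (by simp)).sub
    ((h.isMult_U i).mul (h'.isMult_W j).conj (by simp) (by simp))
  have h1 := ((hB.conj.mul m1 (by finiteness)).add (hB.mul m2 (by finiteness))).half
  refine h1.mono ?_
  rw [← add_mul, ← mul_assoc]
  gcongr
  norm_num

lemma tendsto_transition (h : IsFrame W U q)
    (hW : ∀ j, Tendsto (fun r => V j r - W j r) atTop (𝓝 0))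
    (hU : ∀ j, Tendsto (fun r => Q j r - U j r) atTop (𝓝 0)) (i j : Fin 3) :
    Tendsto (transition W U V Q i j) atTop (𝓝 0) := by
  have h0 : Tendsto (fun r => ‖V j r - W j r‖ + ‖Q j r - U j r‖) atTop (𝓝 0) := by
    simpa using (hW j).norm.add (hU j).norm
  refine squeeze_zero_norm' ?_ h0
  filter_upwards [eventually_gt_atTop 0] with r hr
  have e : transition W U V Q i j r = (W i r * conj (V j r - W j r) +
      conj (W i r) * (V j r - W j r)) / 2 + U i r * (Q j r - U j r) := by
    rw [transition, ← h.orth r hr i j, map_sub]; ring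
  rw [e]
  refine (norm_add_le _ _).trans ?_
  rw [norm_div, Complex.norm_two, norm_mul]
  refine add_le_add ?_ (mul_le_of_le_one_left (norm_nonneg _) (h.norm_U_le i hr))
  rw [div_le_iff₀ two_pos]
  refine (norm_add_le _ _).trans ?_
  rw [norm_mul, norm_mul, RCLike.norm_conj, RCLike.norm_conj]
  nlinarith [h.norm_W_le i hr, norm_nonneg (V j r - W j r)]

lemma isMult_transition (h : IsFrame W U q) (h' : IsFrame V Q q₀) {B : ℝ≥0∞} (hBt : B ≠ ⊤)
    (hB : IsBesov (fun r => q r - q₀ r) B)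
    (hW : ∀ j, Tendsto (fun r => V j r - W j r) atTop (𝓝 0))
    (hU : ∀ j, Tendsto (fun r => Q j r - U j r) atTop (𝓝 0)) (i j : Fin 3) :
    IsMult (transition W U V Q i j) (15000 * B) := by
  have hd := isBesov_transitionDeriv h h' hB i j
  have e : (15000 : ℝ≥0∞) * B = 3 * (5000 * B) := by rw [← mul_assoc]; norm_num
  refine .of_acDeriv (acDeriv_transition h h' i j) (fun r hr => ?_) ?_
  · rw [e]
    exact hd.primitive_bound (by finiteness) (acDeriv_transition h h' i j)
      (tendsto_transition h hW hU i j) hr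
  · refine hd.radNorm_le.trans ?_
    gcongr
    norm_num

lemma sub_eq_sum (h' : IsFrame V Q q₀) (U W : Fin 3 → ℝ → ℂ) (i : Fin 3) {r : ℝ} (hr : 0 < r) :
    U i r - Q i r = ∑ j, transition W U V Q i j r * Q j r := by
  have h0 : conj (V 0 r) * Q 0 r + conj (V 1 r) * Q 1 r + conj (V 2 r) * Q 2 r = 0 := by
    have := congrArg conj (h'.dot r hr)
    simpa [h'.real _ r hr] using this
  have hi : ∑ j, (if i = j then (1 : ℂ) else 0) * Q j r = Q i r := by simp
  simp only [transition, sub_mul, Finset.sum_sub_distrib]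
  rw [hi, Fin.sum_univ_three]
  linear_combination -(W i r / 2) * h0 - (conj (W i r) / 2) * h'.dot r hr -
    U i r * h'.unit r hr

lemma isBesov_deriv_U (h : IsFrame W U q) {B : ℝ≥0∞} (hq : IsBesov q B) (j : Fin 3) :
    IsBesov (fun r => (conj (q r) * W j r + q r * conj (W j r)) / 2) (108 * B) := by
  have h1 := ((hq.conj.mul (h.isMult_W j) (by simp)).add
    (hq.mul (h.isMult_W j).conj (by simp))).half
  refine (h1.mono (le_of_eq ?_)).congr (Eventually.of_forall fun r _ => ?_)
  · rw [← add_mul, ← mul_assoc]; norm_num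
  · ring

lemma isBesov_sum {f : Fin 3 → ℝ → ℂ} {B : ℝ≥0∞} (h : ∀ j, IsBesov (f j) B) :
    IsBesov (fun r => ∑ j, f j r) (3 * B) := by
  refine (((h 0).add (h 1)).add (h 2)).mono (le_of_eq (by ring)) |>.congr
    (Eventually.of_forall fun r _ => ?_)
  rw [Fin.sum_univ_three]

lemma isBesov_deriv_sub (h : IsFrame W U q) (h' : IsFrame V Q q₀) {B : ℝ≥0∞} (hBt : B ≠ ⊤)
    (hB : IsBesov (fun r => q r - q₀ r) B) (hq₀ : IsBesov q₀ 1500)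
    (hW : ∀ j, Tendsto (fun r => V j r - W j r) atTop (𝓝 0))
    (hU : ∀ j, Tendsto (fun r => Q j r - U j r) atTop (𝓝 0)) (i : Fin 3) :
    IsBesov (fun r => (conj (q r) * W i r + q r * conj (W i r)) / 2 -
      (conj (q₀ r) * V i r + q₀ r * conj (V i r)) / 2) (10 ^ 11 * B) := by
  have hj : ∀ j, IsBesov (fun r => transitionDeriv W U V Q q q₀ i j r * Q j r +
      transition W U V Q i j r * ((conj (q₀ r) * V j r + q₀ r * conj (V j r)) / 2))
      (10 ^ 10 * B) := fun j => by
    have h1 := ((isBesov_transitionDeriv h h' hB i j).mul (h'.isMult_U j) (by simp)).add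
      ((h'.isBesov_deriv_U hq₀ j).mul (isMult_transition h h' hBt hB hW hU i j) (by finiteness))
    refine (h1.mono ?_).congr (Eventually.of_forall fun r _ => by ring)
    calc (3 * 6 * (5000 * B) + 3 * (15000 * B) * (108 * 1500) : ℝ≥0∞)
        = (3 * 6 * 5000 + 3 * 15000 * 108 * 1500) * B := by ring
      _ ≤ 10 ^ 10 * B := by gcongr; norm_num
  have hs := isBesov_sum hj
  have a1 := (h.acU i).sub (h'.acU i)
  have a2 : ACDeriv (fun r => U i r - Q i r) (fun r => ∑ j, (transitionDeriv W U V Q q q₀ i j r * Q j r +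
      transition W U V Q i j r * ((conj (q₀ r) * V j r + q₀ r * conj (V j r)) / 2))) := by
    have := fun j => (acDeriv_transition h h' i j).mul (h'.acU j)
    refine ((((this 0).add (this 1)).add (this 2)).congr_deriv
      (Eventually.of_forall fun r _ => ?_)).congr fun r hr => ?_
    · rw [Fin.sum_univ_three]
    · rw [h'.sub_eq_sum U W i hr, Fin.sum_univ_three]
  refine (hs.mono ?_).congr ?_
  · rw [← mul_assoc]; gcongr; norm_num
  · filter_upwards [a1.ae_deriv_eq, a2.ae_deriv_eq] with r h1 h2 hr
    rw [← h2 hr, h1 hr]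

lemma isBesov_sub_div (h : IsFrame W U q) (h' : IsFrame V Q q₀) {B : ℝ≥0∞} (hBt : B ≠ ⊤)
    (hB : IsBesov (fun r => q r - q₀ r) B) (hQ : ∀ j, j ≠ 2 → IsBesov (fun r => Q j r / r) 1500)
    (hp : IsBesov (fun r => (W 2 r - V 2 r) / r) B) (hf : IsBesov (fun r => (U 2 r - Q 2 r) / r) B)
    (hW : ∀ j, Tendsto (fun r => V j r - W j r) atTop (𝓝 0))
    (hU : ∀ j, Tendsto (fun r => Q j r - U j r) atTop (𝓝 0)) {i : Fin 3} (hi : i ≠ 2) :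
    IsBesov (fun r => (U i r - Q i r) / r) (10 ^ 9 * B) := by
  have hj : ∀ j, IsBesov (fun r => transition W U V Q i j r * (Q j r / r)) (10 ^ 8 * B) := fun j => by
    by_cases hj : j = 2
    · subst hj
      have h1 := (((hp.conj.mul (h.isMult_W i) (by simp)).add
        (hp.mul (h.isMult_W i).conj (by simp))).half.add
          (hf.mul (h.isMult_U i) (by simp))).neg.mul (h'.isMult_U 2) (by simp)
      refine (h1.mono ?_).congr (Eventually.of_forall fun r hr => ?_)
      · calc (3 * 6 * (3 * (3 * (3 * 6 * B + 3 * 6 * B) + 3 * 6 * B)) : ℝ≥0∞)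
            = 6804 * B := by ring
          _ ≤ 10 ^ 8 * B := by gcongr; norm_num
      · have e : transition W U V Q i 2 r = - ((W i r * conj (W 2 r - V 2 r) +
            conj (W i r) * (W 2 r - V 2 r)) / 2 + U i r * (U 2 r - Q 2 r)) := by
          have := h.orth r hr i 2
          rw [if_neg hi] at this
          rw [transition, if_neg hi, map_sub]
          linear_combination this
        rw [e]
        simp only [map_div₀, Complex.conj_ofReal, map_sub]
        ring
    · refine ((hQ j hj).mul (isMult_transition h h' hBt hB hW hU i j) (by finiteness)).mono ?_
      calc (3 * (15000 * B) * 1500 : ℝ≥0∞) = (3 * 15000 * 1500) * B := by ring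
        _ ≤ 10 ^ 8 * B := by gcongr; norm_num
  refine ((isBesov_sum hj).mono ?_).congr (Eventually.of_forall fun r hr => ?_)
  · rw [← mul_assoc]; gcongr; norm_num
  · rw [h'.sub_eq_sum U W i hr, Fin.sum_univ_three, Fin.sum_univ_three]; ring

end IsFrame

/-! ### The frame of the soliton -/

/-- The Coulomb frame of the soliton. -/
def solW (α lam : ℝ) (j : Fin 3) (r : ℝ) : ℂ :=
  Complex.exp (2 * α * Complex.I) *
    ![Real.cos (2 * α) * h3 (lam * r) - Complex.I * Real.sin (2 * α),
      Real.sin (2 * α) * h3 (lam * r) + Complex.I * Real.cos (2 * α), -(h1 (lam * r) : ℂ)] j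

/-- The coordinates of the soliton. -/
def solU (α lam : ℝ) (j : Fin 3) (r : ℝ) : ℂ :=
  ![(Real.cos (2 * α) : ℂ) * h1 (lam * r), Real.sin (2 * α) * h1 (lam * r), h3 (lam * r)] j

/-- The derivative of the soliton, read in its frame. -/
def solq (α lam r : ℝ) : ℂ := -2 * Complex.exp (2 * α * Complex.I) * (h1 (lam * r) / r)

lemma conj_phase (α : ℝ) :
    Complex.exp (2 * α * Complex.I) * conj (Complex.exp (2 * α * Complex.I)) = 1 := by
  rw [← Complex.exp_conj, ← Complex.exp_add]
  simp [map_ofNat]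

lemma norm_phase (α : ℝ) : ‖Complex.exp (2 * α * Complex.I)‖ = 1 := by
  rw [show (2 * α * Complex.I : ℂ) = ((2 * α : ℝ) : ℂ) * Complex.I by push_cast; ring]
  exact Complex.norm_exp_ofReal_mul_I _

lemma isFrame_soliton (α : ℝ) {lam : ℝ} (hl : 0 < lam) :
    IsFrame (solW α lam) (solU α lam) (solq α lam) := by
  have hz := conj_phase α
  have hcs : (Real.cos (2 * α) : ℂ) ^ 2 + (Real.sin (2 * α) : ℂ) ^ 2 = 1 := by
    exact_mod_cast Real.cos_sq_add_sin_sq (2 * α)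
  have hh : ∀ r : ℝ, (h1 (lam * r) : ℂ) ^ 2 + (h3 (lam * r) : ℂ) ^ 2 = 1 := fun r => by
    exact_mod_cast h1_sq_add_h3_sq (lam * r)
  have a1 := acDeriv_h1 hl
  have a3 := acDeriv_h3 hl
  set z := Complex.exp (2 * α * Complex.I) with hzdef
  set c := (Real.cos (2 * α) : ℂ) with hc
  set s := (Real.sin (2 * α) : ℂ) with hs
  have hcc : conj c = c := Complex.conj_ofReal _
  have hsc : conj s = s := Complex.conj_ofReal _
  have hI := Complex.I_sq
  have w0 : ∀ r, solW α lam 0 r = z * (c * h3 (lam * r) - Complex.I * s) := fun r => rfl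
  have w1 : ∀ r, solW α lam 1 r = z * (s * h3 (lam * r) + Complex.I * c) := fun r => rfl
  have w2 : ∀ r, solW α lam 2 r = z * -(h1 (lam * r) : ℂ) := fun r => rfl
  have u0 : ∀ r, solU α lam 0 r = c * h1 (lam * r) := fun r => rfl
  have u1 : ∀ r, solU α lam 1 r = s * h1 (lam * r) := fun r => rfl
  have u2 : ∀ r, solU α lam 2 r = h3 (lam * r) := fun r => rfl
  have q0 : ∀ r, solq α lam r = -2 * z * (h1 (lam * r) / r) := fun r => rfl
  refine ⟨fun j r _ => ?_, fun j => ?_, fun j => ?_, fun r _ i j => ?_, fun r _ => ?_,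
    fun r _ => ?_, fun r _ => ?_, fun r _ => ?_, ?_⟩
  · fin_cases j <;> simp [u0, u1, u2, hcc, hsc]
  · fin_cases j
    · refine (a1.const_mul c).congr_deriv (Eventually.of_forall fun r hr => ?_)
      simp only [Fin.zero_eta, w0, q0, map_mul, map_neg, map_div₀, map_sub, Complex.conj_ofReal,
        Complex.conj_I, hcc, hsc, map_ofNat]
      push_cast
      linear_combination 2 * c * h1 (lam * r) * h3 (lam * r) / r * hz
    · refine (a1.const_mul s).congr_deriv (Eventually.of_forall fun r hr => ?_)
      simp only [Fin.mk_one, w1, q0, map_mul, map_neg, map_div₀, map_add, Complex.conj_ofReal,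
        Complex.conj_I, hcc, hsc, map_ofNat]
      push_cast
      linear_combination 2 * s * h1 (lam * r) * h3 (lam * r) / r * hz
    · refine a3.congr_deriv (Eventually.of_forall fun r hr => ?_)
      simp only [Fin.reduceFinMk, w2, q0, map_mul, map_neg, map_div₀, Complex.conj_ofReal,
        map_ofNat]
      push_cast
      linear_combination -2 * (h1 (lam * r) : ℂ) ^ 2 / r * hz
  · fin_cases j
    · refine ((((a3.const_mul c).sub (ACDeriv.const (Complex.I * s))).const_mul z).congr_deriv
        (Eventually.of_forall fun r hr => ?_))
      simp only [Fin.zero_eta, u0, q0]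
      push_cast; ring
    · refine ((((a3.const_mul s).add (ACDeriv.const (Complex.I * c))).const_mul z).congr_deriv
        (Eventually.of_forall fun r hr => ?_))
      simp only [Fin.mk_one, u1, q0]
      push_cast; ring
    · refine ((a1.neg.const_mul z).congr_deriv (Eventually.of_forall fun r hr => ?_))
      simp only [Fin.reduceFinMk, u2, q0]
      push_cast; ring
  · have hh := hh r
    fin_cases i <;> fin_cases j <;>
      simp only [Fin.zero_eta, Fin.mk_one, Fin.reduceFinMk, w0, w1, w2, u0, u1, u2, map_mul,
        map_neg, map_add, map_sub, Complex.conj_ofReal, Complex.conj_I, hcc, hsc] <;>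
      generalize (h1 (lam * r) : ℂ) = x at hh ⊢ <;> generalize (h3 (lam * r) : ℂ) = y at hh ⊢ <;>
      simp only [if_true, Fin.reduceEq, if_false]
    · linear_combination (c ^ 2 * y ^ 2 - Complex.I ^ 2 * s ^ 2) * hz - s ^ 2 * hI + c ^ 2 * hh + hcs
    · linear_combination (c * s * y ^ 2 + Complex.I ^ 2 * s * c) * hz + s * c * hI + c * s * hh
    · linear_combination (-c * x * y) * hz
    · linear_combination (c * s * y ^ 2 + Complex.I ^ 2 * s * c) * hz + s * c * hI + c * s * hh
    · linear_combination (s ^ 2 * y ^ 2 - Complex.I ^ 2 * c ^ 2) * hz - c ^ 2 * hI + s ^ 2 * hh + hcs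
    · linear_combination (-s * x * y) * hz
    · linear_combination (-c * x * y) * hz
    · linear_combination (-s * x * y) * hz
    · linear_combination x ^ 2 * hz + hh
  · rw [u0, u1, u2]
    linear_combination (h1 (lam * r) : ℂ) ^ 2 * hcs + hh r
  · rw [u0, u1, u2, w0, w1, w2]
    linear_combination z * h1 (lam * r) * h3 (lam * r) * hcs
  · rw [w0, w1, w2]
    linear_combination (z ^ 2 * (h3 (lam * r) : ℂ) ^ 2 + z ^ 2 * Complex.I ^ 2) * hcs + z ^ 2 * hh r +
      z ^ 2 * hI
  · simp only [w0, w1, w2, map_mul, map_neg, map_add, map_sub, Complex.conj_ofReal, Complex.conj_I,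
      hcc, hsc]
    linear_combination (((h3 (lam * r) : ℂ) ^ 2 - Complex.I ^ 2) * (c ^ 2 + s ^ 2) +
      (h1 (lam * r) : ℂ) ^ 2) * hz + ((h3 (lam * r) : ℂ) ^ 2 - Complex.I ^ 2) * hcs + hh r - hI
  · refine radNorm_le_of_h1_div hl fun r hr => ?_
    rw [q0, norm_mul, norm_mul, norm_neg, Complex.norm_two, hzdef, norm_phase, norm_h1_div hr,
      mul_one]

lemma isBesov_h1_div {lam : ℝ} (hl : 0 < lam) : IsBesov (fun r => (h1 (lam * r) : ℂ) / r) 216 := by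
  have h : IsNearSoliton lam (fun r => h3 (lam * r)) 0 :=
    ⟨hl, continuousOn_h3 hl, fun r _ => by simp, by norm_num⟩
  have h0 := h.isBesov_of_flow (y := fun r => (h1 (lam * r) : ℂ)) (f := fun _ => 0) (B := 0)
    ((acDeriv_h1 hl).congr_deriv (Eventually.of_forall fun r _ => by push_cast; ring))
    IsBesov.zero (by simp)
  refine h0.mono ?_
  rw [mul_inv_cancel₀ hl.ne', show h1 1 = 1 by norm_num [h1]]
  simp

lemma isBesov_solq (α : ℝ) {lam : ℝ} (hl : 0 < lam) : IsBesov (solq α lam) 1500 := by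
  refine ((isBesov_h1_div hl).const_mul _).mono ?_
  rw [← ofReal_norm, norm_mul, norm_phase, norm_neg, Complex.norm_two, mul_one]
  norm_num

lemma isBesov_solU_div (α : ℝ) {lam : ℝ} (hl : 0 < lam) {j : Fin 3} (hj : j ≠ 2) :
    IsBesov (fun r => solU α lam j r / r) 1500 := by
  have key : ∀ x : ℝ, |x| ≤ 1 → IsBesov (fun r => (x : ℂ) * ((h1 (lam * r) : ℂ) / r)) 1500 :=
    fun x hx => ((isBesov_h1_div hl).const_mul _).mono (by
      have := enorm_ofReal_le hx
      rw [ENNReal.ofReal_one] at this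
      calc 3 * ‖(x : ℂ)‖ₑ * 216 ≤ 3 * 1 * 216 := by gcongr
        _ ≤ 1500 := by norm_num)
  have e := fun (x : ℝ) (r : ℝ) => mul_div_assoc (x : ℂ) (h1 (lam * r) : ℂ) (r : ℂ)
  fin_cases j
  · refine (key _ (Real.abs_cos_le_one (2 * α))).congr (Eventually.of_forall fun r _ => (e _ r).symm)
  · refine (key _ (Real.abs_sin_le_one (2 * α))).congr (Eventually.of_forall fun r _ => (e _ r).symm)
  · exact absurd rfl hj

/-! ### The frame of an equivariant map -/

lemma LocallyAC.acDeriv_coord {f : ℝ → E3} (hf : LocallyAC f) :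
    (∀ᵐ r : ℝ, 0 < r → HasDerivAt f (deriv f r) r) ∧
    ∀ j, ACDeriv (fun r => (f r j : ℂ)) (fun r => (deriv f r j : ℂ)) := by
  have hc : ∀ j, LocallyAC (fun r => (f r j : ℂ)) := fun j =>
    (hf.of_dist_le (g := fun r => f r j) fun a b _ _ => ⟨1, fun x _ y _ => by
      rw [one_mul, EuclideanSpace.dist_eq, Real.dist_eq, ← Real.sqrt_sq_eq_abs]
      refine Real.sqrt_le_sqrt ?_
      rw [← sq_abs, ← Real.dist_eq]
      exact Finset.single_le_sum (f := fun i => dist (f x i) (f y i) ^ 2)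
        (fun i _ => sq_nonneg _) (Finset.mem_univ j)⟩).ofReal
  have hd : ∀ᵐ r : ℝ, 0 < r → HasDerivAt f (deriv f r) r := by
    have : ∀ᵐ r : ℝ, ∀ j, 0 < r → DifferentiableAt ℝ (fun r => (f r j : ℂ)) r :=
      ae_all_iff.2 fun j => (hc j).ae_differentiableAt
    filter_upwards [this] with r h hr
    refine (differentiableAt_euclidean.2 fun j => ?_).hasDerivAt
    exact (Complex.reCLM.differentiableAt.comp r (h j hr))
  refine ⟨hd, fun j => ⟨hc j, hd.mono fun r h hr => ?_⟩⟩
  exact ((EuclideanSpace.proj (𝕜 := ℝ) j).hasFDerivAt.comp_hasDerivAt r (h hr)).ofReal_comp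

lemma inner_eq (p q : E3) : ⟪p, q⟫ = p 0 * q 0 + p 1 * q 1 + p 2 * q 2 := by
  rw [PiLp.inner_apply, Fin.sum_univ_three]
  simp only [RCLike.inner_apply, conj_trivial]
  ring

lemma norm_sq_eq (p : E3) : ‖p‖ ^ 2 = p 0 * p 0 + p 1 * p 1 + p 2 * p 2 := by
  rw [← real_inner_self_eq_norm_sq, inner_eq]

namespace IsCoulombFrame

variable {u : ℂ → E3} {v w : ℝ → E3}

lemma rows (h : IsCoulombFrame u v w) (hu : ∀ x, ‖u x‖ = 1) {r : ℝ} (hr : 0 < r) (i j : Fin 3) :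
    v r i * v r j + w r i * w r j + profile u r i * profile u r j = if i = j then 1 else 0 := by
  have n1 := congrArg (· ^ 2) (h.norm_v r hr)
  have n2 := congrArg (· ^ 2) (h.norm_w r hr)
  have n3 := congrArg (· ^ 2) (hu r)
  have i1 := h.inner_vw r hr
  have i2 := h.inner_uv r hr
  have i3 := h.inner_uw r hr
  simp only [norm_sq_eq, one_pow] at n1 n2 n3
  rw [inner_eq] at i1 i2 i3
  let M : Matrix (Fin 3) (Fin 3) ℝ := Matrix.of ![v r, w r, profile u r]
  have hM : M * M.transpose = 1 := by
    ext a b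
    rw [Matrix.mul_apply, Fin.sum_univ_three]
    fin_cases a <;> fin_cases b <;> simp [M, Matrix.transpose_apply] <;>
      simp only [profile] at i2 i3 ⊢ <;> linarith
  have hM' : M.transpose * M = 1 := mul_eq_one_comm.1 hM
  have h1 := congrFun (congrFun hM' i) j
  rw [Matrix.mul_apply, Fin.sum_univ_three, Matrix.one_apply] at h1
  exact h1

lemma expand (h : IsCoulombFrame u v w) (hu : ∀ x, ‖u x‖ = 1) {r : ℝ} (hr : 0 < r) (p : E3)
    (j : Fin 3) : p j = ⟪p, v r⟫ * v r j + ⟪p, w r⟫ * w r j + ⟪p, profile u r⟫ * profile u r j := by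
  have h0 := h.rows hu hr 0 j
  have h1 := h.rows hu hr 1 j
  have h2 := h.rows hu hr 2 j
  have e : p j = ∑ i, p i * (if i = j then 1 else 0) := by simp
  rw [e, Fin.sum_univ_three, ← h0, ← h1, ← h2, inner_eq, inner_eq, inner_eq]
  ring

lemma inner_deriv {f g : ℝ → E3} {f' g' : E3} {c r : ℝ} (hr : 0 < r)
    (h : ∀ r, 0 < r → ⟪f r, g r⟫ = c) (hf : HasDerivAt f f' r) (hg : HasDerivAt g g' r) :
    ⟪f r, g'⟫ + ⟪f', g r⟫ = 0 := by
  have h1 := hf.inner ℝ hg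
  have h2 : HasDerivAt (fun t => ⟪f t, g t⟫) 0 r :=
    (hasDerivAt_const r c).congr_of_eventuallyEq
      (eventually_of_mem (Ioi_mem_nhds hr) fun t ht => h t ht)
  exact h1.unique h2

end IsCoulombFrame

/-! ### The energy of an equivariant map -/

lemma horL_rotZ (β : ℝ) (p : E3) : horL (rotZ β p) = Complex.exp (β * Complex.I) * horL p := by
  rw [horL_apply, horL_apply, Complex.exp_mul_I, ← Complex.ofReal_cos, ← Complex.ofReal_sin]
  simp only [rotZ]
  apply Complex.ext <;> simp <;> ring

lemma verL_rotZ (β : ℝ) (p : E3) : verL (rotZ β p) = verL p := rfl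

namespace IsEquivariantMap

variable {u : ℂ → E3}

lemma exp_arg {e : ℂ} (he : ‖e‖ = 1) : Complex.exp (Complex.arg e * Complex.I) = e := by
  have := Complex.norm_mul_exp_arg_mul_I e
  rwa [he, Complex.ofReal_one, one_mul] at this

lemma hasMode_hor (h : IsEquivariantMap u) : HasMode 2 (fun x => horL (u x)) := fun e he x => by
  have h1 := h.equivariant (Complex.arg e) x
  rw [exp_arg he] at h1
  simp only
  rw [h1, horL_rotZ]
  conv_rhs => rw [← exp_arg he, ← Complex.exp_int_mul]
  congr 2
  push_cast; ring

lemma hasMode_ver (h : IsEquivariantMap u) : HasMode 0 (fun x => verL (u x)) := fun e he x => by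
  have h1 := h.equivariant (Complex.arg e) x
  rw [exp_arg he] at h1
  simp only
  rw [h1, verL_rotZ, zpow_zero, one_mul]

end IsEquivariantMap

lemma norm_div_norm {x : ℂ} (hx : x ≠ 0) : ‖x / (‖x‖ : ℂ)‖ = 1 := by
  rw [norm_div, Complex.norm_real, norm_norm, div_self (norm_ne_zero_iff.2 hx)]

lemma div_norm_mul {x : ℂ} (hx : x ≠ 0) : x / (‖x‖ : ℂ) * (‖x‖ : ℝ) = x :=
  div_mul_cancel₀ x (by simpa using hx)

lemma HasMode.eq_modeLift {n : ℤ} {G : ℂ → ℂ} (hG : HasMode n G) {x : ℂ} (hx : x ≠ 0) :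
    G x = modeLift n (fun r => G r) x := by
  conv_lhs => rw [← div_norm_mul hx]
  exact hG _ (norm_div_norm hx) _

lemma HasMode.differentiableAt {n : ℕ} {G : ℂ → ℂ} (hG : HasMode n G) {x : ℂ} (hx : x ≠ 0)
    (hd : DifferentiableAt ℝ (fun r : ℝ => G r) ‖x‖) : DifferentiableAt ℝ G x := by
  have h1 : DifferentiableAt ℝ (fun y : ℂ => ‖y‖) x := (contDiffAt_norm (n := 1) ℝ hx).differentiableAt (by simp)
  have h2 : DifferentiableAt ℝ (fun y : ℂ => ((‖y‖ : ℝ) : ℂ)) x :=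
    Complex.ofRealCLM.differentiableAt.comp x h1
  have h3 : DifferentiableAt ℝ (fun y : ℂ => (y / (‖y‖ : ℂ)) ^ n * G (‖y‖ : ℝ)) x :=
    ((differentiableAt_id.fun_mul (h2.fun_inv (by simpa using hx))).fun_pow n).fun_mul
      (DifferentiableAt.comp x (g := fun r : ℝ => G r) hd h1)
  refine h3.congr_of_eventuallyEq ?_
  filter_upwards [isOpen_ne.mem_nhds hx] with y hy
  rw [hG.eq_modeLift hy, modeLift, zpow_natCast]

lemma norm_sq_rotate (L : ℂ →L[ℝ] E3) {e : ℂ} (he : ‖e‖ = 1) :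
    ‖L 1‖ ^ 2 + ‖L Complex.I‖ ^ 2 = ‖L e‖ ^ 2 + ‖L (Complex.I * e)‖ ^ 2 := by
  have h1 : L e = e.re • L 1 + e.im • L Complex.I := by
    rw [← map_smul, ← map_smul, ← map_add]
    congr 1
    simp
  have h2 : L (Complex.I * e) = (-e.im) • L 1 + e.re • L Complex.I := by
    rw [← map_smul, ← map_smul, ← map_add]
    congr 1
    apply Complex.ext <;> simp
  have h3 : e.re ^ 2 + e.im ^ 2 = 1 := by
    have := congrArg (· ^ 2) he
    simp only [← Complex.normSq_eq_norm_sq, Complex.normSq_apply] at this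
    linarith
  rw [h1, h2, norm_add_sq_real, norm_add_sq_real]
  simp only [norm_smul, real_inner_smul_left, real_inner_smul_right, mul_pow, Real.norm_eq_abs,
    sq_abs]
  linear_combination (-(‖L 1‖ ^ 2 + ‖L Complex.I‖ ^ 2)) * h3

lemma IsEquivariantMap.norm_sq_fderiv {u : ℂ → E3} (h : IsEquivariantMap u) {x : ℂ} (hx : x ≠ 0)
    (hd : HasDerivAt (profile u) (deriv (profile u) ‖x‖) ‖x‖) :
    ‖fderiv ℝ u x 1‖ ^ 2 + ‖fderiv ℝ u x Complex.I‖ ^ 2 =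
      ‖deriv (profile u) ‖x‖‖ ^ 2 + (2 * (‖horL (profile u ‖x‖)‖ / ‖x‖)) ^ 2 := by
  have hx0 : 0 < ‖x‖ := norm_pos_iff.2 hx
  have hh := horL.hasFDerivAt.comp_hasDerivAt _ hd
  have hv := verL.hasFDerivAt.comp_hasDerivAt _ hd
  have dh : DifferentiableAt ℝ (fun y => horL (u y)) x :=
    HasMode.differentiableAt (n := 2) h.hasMode_hor hx hh.differentiableAt
  have dv : DifferentiableAt ℝ (fun y => verL (u y)) x :=
    HasMode.differentiableAt (n := 0) h.hasMode_ver hx hv.differentiableAt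
  have du : DifferentiableAt ℝ u x := by
    refine differentiableAt_euclidean.2 fun j => ?_
    fin_cases j
    · refine (Complex.reCLM.differentiableAt.comp x dh).congr_of_eventuallyEq
        (Eventually.of_forall fun y => ?_)
      simp [horL_apply]
    · refine (Complex.imCLM.differentiableAt.comp x dh).congr_of_eventuallyEq
        (Eventually.of_forall fun y => ?_)
      simp [horL_apply]
    · refine (Complex.reCLM.differentiableAt.comp x dv).congr_of_eventuallyEq
        (Eventually.of_forall fun y => ?_)
      simp [verL_apply]
  set L := fderiv ℝ u x with hL
  have hu : HasFDerivAt u L x := du.hasFDerivAt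
  set e := x / (‖x‖ : ℂ) with he
  have he1 : ‖e‖ = 1 := norm_div_norm hx
  have hex : ((‖x‖ : ℝ) : ℂ) * e = x := by rw [mul_comm]; exact div_norm_mul hx
  -- the radial direction
  have hc : HasDerivAt (fun t : ℝ => u (t * e)) (L e) ‖x‖ := by
    have h1 : HasDerivAt (fun t : ℝ => (t : ℂ) * e) e ‖x‖ := by
      simpa using (Complex.ofRealCLM.hasDerivAt (x := ‖x‖)).mul_const e
    exact hu.comp_hasDerivAt_of_eq ‖x‖ h1 hex.symm
  have e1 : ‖horL (L e)‖ = ‖horL (deriv (profile u) ‖x‖)‖ := by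
    have h1 := (horL.hasFDerivAt.comp_hasDerivAt _ hc)
    have h2 := hh.const_mul (e ^ (2 : ℤ))
    rw [h1.unique (h2.congr_of_eventuallyEq (Eventually.of_forall fun t => ?_)), norm_mul,
      norm_zpow, he1, one_zpow, one_mul]
    have := h.hasMode_hor e he1 t
    simp only [Function.comp_apply, profile]
    rw [mul_comm (t : ℂ)]
    exact this
  have e2 : verL (L e) = verL (deriv (profile u) ‖x‖) := by
    have h1 := (verL.hasFDerivAt.comp_hasDerivAt _ hc)
    refine h1.unique (hv.congr_of_eventuallyEq (Eventually.of_forall fun t => ?_))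
    have := h.hasMode_ver e he1 t
    rw [zpow_zero, one_mul] at this
    simp only [Function.comp_apply, profile]
    rw [mul_comm (t : ℂ)]
    exact this
  -- the angular direction
  have ha : HasDerivAt (fun θ : ℝ => u (Complex.exp (θ * Complex.I) * x)) (L (Complex.I * x)) 0 := by
    have h1 : HasDerivAt (fun θ : ℝ => Complex.exp (θ * Complex.I) * x) (Complex.I * x) 0 := by
      have h0 : HasDerivAt (fun θ : ℝ => (θ : ℂ) * Complex.I) Complex.I 0 := by
        simpa using (Complex.ofRealCLM.hasDerivAt (x := (0 : ℝ))).mul_const Complex.I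
      simpa using h0.cexp.mul_const x
    exact hu.comp_hasDerivAt_of_eq 0 h1 (by simp)
  have hexp : ∀ θ : ℝ, ‖Complex.exp (θ * Complex.I)‖ = 1 := Complex.norm_exp_ofReal_mul_I
  have e3 : ‖horL (L (Complex.I * x))‖ = 2 * ‖horL (profile u ‖x‖)‖ := by
    have h1 := (horL.hasFDerivAt.comp_hasDerivAt _ ha)
    have h2 : HasDerivAt (fun θ : ℝ => Complex.exp (θ * Complex.I) ^ (2 : ℤ) * horL (u x))
        (2 * Complex.I * horL (u x)) 0 := by
      simpa using (hasDerivAt_exp_zpow 2 0).mul_const (horL (u x))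
    rw [h1.unique (h2.congr_of_eventuallyEq (Eventually.of_forall fun t => ?_)), norm_mul, norm_mul,
      Complex.norm_two, Complex.norm_I, mul_one, h.hasMode_hor.norm_eq x]
    · rfl
    · exact h.hasMode_hor _ (hexp t) x
  have e4 : verL (L (Complex.I * x)) = 0 := by
    have h1 := (verL.hasFDerivAt.comp_hasDerivAt _ ha)
    refine h1.unique ((hasDerivAt_const (0 : ℝ) (verL (u x))).congr_of_eventuallyEq
      (Eventually.of_forall fun t => ?_))
    have := h.hasMode_ver _ (hexp t) x
    rwa [zpow_zero, one_mul] at this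
  have e5 : L (Complex.I * x) = ‖x‖ • L (Complex.I * e) := by
    rw [← map_smul, Complex.real_smul, mul_left_comm, hex]
  have e6 : ‖L (Complex.I * e)‖ = 2 * (‖horL (profile u ‖x‖)‖ / ‖x‖) := by
    have h1 := norm_sq_horL_add (L (Complex.I * x))
    rw [e3, e4, norm_zero, e5, norm_smul, norm_norm] at h1
    have h2 : 2 * ‖horL (profile u ‖x‖)‖ = ‖x‖ * ‖L (Complex.I * e)‖ :=
      (sq_eq_sq₀ (by positivity) (by positivity)).1 (by linarith)
    field_simp
    linarith
  rw [norm_sq_rotate L he1, e6, ← norm_sq_horL_add (L e), e1, e2, norm_sq_horL_add]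

lemma radNorm_sq_eq (f : ℝ → ℂ) : radNorm f ^ 2 = ∫⁻ r, ‖f r‖ₑ ^ 2 ∂radialMeasure :=
  eLpNorm_two_sq radialMeasure f

lemma IsEquivariantMap.radNorm_le {u : ℂ → E3} (h : IsEquivariantMap u) {δ : ℝ} (hδ : |δ| ≤ 1)
    (hE : energy u ≤ ENNReal.ofReal (8 * Real.pi + δ ^ 2)) {q : ℝ → ℂ}
    (hqm : AEStronglyMeasurable q radialMeasure)
    (hq : ∀ᵐ r : ℝ, 0 < r → ‖q r‖ ≤ ‖deriv (profile u) r‖) :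
    radNorm q ≤ 6 ∧ radNorm (fun r => horL (profile u r) / r) ≠ ⊤ := by
  obtain ⟨hd, hc⟩ := h.locallyAC.acDeriv_coord
  have hhm : AEStronglyMeasurable (fun r => horL (profile u r) / r) radialMeasure :=
    aesm_div ((hc 0).aesm.add ((hc 1).aesm.const_mul Complex.I))
  have h1 : ∀ᵐ x : ℂ, ‖q ‖x‖‖ₑ ^ 2 + ‖horL (profile u ‖x‖) / (‖x‖ : ℝ)‖ₑ ^ 2 ≤
      ‖fderiv ℝ u x 1‖ₑ ^ 2 + ‖fderiv ℝ u x Complex.I‖ₑ ^ 2 := by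
    filter_upwards [quasiMeasurePreserving_norm.ae (ae_radialMeasure_iff.2 (hd.and hq |>.mono
      fun r hr (h0 : 0 < r) => And.intro (hr.1 h0) (hr.2 h0))), ae_ne_zero] with x hx hx0
    have := h.norm_sq_fderiv hx0 hx.1
    simp_rw [← ofReal_norm]
    simp only [← ENNReal.ofReal_pow (norm_nonneg _)]
    rw [← ENNReal.ofReal_add (by positivity) (by positivity),
      ← ENNReal.ofReal_add (by positivity) (by positivity), this]
    refine ENNReal.ofReal_le_ofReal (add_le_add (pow_le_pow_left₀ (norm_nonneg _) hx.2 2)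
      (pow_le_pow_left₀ (norm_nonneg _) ?_ 2))
    rw [norm_div, Complex.norm_real, norm_norm]
    linarith [show 0 ≤ ‖horL (profile u ‖x‖)‖ / ‖x‖ by positivity]
  have hm1 : AEMeasurable (fun r => ‖q r‖ₑ ^ 2) radialMeasure := hqm.enorm.pow_const 2
  have hm2 : AEMeasurable (fun r => ‖horL (profile u r) / r‖ₑ ^ 2) radialMeasure :=
    hhm.enorm.pow_const 2
  have h2 : ∫⁻ x : ℂ, ‖q ‖x‖‖ₑ ^ 2 + ‖horL (profile u ‖x‖) / (‖x‖ : ℝ)‖ₑ ^ 2 =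
      ENNReal.ofReal (2 * Real.pi) *
        (radNorm q ^ 2 + radNorm (fun r => horL (profile u r) / r) ^ 2) := by
    have e1 := lintegral_comp_norm (φ := fun r => ‖q r‖ₑ ^ 2 + ‖horL (profile u r) / r‖ₑ ^ 2) (by
      refine (aemeasurable_restrict_of_aesm hqm).enorm.pow_const 2 |>.add
        ((aemeasurable_restrict_of_aesm hhm).enorm.pow_const 2))
    rw [lintegral_add_left' hm1, ← radNorm_sq_eq, ← radNorm_sq_eq] at e1
    exact e1
  have h3 : ∫⁻ x : ℂ, (‖fderiv ℝ u x 1‖ₑ ^ 2 + ‖fderiv ℝ u x Complex.I‖ₑ ^ 2) = 2 * energy u := by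
    rw [energy, ← mul_assoc, one_div, ENNReal.mul_inv_cancel (by simp) (by simp), one_mul]
  have h4 := lintegral_mono_ae h1
  rw [h2, h3] at h4
  have hpi := Real.pi_pos
  have hδ2 : δ ^ 2 ≤ 1 := by rw [← sq_abs]; exact pow_le_one₀ (abs_nonneg _) hδ
  have h5 : ENNReal.ofReal (2 * Real.pi) *
      (radNorm q ^ 2 + radNorm (fun r => horL (profile u r) / r) ^ 2) ≤
      ENNReal.ofReal (2 * Real.pi) * 36 := by
    refine h4.trans ((mul_le_mul_right hE 2).trans ?_)
    rw [show (2 : ℝ≥0∞) = ENNReal.ofReal 2 by simp, show (36 : ℝ≥0∞) = ENNReal.ofReal 36 by simp,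
      ← ENNReal.ofReal_mul (by norm_num), ← ENNReal.ofReal_mul (by positivity)]
    exact ENNReal.ofReal_le_ofReal (by nlinarith [Real.pi_gt_three])
  rw [ENNReal.mul_le_mul_iff_right (by simpa using hpi) ENNReal.ofReal_ne_top] at h5
  constructor
  · rw [← ENNReal.pow_le_pow_left_iff two_ne_zero]
    refine (le_self_add.trans h5).trans (by norm_num)
  · intro ht
    rw [ht] at h5
    simp at h5

/-! ### The derivative field in the Coulomb frame -/

lemma IsEquivariantMap.angularDeriv_eq {u : ℂ → E3} (h : IsEquivariantMap u) (r : ℝ) :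
    angularDeriv u r = (2 : ℝ) • !₂[-(profile u r 1), profile u r 0, 0] := by
  set p := profile u r with hp
  have e : (fun θ : ℝ => u (r * Complex.exp (θ * Complex.I))) = fun θ =>
      Real.cos (2 * θ) • (!₂[p 0, p 1, 0] : E3) + Real.sin (2 * θ) • (!₂[-(p 1), p 0, 0] : E3) +
        !₂[0, 0, p 2] := by
    funext θ
    rw [mul_comm, h.equivariant]
    ext j
    fin_cases j <;> simp [rotZ, hp, profile] <;> ring
  have h1 : HasDerivAt (fun θ : ℝ => 2 * θ) 2 0 := by simpa using (hasDerivAt_id (0 : ℝ)).const_mul 2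
  have h2 := ((h1.cos.smul_const (!₂[p 0, p 1, 0] : E3)).add
    (h1.sin.smul_const (!₂[-(p 1), p 0, 0] : E3))).add_const (!₂[0, 0, p 2] : E3)
  rw [angularDeriv, e]
  refine (HasDerivAt.deriv h2).trans ?_
  simp

lemma cross_coord {p a b : E3} (h : cross p a = b) :
    b 0 = p 1 * a 2 - p 2 * a 1 ∧ b 1 = p 2 * a 0 - p 0 * a 2 ∧ b 2 = p 0 * a 1 - p 1 * a 0 := by
  subst h
  simp [cross, cross_apply]

namespace IsCoulombFrame

variable {u : ℂ → E3} {v w : ℝ → E3}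

/-- The rows of the tangent frame. -/
def row (v w : ℝ → E3) (j : Fin 3) (r : ℝ) : ℂ := v r j + Complex.I * w r j

/-- The coordinates of the map. -/
def coord (u : ℂ → E3) (j : Fin 3) (r : ℝ) : ℂ := profile u r j

lemma cross_row (h : IsCoulombFrame u v w) (hu : ∀ x, ‖u x‖ = 1) {r : ℝ} (hr : 0 < r) :
    row v w 2 r = Complex.I * (row v w 1 r * coord u 0 r - row v w 0 r * coord u 1 r) := by
  obtain ⟨c0, c1, c2⟩ := cross_coord (h.cross_uv r hr)
  have n := congrArg (· ^ 2) (hu r)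
  have i2 := h.inner_uv r hr
  simp only [norm_sq_eq, one_pow] at n
  rw [inner_eq] at i2
  have hv : v r 2 = w r 0 * profile u r 1 - w r 1 * profile u r 0 := by
    rw [c0, c1]
    simp only [profile] at *
    linear_combination (-(v r 2)) * n + u r 2 * i2
  rw [row, row, row, coord, coord, c2, hv]
  push_cast
  linear_combination (w r 0 * profile u r 1 - w r 1 * profile u r 0 : ℂ) * Complex.I_sq

lemma gaugeField_eq (h : IsCoulombFrame u v w) (hu : IsEquivariantMap u) {r : ℝ} (hr : 0 < r) :
    psi2 u v w r = -2 * Complex.I * row v w 2 r := by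
  obtain ⟨c0, c1, c2⟩ := cross_coord (h.cross_uv r hr)
  have n := congrArg (· ^ 2) (hu.norm_eq_one r)
  have i2 := h.inner_uv r hr
  simp only [norm_sq_eq, one_pow] at n
  rw [inner_eq] at i2
  have e1 : ⟪angularDeriv u r, v r⟫ = 2 * w r 2 := by
    rw [hu.angularDeriv_eq, inner_eq, c2]
    simp
    ring
  have e2 : ⟪angularDeriv u r, w r⟫ = -2 * v r 2 := by
    rw [hu.angularDeriv_eq, inner_eq, c0, c1]
    simp only [profile] at *
    simp
    linear_combination (-2 * v r 2) * n + 2 * u r 2 * i2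
  rw [psi2, e1, e2, row]
  push_cast
  linear_combination (2 * w r 2 : ℂ) * Complex.I_sq

end IsCoulombFrame

namespace IsCoulombFrame

variable {u : ℂ → E3} {v w : ℝ → E3}

lemma isFrame (h : IsCoulombFrame u v w) (hu : IsEquivariantMap u) {δ : ℝ} (hδ : |δ| ≤ 1)
    (hE : energy u ≤ ENNReal.ofReal (8 * Real.pi + δ ^ 2)) :
    IsFrame (row v w) (coord u) (psi1 u v w) ∧
      radNorm (fun r => (coord u 0 r + Complex.I * coord u 1 r) / r) ≠ ⊤ := by
  obtain ⟨du, cu⟩ := hu.locallyAC.acDeriv_coord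
  obtain ⟨dv, cv⟩ := h.locallyAC_v.acDeriv_coord
  obtain ⟨dw, cw⟩ := h.locallyAC_w.acDeriv_coord
  have hex := fun {r : ℝ} (hr : 0 < r) => h.expand hu.norm_eq_one hr
  have hrow := fun {r : ℝ} (hr : 0 < r) => h.rows hu.norm_eq_one hr
  have huu : ∀ r, 0 < r → ⟪profile u r, profile u r⟫ = 1 := fun r _ => by
    rw [real_inner_self_eq_norm_sq, profile, hu.norm_eq_one, one_pow]
  have hvv : ∀ r, 0 < r → ⟪v r, v r⟫ = 1 := fun r hr => by
    rw [real_inner_self_eq_norm_sq, h.norm_v r hr, one_pow]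
  have hww : ∀ r, 0 < r → ⟪w r, w r⟫ = 1 := fun r hr => by
    rw [real_inner_self_eq_norm_sq, h.norm_w r hr, one_pow]
  set a := fun r => ⟪deriv (profile u) r, v r⟫ with ha
  set b := fun r => ⟪deriv (profile u) r, w r⟫ with hb
  have hq : ∀ r, psi1 u v w r = a r + Complex.I * b r := fun r => rfl
  have hU : ∀ᵐ r : ℝ, 0 < r → ∀ j, deriv (profile u) r j = a r * v r j + b r * w r j := by
    filter_upwards [du] with r d hr j
    have e := inner_deriv hr huu (d hr) (d hr)
    rw [real_inner_comm] at e
    rw [hex hr (deriv (profile u) r) j, show ⟪deriv (profile u) r, profile u r⟫ = 0 by linarith]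
    ring
  have hW : ∀ᵐ r : ℝ, 0 < r → ∀ j, deriv v r j = -(a r * profile u r j) ∧
      deriv w r j = -(b r * profile u r j) := by
    filter_upwards [du, dv, dw, h.coulomb] with r d1 d2 d3 hc hr j
    have e1 := inner_deriv hr hvv (d2 hr) (d2 hr)
    have e2 := inner_deriv hr hww (d3 hr) (d3 hr)
    have e3 := inner_deriv hr h.inner_vw (d2 hr) (d3 hr)
    have e4 := inner_deriv hr h.inner_uv (d1 hr) (d2 hr)
    have e5 := inner_deriv hr h.inner_uw (d1 hr) (d3 hr)
    rw [real_inner_comm] at e1 e2 e4 e5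
    rw [real_inner_comm] at e3
    have hc := hc hr
    rw [hex hr (deriv v r) j, hex hr (deriv w r) j, show ⟪deriv v r, v r⟫ = 0 by linarith,
      show ⟪deriv w r, w r⟫ = 0 by linarith, hc, show ⟪deriv w r, v r⟫ = 0 by linarith,
      show ⟪deriv v r, profile u r⟫ = -a r by simp only [ha]; linarith,
      show ⟪deriv w r, profile u r⟫ = -b r by simp only [hb]; linarith]
    constructor <;> ring
  have hcol : ∀ r, 0 < r → v r 0 * v r 0 + v r 1 * v r 1 + v r 2 * v r 2 = 1 ∧
      w r 0 * w r 0 + w r 1 * w r 1 + w r 2 * w r 2 = 1 ∧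
      v r 0 * w r 0 + v r 1 * w r 1 + v r 2 * w r 2 = 0 ∧
      profile u r 0 * v r 0 + profile u r 1 * v r 1 + profile u r 2 * v r 2 = 0 ∧
      profile u r 0 * w r 0 + profile u r 1 * w r 1 + profile u r 2 * w r 2 = 0 := fun r hr => by
    have e1 := hvv r hr
    have e2 := hww r hr
    have e3 := h.inner_vw r hr
    have e4 := h.inner_uv r hr
    have e5 := h.inner_uw r hr
    rw [inner_eq] at e1 e2 e3 e4 e5
    exact ⟨e1, e2, e3, e4, e5⟩
  have hqm : AEStronglyMeasurable (psi1 u v w) radialMeasure := by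
    have hm : AEStronglyMeasurable (fun r => (deriv (profile u) r 0 : ℂ) * row v w 0 r +
        (deriv (profile u) r 1 : ℂ) * row v w 1 r + (deriv (profile u) r 2 : ℂ) * row v w 2 r)
        radialMeasure := by
      have hr : ∀ j, AEStronglyMeasurable (row v w j) radialMeasure := fun j =>
        (cv j).aesm.add ((cw j).aesm.const_mul _)
      exact (((cu 0).aesm_deriv.mul (hr 0)).add ((cu 1).aesm_deriv.mul (hr 1))).add
        ((cu 2).aesm_deriv.mul (hr 2))
    refine hm.congr (Eventually.of_forall fun r => ?_)
    simp only [psi1, row, inner_eq]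
    push_cast
    ring
  obtain ⟨hN, hfin⟩ := hu.radNorm_le hδ hE hqm (by
    filter_upwards [hU] with r hr h0
    have hr := hr h0
    have hc := hcol r h0
    rw [← abs_of_nonneg (norm_nonneg (psi1 u v w r)), ← abs_of_nonneg (norm_nonneg (deriv _ _)),
      ← sq_le_sq, norm_sq_eq, hr 0, hr 1, hr 2, ← Complex.normSq_eq_norm_sq, hq,
      Complex.normSq_apply]
    simp
    refine le_of_eq ?_
    linear_combination (-(a r ^ 2)) * hc.1 - b r ^ 2 * hc.2.1 - 2 * a r * b r * hc.2.2.1)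
  refine ⟨⟨fun j r _ => Complex.conj_ofReal _, fun j => ?_, fun j => ?_, fun r hr i j => ?_,
    fun r hr => ?_, fun r hr => ?_, fun r hr => ?_, fun r hr => ?_, hN⟩, hfin⟩
  · refine (cu j).congr_deriv (hU.mono fun r hr h0 => ?_)
    rw [hr h0 j, hq, row]
    simp only [map_add, map_mul, Complex.conj_ofReal, Complex.conj_I]
    push_cast
    linear_combination (b r * w r j : ℂ) * Complex.I_sq
  · refine ((cv j).add ((cw j).const_mul Complex.I)).congr_deriv (hW.mono fun r hr h0 => ?_)
    rw [(hr h0 j).1, (hr h0 j).2, hq, coord]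
    push_cast
    ring
  · have e := congrArg (fun x : ℝ => (x : ℂ)) (hrow hr i j)
    simp only [row, coord, map_add, map_mul, Complex.conj_ofReal, Complex.conj_I]
    split_ifs at e ⊢ <;> push_cast at e <;> linear_combination e + (-(w r i * w r j) : ℂ) * Complex.I_sq
  · have e := congrArg (fun x : ℝ => (x : ℂ)) (huu r hr)
    rw [inner_eq] at e
    push_cast at e
    exact e
  · obtain ⟨-, -, -, e1, e2⟩ := hcol r hr
    have e1 := congrArg (fun x : ℝ => (x : ℂ)) e1
    have e2 := congrArg (fun x : ℝ => (x : ℂ)) e2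
    push_cast at e1 e2
    simp only [row, coord]
    linear_combination e1 + Complex.I * e2
  · obtain ⟨e1, e2, e3, -, -⟩ := hcol r hr
    have e1 := congrArg (fun x : ℝ => (x : ℂ)) e1
    have e2 := congrArg (fun x : ℝ => (x : ℂ)) e2
    have e3 := congrArg (fun x : ℝ => (x : ℂ)) e3
    push_cast at e1 e2 e3
    simp only [row]
    linear_combination e1 + Complex.I ^ 2 * e2 + Complex.I_sq + 2 * Complex.I * e3
  · obtain ⟨e1, e2, e3, -, -⟩ := hcol r hr
    have e1 := congrArg (fun x : ℝ => (x : ℂ)) e1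
    have e2 := congrArg (fun x : ℝ => (x : ℂ)) e2
    push_cast at e1 e2
    simp only [row, map_add, map_mul, Complex.conj_ofReal, Complex.conj_I]
    linear_combination e1 - Complex.I ^ 2 * e2 - Complex.I_sq

end IsCoulombFrame

/-! ### Limits at infinity -/

lemma tendsto_h1_h3 {lam : ℝ} (hl : 0 < lam) :
    Tendsto (fun r => h1 (lam * r)) atTop (𝓝 0) ∧ Tendsto (fun r => h3 (lam * r)) atTop (𝓝 1) := by
  have hx : Tendsto (fun r : ℝ => lam * r) atTop atTop := tendsto_id.const_mul_atTop hl
  have hp : ∀ n : ℕ, n ≠ 0 → Tendsto (fun r : ℝ => 2 / ((lam * r) ^ n + 1)) atTop (𝓝 0) := fun n hn =>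
    tendsto_const_nhds.div_atTop
      (tendsto_atTop_add_const_right _ 1 ((tendsto_pow_atTop hn).comp hx))
  constructor
  · have h2 := (hp 2 two_ne_zero).const_mul 2
    rw [mul_zero] at h2
    refine squeeze_zero' (Eventually.of_forall fun r => h1_nonneg _) ?_ h2
    filter_upwards [eventually_gt_atTop 0] with r hr
    refine (h1_le_weight (mul_pos hl hr)).1.trans (le_of_eq ?_)
    ring
  · have h4 := (hp 4 (by norm_num)).const_sub 1
    rw [sub_zero] at h4
    refine h4.congr fun r => ?_
    have : (lam * r) ^ 4 + 1 ≠ 0 := by positivity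
    rw [h3]
    field_simp
    ring

lemma tendsto_sol_sub {u : ℂ → E3} {v w : ℝ → E3} (h : IsCoulombFrame u v w)
    (hu : IsEquivariantMap u) (α : ℝ) {lam : ℝ} (hl : 0 < lam) (j : Fin 3) :
    Tendsto (fun r => solW α lam j r - IsCoulombFrame.row v w j r) atTop (𝓝 0) ∧
    Tendsto (fun r => solU α lam j r - IsCoulombFrame.coord u j r) atTop (𝓝 0) := by
  obtain ⟨t1, t3⟩ := tendsto_h1_h3 hl
  have t1 := (Complex.continuous_ofReal.tendsto _).comp t1
  have t3 := (Complex.continuous_ofReal.tendsto _).comp t3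
  simp only [Function.comp_def, Complex.ofReal_zero, Complex.ofReal_one] at t1 t3
  have hc : ∀ {f : ℝ → E3} {p : E3}, Tendsto f atTop (𝓝 p) →
      Tendsto (fun r => (f r j : ℂ)) atTop (𝓝 (p j : ℂ)) := fun hf =>
    ((Complex.continuous_ofReal.comp (EuclideanSpace.proj (𝕜 := ℝ) j).continuous).tendsto _).comp hf
  have hrow : Tendsto (IsCoulombFrame.row v w j) atTop (𝓝 (vecI j + Complex.I * vecJ j)) :=
    (hc h.tendsto_v).add ((hc h.tendsto_w).const_mul _)
  have hco : Tendsto (IsCoulombFrame.coord u j) atTop (𝓝 (vecK j : ℂ)) := hc hu.tendsto_infty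
  have hz : Complex.exp (2 * α * Complex.I) * (Real.cos (2 * α) - Complex.I * Real.sin (2 * α)) = 1 := by
    have := conj_phase α
    rw [show (2 * α * Complex.I : ℂ) = ((2 * α : ℝ) : ℂ) * Complex.I by push_cast; ring,
      Complex.exp_mul_I, ← Complex.ofReal_cos, ← Complex.ofReal_sin] at this ⊢
    simp only [map_add, map_mul, Complex.conj_ofReal, Complex.conj_I] at this
    linear_combination this
  constructor
  · rw [← sub_self (vecI j + Complex.I * vecJ j : ℂ)]
    refine Tendsto.sub ?_ hrow
    fin_cases j
    · have := ((t3.const_mul (Real.cos (2 * α) : ℂ)).sub_const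
        (Complex.I * Real.sin (2 * α))).const_mul (Complex.exp (2 * α * Complex.I))
      rw [mul_one, hz] at this
      have h0 : Tendsto (solW α lam 0) atTop (𝓝 1) := this
      simpa [vecI, vecJ] using h0
    · have := ((t3.const_mul (Real.sin (2 * α) : ℂ)).add_const
        (Complex.I * Real.cos (2 * α))).const_mul (Complex.exp (2 * α * Complex.I))
      rw [mul_one, show Complex.exp (2 * α * Complex.I) * ((Real.sin (2 * α) : ℂ) +
        Complex.I * Real.cos (2 * α)) = Complex.I by
          linear_combination Complex.I * hz + Complex.exp (2 * α * Complex.I) * Real.sin (2 * α) *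
            Complex.I_sq] at this
      have h0 : Tendsto (solW α lam 1) atTop (𝓝 Complex.I) := this
      simpa [vecI, vecJ] using h0
    · have := t1.neg.const_mul (Complex.exp (2 * α * Complex.I))
      rw [neg_zero, mul_zero] at this
      have h0 : Tendsto (solW α lam 2) atTop (𝓝 0) := this
      simpa [vecI, vecJ] using h0
  · rw [← sub_self (vecK j : ℂ)]
    refine Tendsto.sub ?_ hco
    fin_cases j
    · have := t1.const_mul (Real.cos (2 * α) : ℂ)
      rw [mul_zero] at this
      have h0 : Tendsto (solU α lam 0) atTop (𝓝 0) := this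
      simpa [vecK] using h0
    · have := t1.const_mul (Real.sin (2 * α) : ℂ)
      rw [mul_zero] at this
      have h0 : Tendsto (solU α lam 1) atTop (𝓝 0) := this
      simpa [vecK] using h0
    · have h0 : Tendsto (solU α lam 2) atTop (𝓝 1) := t3
      simpa [vecK] using h0

open IsCoulombFrame

/-! ### The difference of the map and the soliton -/

/-- The derivative of the `j`-th coordinate of the map, in terms of the frame. -/
def dcoord (W : Fin 3 → ℝ → ℂ) (q : ℝ → ℂ) (j : Fin 3) (r : ℝ) : ℂ :=
  (conj (q r) * W j r + q r * conj (W j r)) / 2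

lemma conj_dcoord (W : Fin 3 → ℝ → ℂ) (q : ℝ → ℂ) (j : Fin 3) (r : ℝ) :
    conj (dcoord W q j r) = dcoord W q j r := by
  simp only [dcoord, map_div₀, map_add, map_mul, Complex.conj_conj, map_ofNat]
  ring

lemma dcoord_soliton (α lam : ℝ) (j : Fin 3) {r : ℝ} :
    dcoord (solW α lam) (solq α lam) j r =
      -2 * h3 (lam * r) * solU α lam j r / r + if j = 2 then 2 / (r : ℂ) else 0 := by
  have hz := conj_phase α
  have hh : (h1 (lam * r) : ℂ) ^ 2 + (h3 (lam * r) : ℂ) ^ 2 = 1 := by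
    exact_mod_cast h1_sq_add_h3_sq (lam * r)
  simp only [dcoord, solW, solq, solU]
  fin_cases j <;>
    simp only [map_mul, map_neg, map_div₀, map_sub, map_add, Complex.conj_ofReal, Complex.conj_I,
      map_ofNat, Fin.zero_eta, Fin.mk_one, Fin.reduceFinMk, Matrix.cons_val, Fin.reduceEq, if_false,
      if_true]
  · linear_combination (-2 * Real.cos (2 * α) * h1 (lam * r) * h3 (lam * r) / r : ℂ) * hz
  · linear_combination (-2 * Real.sin (2 * α) * h1 (lam * r) * h3 (lam * r) / r : ℂ) * hz
  · linear_combination (2 * (h1 (lam * r) : ℂ) ^ 2 / r : ℂ) * hz + 2 / r * hh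

lemma soliton_hor (α lam : ℝ) (x : ℂ) : horL (soliton α lam x) =
    equivariantLift (fun r => solU α lam 0 r + Complex.I * solU α lam 1 r) x := by
  rw [soliton, horL_rotZ, horL_rotZ, equivariantLift]
  have e : horL !₂[h1 (lam * ‖x‖), 0, h3 (lam * ‖x‖)] = h1 (lam * ‖x‖) := by simp [horL_apply]
  have e1 : solU α lam 0 ‖x‖ + Complex.I * solU α lam 1 ‖x‖ =
      Complex.exp ((2 * α : ℝ) * Complex.I) * h1 (lam * ‖x‖) := by
    rw [Complex.exp_mul_I, ← Complex.ofReal_cos, ← Complex.ofReal_sin]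
    simp only [solU, Matrix.cons_val]
    ring
  rw [e, e1]
  push_cast
  rw [show (2 * Complex.I * Complex.arg x : ℂ) = 2 * Complex.arg x * Complex.I by ring]
  ring

lemma soliton_ver (α lam : ℝ) (x : ℂ) : verL (soliton α lam x) = solU α lam 2 ‖x‖ := by
  rw [soliton, verL_rotZ, verL_rotZ, verL_apply]
  simp [solU]

lemma norm_soliton (α lam : ℝ) {x : ℂ} (hx : x ≠ 0) : ‖soliton α lam x‖ ^ 2 = 1 := by
  rw [← norm_sq_horL_add, soliton_hor, soliton_ver, equivariantLift_eq _ hx, norm_modeLift _ _ hx,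
    ← h1_sq_add_h3_sq (lam * ‖x‖)]
  have e : solU α lam 0 ‖x‖ + Complex.I * solU α lam 1 ‖x‖ =
      Complex.exp ((2 * α : ℝ) * Complex.I) * h1 (lam * ‖x‖) := by
    rw [Complex.exp_mul_I, ← Complex.ofReal_cos, ← Complex.ofReal_sin]
    simp only [solU, Matrix.cons_val]
    ring
  rw [e, norm_mul, Complex.norm_exp_ofReal_mul_I, one_mul, Complex.norm_real, Real.norm_eq_abs,
    sq_abs]
  simp only [solU, Matrix.cons_val, Complex.norm_real, Real.norm_eq_abs, sq_abs]

/-- The horizontal part of the difference of two systems of coordinates. -/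
def horDiff (U Q : Fin 3 → ℝ → ℂ) (r : ℝ) : ℂ := U 0 r - Q 0 r + Complex.I * (U 1 r - Q 1 r)

lemma hor_sub_soliton {u : ℂ → E3} (hu : IsEquivariantMap u) (α lam : ℝ) {x : ℂ} (hx : x ≠ 0) :
    horL ((u - soliton α lam) x) = modeLift 2 (horDiff (coord u) (solU α lam)) x := by
  rw [Pi.sub_apply, map_sub, soliton_hor, equivariantLift_eq _ hx, hu.hasMode_hor.eq_modeLift hx]
  simp only [modeLift, horL_apply, coord, profile, horDiff]
  ring

lemma ver_sub_soliton {u : ℂ → E3} (hu : IsEquivariantMap u) (α lam : ℝ) {x : ℂ} (hx : x ≠ 0) :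
    verL ((u - soliton α lam) x) = modeLift 0 (fun r => coord u 2 r - solU α lam 2 r) x := by
  rw [Pi.sub_apply, map_sub, soliton_ver, hu.hasMode_ver.eq_modeLift hx]
  simp only [modeLift, verL_apply, coord, profile, zpow_zero, one_mul]

lemma IsFrame.isBesov_gauge {W U : Fin 3 → ℝ → ℂ} {q : ℝ → ℂ} {α lam : ℝ} {B : ℝ≥0∞}
    (h : IsFrame W U q) (hl : 0 < lam)
    (hW : ∀ r, 0 < r → W 2 r = Complex.I * (W 1 r * U 0 r - W 0 r * U 1 r)) (hB : B ≠ ⊤)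
    (hd : ∀ j, IsBesov (fun r => dcoord W q j r - dcoord (solW α lam) (solq α lam) j r) B)
    (hdiv : ∀ j, j ≠ 2 → IsBesov (fun r => (U j r - solU α lam j r) / r) B)
    (hlim : Tendsto (fun r => U 2 r - solU α lam 2 r) atTop (𝓝 0)) :
    IsBesov (fun r => q r - 2 * W 2 r / r) (10 ^ 10 * B) := by
  have h' := isFrame_soliton α hl
  have f0 := hdiv 0 (by decide)
  have f1 := hdiv 1 (by decide)
  have hac : ACDeriv (fun r => U 2 r - solU α lam 2 r)
      (fun r => dcoord W q 2 r - dcoord (solW α lam) (solq α lam) 2 r) := (h.acU 2).sub (h'.acU 2)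
  have hm : IsMult (fun r => U 2 r - solU α lam 2 r) 12 :=
    ((h.isMult_U 2).sub (h'.isMult_U 2)).mono (by norm_num)
  have hm' : IsMult (fun r => U 2 r - solU α lam 2 r) (3 * B) :=
    .of_acDeriv hac (fun r hr => (hd 2).primitive_bound hB hac hlim hr)
      ((hd 2).radNorm_le.trans (le_mul_of_one_le_left zero_le (by norm_num)))
  have T1 := IsFrame.isBesov_sum fun j => (hd j).mul (h.isMult_W j) (by simp)
  have T2 := (f0.mul (h.isMult_W 0) (by simp)).add (f1.mul (h.isMult_W 1) (by simp))
  have T3 := ((f0.mul (h.isMult_W 1) (by simp)).sub (f1.mul (h.isMult_W 0) (by simp))).mul hm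
    (by simp)
  have T4 := (((isBesov_solU_div α hl (j := 0) (by decide)).mul (h.isMult_W 1) (by simp)).sub
    ((isBesov_solU_div α hl (j := 1) (by decide)).mul (h.isMult_W 0) (by simp))).mul hm'
      (by finiteness)
  have T := T1.add (((T2.add ((T3.add T4).const_mul Complex.I)).mul (h'.isMult_U 2)
    (by simp)).const_mul 2)
  refine (T.mono ?_).congr (Eventually.of_forall fun r hr => ?_)
  · rw [← ofReal_norm, ← ofReal_norm, Complex.norm_I, Complex.norm_two]
    simp only [ENNReal.ofReal_one, ENNReal.ofReal_ofNat]
    ring_nf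
    gcongr
    norm_num
  · have e := h.sum_deriv hr
    have ed := fun j => dcoord_soliton α lam j (r := r)
    have hdot := h.dot r hr
    have hr0 : (r : ℂ) ≠ 0 := by exact_mod_cast hr.ne'
    have e2 : solU α lam 2 r = h3 (lam * r) := rfl
    have ed2 : dcoord (solW α lam) (solq α lam) 2 r =
      -2 * h3 (lam * r) * solU α lam 2 r / r + 2 / (r : ℂ) := by rw [ed 2, if_pos rfl]
    have ed0 : dcoord (solW α lam) (solq α lam) 0 r =
      -2 * h3 (lam * r) * solU α lam 0 r / r := by rw [ed 0, if_neg (by decide), add_zero]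
    have ed1 : dcoord (solW α lam) (solq α lam) 1 r =
      -2 * h3 (lam * r) * solU α lam 1 r / r := by rw [ed 1, if_neg (by decide), add_zero]
    rw [Fin.sum_univ_three] at e ⊢
    change W 0 r * dcoord W q 0 r + W 1 r * dcoord W q 1 r + W 2 r * dcoord W q 2 r = q r at e
    rw [ed0, ed1, ed2, ← e2]
    linear_combination e + 2 * solU α lam 2 r / r * hdot -
      2 * solU α lam 2 r * (U 2 r - solU α lam 2 r) / r * hW r hr

lemma scalarX_congr {m : ℝ → ℝ} (hm : IsDyadicCutoff m) {F G : ℂ → ℂ}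
    (h : ∀ x, x ≠ 0 → F x = G x) : scalarX m F = scalarX m G := by
  unfold scalarX
  simp_rw [hm.lpProj_eq]
  exact tsum_congr fun k => by rw [conv_congr_ae _ (ae_ne_zero.mono h)]

lemma isProfile_hor {W U V Q : Fin 3 → ℝ → ℂ} {q q₀ : ℝ → ℂ} (h : IsFrame W U q)
    (h' : IsFrame V Q q₀) : IsProfile (horDiff U Q) (fun r => dcoord W q 0 r - dcoord V q₀ 0 r +
      Complex.I * (dcoord W q 1 r - dcoord V q₀ 1 r)) ∧
    IsProfile (fun r => U 2 r - Q 2 r) (fun r => dcoord W q 2 r - dcoord V q₀ 2 r) := by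
  have ha := fun j => (h.acU j).sub (h'.acU j)
  have hb : ∀ j r, 0 < r → ‖U j r - Q j r‖ ≤ 2 := fun j r hr =>
    (norm_sub_le _ _).trans (by linarith [h.norm_U_le j hr, h'.norm_U_le j hr])
  have hN : ∀ j, radNorm (fun r => dcoord W q j r - dcoord V q₀ j r) ≤ 12 := fun j =>
    (radNorm_sub_le (h.acU j).aesm_deriv (h'.acU j).aesm_deriv).trans
      ((add_le_add (h.radNorm_deriv j) (h'.radNorm_deriv j)).trans (by norm_num))
  refine ⟨⟨(ha 0).add ((ha 1).const_mul Complex.I), ⟨4, fun r hr => ?_⟩, ?_⟩,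
    ⟨ha 2, ⟨2, hb 2⟩, ne_top_of_le_ne_top (by simp) (hN 2)⟩⟩
  · refine (norm_add_le _ _).trans ?_
    rw [norm_mul, Complex.norm_I, one_mul]
    linarith [hb 0 r hr, hb 1 r hr]
  · refine ne_top_of_le_ne_top ?_ ((radNorm_add_le (ha 0).aesm_deriv
      ((ha 1).aesm_deriv.const_mul Complex.I)).trans (add_le_add (hN 0) (le_of_eq
        (radNorm_const_mul Complex.I _))))
    refine ENNReal.add_ne_top.2 ⟨by simp, ENNReal.mul_ne_top (by simp)
      (ne_top_of_le_ne_top (by simp) (hN 1))⟩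

lemma IsBesov.of_add_I_mul {x y : ℝ → ℂ} {B : ℝ≥0∞}
    (h : IsBesov (fun r => x r + Complex.I * y r) B) (hx : ∀ r, 0 < r → conj (x r) = x r)
    (hy : ∀ r, 0 < r → conj (y r) = y r) : IsBesov x (36 * B) ∧ IsBesov y (36 * B) := by
  constructor
  · refine ((h.add h.conj).half.mono ?_).congr (Eventually.of_forall fun r hr => ?_)
    · calc 3 * (B + B) = 6 * B := by ring
        _ ≤ 36 * B := by gcongr; norm_num
    · rw [map_add, map_mul, hx r hr, hy r hr, Complex.conj_I]; ring
  · refine (((h.sub h.conj).half.const_mul (-Complex.I)).mono ?_).congr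
      (Eventually.of_forall fun r hr => ?_)
    · rw [← ofReal_norm, norm_neg, Complex.norm_I, ENNReal.ofReal_one]
      exact le_of_eq (by ring)
    · rw [map_add, map_mul, hx r hr, hy r hr, Complex.conj_I]
      linear_combination -(y r) * Complex.I_sq

lemma aesm_sub_soliton {u : ℂ → E3} (hu : IsEquivariantMap u) (α : ℝ) {lam : ℝ} (hl : 0 < lam)
    {W : Fin 3 → ℝ → ℂ} {q : ℝ → ℂ} (h : IsFrame W (coord u) q) :
    AEStronglyMeasurable (u - soliton α lam) := by
  obtain ⟨h1, h2⟩ := isProfile_hor h (isFrame_soliton α hl)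
  have hc : Continuous fun p : ℂ × ℂ => (!₂[p.1.re, p.1.im, p.2.re] : E3) :=
    (PiLp.continuous_toLp 2 _).comp (continuous_pi fun j => by
      fin_cases j <;> simp <;> fun_prop)
  refine (hc.comp_aestronglyMeasurable ((aesm_modeLift 2 h1.ac.aesm).prodMk
    (aesm_modeLift 0 h2.ac.aesm))).congr (ae_ne_zero.mono fun x hx => ?_)
  simp only
  rw [← hor_sub_soliton hu α lam hx, ← ver_sub_soliton hu α lam hx]
  ext j
  fin_cases j <;> simp [horL_apply, verL_apply]

lemma norm_sub_soliton_le {u : ℂ → E3} (hu : IsEquivariantMap u) (α lam : ℝ) (x : ℂ) :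
    ‖(u - soliton α lam) x‖ ≤ 1 + max 1 ‖soliton α lam 0‖ := by
  refine (norm_sub_le _ _).trans (add_le_add (hu.norm_eq_one x).le ?_)
  rcases eq_or_ne x 0 with rfl | hx
  · exact le_max_right _ _
  · exact le_max_of_le_left (sq_le_one_iff₀ (norm_nonneg _) |>.1 (norm_soliton α lam hx).le)

lemma IsDyadicCutoff.exists_besov_two {m : ℝ → ℝ} (hm : IsDyadicCutoff m) :
    ∃ C : ℝ≥0∞, C ≠ ⊤ ∧ ∀ (f f' : ℝ → ℂ) (X : ℝ≥0∞), IsProfile f f' →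
      radNorm (fun r => f r / r) ≠ ⊤ → X ≠ ⊤ → scalarX m (modeLift 2 f) ≤ X →
      IsBesov f' (C * X) ∧ IsBesov (fun r => f r / r) (C * X) := by
  obtain ⟨C1, hC1, H1⟩ := hm.exists_besov_of_scalarX (n := 2) (s := 1) (Or.inl rfl) (by norm_num)
  obtain ⟨C2, hC2, H2⟩ := hm.exists_besov_of_scalarX (n := 2) (s := -1) (Or.inr rfl) (by norm_num)
  refine ⟨27 * (C1 + C2), by finiteness, fun f f' X p hdiv hX hle => ?_⟩
  have hN : ∀ c : ℂ, radNorm (fun r => f' r - c * (f r / r)) ≠ ⊤ := fun c => by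
    refine ne_top_of_le_ne_top ?_ (radNorm_sub_le p.ac.aesm_deriv
      ((aesm_div p.ac.aesm).const_mul c))
    rw [radNorm_const_mul]
    exact ENNReal.add_ne_top.2 ⟨p.deriv, ENNReal.mul_ne_top (by simp) hdiv⟩
  have b1 := (H1 f f' p (hN _) (ne_top_of_le_ne_top hX hle)).mono (mul_le_mul_right hle C1)
  have b2 := (H2 f f' p (hN _) (ne_top_of_le_ne_top hX hle)).mono (mul_le_mul_right hle C2)
  constructor
  · refine ((b1.add b2).half.mono ?_).congr (Eventually.of_forall fun r hr => ?_)
    · calc 3 * (C1 * X + C2 * X) = 3 * (C1 + C2) * X := by ring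
        _ ≤ _ := by gcongr; norm_num
    · push_cast; ring
  · refine ((b2.sub b1).half.half.mono ?_).congr (Eventually.of_forall fun r hr => ?_)
    · calc 3 * (3 * (C2 * X + 3 * (C1 * X))) = (9 * C2 + 27 * C1) * X := by ring
        _ ≤ (27 * C2 + 27 * C1) * X := by gcongr; norm_num
        _ = _ := by ring
    · push_cast; ring

lemma IsDyadicCutoff.exists_besov_zero {m : ℝ → ℝ} (hm : IsDyadicCutoff m) :
    ∃ C : ℝ≥0∞, C ≠ ⊤ ∧ ∀ (f f' : ℝ → ℂ) (X : ℝ≥0∞), IsProfile f f' → X ≠ ⊤ →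
      scalarX m (modeLift 0 f) ≤ X → IsBesov f' (C * X) := by
  obtain ⟨C, hC, H⟩ := hm.exists_besov_of_scalarX (n := 0) (s := 1) (Or.inl rfl) (by norm_num)
  refine ⟨C, hC, fun f f' X p hX hle => ?_⟩
  have e : (fun r : ℝ => f' r - ((1 : ℤ) : ℂ) * ((0 : ℤ) : ℂ) * (f r / r)) = f' := by
    funext r; push_cast; ring
  have := H f f' p (by rw [e]; exact p.deriv) (ne_top_of_le_ne_top hX hle)
  rw [e] at this
  exact this.mono (mul_le_mul_right hle C)

/-- The gauge field is controlled by the distance of the map to the soliton. -/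
lemma IsDyadicCutoff.exists_gauge_le {m : ℝ → ℝ} (hm : IsDyadicCutoff m) :
    ∃ C : ℝ≥0∞, C ≠ ⊤ ∧ ∀ (u : ℂ → E3) (α lam : ℝ) (W : Fin 3 → ℝ → ℂ) (q : ℝ → ℂ),
      IsEquivariantMap u → 0 < lam → IsFrame W (coord u) q →
      (∀ r, 0 < r → W 2 r = Complex.I * (W 1 r * coord u 0 r - W 0 r * coord u 1 r)) →
      radNorm (fun r => (coord u 0 r + Complex.I * coord u 1 r) / r) ≠ ⊤ →
      Tendsto (fun r => coord u 2 r - solU α lam 2 r) atTop (𝓝 0) →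
      normX m (u - soliton α lam) ≠ ⊤ →
      IsBesov (fun r => q r - 2 * W 2 r / r) (C * normX m (u - soliton α lam)) := by
  obtain ⟨C1, hC1, H1⟩ := hm.exists_besov_two
  obtain ⟨C2, hC2, H2⟩ := hm.exists_besov_zero
  refine ⟨10 ^ 10 * (36 * (C1 + C2)), by finiteness,
    fun u α lam W q hu hl h hW hfin hlim hX => ?_⟩
  have h' := isFrame_soliton α hl
  obtain ⟨p1, p2⟩ := isProfile_hor h h'
  set X := normX m (u - soliton α lam) with hXdef
  have hm1 := aesm_sub_soliton hu α hl h
  have hb1 := norm_sub_soliton_le hu α lam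
  have X1 : scalarX m (modeLift 2 (horDiff (coord u) (solU α lam))) ≤ X := by
    rw [← scalarX_congr hm fun x hx => hor_sub_soliton hu α lam hx]
    exact hm.scalarX_le hm1 hb1 norm_horL_le
  have X2 : scalarX m (modeLift 0 (fun r => coord u 2 r - solU α lam 2 r)) ≤ X := by
    rw [← scalarX_congr hm fun x hx => ver_sub_soliton hu α lam hx]
    exact hm.scalarX_le hm1 hb1 norm_verL_le
  have hdivN : radNorm (fun r => horDiff (coord u) (solU α lam) r / r) ≠ ⊤ := by
    have e : (fun r : ℝ => horDiff (coord u) (solU α lam) r / r) = fun r =>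
        (coord u 0 r + Complex.I * coord u 1 r) / r -
          (solU α lam 0 r / r + Complex.I * (solU α lam 1 r / r)) := by
      funext r; rw [horDiff]; ring
    have b0 := isBesov_solU_div α hl (j := 0) (by decide)
    have b1 := (isBesov_solU_div α hl (j := 1) (by decide)).const_mul Complex.I
    rw [e]
    refine ne_top_of_le_ne_top ?_ (radNorm_sub_le (aesm_div ((h.acU 0).aesm.add
      ((h.acU 1).aesm.const_mul _))) (b0.add b1).aesm)
    exact ENNReal.add_ne_top.2 ⟨hfin, ne_top_of_le_ne_top (by finiteness) (b0.add b1).radNorm_le⟩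
  obtain ⟨b1, b2⟩ := H1 _ _ X p1 hdivN hX X1
  have b3 := H2 _ _ X p2 hX X2
  have reU : ∀ j r, 0 < r → conj (coord u j r - solU α lam j r) = coord u j r - solU α lam j r :=
    fun j r hr => by rw [map_sub, h.real j r hr, h'.real j r hr]
  have reD : ∀ j r, 0 < r → conj (dcoord W q j r - dcoord (solW α lam) (solq α lam) j r) =
      dcoord W q j r - dcoord (solW α lam) (solq α lam) j r :=
    fun j r _ => by rw [map_sub, conj_dcoord, conj_dcoord]
  obtain ⟨d0, d1⟩ := b1.of_add_I_mul (reD 0) (reD 1)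
  obtain ⟨e0, e1⟩ := IsBesov.of_add_I_mul (x := fun r => (coord u 0 r - solU α lam 0 r) / r)
    (y := fun r => (coord u 1 r - solU α lam 1 r) / r)
    (b2.congr (Eventually.of_forall fun r hr => by rw [horDiff]; ring))
    (fun r hr => by rw [map_div₀, Complex.conj_ofReal, reU 0 r hr])
    (fun r hr => by rw [map_div₀, Complex.conj_ofReal, reU 1 r hr])
  have c1 : 36 * (C1 * X) ≤ 36 * (C1 + C2) * X := by
    rw [← mul_assoc]; gcongr; exact le_self_add
  have c3 : C2 * X ≤ 36 * (C1 + C2) * X := by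
    gcongr
    exact le_add_self.trans (le_mul_of_one_le_left zero_le (by norm_num))
  rw [mul_assoc]
  refine h.isBesov_gauge hl hW (ENNReal.mul_ne_top (by finiteness) hX) (fun j => ?_) (fun j hj => ?_)
    hlim
  · fin_cases j
    · exact d0.mono c1
    · exact d1.mono c1
    · exact b3.mono c3
  · fin_cases j
    · exact e0.mono c1
    · exact e1.mono c1
    · exact absurd rfl hj

/-! ### The reduced system -/

section

variable {f f' : ℝ → ℂ} {B M : ℝ≥0∞}

lemma ACDeriv.ofReal_re (h : ACDeriv f f') :
    ACDeriv (fun r => ((f r).re : ℂ)) (fun r => ((f' r).re : ℂ)) :=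
  ⟨h.ac.re.ofReal, h.re.mono fun _ hd hr => (hd hr).ofReal_comp⟩

lemma ACDeriv.ofReal_im (h : ACDeriv f f') :
    ACDeriv (fun r => ((f r).im : ℂ)) (fun r => ((f' r).im : ℂ)) :=
  ⟨h.ac.im.ofReal, h.im.mono fun _ hd hr => (hd hr).ofReal_comp⟩

lemma IsMult.ofReal_re (h : IsMult f M) : IsMult (fun r => ((f r).re : ℂ)) M := by
  refine .of_acDeriv h.acDeriv.ofReal_re (fun r hr => le_trans ?_ (h.bound r hr))
    ((radNorm_mono (Eventually.of_forall fun r _ => ?_)).trans h.deriv)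
  · rw [← ofReal_norm, ← ofReal_norm]
    exact ENNReal.ofReal_le_ofReal (by
      rw [Complex.norm_real, Real.norm_eq_abs]; exact Complex.abs_re_le_norm _)
  · rw [Complex.norm_real, Real.norm_eq_abs]
    exact Complex.abs_re_le_norm _

lemma IsMult.ofReal_im (h : IsMult f M) : IsMult (fun r => ((f r).im : ℂ)) M := by
  refine .of_acDeriv h.acDeriv.ofReal_im (fun r hr => le_trans ?_ (h.bound r hr))
    ((radNorm_mono (Eventually.of_forall fun r _ => ?_)).trans h.deriv)
  · rw [← ofReal_norm, ← ofReal_norm]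
    exact ENNReal.ofReal_le_ofReal (by
      rw [Complex.norm_real, Real.norm_eq_abs]; exact Complex.abs_im_le_norm _)
  · rw [Complex.norm_real, Real.norm_eq_abs]
    exact Complex.abs_im_le_norm _

lemma IsBesov.ofReal_re (h : IsBesov f B) : IsBesov (fun r => ((f r).re : ℂ)) (6 * B) :=
  ((h.add h.conj).half.mono (le_of_eq (by ring))).congr (Eventually.of_forall fun r _ => by
    rw [Complex.add_conj]; push_cast; ring)

lemma IsBesov.ofReal_im (h : IsBesov f B) : IsBesov (fun r => ((f r).im : ℂ)) (18 * B) := by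
  refine ((h.const_mul (-Complex.I)).ofReal_re.mono (le_of_eq ?_)).congr
    (Eventually.of_forall fun r _ => by simp)
  rw [← ofReal_norm, norm_neg, Complex.norm_I, ENNReal.ofReal_one]
  ring

end

/-- Solutions of `y' = -(2σ/r) y + f` that are almost orthogonal to a nondegenerate weight. -/
lemma IsNearSoliton.isBesov_of_orthogonal {lam ε : ℝ} {σ : ℝ → ℝ} (h : IsNearSoliton lam σ ε)
    {y f ϖ : ℝ → ℂ} {M c : ℝ} {B D : ℝ≥0∞}
    (hy : ACDeriv y (fun r => ((-(2 * σ r / r) : ℝ) : ℂ) * y r + f r))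
    (hf : IsBesov f B) (hB : B ≠ ⊤) (hϖm : AEStronglyMeasurable ϖ radialMeasure) (hM : 0 ≤ M)
    (hϖ : ∀ r, 0 < r → ‖ϖ r‖ ≤ M) (hs : ∀ r, 2 / lam < r → ϖ r = 0) (hc0 : 0 < c)
    (hc : c / lam ^ 2 ≤ ‖∫ r in Ioi (0 : ℝ), ϖ r * h1 (lam * r) * r‖)
    (hε : 96 * ε * M ≤ c)
    (hd : ENNReal.ofReal (lam ^ 2) * ‖∫ r in Ioi (0 : ℝ), ϖ r * y r * r‖ₑ ≤ D * B) :
    IsBesov (fun r => y r / r)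
      ((1000 + 216 * ((D + 4000 * ENNReal.ofReal M) / ENNReal.ofReal (c / 2))) * B) := by
  have h1 := h.initial_le hy hf hB hϖm hM hϖ hs hc hε
  have hc2 : ENNReal.ofReal (c / 2) ≠ 0 := by simpa using hc0
  have h2 : ‖y lam⁻¹‖ₑ ≤ (D + 4000 * ENNReal.ofReal M) / ENNReal.ofReal (c / 2) * B := by
    rw [ENNReal.mul_comm_div, ← mul_div_assoc, ENNReal.le_div_iff_mul_le (Or.inl hc2)
      (Or.inl ENNReal.ofReal_ne_top), mul_comm]
    refine h1.trans ((add_le_add_left hd _).trans (le_of_eq (by ring)))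
  refine (h.isBesov_of_flow hy hf hB).mono ?_
  rw [add_mul, mul_assoc 216]
  gcongr

/-- The vertical component `p` of the tangent frame and `s` of the map, close to those of the
soliton. -/
structure IsReduced (lam : ℝ) (p : ℝ → ℂ) (s : ℝ → ℝ) (φ : ℝ → ℂ) (ε : ℝ) : Prop where
  lam_pos : 0 < lam
  acp : ACDeriv p (fun r => -(s r * (φ r + 2 * p r / r)))
  acs : ACDeriv (fun r => (s r : ℂ))
    (fun r => (((conj (φ r) * p r).re + 2 * ((p r).re ^ 2 + (p r).im ^ 2) / r : ℝ) : ℂ))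
  unit : ∀ r, 0 < r → (p r).re ^ 2 + (p r).im ^ 2 + s r ^ 2 = 1
  multp : IsMult p 6
  mults : IsMult (fun r => (s r : ℂ)) 6
  small_p : ∀ r, 0 < r → ‖p r - h1 (lam * r)‖ ≤ ε
  small_s : ∀ r, 0 < r → |s r - h3 (lam * r)| ≤ ε
  eps_le : ε ≤ 1 / 12

/-- The component of `(P, s)` tangent to the soliton curve. -/
def redT (lam : ℝ) (p : ℝ → ℂ) (s : ℝ → ℝ) (r : ℝ) : ℝ :=
  h1 (lam * r) * s r - h3 (lam * r) * (p r).re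

/-- The component of `(P, s)` along the soliton. -/
def redC (lam : ℝ) (p : ℝ → ℂ) (s : ℝ → ℝ) (r : ℝ) : ℝ :=
  h1 (lam * r) * (p r).re + h3 (lam * r) * s r

/-- The coefficient of the equation of `redT`. -/
def redSigma (lam : ℝ) (p : ℝ → ℂ) (s : ℝ → ℝ) (r : ℝ) : ℝ :=
  s r - h1 (lam * r) * redT lam p s r * (1 + redC lam p s r)⁻¹

namespace IsReduced

variable {lam ε : ℝ} {p φ : ℝ → ℂ} {s : ℝ → ℝ} {B : ℝ≥0∞}

lemma sq_add (h : IsReduced lam p s φ ε) {r : ℝ} (hr : 0 < r) :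
    redC lam p s r ^ 2 + redT lam p s r ^ 2 + (p r).im ^ 2 = 1 := by
  rw [redC, redT]
  linear_combination h.unit r hr + ((p r).re ^ 2 + s r ^ 2) * h1_sq_add_h3_sq (lam * r)

lemma bounds (h : IsReduced lam p s φ ε) {r : ℝ} (hr : 0 < r) :
    |redT lam p s r| ≤ 2 * ε ∧ 1 / 2 ≤ redC lam p s r := by
  have e1 : |(p r).re - h1 (lam * r)| ≤ ε := by
    have := (Complex.abs_re_le_norm _).trans (h.small_p r hr)
    simpa using this
  have e2 := h.small_s r hr
  have e3 := h.eps_le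
  have a1 : |h1 (lam * r)| ≤ 1 := by
    rw [abs_of_nonneg (h1_nonneg _)]; exact h1_le_one _
  have a3 := abs_h3_le_one (lam * r)
  have hh := h1_sq_add_h3_sq (lam * r)
  have m : ∀ x y : ℝ, |x| ≤ 1 → |y| ≤ ε → |x * y| ≤ ε := fun x y hx hy => by
    rw [abs_mul]
    exact (mul_le_of_le_one_left (abs_nonneg _) hx).trans hy
  constructor
  · have e : redT lam p s r = h1 (lam * r) * (s r - h3 (lam * r)) -
        h3 (lam * r) * ((p r).re - h1 (lam * r)) := by rw [redT]; ring
    rw [e]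
    linarith [abs_sub (h1 (lam * r) * (s r - h3 (lam * r)))
      (h3 (lam * r) * ((p r).re - h1 (lam * r))), m _ _ a1 e2, m _ _ a3 e1]
  · have e : redC lam p s r = 1 + h1 (lam * r) * ((p r).re - h1 (lam * r)) +
        h3 (lam * r) * (s r - h3 (lam * r)) := by rw [redC]; linear_combination hh
    rw [e]
    linarith [(abs_le.1 (m _ _ a1 e1)).1, (abs_le.1 (m _ _ a3 e2)).1]

lemma inv_le (h : IsReduced lam p s φ ε) {r : ℝ} (hr : 0 < r) :
    0 ≤ (1 + redC lam p s r)⁻¹ ∧ (1 + redC lam p s r)⁻¹ ≤ 1 := by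
  have := (h.bounds hr).2
  exact ⟨inv_nonneg.2 (by linarith), inv_le_one_of_one_le₀ (by linarith)⟩

lemma multT (h : IsReduced lam p s φ ε) : IsMult (fun r => (redT lam p s r : ℂ)) 144 :=
  ((((isMult_h1 h.lam_pos).mul h.mults (by simp) (by simp)).sub
    ((isMult_h3 h.lam_pos).mul h.multp.ofReal_re (by simp) (by simp))).mono (by norm_num)).congr
    fun r _ => by rw [redT]; push_cast; ring

lemma multC (h : IsReduced lam p s φ ε) :
    IsMult (fun r => (((1 + redC lam p s r)⁻¹ : ℝ) : ℂ)) 146 := by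
  have h0 : IsMult (fun r => 1 + (redC lam p s r : ℂ)) 145 :=
    ((IsMult.const 1).add (((isMult_h1 h.lam_pos).mul h.multp.ofReal_re (by simp) (by simp)).add
      ((isMult_h3 h.lam_pos).mul h.mults (by simp) (by simp)))).mono (by
        rw [← ofReal_norm, norm_one, ENNReal.ofReal_one]; norm_num) |>.congr
      fun r _ => by rw [redC]; push_cast; ring
  refine ((h0.inv fun r hr => ?_).mono (by norm_num)).congr fun r _ => by push_cast; ring
  have := (h.bounds hr).2
  rw [← Complex.ofReal_one, ← Complex.ofReal_add, Complex.norm_real, Real.norm_eq_abs]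
  exact (by linarith : 1 ≤ 1 + redC lam p s r).trans (le_abs_self _)

lemma near_s (h : IsReduced lam p s φ ε) : IsNearSoliton lam s ε :=
  ⟨h.lam_pos, (Complex.continuous_re.comp_continuousOn h.acs.continuousOn), h.small_s,
    h.eps_le.trans (by norm_num)⟩

lemma near_sigma (h : IsReduced lam p s φ ε) : IsNearSoliton lam (redSigma lam p s) (3 * ε) := by
  refine ⟨h.lam_pos, ?_, fun r hr => ?_, by linarith [h.eps_le]⟩
  · have k := ((h.mults.sub (((isMult_h1 h.lam_pos).mul h.multT (by simp) (by simp)).mul h.multC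
      (by finiteness) (by simp))).acDeriv).continuousOn
    refine (Complex.continuous_re.comp_continuousOn k).congr fun r _ => ?_
    rw [redSigma, ← Complex.ofReal_re (s r - h1 (lam * r) * redT lam p s r * (1 + redC lam p s r)⁻¹)]
    simp only [Function.comp]
    push_cast
    rfl
  · have e2 := h.small_s r hr
    obtain ⟨b1, -⟩ := h.bounds hr
    obtain ⟨i0, i1⟩ := h.inv_le hr
    have e : |h1 (lam * r) * redT lam p s r * (1 + redC lam p s r)⁻¹| ≤ 2 * ε := by
      rw [abs_mul, abs_mul, abs_of_nonneg i0, abs_of_nonneg (h1_nonneg _)]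
      refine (mul_le_of_le_one_right (by positivity [h1_nonneg (lam * r)]) i1).trans ?_
      exact (mul_le_of_le_one_left (abs_nonneg _) (h1_le_one _)).trans b1
    rw [redSigma, sub_right_comm]
    linarith [abs_sub (s r - h3 (lam * r)) (h1 (lam * r) * redT lam p s r * (1 + redC lam p s r)⁻¹)]

lemma acDeriv_im (h : IsReduced lam p s φ ε) :
    ACDeriv (fun r => ((p r).im : ℂ))
      (fun r => ((-(2 * s r / r) : ℝ) : ℂ) * ((p r).im : ℂ) + -((s r : ℂ) * ((φ r).im : ℂ))) := by
  refine h.acp.ofReal_im.congr_deriv (Eventually.of_forall fun r hr => ?_)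
  have e : -((s r : ℂ) * (φ r + 2 * p r / r)) =
      ((-s r : ℝ) : ℂ) * φ r + ((-(2 * s r / r) : ℝ) : ℂ) * p r := by push_cast; ring
  rw [e, Complex.add_im, Complex.im_ofReal_mul, Complex.im_ofReal_mul]
  push_cast
  ring

lemma acDeriv_T (h : IsReduced lam p s φ ε) :
    ACDeriv (fun r => (redT lam p s r : ℂ))
      (fun r => ((-(2 * redSigma lam p s r / r) : ℝ) : ℂ) * (redT lam p s r : ℂ) +
        (2 * h1 (lam * r) * (p r).im * (((1 + redC lam p s r)⁻¹ : ℝ) : ℂ) * ((p r).im / r) +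
          h1 (lam * r) * ((conj (φ r) * p r).re : ℂ) + h3 (lam * r) * s r * ((φ r).re : ℂ))) := by
  have k := ((acDeriv_h1 h.lam_pos).mul h.acs).sub ((acDeriv_h3 h.lam_pos).mul h.acp.ofReal_re)
  refine (k.congr fun r _ => by rw [redT]; push_cast; ring).congr_deriv
    (Eventually.of_forall fun r hr => ?_)
  have e : -((s r : ℂ) * (φ r + 2 * p r / r)) =
      ((-s r : ℝ) : ℂ) * φ r + ((-(2 * s r / r) : ℝ) : ℂ) * p r := by push_cast; ring
  rw [e, Complex.add_re, Complex.re_ofReal_mul, Complex.re_ofReal_mul]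
  norm_cast
  have hc := (h.bounds hr).2
  have hu := h.unit r hr
  have hsq := h.sq_add hr
  have hi : (1 + redC lam p s r) * (1 + redC lam p s r)⁻¹ = 1 :=
    mul_inv_cancel₀ (by linarith)
  have e2 : (redT lam p s r ^ 2 + (p r).im ^ 2) * (1 + redC lam p s r)⁻¹ = 1 - redC lam p s r := by
    linear_combination (1 + redC lam p s r)⁻¹ * hsq + (1 - redC lam p s r) * hi
  rw [redSigma]
  have hT : redT lam p s r = h1 (lam * r) * s r - h3 (lam * r) * (p r).re := rfl
  have hC : redC lam p s r = h1 (lam * r) * (p r).re + h3 (lam * r) * s r := rfl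
  rw [show ((Int.negSucc 1 : ℤ) : ℝ) = -2 by norm_num]
  linear_combination (2 * h1 (lam * r) / r) * (hu - e2 + hC) + (2 * s r / r) * hT

/-- The soliton is recovered from `redT` and the imaginary part. -/
lemma sub_eq (h : IsReduced lam p s φ ε) {r : ℝ} (hr : 0 < r) :
    (p r).re - h1 (lam * r) = -h3 (lam * r) * redT lam p s r -
      h1 (lam * r) * (1 + redC lam p s r)⁻¹ * (redT lam p s r ^ 2 + (p r).im ^ 2) ∧
    s r - h3 (lam * r) = h1 (lam * r) * redT lam p s r -
      h3 (lam * r) * (1 + redC lam p s r)⁻¹ * (redT lam p s r ^ 2 + (p r).im ^ 2) := by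
  have hc := (h.bounds hr).2
  have hsq := h.sq_add hr
  have hh := h1_sq_add_h3_sq (lam * r)
  have hi : (1 + redC lam p s r) * (1 + redC lam p s r)⁻¹ = 1 :=
    mul_inv_cancel₀ (by linarith)
  have e2 : (1 + redC lam p s r)⁻¹ * (redT lam p s r ^ 2 + (p r).im ^ 2) = 1 - redC lam p s r := by
    linear_combination (1 + redC lam p s r)⁻¹ * hsq + (1 - redC lam p s r) * hi
  rw [mul_assoc, mul_assoc, e2, redT, redC]
  constructor
  · linear_combination -(p r).re * hh
  · linear_combination -s r * hh

end IsReduced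

/-- Integrals of functions supported in `(0, a]`. -/
lemma integrable_of_support {F : ℝ → ℂ} {a M : ℝ} (ha : 0 < a)
    (hm : AEStronglyMeasurable F radialMeasure) (hb : ∀ r, 0 < r → ‖F r‖ ≤ M)
    (hs : ∀ r, a < r → F r = 0) : IntegrableOn (fun r => F r * r) (Ioi 0) ∧
      ‖∫ r in Ioi (0 : ℝ), F r * r‖ ≤ M * a ^ 2 / 2 := by
  have hM : 0 ≤ M := (norm_nonneg _).trans (hb 1 one_pos)
  set g : ℝ → ℝ := (Ioc 0 a).indicator fun r => M * r with hg
  have hi : IntegrableOn (fun r : ℝ => M * r) (Ioc 0 a) :=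
    (by fun_prop : Continuous fun r : ℝ => M * r).continuousOn.integrableOn_Icc.mono_set
      Ioc_subset_Icc_self
  have hgi : IntegrableOn g (Ioi 0) := by
    rw [hg, integrableOn_indicator_iff measurableSet_Ioc]
    exact hi.mono_set inter_subset_left
  have hle : ∀ᵐ r ∂volume.restrict (Ioi (0 : ℝ)), ‖F r * r‖ ≤ g r := by
    refine (ae_restrict_iff' measurableSet_Ioi).2 (Eventually.of_forall fun r hr => ?_)
    have hr : 0 < r := hr
    by_cases h : r ≤ a
    · rw [hg, indicator_of_mem (show r ∈ Ioc 0 a from ⟨hr, h⟩), norm_mul, Complex.norm_real,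
        Real.norm_of_nonneg hr.le]
      gcongr
      exact hb r hr
    · rw [hg, indicator_of_notMem (fun h' => h h'.2), hs r (not_le.1 h), zero_mul, norm_zero]
  refine ⟨hgi.mono' ?_ hle, (norm_integral_le_of_norm_le hgi hle).trans (le_of_eq ?_)⟩
  · exact ((aemeasurable_restrict_of_aesm hm).mul
      Complex.measurable_ofReal.aemeasurable).aestronglyMeasurable
  · rw [hg, setIntegral_indicator measurableSet_Ioc,
      show Ioi (0 : ℝ) ∩ Ioc 0 a = Ioc 0 a from inter_eq_right.2 Ioc_subset_Ioi_self,
      ← intervalIntegral.integral_of_le ha.le, intervalIntegral.integral_const_mul, integral_id]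
    ring

section Weight

variable {κ : ℝ → ℝ} {lam : ℝ}

lemma IsModulationWeight.exists_bound (hκ : IsModulationWeight κ) : ∃ M : ℝ, 1 ≤ M ∧ ∀ r, |κ r| ≤ M := by
  have hc : HasCompactSupport κ := isCompact_Icc.of_isClosed_subset (isClosed_tsupport κ) hκ.support
  obtain ⟨C, hC⟩ := hc.exists_bound_of_continuous hκ.smooth.continuous
  exact ⟨max C 1, le_max_right _ _, fun r => (hC r).trans (le_max_left _ _)⟩

lemma IsModulationWeight.eq_zero (hκ : IsModulationWeight κ) (hl : 0 < lam) {r : ℝ}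
    (hr : 2 / lam < r) : κ (lam * r) = 0 := by
  by_contra h
  have := (hκ.support (subset_tsupport κ h)).2
  rw [div_lt_iff₀' hl] at hr
  linarith

lemma IsModulationWeight.aesm (hκ : IsModulationWeight κ) :
    AEStronglyMeasurable (fun r => (κ (lam * r) : ℂ)) radialMeasure :=
  (Complex.continuous_ofReal.comp
    (hκ.smooth.continuous.comp (continuous_const_mul lam))).aestronglyMeasurable

lemma integral_scaled (hl : 0 < lam) (g : ℝ → ℝ) :
    ∫ r in Ioi (0 : ℝ), ((g (lam * r) : ℝ) : ℂ) * r =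
      ((lam ^ 2)⁻¹ * ∫ r in Ioi (0 : ℝ), g r * r : ℝ) := by
  have h := integral_comp_mul_left_Ioi (fun r => g r * r) 0 hl
  rw [mul_zero] at h
  have e : ∀ r : ℝ, ((g (lam * r) : ℝ) : ℂ) * r = ((lam⁻¹ * (g (lam * r) * (lam * r)) : ℝ) : ℂ) :=
    fun r => by
      have : (lam : ℂ) ≠ 0 := by exact_mod_cast hl.ne'
      push_cast; field_simp
  simp_rw [e]
  rw [integral_complex_ofReal, integral_const_mul, h, smul_eq_mul, ← mul_assoc, ← mul_inv, sq]

end Weight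

namespace IsReduced

variable {lam ε M : ℝ} {p φ : ℝ → ℂ} {s κ : ℝ → ℝ} {B : ℝ≥0∞}

lemma norm_p_le (h : IsReduced lam p s φ ε) {r : ℝ} (hr : 0 < r) : ‖p r‖ ≤ 1 := by
  have := h.unit r hr
  rw [← sq_le_one_iff₀ (norm_nonneg _), ← Complex.normSq_eq_norm_sq, Complex.normSq_apply]
  nlinarith [sq_nonneg (s r)]

lemma orthogonal_re_im (h : IsReduced lam p s φ ε) (hκ : IsModulationWeight κ)
    (hM : ∀ r, |κ r| ≤ M)
    (ho : ∫ r in Ioi (0 : ℝ), (p r - h1 (lam * r)) * ((κ (lam * r) * r : ℝ) : ℂ) = 0) :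
    IntegrableOn (fun r => (κ (lam * r) * ((p r).re - h1 (lam * r) : ℝ) : ℂ) * r) (Ioi 0) ∧
    ∫ r in Ioi (0 : ℝ), (κ (lam * r) * ((p r).re - h1 (lam * r) : ℝ) : ℂ) * r = 0 ∧
    ∫ r in Ioi (0 : ℝ), (κ (lam * r) : ℂ) * ((p r).im : ℂ) * r = 0 := by
  have hl := h.lam_pos
  have key := (integrable_of_support (F := fun r => (κ (lam * r) : ℂ) * (p r - h1 (lam * r)))
    (M := M * ε) (a := 2 / lam) (by positivity) (hκ.aesm.mul (h.acp.sub (acDeriv_h1 hl)).aesm)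
    (fun r hr => by
      rw [norm_mul, Complex.norm_real]
      exact mul_le_mul (hM _) (h.small_p r hr) (norm_nonneg _) ((abs_nonneg _).trans (hM 0)))
    (fun r hr => by rw [hκ.eq_zero hl hr]; simp)).1
  have e : ∀ r : ℝ, (p r - h1 (lam * r)) * ((κ (lam * r) * r : ℝ) : ℂ) =
      (κ (lam * r) : ℂ) * (p r - h1 (lam * r)) * r := fun r => by push_cast; ring
  simp_rw [e] at ho
  have e1 : ∀ r : ℝ, (κ (lam * r) * ((p r).re - h1 (lam * r) : ℝ) : ℂ) * r =
      ((((κ (lam * r) : ℂ) * (p r - h1 (lam * r)) * r).re : ℝ) : ℂ) := fun r => by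
    rw [show (κ (lam * r) : ℂ) * (p r - h1 (lam * r)) * r =
      ((κ (lam * r) * r : ℝ) : ℂ) * (p r - h1 (lam * r)) by push_cast; ring, Complex.re_ofReal_mul,
      Complex.sub_re, Complex.ofReal_re]
    push_cast; ring
  have e2 : ∀ r : ℝ, (κ (lam * r) : ℂ) * ((p r).im : ℂ) * r =
      ((((κ (lam * r) : ℂ) * (p r - h1 (lam * r)) * r).im : ℝ) : ℂ) := fun r => by
    rw [show (κ (lam * r) : ℂ) * (p r - h1 (lam * r)) * r =
      ((κ (lam * r) * r : ℝ) : ℂ) * (p r - h1 (lam * r)) by push_cast; ring, Complex.im_ofReal_mul,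
      Complex.sub_im, Complex.ofReal_im]
    push_cast; ring
  simp_rw [e1, e2]
  refine ⟨Integrable.ofReal (Integrable.re key), ?_, ?_⟩
  · have := integral_re key
    rw [integral_complex_ofReal, Complex.ofReal_eq_zero]
    exact this.trans (by rw [ho]; rfl)
  · have := integral_im key
    rw [integral_complex_ofReal, Complex.ofReal_eq_zero]
    exact this.trans (by rw [ho]; rfl)

lemma isBesov_im_div (h : IsReduced lam p s φ ε) (hκ : IsModulationWeight κ) (hM : ∀ r, |κ r| ≤ M)
    (ho : ∫ r in Ioi (0 : ℝ), (p r - h1 (lam * r)) * ((κ (lam * r) * r : ℝ) : ℂ) = 0)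
    (hε : 96 * ε * M ≤ |∫ r in Ioi (0 : ℝ), κ r * h1 r * r|) (hφ : IsBesov φ B) (hB : B ≠ ⊤) :
    IsBesov (fun r => ((p r).im : ℂ) / r) ((1000 + 216 * (4000 * ENNReal.ofReal M /
      ENNReal.ofReal (|∫ r in Ioi (0 : ℝ), κ r * h1 r * r| / 2))) * (1000 * B)) := by
  have hl := h.lam_pos
  have hf : IsBesov (fun r => -((s r : ℂ) * ((φ r).im : ℂ))) (1000 * B) :=
    (hφ.ofReal_im.mul h.mults (by simp)).neg.mono (by
      calc 3 * (3 * 6 * (18 * B)) = 972 * B := by ring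
        _ ≤ _ := by gcongr; norm_num)
  have := h.near_s.isBesov_of_orthogonal (D := 0) (M := M) (ϖ := fun r => (κ (lam * r) : ℂ))
    h.acDeriv_im hf (by finiteness) hκ.aesm ((abs_nonneg _).trans (hM 0))
    (fun r _ => by rw [Complex.norm_real]; exact hM _)
    (fun r hr => by rw [hκ.eq_zero hl hr, Complex.ofReal_zero]) (abs_pos.2 hκ.nondeg_h1) (by
      have e := integral_scaled hl fun r => κ r * h1 r
      simp only [Complex.ofReal_mul] at e
      rw [e, ← Complex.ofReal_mul, Complex.norm_real, Real.norm_eq_abs, abs_mul,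
        abs_of_pos (by positivity : 0 < (lam ^ 2)⁻¹), div_eq_inv_mul]) hε (by
      rw [(h.orthogonal_re_im hκ hM ho).2.2]; simp)
  rwa [zero_add] at this

lemma isBesov_redT_div {A : ℝ≥0∞} (h : IsReduced lam p s φ ε) (hκ : IsModulationWeight κ)
    (hM : ∀ r, |κ r| ≤ M)
    (ho : ∫ r in Ioi (0 : ℝ), (p r - h1 (lam * r)) * ((κ (lam * r) * r : ℝ) : ℂ) = 0)
    (hε : 1152 * ε * M ≤ |∫ r in Ioi (0 : ℝ), κ r * (h1 r * h3 r) * r|) (hφ : IsBesov φ B)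
    (hB : B ≠ ⊤) (hA : A ≠ ⊤) (him : IsBesov (fun r => ((p r).im : ℂ) / r) (A * B)) :
    IsBesov (fun r => (redT lam p s r : ℂ) / r)
      ((1000 + 216 * ((ENNReal.ofReal (4 * M) + 4000 * ENNReal.ofReal (2 * M)) /
        ENNReal.ofReal (|∫ r in Ioi (0 : ℝ), κ r * (h1 r * h3 r) * r| / 2 / 2))) *
          ((400000 * A + 4000) * B)) := by
  have hl := h.lam_pos
  have hM0 : 0 ≤ M := (abs_nonneg _).trans (hM 0)
  have hc2 := abs_pos.2 hκ.nondeg_h1h3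
  set c2 := |∫ r in Ioi (0 : ℝ), κ r * (h1 r * h3 r) * r|
  have m1 := isMult_h1 hl
  have m3 := isMult_h3 hl
  have hf1 := (him.mul ((m1.mul h.multp.ofReal_im (by simp) (by simp)).mul h.multC
    (by finiteness) (by simp)) (by finiteness)).const_mul 2
  have hf2 := (hφ.conj.mul h.multp (by simp)).ofReal_re.mul m1 (by simp)
  have hf3 := hφ.ofReal_re.mul (m3.mul h.mults (by simp) (by simp)) (by finiteness)
  have hf : IsBesov (fun r =>
      2 * h1 (lam * r) * (p r).im * (((1 + redC lam p s r)⁻¹ : ℝ) : ℂ) * ((p r).im / r) +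
        h1 (lam * r) * ((conj (φ r) * p r).re : ℂ) + h3 (lam * r) * s r * ((φ r).re : ℂ))
      ((400000 * A + 4000) * B) := by
    refine (((hf1.add hf2).add hf3).mono ?_).congr (Eventually.of_forall fun r hr => ?_)
    · rw [← ofReal_norm, Complex.norm_two, ENNReal.ofReal_ofNat]
      calc _ = (378432 * A + 3240) * B := by ring
        _ ≤ _ := by gcongr <;> norm_num
    · rw [mul_comm (conj (φ r))]; ring
  set ϖ : ℝ → ℂ := fun r => (κ (lam * r) : ℂ) * (h3 (lam * r) + h1 (lam * r) *
    redT lam p s r * (((1 + redC lam p s r)⁻¹ : ℝ) : ℂ)) with hϖ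
  have mq := (m1.mul h.multT (by simp) (by simp)).mul h.multC (by finiteness) (by simp)
  have hq : ∀ r, 0 < r → ‖(h1 (lam * r) * redT lam p s r *
      (((1 + redC lam p s r)⁻¹ : ℝ) : ℂ) : ℂ)‖ ≤ 2 * ε := fun r hr => by
    obtain ⟨i0, i1⟩ := h.inv_le hr
    rw [norm_mul, norm_mul, Complex.norm_real, Complex.norm_real, Complex.norm_real,
      Real.norm_of_nonneg i0, Real.norm_of_nonneg (h1_nonneg _), Real.norm_eq_abs]
    exact (mul_le_of_le_one_right (mul_nonneg (h1_nonneg _) (abs_nonneg _)) i1).trans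
      ((mul_le_of_le_one_left (abs_nonneg _) (h1_le_one _)).trans (h.bounds hr).1)
  have hε1 := h.eps_le
  have hϖm : AEStronglyMeasurable ϖ radialMeasure :=
    hκ.aesm.mul ((m3.add mq).acDeriv.aesm)
  have hϖM : ∀ r, 0 < r → ‖ϖ r‖ ≤ 2 * M := fun r hr => by
    rw [hϖ]
    simp only
    rw [norm_mul, Complex.norm_real, mul_comm 2]
    refine mul_le_mul (hM _) ((norm_add_le _ _).trans ?_) (norm_nonneg _) hM0
    rw [Complex.norm_real]
    linarith [hq r hr, abs_h3_le_one (lam * r), Real.norm_eq_abs (h3 (lam * r))]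
  have hϖs : ∀ r, 2 / lam < r → ϖ r = 0 := fun r hr => by simp [hϖ, hκ.eq_zero hl hr]
  refine h.near_sigma.isBesov_of_orthogonal h.acDeriv_T hf (by finiteness) hϖm (by linarith) hϖM hϖs
    (half_pos hc2) ?_ (by linarith) ?_
  · obtain ⟨i1, -⟩ := integrable_of_support (F := fun r => (κ (lam * r) : ℂ) *
      (h1 (lam * r) * h3 (lam * r))) (M := M) (a := 2 / lam) (by positivity)
      (hκ.aesm.mul (m1.acDeriv.aesm.mul m3.acDeriv.aesm)) (fun r hr => by
        rw [norm_mul, norm_mul, Complex.norm_real, Complex.norm_real, Complex.norm_real,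
          Real.norm_of_nonneg (h1_nonneg _)]
        refine (mul_le_of_le_one_right (abs_nonneg _) ?_).trans (hM _)
        exact mul_le_one₀ (h1_le_one _) (abs_nonneg _) (abs_h3_le_one _))
      (fun r hr => by simp [hκ.eq_zero hl hr])
    obtain ⟨i2, b2⟩ := integrable_of_support (F := fun r => (κ (lam * r) : ℂ) *
      ((h1 (lam * r) * redT lam p s r * (((1 + redC lam p s r)⁻¹ : ℝ) : ℂ)) * h1 (lam * r)))
      (M := M * (2 * ε)) (a := 2 / lam) (by positivity)
      (hκ.aesm.mul (mq.acDeriv.aesm.mul m1.acDeriv.aesm)) (fun r hr => by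
        rw [norm_mul, norm_mul, Complex.norm_real, Complex.norm_real,
          Real.norm_of_nonneg (h1_nonneg _)]
        refine mul_le_mul (hM _) ?_ (by positivity [h1_nonneg (lam * r)]) hM0
        exact (mul_le_of_le_one_right (norm_nonneg _) (h1_le_one _)).trans (hq r hr))
      (fun r hr => by simp [hκ.eq_zero hl hr])
    have e : ∫ r in Ioi (0 : ℝ), ϖ r * h1 (lam * r) * r =
        (∫ r in Ioi (0 : ℝ), (κ (lam * r) : ℂ) * (h1 (lam * r) * h3 (lam * r)) * r) +
        ∫ r in Ioi (0 : ℝ), (κ (lam * r) : ℂ) * ((h1 (lam * r) * redT lam p s r *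
          (((1 + redC lam p s r)⁻¹ : ℝ) : ℂ)) * h1 (lam * r)) * r := by
      rw [← integral_add i1 i2]
      congr 1; funext r; rw [hϖ]; ring
    have e1 := integral_scaled hl fun r => κ r * (h1 r * h3 r)
    simp only [Complex.ofReal_mul] at e1
    have e2 : ‖∫ r in Ioi (0 : ℝ), (κ (lam * r) : ℂ) * (h1 (lam * r) * h3 (lam * r)) * r‖ =
        c2 / lam ^ 2 := by
      rw [e1, ← Complex.ofReal_mul, Complex.norm_real, Real.norm_eq_abs, abs_mul,
        abs_of_pos (by positivity : 0 < (lam ^ 2)⁻¹), div_eq_inv_mul]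
    rw [e]
    refine le_trans ?_ (norm_sub_le_norm_add _ _)
    rw [e2]
    have e3 : M * (2 * ε) * (2 / lam) ^ 2 / 2 ≤ c2 / 2 / lam ^ 2 := by
      rw [div_pow, ← mul_div_assoc, div_div, div_le_div_iff₀ (by positivity) (by positivity)]
      have : 0 ≤ ε := by linarith [abs_nonneg (redT lam p s 1), (h.bounds one_pos).1]
      nlinarith [mul_nonneg this hM0, sq_nonneg lam, mul_nonneg (mul_nonneg this hM0) (sq_nonneg lam)]
    have e4 : c2 / lam ^ 2 = c2 / 2 / lam ^ 2 + c2 / 2 / lam ^ 2 := by ring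
    linarith
  · obtain ⟨o1, o2, -⟩ := h.orthogonal_re_im hκ hM ho
    set g : ℝ → ℂ := fun r => (κ (lam * r) : ℂ) * (h1 (lam * r) * (p r).im *
      (((1 + redC lam p s r)⁻¹ : ℝ) : ℂ)) with hg
    have hgb : ∀ r, 0 < r → ‖g r‖ ≤ M := fun r hr => by
      obtain ⟨i0, i1⟩ := h.inv_le hr
      rw [hg]
      simp only
      rw [norm_mul, norm_mul, norm_mul, Complex.norm_real, Complex.norm_real, Complex.norm_real,
        Complex.norm_real, Real.norm_of_nonneg i0, Real.norm_of_nonneg (h1_nonneg _)]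
      refine (mul_le_of_le_one_right (abs_nonneg _) ?_).trans (hM _)
      refine mul_le_one₀ (mul_le_one₀ (h1_le_one _) (abs_nonneg _) ?_) i0 i1
      exact (Complex.abs_im_le_norm _).trans (h.norm_p_le hr)
    have hgm : AEStronglyMeasurable g radialMeasure := hκ.aesm.mul
      ((m1.mul h.multp.ofReal_im (by simp) (by simp)).mul h.multC (by finiteness)
        (by simp)).acDeriv.aesm
    have hrgm : AEStronglyMeasurable (fun r : ℝ => (r : ℂ) * g r) radialMeasure :=
      Complex.measurable_ofReal.aestronglyMeasurable.mul hgm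
    have hgN := (radNorm_le_of_support hl hM0 hgb
      (fun r hr => by simp [hg, hκ.eq_zero hl hr])).2
    obtain ⟨j1, j2⟩ := integrable_radial_mul hrgm him.aesm
      (ne_top_of_le_ne_top ENNReal.ofReal_ne_top hgN)
      (ne_top_of_le_ne_top (by finiteness) him.radNorm_le)
    have e : ∫ r in Ioi (0 : ℝ), ϖ r * redT lam p s r * r =
        -((∫ r in Ioi (0 : ℝ), (κ (lam * r) * ((p r).re - h1 (lam * r) : ℝ) : ℂ) * r) +
          ∫ r in Ioi (0 : ℝ), (r * g r) * (((p r).im : ℂ) / r) * r) := by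
      rw [← integral_add o1 j1, ← integral_neg]
      refine setIntegral_congr_fun measurableSet_Ioi fun r hr => ?_
      have hr0 : (r : ℂ) ≠ 0 := by exact_mod_cast (mem_Ioi.1 hr).ne'
      have := congrArg Complex.ofReal (h.sub_eq hr).1
      simp only [hϖ, hg]
      rw [this]
      push_cast
      field_simp
      ring
    rw [e, o2, zero_add, enorm_neg]
    calc ENNReal.ofReal (lam ^ 2) * _
        ≤ ENNReal.ofReal (lam ^ 2) * (ENNReal.ofReal (4 * M / lam ^ 2) * (A * B)) := by
          gcongr
          exact j2.trans (mul_le_mul' hgN him.radNorm_le)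
      _ = ENNReal.ofReal (4 * M) * (A * B) := by
          rw [← mul_assoc, ← ENNReal.ofReal_mul (by positivity)]
          congr 2
          field_simp
      _ ≤ ENNReal.ofReal (4 * M) * ((400000 * A + 4000) * B) := by
          gcongr
          exact (le_mul_of_one_le_left zero_le (by norm_num)).trans le_self_add

lemma isBesov_sub_div {A : ℝ≥0∞} (h : IsReduced lam p s φ ε)
    (him : IsBesov (fun r => ((p r).im : ℂ) / r) A)
    (hT : IsBesov (fun r => (redT lam p s r : ℂ) / r) A) :
    IsBesov (fun r => (p r - h1 (lam * r)) / r) (10 ^ 8 * A) ∧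
    IsBesov (fun r => ((s r : ℂ) - h3 (lam * r)) / r) (10 ^ 8 * A) := by
  have m1 := isMult_h1 h.lam_pos
  have m3 := isMult_h3 h.lam_pos
  have hQ := ((hT.mul h.multT (by simp)).add (him.mul h.multp.ofReal_im (by simp))).mul h.multC
    (by simp)
  have r1 := ((hT.mul m3 (by simp)).neg.sub (hQ.mul m1 (by simp))).add (him.const_mul Complex.I)
  have r2 := (hT.mul m1 (by simp)).sub (hQ.mul m3 (by simp))
  constructor
  · refine (r1.mono ?_).congr (Eventually.of_forall fun r hr => ?_)
    · rw [← ofReal_norm, Complex.norm_I, ENNReal.ofReal_one]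
      ring_nf
      gcongr
      norm_num
    · have := congrArg Complex.ofReal (h.sub_eq hr).1
      simp only [Complex.ofReal_sub] at this
      have e : p r - h1 (lam * r) = ((p r).re - h1 (lam * r)) + Complex.I * (p r).im := by
        nth_rw 1 [← Complex.re_add_im (p r)]; ring
      rw [e, this]
      push_cast
      ring
  · refine (r2.mono ?_).congr (Eventually.of_forall fun r hr => ?_)
    · ring_nf
      gcongr
      norm_num
    · have := congrArg Complex.ofReal (h.sub_eq hr).2
      simp only [Complex.ofReal_sub] at this
      rw [this]
      push_cast
      ring

end IsReduced

lemma IsModulationWeight.exists_reduced_le {κ : ℝ → ℝ} (hκ : IsModulationWeight κ) :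
    ∃ ε : ℝ, 0 < ε ∧ ε ≤ 1 / 12 ∧ ∃ C : ℝ≥0∞, C ≠ ⊤ ∧ ∀ (lam : ℝ) (p φ : ℝ → ℂ) (s : ℝ → ℝ)
      (B : ℝ≥0∞), IsReduced lam p s φ ε → B ≠ ⊤ → IsBesov φ B →
      ∫ r in Ioi (0 : ℝ), (p r - h1 (lam * r)) * ((κ (lam * r) * r : ℝ) : ℂ) = 0 →
      IsBesov (fun r => (p r - h1 (lam * r)) / r) (C * B) ∧
      IsBesov (fun r => ((s r : ℂ) - h3 (lam * r)) / r) (C * B) := by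
  obtain ⟨M, hM1, hM⟩ := hκ.exists_bound
  have hc1 := abs_pos.2 hκ.nondeg_h1
  have hc2 := abs_pos.2 hκ.nondeg_h1h3
  set c1 := |∫ r in Ioi (0 : ℝ), κ r * h1 r * r|
  set c2 := |∫ r in Ioi (0 : ℝ), κ r * (h1 r * h3 r) * r|
  have hM0 : 0 < M := by linarith
  set A1 : ℝ≥0∞ := (1000 + 216 * (4000 * ENNReal.ofReal M / ENNReal.ofReal (c1 / 2))) * 1000
  set A2 : ℝ≥0∞ := (1000 + 216 * ((ENNReal.ofReal (4 * M) + 4000 * ENNReal.ofReal (2 * M)) /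
    ENNReal.ofReal (c2 / 2 / 2))) * (400000 * A1 + 4000)
  have hA1 : A1 ≠ ⊤ := ENNReal.mul_ne_top (ENNReal.add_ne_top.2 ⟨by simp, ENNReal.mul_ne_top (by simp)
    (ENNReal.div_ne_top (by finiteness) (by simpa using hc1))⟩) (by simp)
  have hA2 : A2 ≠ ⊤ := ENNReal.mul_ne_top (ENNReal.add_ne_top.2 ⟨by simp, ENNReal.mul_ne_top (by simp)
    (ENNReal.div_ne_top (by finiteness) (by simpa using hc2))⟩) (by finiteness)
  refine ⟨min (1 / 12) (min (c1 / (96 * M)) (c2 / (1152 * M))), by positivity, min_le_left _ _,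
    10 ^ 8 * (A1 + A2), by finiteness, fun lam p φ s B h hB hφ ho => ?_⟩
  set ε := min (1 / 12) (min (c1 / (96 * M)) (c2 / (1152 * M)))
  have e1 : ε * (96 * M) ≤ c1 := (le_div_iff₀ (by positivity)).1
    ((min_le_right _ _).trans (min_le_left _ _))
  have e2 : ε * (1152 * M) ≤ c2 := (le_div_iff₀ (by positivity)).1
    ((min_le_right _ _).trans (min_le_right _ _))
  have k1 : IsBesov (fun r => ((p r).im : ℂ) / r) (A1 * B) :=
    (h.isBesov_im_div hκ hM ho (by linarith) hφ hB).mono (le_of_eq (by rw [← mul_assoc]))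
  have k2 : IsBesov (fun r => (redT lam p s r : ℂ) / r) (A2 * B) :=
    (h.isBesov_redT_div hκ hM ho (by linarith) hφ hB hA1 k1).mono (le_of_eq (by rw [← mul_assoc]))
  have := h.isBesov_sub_div (A := (A1 + A2) * B)
    (k1.mono (by gcongr; exact le_self_add)) (k2.mono (by gcongr; exact le_add_self))
  rwa [← mul_assoc] at this

/-! ### The distance to the soliton is controlled by the gauge field -/

lemma h3_mono {x y : ℝ} (hx : 0 ≤ x) (hxy : x ≤ y) : h3 x ≤ h3 y := by
  have h4 : x ^ 4 ≤ y ^ 4 := pow_le_pow_left₀ hx hxy 4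
  unfold h3
  rw [div_le_div_iff₀ (by positivity) (by positivity)]
  linarith

lemma abs_sub_h3_le {lam η ε : ℝ} (hl : 0 < lam) {s : ℝ → ℝ} (hc : ContinuousOn s (Ioi 0))
    (h0 : Tendsto s (𝓝[>] 0) (𝓝 (-1))) (ht : Tendsto s atTop (𝓝 1)) (hη : 0 ≤ η)
    (hsq : ∀ r, 0 < r → |s r ^ 2 - h3 (lam * r) ^ 2| ≤ 2 * η) (hε0 : 0 ≤ ε)
    (hε : 16 * η ≤ ε ^ 2) {r : ℝ} (hr : 0 < r) : |s r - h3 (lam * r)| ≤ ε := by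
  refine abs_le_of_sq_le_sq ?_ hε0
  have hr2 := abs_le.1 (hsq r hr)
  by_cases hcase : h3 (lam * r) ^ 2 ≤ 2 * η
  · nlinarith [sq_nonneg (s r + h3 (lam * r))]
  rw [not_le] at hcase
  have hzero : ∀ x, 0 < x → s x = 0 → h3 (lam * x) ^ 2 ≤ 2 * η := fun x hx hs => by
    have := (abs_le.1 (hsq x hx)).1
    rw [hs] at this
    linarith
  have hsame : 0 ≤ s r * h3 (lam * r) := by
    rcases lt_or_ge 0 (h3 (lam * r)) with hp | hn
    · refine mul_nonneg ?_ hp.le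
      by_contra! hneg
      obtain ⟨r1, h1, h1r⟩ := ((ht.eventually (eventually_gt_nhds one_pos)).and
        (eventually_gt_atTop r)).exists
      obtain ⟨x, hx, hx0⟩ := intermediate_value_Icc h1r.le (hc.mono fun y hy => hr.trans_le hy.1)
        ⟨hneg.le, h1.le⟩
      have := hzero x (hr.trans_le hx.1) hx0
      have := h3_mono (by positivity) (mul_le_mul_of_nonneg_left hx.1 hl.le)
      nlinarith
    · refine mul_nonneg_of_nonpos_of_nonpos ?_ hn
      by_contra! hpos
      obtain ⟨r1, h1, h1r⟩ := ((h0.eventually (eventually_lt_nhds (by norm_num : (-1 : ℝ) < 0))).and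
        (Ioo_mem_nhdsGT hr)).exists
      obtain ⟨x, hx, hx0⟩ := intermediate_value_Icc h1r.2.le
        (hc.mono fun y hy => h1r.1.trans_le hy.1) ⟨h1.le, hpos.le⟩
      have hx' : 0 < x := h1r.1.trans_le hx.1
      have := hzero x hx' hx0
      have := h3_mono (by positivity) (mul_le_mul_of_nonneg_left hx.2 hl.le)
      nlinarith
  have hd : (s r - h3 (lam * r)) ^ 2 * h3 (lam * r) ^ 2 ≤ (2 * η) ^ 2 := by
    have e1 : h3 (lam * r) ^ 2 ≤ (s r + h3 (lam * r)) ^ 2 := by nlinarith [sq_nonneg (s r)]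
    calc (s r - h3 (lam * r)) ^ 2 * h3 (lam * r) ^ 2
        ≤ (s r - h3 (lam * r)) ^ 2 * (s r + h3 (lam * r)) ^ 2 := by gcongr
      _ = |s r ^ 2 - h3 (lam * r) ^ 2| ^ 2 := by rw [sq_abs]; ring
      _ ≤ _ := pow_le_pow_left₀ (abs_nonneg _) (hsq r hr) 2
  nlinarith [sq_nonneg (s r - h3 (lam * r)), sq_nonneg ε]

lemma IsFrame.isReduced {W U : Fin 3 → ℝ → ℂ} {q : ℝ → ℂ} (h : IsFrame W U q) {lam ε : ℝ}
    (hl : 0 < lam) {z : ℂ} (hz : ‖z‖ = 1) (hp : ∀ r, 0 < r → ‖z * W 2 r - h1 (lam * r)‖ ≤ ε)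
    (hs : ∀ r, 0 < r → |(U 2 r).re - h3 (lam * r)| ≤ ε) (hε : ε ≤ 1 / 12) :
    IsReduced lam (fun r => z * W 2 r) (fun r => (U 2 r).re)
      (fun r => z * (q r - 2 * W 2 r / r)) ε := by
  have hU : ∀ r, 0 < r → ((U 2 r).re : ℂ) = U 2 r := fun r hr =>
    Complex.conj_eq_iff_re.1 (h.real 2 r hr)
  have hzz : conj z * z = 1 := by rw [Complex.conj_mul', hz]; norm_num
  have hsq : ∀ r, (((z * W 2 r).re ^ 2 + (z * W 2 r).im ^ 2 : ℝ) : ℂ) = conj (W 2 r) * W 2 r :=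
    fun r => by
      rw [Complex.conj_mul', ← one_mul ‖W 2 r‖, ← hz, ← norm_mul, ← Complex.ofReal_pow,
        ← Complex.normSq_eq_norm_sq, Complex.normSq_apply]
      push_cast; ring
  refine ⟨hl, ?_, ?_, fun r hr => ?_, ?_, ?_, hp, hs, hε⟩
  · refine ((h.acW 2).const_mul z).congr_deriv (Eventually.of_forall fun r hr => ?_)
    rw [hU r hr]
    ring
  · refine ((h.acU 2).congr fun r hr => (hU r hr).symm).congr_deriv
      (Eventually.of_forall fun r hr => ?_)
    rw [Complex.ofReal_add, Complex.ofReal_div, Complex.ofReal_mul, hsq, Complex.re_eq_add_conj]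
    simp only [map_mul, map_sub, map_div₀, Complex.conj_conj, Complex.conj_ofReal, map_ofNat]
    push_cast
    linear_combination (-(conj (q r) * W 2 r + q r * conj (W 2 r)) / 2 +
      2 * conj (W 2 r) * W 2 r / r) * hzz
  · have := h.norm_sq_add 2 hr
    rw [← hU r hr, Complex.norm_real, Real.norm_eq_abs, sq_abs, ← one_mul ‖W 2 r‖, ← hz, ← norm_mul,
      ← Complex.normSq_eq_norm_sq, Complex.normSq_apply] at this
    linarith
  · have hm := h.isMult_W 2
    refine .of_acDeriv (hm.acDeriv.const_mul z) (fun r hr => ?_) ?_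
    · rw [enorm_mul, ← ofReal_norm z, hz, ENNReal.ofReal_one, one_mul]
      exact hm.bound r hr
    · rw [radNorm_const_mul, ← ofReal_norm z, hz, ENNReal.ofReal_one, one_mul]
      exact hm.deriv
  · exact (h.isMult_U 2).congr fun r hr => (hU r hr).symm

/-- The distance of the map to the soliton is controlled by the differences of the vertical
components and of the derivatives. -/
lemma IsDyadicCutoff.exists_sub_soliton_le {m : ℝ → ℝ} (hm : IsDyadicCutoff m) :
    ∃ C : ℝ≥0∞, C ≠ ⊤ ∧ ∀ (u : ℂ → E3) (α lam : ℝ) (W : Fin 3 → ℝ → ℂ) (q : ℝ → ℂ) (B : ℝ≥0∞),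
      IsEquivariantMap u → 0 < lam → IsFrame W (coord u) q → B ≠ ⊤ →
      IsBesov (fun r => q r - solq α lam r) B →
      IsBesov (fun r => (W 2 r - solW α lam 2 r) / r) B →
      IsBesov (fun r => (coord u 2 r - solU α lam 2 r) / r) B →
      (∀ j, Tendsto (fun r => solW α lam j r - W j r) atTop (𝓝 0)) →
      (∀ j, Tendsto (fun r => solU α lam j r - coord u j r) atTop (𝓝 0)) →
      normX m (u - soliton α lam) ≤ C * B := by
  obtain ⟨C1, hC1, H1⟩ := hm.exists_scalarX_le (n := 2) (s := 1) (Or.inl rfl) (by norm_num)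
  obtain ⟨C2, hC2, H2⟩ := hm.exists_scalarX_le (n := 0) (s := 1) (Or.inl rfl) (by norm_num)
  refine ⟨C1 * 10 ^ 13 + C2 * 10 ^ 11, by finiteness,
    fun u α lam W q B hu hl h hB hq hp hf hW hU => ?_⟩
  have h' := isFrame_soliton α hl
  obtain ⟨p1, p2⟩ := isProfile_hor h h'
  have hd : ∀ j, IsBesov (fun r => dcoord W q j r - dcoord (solW α lam) (solq α lam) j r)
      (10 ^ 11 * B) := fun j => h.isBesov_deriv_sub h' hB hq (isBesov_solq α hl) hW hU j
  have he : ∀ j, j ≠ 2 → IsBesov (fun r => (coord u j r - solU α lam j r) / r) (10 ^ 9 * B) :=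
    fun j hj => h.isBesov_sub_div h' hB hq (fun j hj => isBesov_solU_div α hl hj) hp hf hW hU hj
  have hI : ‖Complex.I‖ₑ = 1 := by rw [← ofReal_norm, Complex.norm_I, ENNReal.ofReal_one]
  have k1 := ((hd 0).add ((hd 1).const_mul Complex.I)).sub
    (((he 0 (by decide)).add ((he 1 (by decide)).const_mul Complex.I)).const_mul 2)
  have l1 := H1 _ _ (10 ^ 13 * B) p1 (by finiteness) ((k1.mono (by
    rw [hI, ← ofReal_norm, Complex.norm_two, ENNReal.ofReal_ofNat]
    ring_nf
    gcongr
    norm_num)).congr (Eventually.of_forall fun r hr => by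
      simp only [horDiff]; push_cast; ring))
  have l2 := H2 _ _ (10 ^ 11 * B) p2 (by finiteness)
    ((hd 2).congr (Eventually.of_forall fun r hr => by push_cast; ring))
  refine (hm.normX_le (aesm_sub_soliton hu α hl h) (norm_sub_soliton_le hu α lam)).trans ?_
  rw [scalarX_congr hm fun x hx => hor_sub_soliton hu α lam hx,
    scalarX_congr hm fun x hx => ver_sub_soliton hu α lam hx, add_mul, mul_assoc, mul_assoc]
  exact add_le_add l1 l2

lemma gaugeField_congr {u : ℂ → E3} {v w : ℝ → E3} (h : IsCoulombFrame u v w)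
    (hu : IsEquivariantMap u) {r : ℝ} (hr : 0 < r) :
    psi1 u v w r - 2 * row v w 2 r / r = gaugeField u v w r := by
  rw [gaugeField, h.gaugeField_eq hu hr]
  linear_combination (-2 * row v w 2 r / r) * Complex.I_sq

/-- The gauge field is bounded by the distance to the soliton. -/
lemma IsDyadicCutoff.exists_gaugeField_le {m : ℝ → ℝ} (hm : IsDyadicCutoff m) :
    ∃ C : ℝ≥0∞, C ≠ ⊤ ∧ ∀ (δ : ℝ) (u : ℂ → E3) (v w : ℝ → E3) (α lam : ℝ), |δ| ≤ 1 →
      IsEquivariantMap u → energy u ≤ ENNReal.ofReal (8 * Real.pi + δ ^ 2) →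
      IsCoulombFrame u v w → 0 < lam → normX m (u - soliton α lam) < ⊤ →
      MemLX m (gaugeField u v w) ∧
      normLX m (gaugeField u v w) ≤ C * normX m (u - soliton α lam) := by
  obtain ⟨C1, hC1, H1⟩ := hm.exists_gauge_le
  obtain ⟨C2, hC2, H2⟩ := hm.exists_normLX_le
  refine ⟨C2 * C1, by finiteness, fun δ u v w α lam hδ hu hE h hl hX => ?_⟩
  obtain ⟨hF, hfin⟩ := h.isFrame hu hδ hE
  have hlim : Tendsto (fun r => coord u 2 r - solU α lam 2 r) atTop (𝓝 0) := by
    simpa using (tendsto_sol_sub h hu α hl 2).2.neg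
  have hb := (H1 u α lam _ _ hu hl hF (fun r hr => h.cross_row hu.norm_eq_one hr) hfin hlim
    hX.ne).congr (Eventually.of_forall fun r hr => gaugeField_congr h hu hr)
  have := H2 _ _ (ENNReal.mul_ne_top hC1 hX.ne) hb
  rwa [← mul_assoc] at this

lemma tendsto_coord {u : ℂ → E3} (hu : IsEquivariantMap u) :
    Tendsto (fun r => (coord u 2 r).re) (𝓝[>] 0) (𝓝 (-1)) ∧
    Tendsto (fun r => (coord u 2 r).re) atTop (𝓝 1) := by
  have hc : Continuous fun p : E3 => p 2 := by fun_prop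
  have h0 := (hc.tendsto _).comp hu.tendsto_zero
  have h1 := (hc.tendsto _).comp hu.tendsto_infty
  have e : vecK 2 = 1 := by simp [vecK]
  rw [PiLp.neg_apply, e] at h0
  rw [e] at h1
  exact ⟨h0.congr fun r => by simp [coord], h1.congr fun r => by simp [coord]⟩

lemma IsModulation.isReduced {κ : ℝ → ℝ} {u : ℂ → E3} {v w : ℝ → E3} {α lam η ε : ℝ}
    (h : IsModulation κ u v w α lam η) (hF : IsFrame (row v w) (coord u) (psi1 u v w))
    (hu : IsEquivariantMap u) (hv : IsCoulombFrame u v w) (hη : 8 * η ≤ ε ^ 2) (hε0 : 0 < ε)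
    (hε : ε ≤ 1 / 12) {z : ℂ} (hz : z = -conj (Complex.exp (2 * α * Complex.I))) :
    IsReduced lam (fun r => z * row v w 2 r) (fun r => (coord u 2 r).re)
      (fun r => z * (psi1 u v w r - 2 * row v w 2 r / r)) ε ∧
    ∫ r in Ioi (0 : ℝ), (z * row v w 2 r - h1 (lam * r)) * ((κ (lam * r) * r : ℝ) : ℂ) = 0 := by
  have hl := h.lam_pos
  have hzn : ‖z‖ = 1 := by rw [hz, norm_neg, RCLike.norm_conj, norm_phase]
  have hph := conj_phase α
  have key : ∀ r, 0 < r → z * row v w 2 r - h1 (lam * r) =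
      z * (Complex.I / 2) * deltaPsi2 u v w α lam r := fun r hr => by
    rw [deltaPsi2, hv.gaugeField_eq hu hr, hz,
      show (2 * Complex.I * α : ℂ) = 2 * α * Complex.I by ring]
    linear_combination (-conj (Complex.exp (2 * α * Complex.I)) * row v w 2 r -
      conj (Complex.exp (2 * α * Complex.I)) * Complex.exp (2 * α * Complex.I) * h1 (lam * r)) *
        Complex.I_sq + (h1 (lam * r) : ℂ) * hph
  have hp : ∀ r, 0 < r → ‖z * row v w 2 r - h1 (lam * r)‖ ≤ η / 2 := fun r hr => by
    rw [key r hr, norm_mul, norm_mul, hzn, norm_div, Complex.norm_I, Complex.norm_two]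
    linarith [h.small r hr]
  have hη0 : 0 ≤ η := (norm_nonneg _).trans (h.small 1 one_pos)
  obtain ⟨t0, t1⟩ := tendsto_coord hu
  refine ⟨hF.isReduced hl hzn (fun r hr => (hp r hr).trans (by nlinarith)) (fun r hr => ?_) hε, ?_⟩
  · refine abs_sub_h3_le (η := η / 2) (s := fun r => (coord u 2 r).re) hl
      (Complex.continuous_re.comp_continuousOn (hF.acU 2).continuousOn) t0 t1 (by linarith)
      (fun r hr => ?_) hε0.le (by linarith) hr
    have n1 := hF.norm_sq_add 2 hr
    have n2 := h1_sq_add_h3_sq (lam * r)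
    have hU : ‖coord u 2 r‖ ^ 2 = (coord u 2 r).re ^ 2 := by simp [coord]
    have n3 := abs_le.1 ((abs_norm_sub_norm_le _ _).trans (hp r hr))
    rw [norm_mul, hzn, one_mul, Complex.norm_real, Real.norm_of_nonneg (h1_nonneg _)] at n3
    have n4 := hF.norm_W_le 2 hr
    have n5 := h1_le_one (lam * r)
    have n6 := h1_nonneg (lam * r)
    have n7 := norm_nonneg (row v w 2 r)
    rw [hU] at n1
    rw [show (coord u 2 r).re ^ 2 - h3 (lam * r) ^ 2 =
      (h1 (lam * r) - ‖row v w 2 r‖) * (h1 (lam * r) + ‖row v w 2 r‖) by linarith, abs_mul,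
      mul_comm 2]
    exact mul_le_mul (abs_le.2 ⟨by linarith, by linarith⟩) (abs_le.2 ⟨by linarith, by linarith⟩)
      (abs_nonneg _) (by linarith)
  · have e : ∫ r in Ioi (0 : ℝ), (z * row v w 2 r - h1 (lam * r)) * ((κ (lam * r) * r : ℝ) : ℂ) =
        ∫ r in Ioi (0 : ℝ), z * (Complex.I / 2) *
          (deltaPsi2 u v w α lam r * ((κ (lam * r) * r : ℝ) : ℂ)) :=
      setIntegral_congr_fun measurableSet_Ioi fun r hr => by
        rw [key r hr, mul_assoc]
    rw [e, integral_const_mul, h.orthogonal, mul_zero]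

/-- The distance to the soliton is bounded by the gauge field. -/
lemma IsDyadicCutoff.exists_normX_le {m κ : ℝ → ℝ} (hm : IsDyadicCutoff m)
    (hκ : IsModulationWeight κ) : ∃ ε : ℝ, 0 < ε ∧ ∃ C : ℝ≥0∞, C ≠ ⊤ ∧
      ∀ (δ : ℝ) (u : ℂ → E3) (v w : ℝ → E3) (α lam η : ℝ), |δ| ≤ 1 →
      IsEquivariantMap u → energy u ≤ ENNReal.ofReal (8 * Real.pi + δ ^ 2) →
      IsCoulombFrame u v w → IsModulation κ u v w α lam η → 8 * η ≤ ε ^ 2 →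
      MemLX m (gaugeField u v w) →
      normX m (u - soliton α lam) ≤ C * normLX m (gaugeField u v w) := by
  obtain ⟨ε, hε0, hε, C1, hC1, H1⟩ := hκ.exists_reduced_le
  obtain ⟨C2, hC2, H2⟩ := hm.exists_besov_of_memLX
  obtain ⟨C3, hC3, H3⟩ := hm.exists_sub_soliton_le
  refine ⟨ε, hε0, C3 * ((18 * C1 * 3 + 1) * C2), by finiteness,
    fun δ u v w α lam η hδ hu hE hv h hη hψ => ?_⟩
  have hl := h.lam_pos
  obtain ⟨hF, -⟩ := hv.isFrame hu hδ hE
  set z : ℂ := -conj (Complex.exp (2 * α * Complex.I)) with hz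
  have hzn : ‖z‖ₑ = 1 := by
    rw [← ofReal_norm, hz, norm_neg, RCLike.norm_conj, norm_phase, ENNReal.ofReal_one]
  have hzn' : ‖conj z‖ₑ = 1 := by rw [RCLike.enorm_conj, hzn]
  have hzz : conj z * z = 1 := by
    rw [hz, map_neg, Complex.conj_conj, neg_mul_neg, conj_phase]
  set B := C2 * normLX m (gaugeField u v w) with hB
  have hBt : B ≠ ⊤ := ENNReal.mul_ne_top hC2 hψ.2.ne
  have b0 := (H2 _ hψ).congr (Eventually.of_forall fun r hr => (gaugeField_congr hv hu hr).symm)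
  obtain ⟨hR, ho⟩ := h.isReduced hF hu hv hη hε0 hε hz
  obtain ⟨k1, k2⟩ := H1 _ _ _ _ (3 * B) hR (by finiteness)
    ((b0.const_mul z).mono (by rw [hzn, mul_one])) ho
  have s2 : ∀ r, solW α lam 2 r = conj z * h1 (lam * r) := fun r => by
    simp [solW, hz]
  have b1 : IsBesov (fun r => (row v w 2 r - solW α lam 2 r) / r) (3 * (C1 * (3 * B))) :=
    ((k1.const_mul (conj z)).mono (by rw [hzn', mul_one])).congr
      (Eventually.of_forall fun r hr => by
        rw [s2]
        linear_combination (row v w 2 r / r) * hzz)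
  have b2 : IsBesov (fun r => (coord u 2 r - solU α lam 2 r) / r) (C1 * (3 * B)) :=
    k2.congr (Eventually.of_forall fun r hr => by simp [coord, solU])
  have b3 : IsBesov (fun r => psi1 u v w r - solq α lam r) (B + 3 * 2 * (3 * (C1 * (3 * B)))) :=
    ((b0.add (b1.const_mul 2)).mono (by
      rw [← ofReal_norm, Complex.norm_two, ENNReal.ofReal_ofNat])).congr
      (Eventually.of_forall fun r hr => by
        rw [s2, solq, hz, map_neg, Complex.conj_conj]
        ring)
  have e : (18 * C1 * 3 + 1) * B = B + 3 * 2 * (3 * (C1 * (3 * B))) := by ring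
  have := H3 u α lam _ _ ((18 * C1 * 3 + 1) * B) hu hl hF (by finiteness)
    (b3.mono e.ge) (b1.mono ?_) (b2.mono ?_) (fun j => (tendsto_sol_sub hv hu α hl j).1)
    (fun j => (tendsto_sol_sub hv hu α hl j).2)
  · refine this.trans (le_of_eq ?_)
    rw [hB]; ring
  · rw [e]
    exact (le_mul_of_one_le_left zero_le (by norm_num)).trans le_add_self
  · rw [e, ← mul_assoc (3 * 2)]
    exact (le_mul_of_one_le_left zero_le (by norm_num)).trans le_add_self

end SchrodingerMap

end

open SchrodingerMap
theorem mainTheorem7 (m κ : ℝ → ℝ) (hm : IsDyadicCutoff m) (hκ : IsModulationWeight κ) :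
    ∃ C : ℝ, 0 < C ∧ ∀ K : ℝ, 0 < K → ∃ δ₀ : ℝ, 0 < δ₀ ∧
      ∀ (δ : ℝ), 0 < δ → δ ≤ δ₀ →
      ∀ (u : ℂ → E3) (v w : ℝ → E3) (α lam : ℝ),
        IsEquivariantMap u →
        energy u ≤ ENNReal.ofReal (8 * Real.pi + δ ^ 2) →
        IsCoulombFrame u v w →
        IsModulation κ u v w α lam (K * δ) →
        (normX m (u - soliton α lam) < ⊤ →
          MemLX m (gaugeField u v w) ∧
          normLX m (gaugeField u v w) ≤ ENNReal.ofReal C * normX m (u - soliton α lam)) ∧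
        (MemLX m (gaugeField u v w) →
          normX m (u - soliton α lam) ≤ ENNReal.ofReal C * normLX m (gaugeField u v w)) := by
  obtain ⟨C1, hC1, H1⟩ := hm.exists_gaugeField_le
  obtain ⟨ε, hε, C2, hC2, H2⟩ := hm.exists_normX_le hκ
  have hC : C1 + C2 + 1 ≠ ⊤ := by finiteness
  refine ⟨(C1 + C2 + 1).toReal, ENNReal.toReal_pos (by simp) hC, fun K hK =>
    ⟨min 1 (ε ^ 2 / (8 * K)), by positivity,
      fun δ hδ hδ₀ u v w α lam hu hE hv h => ⟨fun hX => ?_, fun hψ => ?_⟩⟩⟩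
  all_goals
    have hδ1 : |δ| ≤ 1 := by rw [abs_of_pos hδ]; exact hδ₀.trans (min_le_left _ _)
    rw [ENNReal.ofReal_toReal hC]
  · obtain ⟨k1, k2⟩ := H1 δ u v w α lam hδ1 hu hE hv h.lam_pos hX
    exact ⟨k1, k2.trans (by gcongr; exact le_self_add.trans le_self_add)⟩
  · have hη := (le_div_iff₀ (by positivity)).1 (hδ₀.trans (min_le_right _ _))
    exact (H2 δ u v w α lam (K * δ) hδ1 hu hE hv h (by linarith) hψ).trans
      (by gcongr; exact le_add_self.trans le_self_add)
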